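/- Let $d\in\{1,2,3\}$ and $2/d<\sigma<2/d+1/2$, and let $0<\kappa_1<\kappa_2$, $\omega_1<\omega_2$, $0<\epsilon_1$, $\delta_1<\delta_2$ be real. Then there exists $\rho_1>0$ such that, with $$\Lambda_{\rho_1}=\{\beta\in\mathbb C:|\beta|\le\rho_1\}\times[\kappa_1,\kappa_2]\times[\omega_1,\omega_2]\times[0,\epsilon_1]\times[\delta_1,\delta_2],$$ for each $\xi_1\ge 1$ and each $(\beta,\kappa,\omega,\epsilon,\delta)\in\Lambda_{\rho_1}$ the boundary value problem on $(\xi_1,\infty)$ $$(1-i\epsilon)\Big(Q''+\frac{d-1}{\xi}Q'\Big)+i\kappa\xi Q'+i\frac{\kappa}{\sigma}Q-\omega Q+(1+i\delta)|Q|^{2\sigma}Q=0,$$ $$Q(\xi_1)=\beta,\qquad Q(\xi)\sim c\,\xi^{-1/\sigma-i\omega/\kappa}\ \text{ as }\xi\to\infty\text{ for some }c\in\mathbb C$$ (where $c=0$ is allowed only if $Q$ vanishes for all large $\xi$) has a solution $F(\xi)=F(\beta,\kappa,\omega,\epsilon,\delta,\xi_1;\xi)$, continuous on $[\xi_1,\infty)$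 and smooth on $(\xi_1,\infty)$. Moreover, for each $\xi_1\ge1$, $F$ can be constructed in such a way that the following holds. (i) For each $\vartheta>0$ let $\mathcal X_\vartheta$ be the space of continuous $u:[\xi_1,\infty)\to\mathbb C$ with $\|u\|_\vartheta=\sup_{\xi\ge\xi_1}|\xi|^{1/\sigma-\vartheta}|u(\xi)|<\infty$. The map $(\beta,\kappa,\omega,\epsilon,\delta)\mapsto F(\beta,\kappa,\omega,\epsilon,\delta,\xi_1;\cdot)$ from $\Lambda_{\rho_1}$ to $\mathcal X_\vartheta$ is $C^1$ up to the boundary (in the sense of real differentiability). (ii) The one-sided derivative $\frac{\partial F}{\partial\xi}(\beta,\kappa,\omega,\epsilon,\delta,\xi_1;\xi_1)$ exists and is a $C^1$ function of $(\beta,\kappa,\omega,\epsilon,\delta)\in\Lambda_{\rho_1}$, up to the boundary. (iii) For each parameter in $\Lambda_{\rho_1}$ there are complex numbers $a_0,a_1,a_2,\dots$ such that for all integers $n,k\ge0$, as $\xi\to\infty$, $$F(\xi)=\xi^{-1/\sigma-i\omega/\kappa}\Big(\sum_{l=0}^n a_l\xi^{-2l}+O(\xi^{-2(n+1)})\Big),$$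 $$F^{(k)}(\xi)=\frac{d^k}{d\xi^k}\Big(\xi^{-1/\sigma-i\omega/\kappa}\sum_{l=0}^n a_l\xi^{-2l}\Big)+O(\xi^{-1/\sigma-2(n+1)-k}).$$ (iv) $F(0,\kappa,\omega,\epsilon,\delta,\xi_1;\xi)=0$ for $\xi\ge\xi_1$, and $$\frac{\partial F}{\partial\beta}(0,\kappa,\omega,\epsilon,\delta,\xi_1;\xi)=\frac{P(\kappa,\omega,\epsilon;\xi)}{P(\kappa,\omega,\epsilon;\xi_1)},$$ where $P(\kappa,\omega,\epsilon;\xi_1)\ne0$, $P(\kappa,\omega,\epsilon;\xi)=U(a,b,z)$ with $a=\frac12\big(\frac1\sigma+\frac{i\omega}{\kappa}\big)$, $b=\frac d2$, $z=\frac{-i\kappa}{1-i\epsilon}\frac{\xi^2}{2}$, and $$U(a,b,z)=\frac{z^{-a}}{\Gamma(a)}\int_0^\infty e^{-s}s^{a-1}\Big(1+\frac sz\Big)^{b-a-1}\,ds$$ (principal branches) is Kummer's function; the derivative in $\beta$ is a complex derivative. -/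

import Mathlib

open scoped Topology
open Filter Asymptotics

noncomputable section

namespace CGL

/-! ### The confluent hypergeometric function `U` and the linearized profile `P` -/

/-- Kummer's (Tricomi's) function `U(a, b, z)` for `Re a > 0` and `-π < arg z < π`,
`U(a,b,z) = Γ(a)⁻¹ z^{-a} ∫₀^∞ e^{-s} s^{a-1} (1 + s/z)^{b-a-1} ds`, principal branches. -/
def kummerU (a b z : ℂ) : ℂ :=
  (Complex.Gamma a)⁻¹ * z ^ (-a) *
    ∫ s in Set.Ioi (0 : ℝ),
      Complex.exp (-(s : ℂ)) * (s : ℂ) ^ (a - 1) * (1 + (s : ℂ) / z) ^ (b - a - 1)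

/-- The solution `P(κ, ω, ε; ξ) = U(a, b, z)` of the linearized profile equation, with
`a = (1/σ + iω/κ)/2`, `b = d/2`, `z = -iκ/(1-iε) · ξ²/2`. -/
def kummerP (d : ℕ) (σ κ ω ε ξ : ℝ) : ℂ :=
  kummerU ((1 / 2) * (1 / (σ : ℂ) + Complex.I * ω / κ)) ((d : ℂ) / 2)
    (-Complex.I * κ / (1 - Complex.I * ε) * ((ξ : ℂ) ^ 2 / 2))

/-! ### The profile boundary value problem -/

/-- The power `ξ^{-1/σ - iω/κ}`. -/
def profilePower (σ κ ω ξ : ℝ) : ℂ :=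
  (ξ : ℂ) ^ (-1 / (σ : ℂ) - Complex.I * ω / κ)

/-- `Q` is a classical solution on `(ξ₁, ∞)`, continuous up to `ξ₁`, of
`(1-iε)(Q'' + (d-1)/ξ Q') + iκξQ' + iκ/σ Q - ωQ + (1+iδ)|Q|^{2σ}Q = 0`,
with `Q(ξ₁) = β` and `Q(ξ) ∼ c ξ^{-1/σ - iω/κ}` at infinity for some complex constant `c`.
(`∼[atTop]` is asymptotic equivalence: for `c ≠ 0` the quotient tends to `1`, and `c = 0` is
possible only if `Q` vanishes identically near infinity.) -/
structure IsProfile (d : ℕ) (σ κ ω ε δ ξ₁ : ℝ) (β : ℂ) (Q : ℝ → ℂ) : Prop where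
  continuousOn : ContinuousOn Q (Set.Ici ξ₁)
  contDiffOn : ContDiffOn ℝ 2 Q (Set.Ioi ξ₁)
  equation : ∀ ξ : ℝ, ξ₁ < ξ →
    (1 - Complex.I * ε) * (iteratedDeriv 2 Q ξ + ((d : ℂ) - 1) / ξ * deriv Q ξ)
      + Complex.I * κ * ξ * deriv Q ξ + Complex.I * κ / σ * Q ξ - ω * Q ξ
      + (1 + Complex.I * δ) * ((‖Q ξ‖ ^ (2 * σ) : ℝ) : ℂ) * Q ξ = 0
  initial : Q ξ₁ = β
  atInfinity : ∃ c : ℂ, Q ~[atTop] fun ξ => c * profilePower σ κ ω ξ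

/-- The set of parameters `(β, κ, ω, ε, δ)`: a closed disc times a compact box. -/
def paramBox (ρ κ₁ κ₂ ω₁ ω₂ ε₁ δ₁ δ₂ : ℝ) : Set (ℂ × ℝ × ℝ × ℝ × ℝ) :=
  Metric.closedBall (0 : ℂ) ρ ×ˢ Set.Icc κ₁ κ₂ ×ˢ Set.Icc ω₁ ω₂ ×ˢ Set.Icc 0 ε₁ ×ˢ
    Set.Icc δ₁ δ₂

/-! ### The weighted space -/

/-- The continuous `u : [ξ₁, ∞) → ℂ` with `sup_{ξ ≥ ξ₁} |ξ|^{1/σ-ϑ} |u(ξ)| < ∞`. -/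
def weightedSubmodule (σ ϑ ξ₁ : ℝ) : Submodule ℂ C(Set.Ici ξ₁, ℂ) where
  carrier := {u | BddAbove (Set.range fun ξ : Set.Ici ξ₁ => |(ξ : ℝ)| ^ (1 / σ - ϑ) * ‖u ξ‖)}
  zero_mem' := ⟨0, by rintro _ ⟨ξ, rfl⟩; simp⟩
  add_mem' := by
    rintro u v ⟨A, hA⟩ ⟨B, hB⟩
    refine ⟨A + B, ?_⟩
    rintro _ ⟨ξ, rfl⟩
    have h1 := hA ⟨ξ, rfl⟩
    have h2 := hB ⟨ξ, rfl⟩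
    have h3 : |(ξ : ℝ)| ^ (1 / σ - ϑ) * ‖u ξ + v ξ‖
        ≤ |(ξ : ℝ)| ^ (1 / σ - ϑ) * (‖u ξ‖ + ‖v ξ‖) := by
      gcongr
      exact norm_add_le _ _
    simp only [ContinuousMap.add_apply] at *
    linarith
  smul_mem' := by
    rintro c u ⟨A, hA⟩
    refine ⟨‖c‖ * A, ?_⟩
    rintro _ ⟨ξ, rfl⟩
    have h1 := mul_le_mul_of_nonneg_left (hA ⟨ξ, rfl⟩) (norm_nonneg c)
    simp only [ContinuousMap.smul_apply, norm_smul] at *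
    linarith

/-- The space `X_ϑ`, as a type of its own, so that its topology is that of the weighted norm. -/
def WeightedSpace (σ ϑ ξ₁ : ℝ) : Type := weightedSubmodule σ ϑ ξ₁

namespace WeightedSpace

variable {σ ϑ ξ₁ : ℝ}

instance : AddCommGroup (WeightedSpace σ ϑ ξ₁) :=
  inferInstanceAs (AddCommGroup (weightedSubmodule σ ϑ ξ₁))

instance : Module ℂ (WeightedSpace σ ϑ ξ₁) :=
  inferInstanceAs (Module ℂ (weightedSubmodule σ ϑ ξ₁))

/-- The underlying continuous function on `[ξ₁, ∞)`. -/
def toFun (u : WeightedSpace σ ϑ ξ₁) : C(Set.Ici ξ₁, ℂ) := Subtype.val u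

/-- The weighted norm `‖u‖ = sup_{ξ ≥ ξ₁} |ξ|^{1/σ-ϑ} |u(ξ)|`. -/
instance : Norm (WeightedSpace σ ϑ ξ₁) :=
  ⟨fun u => ⨆ ξ : Set.Ici ξ₁, |(ξ : ℝ)| ^ (1 / σ - ϑ) * ‖u.toFun ξ‖⟩

theorem norm_def (u : WeightedSpace σ ϑ ξ₁) :
    ‖u‖ = ⨆ ξ : Set.Ici ξ₁, |(ξ : ℝ)| ^ (1 / σ - ϑ) * ‖u.toFun ξ‖ := rfl

theorem le_norm (u : WeightedSpace σ ϑ ξ₁) (ξ : Set.Ici ξ₁) :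
    |(ξ : ℝ)| ^ (1 / σ - ϑ) * ‖u.toFun ξ‖ ≤ ‖u‖ :=
  le_ciSup (f := fun ξ : Set.Ici ξ₁ => |(ξ : ℝ)| ^ (1 / σ - ϑ) * ‖u.toFun ξ‖) u.2 ξ

theorem normedCore : NormedSpace.Core ℂ (WeightedSpace σ ϑ ξ₁) where
  norm_nonneg u := Real.iSup_nonneg fun ξ => by positivity
  norm_smul c u := by
    rw [norm_def, norm_def, Real.mul_iSup_of_nonneg (norm_nonneg c)]
    congr 1
    funext ξ
    have h : (c • u).toFun ξ = c * u.toFun ξ := rfl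
    rw [h, norm_mul]
    ring
  norm_triangle u v := by
    have : Nonempty (Set.Ici ξ₁) := ⟨⟨ξ₁, Set.mem_Ici.mpr le_rfl⟩⟩
    refine ciSup_le fun ξ => ?_
    have h : (u + v).toFun ξ = u.toFun ξ + v.toFun ξ := rfl
    have h3 : |(ξ : ℝ)| ^ (1 / σ - ϑ) * ‖u.toFun ξ + v.toFun ξ‖
        ≤ |(ξ : ℝ)| ^ (1 / σ - ϑ) * (‖u.toFun ξ‖ + ‖v.toFun ξ‖) := by
      gcongr
      exact norm_add_le _ _
    have h1 := le_norm u ξ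
    have h2 := le_norm v ξ
    rw [h]
    linarith
  norm_eq_zero_iff u := by
    constructor
    · intro h
      have key : ∀ ξ : Set.Ici ξ₁, (ξ : ℝ) ≠ 0 → u.toFun ξ = 0 := by
        intro ξ hξ
        have h1 := le_norm u ξ
        rw [h] at h1
        have h2 : 0 < |(ξ : ℝ)| ^ (1 / σ - ϑ) := Real.rpow_pos_of_pos (abs_pos.mpr hξ) _
        have h3 : ‖u.toFun ξ‖ ≤ 0 := by
          by_contra hc
          push Not at hc
          have := mul_pos h2 hc
          linarith
        exact norm_le_zero_iff.mp h3
      refine Subtype.ext (ContinuousMap.ext fun ξ => ?_)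
      change u.toFun ξ = 0
      by_cases hξ : (ξ : ℝ) = 0
      · let g : ℝ → ℂ := fun t => u.toFun ⟨max ξ₁ t, Set.mem_Ici.mpr (le_max_left _ _)⟩
        have hg : Continuous g := u.toFun.continuous.comp (by fun_prop)
        have hle : ξ₁ ≤ 0 := hξ ▸ ξ.2
        have h0 : g 0 = u.toFun ξ := by
          change u.toFun _ = _
          congr 1
          exact Subtype.ext (by rw [hξ]; exact max_eq_right hle)
        have h1 : Tendsto g (𝓝[>] 0) (𝓝 (g 0)) := hg.continuousAt.mono_left nhdsWithin_le_nhds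
        have h2 : Tendsto g (𝓝[>] 0) (𝓝 0) := by
          refine tendsto_const_nhds.congr' ?_
          filter_upwards [self_mem_nhdsWithin] with t ht
          refine (key _ ?_).symm
          exact (lt_of_lt_of_le ht (le_max_right _ _)).ne'
        rw [← h0]
        exact tendsto_nhds_unique h1 h2
      · exact key ξ hξ
    · rintro rfl
      have h : ∀ ξ : Set.Ici ξ₁, (0 : WeightedSpace σ ϑ ξ₁).toFun ξ = 0 := fun _ => rfl
      rw [norm_def]
      simp [h]

instance : NormedAddCommGroup (WeightedSpace σ ϑ ξ₁) := NormedAddCommGroup.ofCore normedCore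

instance : NormedSpace ℂ (WeightedSpace σ ϑ ξ₁) := NormedSpace.ofCore normedCore

end WeightedSpace

end CGL

end

/-! Put x = ξ², X = ξ₁², a = (1/σ + iω/κ)/2, b = d/2, A = b - 2a and μ = -iκ/(2(1-iε)). Since
|ξ^{-2a}|^{2σ} = 1/x, the substitution Q = T ξ^{-2a} g(x) with T = β ξ₁^{2a}/q(X) turns the equation
into g'' + (A/x - μ) g' + a(a+1-b) x⁻² g + γ X x⁻² |g|^{2σ} g = 0, where γ has size |β|^{2σ}. Its
linear part is solved by q(x) = J(a, b-a-1, 1/(μx)), which is Kummer's U stripped of its power and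
of Γ(a).

Write g = q(1+φ) with φ(X) = 0. Variation of constants gives q²φ' = γ X x⁻² W, where W is a decaying
integral of the nonlinear term against exp(-μ·) and a power. Thus φ is a fixed point of an integral
map which is a contraction for small β (`exists_profile`). The weight X/x² has total mass one on (X,
∞), whatever X is, so the admissible radius for β does not depend on ξ₁.

Division by q needs absence of zeros (`kummerJ_ne_zero`). In Weber normal form w'' = Vw along a
horizontal ray, the real part of V exceeds by 2 Re a the potential of a harmonic oscillator at its
ground state energy, so a decaying solution vanishing at the tip is zero. Compactness makes this
quantitative and extends it to a thin cone (`exists_kummerJ_bounds`).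

For ε = 0 the number μ is imaginary and integration along the real axis gives no decay. The fixed
point is therefore sought among functions holomorphic in a complex cone, and W is an integral along
the slanted direction 1 + it. There |g|^{2σ} is continued as (g g*)^σ with g*(x) = conj g(conj x),
which keeps the problem holomorphic in x.

Dependence on parameters: a bounded family of functions that is pointwise holomorphic in a parameter
is C¹ for the supremum norm (`contDiffAt_toBCF`). All ingredients of the map are compositions of
such families with bounded linear maps and with |β|^{2σ}, which is C¹ because 2σ > 1. The implicit
function theorem (`contDiffOn_fixedPoint`) transfers this to φ.

Asymptotics: solving the equation for μg' and using Cauchy estimates in sectors, an expansion of g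
with error O(x^{-m}) improves to O(x^{-m-1}) (`HasExp.succ_of_ode`). Starting from boundedness this
yields all orders, and Cauchy estimates in ξ give the derivatives. Finally φ = O(|β|^{2σ})
identifies the complex derivative in β at 0 with the linear profile. -/

noncomputable section

namespace CGL

section

open BoundedContinuousFunction

/-! ### Holomorphic families of bounded continuous functions -/

/-- A bounded continuous function from a function, with junk value `0`. -/
def toBCF {α : Type*} [TopologicalSpace α] (f : α → ℂ) : α →ᵇ ℂ :=
  open Classical in
  if h : Continuous f ∧ ∃ C, ∀ x, ‖f x‖ ≤ C then
    BoundedContinuousFunction.ofNormedAddCommGroup f h.1 h.2.choose h.2.choose_spec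
  else 0

theorem toBCF_apply {α : Type*} [TopologicalSpace α] {f : α → ℂ} {C : ℝ} (hf : Continuous f)
    (hC : ∀ x, ‖f x‖ ≤ C) (x : α) : toBCF f x = f x := by
  have h : Continuous f ∧ ∃ C, ∀ x, ‖f x‖ ≤ C := ⟨hf, C, hC⟩
  rw [toBCF, dif_pos h]
  rfl

/-- Two successive Cauchy estimates, with radii R/4 and R/8, bound f'' by 32M/R² on the unit disc;
the mean value inequality, used twice, turns this into the bound on the remainder. The condition 4 ≤
R leaves room for both discs. -/
theorem norm_sub_sub_deriv_le {f : ℂ → ℂ} {R M : ℝ} (hR : 4 ≤ R)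
    (hf : DifferentiableOn ℂ f (Metric.ball 0 R)) (hM : ∀ z ∈ Metric.ball (0 : ℂ) R, ‖f z‖ ≤ M) :
    ‖f 1 - f 0 - deriv f 0‖ ≤ 32 * M / R ^ 2 := by
  have hR0 : 0 < R := by linarith
  have h1 : ∀ z ∈ Metric.ball (0 : ℂ) (R / 2), ‖deriv f z‖ ≤ M / (R / 4) := by
    intro z hz
    have hz' : ‖z‖ < R / 2 := by simpa using hz
    have hsub : Metric.closedBall z (R / 4) ⊆ Metric.ball 0 R := by
      intro w hw
      have hw' : ‖w - z‖ ≤ R / 4 := by simpa [dist_eq_norm] using hw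
      have := norm_add_le (w - z) z
      simp only [sub_add_cancel] at this
      simp only [Metric.mem_ball, dist_zero_right]
      linarith
    refine Complex.norm_deriv_le_of_forall_mem_sphere_norm_le (by linarith) ?_ ?_
    · exact (hf.mono hsub).diffContOnCl_ball subset_rfl
    · exact fun w hw => hM w (hsub (Metric.sphere_subset_closedBall hw))
  have hd1 : DifferentiableOn ℂ (deriv f) (Metric.ball 0 R) := hf.deriv Metric.isOpen_ball
  have h2 : ∀ z ∈ Metric.closedBall (0 : ℂ) 1, ‖deriv (deriv f) z‖ ≤ 32 * M / R ^ 2 := by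
    intro z hz
    have hz' : ‖z‖ ≤ 1 := by simpa using hz
    have hsub : Metric.closedBall z (R / 8) ⊆ Metric.ball 0 (R / 2) := by
      intro w hw
      have hw' : ‖w - z‖ ≤ R / 8 := by simpa [dist_eq_norm] using hw
      have := norm_add_le (w - z) z
      simp only [sub_add_cancel] at this
      simp only [Metric.mem_ball, dist_zero_right]
      linarith
    have := Complex.norm_deriv_le_of_forall_mem_sphere_norm_le (c := z) (R := R / 8)
      (C := M / (R / 4)) (f := deriv f) (by linarith)
      ((hd1.mono (hsub.trans (Metric.ball_subset_ball (by linarith)))).diffContOnCl_ball subset_rfl)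
      (fun w hw => h1 w (hsub (Metric.sphere_subset_closedBall hw)))
    refine this.trans (le_of_eq ?_)
    field_simp
    ring
  have hsub1 : Metric.closedBall (0 : ℂ) 1 ⊆ Metric.ball 0 R :=
    Metric.closedBall_subset_ball (by linarith)
  have hM0 : 0 ≤ 32 * M / R ^ 2 := le_trans (norm_nonneg _) (h2 0 (by simp))
  have h3 : ∀ z ∈ Metric.closedBall (0 : ℂ) 1, ‖deriv f z - deriv f 0‖ ≤ 32 * M / R ^ 2 := by
    intro z hz
    have := (convex_closedBall (0 : ℂ) 1).norm_image_sub_le_of_norm_deriv_le (f := deriv f)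
      (fun w hw => (hd1 w (hsub1 hw)).differentiableAt (Metric.isOpen_ball.mem_nhds (hsub1 hw)))
      h2 (Metric.mem_closedBall_self zero_le_one) hz
    refine this.trans ?_
    have hz' : ‖z - 0‖ ≤ 1 := by simpa using hz
    exact mul_le_of_le_one_right hM0 hz'
  have h4 := (convex_closedBall (0 : ℂ) 1).norm_image_sub_le_of_norm_hasDerivWithin_le
      (f := fun z => f z - z * deriv f 0) (f' := fun z => deriv f z - deriv f 0)
      (C := 32 * M / R ^ 2) (x := 0) (y := 1) ?_ h3 (by simp) (by simp)
  · simpa [sub_right_comm] using h4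
  · intro z hz
    have := ((hf z (hsub1 hz)).differentiableAt
      (Metric.isOpen_ball.mem_nhds (hsub1 hz))).hasDerivAt
    have h5 := (this.sub ((hasDerivAt_id z).mul_const (deriv f 0))).hasDerivWithinAt
      (s := Metric.closedBall 0 1)
    simpa using! h5

/-- On the complex line z ↦ p + z h the ball has radius r/‖h‖ ≥ 4, so the one-variable estimate
applies. The constant depends on r and M alone, hence is the same for every member of a bounded
family. -/
theorem norm_sub_sub_fderiv_le {E : Type*} [NormedAddCommGroup E] [NormedSpace ℂ E]
    {g : E → ℂ} {p : E} {r M : ℝ} (hr : 0 < r) (hd : DifferentiableOn ℂ g (Metric.ball p r))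
    (hM : ∀ q ∈ Metric.ball p r, ‖g q‖ ≤ M) {h : E} (hh : ‖h‖ ≤ r / 4) :
    ‖g (p + h) - g p - fderiv ℂ g p h‖ ≤ 32 * M / r ^ 2 * ‖h‖ ^ 2 := by
  rcases eq_or_ne h 0 with rfl | h0
  · simp
  have hn : 0 < ‖h‖ := norm_pos_iff.2 h0
  have hmaps : ∀ z ∈ Metric.ball (0 : ℂ) (r / ‖h‖), p + z • h ∈ Metric.ball p r := by
    intro z hz
    have : ‖z‖ < r / ‖h‖ := by simpa using hz
    simp only [Metric.mem_ball, dist_self_add_left, norm_smul]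
    exact (lt_div_iff₀ hn).1 this
  have hl : ∀ z : ℂ, HasDerivAt (fun z : ℂ => p + z • h) h z := fun z => by
    simpa using ((hasDerivAt_id z).smul_const h).const_add p
  have key := norm_sub_sub_deriv_le (f := fun z => g (p + z • h)) (R := r / ‖h‖) (M := M)
    (by rw [le_div_iff₀ hn]; linarith)
    (hd.comp (fun z _ => (hl z).differentiableAt.differentiableWithinAt) hmaps)
    (fun z hz => hM _ (hmaps z hz))
  have hd0 : HasDerivAt (fun z : ℂ => g (p + z • h)) (fderiv ℂ g p h) 0 := by
    have h1 : HasFDerivAt g (fderiv ℂ g p) (p + (0 : ℂ) • h) := by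
      simpa using (hd.differentiableAt (Metric.ball_mem_nhds p hr)).hasFDerivAt
    exact h1.comp_hasDerivAt (0 : ℂ) (hl 0)
  rw [hd0.deriv] at key
  simp only [one_smul, zero_smul, add_zero] at key
  refine key.trans (le_of_eq ?_)
  field_simp

/-- A quadratic remainder that is uniform in the base point already forces the candidate derivative
to be Lipschitz, so no separate continuity argument is needed. -/
theorem contDiffAt_of_taylor {E F : Type*} [NormedAddCommGroup E] [NormedSpace ℂ E]
    [NormedAddCommGroup F] [NormedSpace ℂ F] {G : E → F} {G' : E → E →L[ℂ] F} {p₀ : E} {r K : ℝ}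
    (hr : 0 < r) (hK : 0 ≤ K)
    (hG : ∀ p ∈ Metric.ball p₀ r, ∀ h : E, ‖h‖ ≤ r →
      ‖G (p + h) - G p - G' p h‖ ≤ K * ‖h‖ ^ 2) : ContDiffAt ℂ 1 G p₀ := by
  rw [contDiffAt_one_iff]
  refine ⟨G', Metric.ball p₀ r, Metric.ball_mem_nhds _ hr, ?_, ?_⟩
  · intro p hp
    have hlip : ∀ q ∈ Metric.ball p₀ r, ‖q - p‖ ≤ r / 2 →
        ‖G' q - G' p‖ ≤ 8 * K * ‖q - p‖ := by
      intro q hq hqp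
      rcases eq_or_ne q p with rfl | hne
      · simp
      set k := q - p with hk
      have hk0 : 0 < ‖k‖ := norm_pos_iff.2 (sub_ne_zero.2 hne)
      have hpk : p + k = q := by rw [hk]; abel
      -- By homogeneity it suffices to test on vectors h with ‖k‖/2 ≤ ‖h‖ < ‖k‖. For these the three
      -- quadratic remainders, at q along h and at p along k + h and k, are all comparable to ‖k‖
      -- ‖h‖.
      refine ContinuousLinearMap.opNorm_le_of_shell' (ε := ‖k‖) (c := (1 / 2 : ℂ)) hk0
        (by positivity) (by norm_num) ?_
      intro h hh1 hh2
      have hh2' : ‖h‖ ≤ ‖k‖ := hh2.le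
      have hh1' : ‖k‖ ≤ 2 * ‖h‖ := by
        have : ‖(1 / 2 : ℂ)‖ = 1 / 2 := by norm_num
        rw [this] at hh1
        linarith
      have e1 := hG q hq h (by linarith)
      have e2 := hG p hp (k + h) ((norm_add_le _ _).trans (by linarith))
      have e3 := hG p hp k (by linarith)
      rw [← add_assoc, hpk] at e2
      rw [hpk] at e3
      have e4 : (G' q - G' p) h = -(G (q + h) - G q - G' q h)
          + (G (q + h) - G p - G' p (k + h)) - (G q - G p - G' p k) := by
        rw [map_add, _root_.sub_apply]; abel
      rw [e4]
      have e5 : ‖k + h‖ ^ 2 ≤ (‖k‖ + ‖h‖) ^ 2 := by gcongr; exact norm_add_le _ _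
      have e6 : K * ‖k + h‖ ^ 2 ≤ K * (‖k‖ + ‖h‖) ^ 2 := by gcongr
      have e7 := norm_sub_le (-(G (q + h) - G q - G' q h)
          + (G (q + h) - G p - G' p (k + h))) (G q - G p - G' p k)
      have e8 := norm_add_le (-(G (q + h) - G q - G' q h)) (G (q + h) - G p - G' p (k + h))
      rw [norm_neg] at e8
      have e9 : ‖h‖ ^ 2 + (‖k‖ + ‖h‖) ^ 2 + ‖k‖ ^ 2 ≤ 8 * ‖k‖ * ‖h‖ := by
        nlinarith [norm_nonneg h, mul_nonneg (sub_nonneg.2 hh2') (sub_nonneg.2 hh1')]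
      nlinarith
    refine Metric.continuousWithinAt_iff.2 fun ε hε => ?_
    refine ⟨min (r / 2) (ε / (8 * K + 1)), by positivity, fun q hq hqd => ?_⟩
    rw [dist_eq_norm] at hqd ⊢
    have h1 := hlip q hq (hqd.le.trans (min_le_left _ _))
    have h2 := hqd.trans_le (min_le_right _ _)
    rw [lt_div_iff₀ (by positivity)] at h2
    nlinarith [norm_nonneg (q - p)]
  · intro p hp
    rw [hasFDerivAt_iff_isLittleO_nhds_zero]
    have h1 : (fun h => G (p + h) - G p - G' p h) =O[𝓝 0] fun h : E => ‖h‖ ^ 2 := by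
      refine IsBigO.of_bound K ?_
      filter_upwards [Metric.closedBall_mem_nhds (0 : E) hr] with h hh
      simpa using hG p hp h (by simpa using hh)
    refine h1.trans_isLittleO ?_
    have h2 : (fun h : E => ‖h‖ ^ 2) =o[𝓝 0] fun h => ‖h‖ ^ 1 :=
      (isLittleO_pow_pow (m := 1) (n := 2) (by norm_num)).comp_tendsto (tendsto_norm_zero)
    exact (by simpa using h2 : (fun h : E => ‖h‖ ^ 2) =o[𝓝 0] fun h => ‖h‖).of_norm_right

/-- A family of bounded continuous functions which is pointwise holomorphic and locally bounded
is continuously differentiable for the supremum norm. -/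
theorem contDiffAt_toBCF {E α : Type*} [NormedAddCommGroup E] [NormedSpace ℂ E]
    [TopologicalSpace α] {g : E → α → ℂ} {p₀ : E} {M : ℝ}
    (h : ∀ᶠ p in 𝓝 p₀, Continuous (g p) ∧ ∀ x, DifferentiableAt ℂ (fun p => g p x) p ∧
      ‖g p x‖ ≤ M) : ContDiffAt ℂ 1 (fun p => toBCF (g p)) p₀ := by
  obtain ⟨r, hr, hball⟩ := Metric.eventually_nhds_iff_ball.1 h
  rcases isEmpty_or_nonempty α with hα | ⟨⟨x₀⟩⟩
  · have : (fun p => toBCF (g p)) = fun _ => 0 := by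
      ext p x; exact hα.elim x
    rw [this]; exact contDiffAt_const
  have hM : 0 ≤ M := (norm_nonneg _).trans ((hball p₀ (Metric.mem_ball_self hr)).2 x₀).2
  have hsub : ∀ p ∈ Metric.ball p₀ (r / 8), Metric.ball p (r / 2) ⊆ Metric.ball p₀ r := by
    intro p hp q hq
    have := dist_triangle q p p₀
    simp only [Metric.mem_ball] at *
    linarith
  set K := 32 * M / (r / 2) ^ 2 with hKdef
  have hK : 0 ≤ K := by positivity
  have tay : ∀ p ∈ Metric.ball p₀ (r / 8), ∀ h : E, ‖h‖ ≤ r / 8 → ∀ x,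
      ‖g (p + h) x - g p x - fderiv ℂ (fun p => g p x) p h‖ ≤ K * ‖h‖ ^ 2 := by
    intro p hp h hh x
    refine norm_sub_sub_fderiv_le (g := fun p => g p x) (r := r / 2) (M := M) (by positivity) ?_ ?_
      (by linarith)
    · exact fun q hq => ((hball q (hsub p hp hq)).2 x).1.differentiableWithinAt
    · exact fun q hq => ((hball q (hsub p hp hq)).2 x).2
  have happ : ∀ p ∈ Metric.ball p₀ r, ∀ x, toBCF (g p) x = g p x := fun p hp x =>
    toBCF_apply (hball p hp).1 (fun x => ((hball p hp).2 x).2) x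
  -- the candidate derivative
  have hbd : ∀ p ∈ Metric.ball p₀ (r / 8), ∀ h : E, ∀ x,
      ‖fderiv ℂ (fun p => g p x) p h‖ ≤ (32 * M / r + K * r) * ‖h‖ := by
    intro p hp h x
    refine ContinuousLinearMap.le_of_opNorm_le _ ?_ h
    refine ContinuousLinearMap.opNorm_le_of_shell' (ε := r / 8) (c := (1 / 2 : ℂ))
      (by positivity) (by positivity) (by norm_num) ?_
    intro h hh1 hh2
    have e1 := tay p hp h hh2.le x
    have hph : p + h ∈ Metric.ball p₀ r := hsub p hp (by
      simp only [Metric.mem_ball, dist_self_add_left]; linarith)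
    have e2 := ((hball _ hph).2 x).2
    have e3 := ((hball _ (Metric.ball_subset_ball (by linarith) hp)).2 x).2
    have e4 : fderiv ℂ (fun p => g p x) p h = g (p + h) x - g p x -
      (g (p + h) x - g p x - fderiv ℂ (fun p => g p x) p h) := by abel
    rw [e4]
    have e5 := norm_sub_le (g (p + h) x - g p x)
      (g (p + h) x - g p x - fderiv ℂ (fun p => g p x) p h)
    have e6 := norm_sub_le (g (p + h) x) (g p x)
    have hh1' : r / 16 ≤ ‖h‖ := by
      have : ‖(1 / 2 : ℂ)‖ = 1 / 2 := by norm_num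
      rw [this] at hh1
      linarith
    have e7 : 2 * M ≤ 32 * M / r * ‖h‖ := by
      have : 32 * M / r * (r / 16) ≤ 32 * M / r * ‖h‖ := by gcongr
      have h9 : 32 * M / r * (r / 16) = 2 * M := by field_simp; ring
      linarith
    have e8 : K * ‖h‖ ^ 2 ≤ K * r * ‖h‖ := by
      have : K * ‖h‖ * ‖h‖ ≤ K * ‖h‖ * r := by gcongr; linarith
      nlinarith
    linarith
  -- The directional derivative is continuous in x as a uniform limit of difference quotients, each
  -- of which is continuous in x; the Taylor bound makes the error at most K τ ‖h‖².
  have hcont : ∀ p ∈ Metric.ball p₀ (r / 8), ∀ h : E,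
      Continuous fun x => fderiv ℂ (fun p => g p x) p h := by
    intro p hp h
    refine continuous_of_uniform_approx_of_continuous fun u hu => ?_
    obtain ⟨ε, hε, hεu⟩ := Metric.mem_uniformity_dist.1 hu
    obtain ⟨τ, hτ, hτ1, hτ2⟩ : ∃ τ : ℝ, 0 < τ ∧ τ * ‖h‖ ≤ r / 8 ∧ K * τ * ‖h‖ ^ 2 < ε := by
      have hc1 : Tendsto (fun τ : ℝ => τ * ‖h‖) (𝓝[>] 0) (𝓝 (0 * ‖h‖)) :=
        (Continuous.tendsto (by fun_prop) 0).mono_left nhdsWithin_le_nhds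
      have hc2 : Tendsto (fun τ : ℝ => K * τ * ‖h‖ ^ 2) (𝓝[>] 0) (𝓝 (K * 0 * ‖h‖ ^ 2)) :=
        (Continuous.tendsto (by fun_prop) 0).mono_left nhdsWithin_le_nhds
      have i1 := hc1.eventually_le_const (u := r / 8) (by simpa using hr)
      have i2 := hc2.eventually_lt_const (u := ε) (by simpa using hε)
      obtain ⟨τ, h1, h2, h3⟩ := (i1.and (i2.and self_mem_nhdsWithin)).exists
      exact ⟨τ, h3, h1, h2⟩
    have hn : ‖(τ : ℂ) • h‖ = τ * ‖h‖ := by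
      rw [norm_smul, Complex.norm_real, Real.norm_of_nonneg hτ.le]
    have hpτ : p + (τ : ℂ) • h ∈ Metric.ball p₀ r := hsub p hp (by
      simp only [Metric.mem_ball, dist_self_add_left, hn]; linarith)
    have hpr := Metric.ball_subset_ball (by linarith : r / 8 ≤ r) hp
    refine ⟨fun x => (τ : ℂ)⁻¹ * (g (p + (τ : ℂ) • h) x - g p x),
      continuous_const.mul ((hball _ hpτ).1.sub (hball _ hpr).1), fun x => hεu ?_⟩
    have e1 := tay p hp ((τ : ℂ) • h) (by rw [hn]; exact hτ1) x
    rw [hn, map_smul, smul_eq_mul] at e1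
    have hτ0 : (τ : ℂ) ≠ 0 := by exact_mod_cast hτ.ne'
    rw [dist_comm, dist_eq_norm]
    have e2 : (τ : ℂ)⁻¹ * (g (p + (τ : ℂ) • h) x - g p x) - fderiv ℂ (fun p => g p x) p h
        = (τ : ℂ)⁻¹ * (g (p + (τ : ℂ) • h) x - g p x
          - τ * fderiv ℂ (fun p => g p x) p h) := by field_simp
    rw [e2, norm_mul, norm_inv, Complex.norm_real, Real.norm_of_nonneg hτ.le,
      inv_mul_lt_iff₀ hτ]
    refine e1.trans_lt ?_
    have : τ * (K * τ * ‖h‖ ^ 2) < τ * ε := by gcongr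
    linarith [this, (by ring : K * (τ * ‖h‖) ^ 2 = τ * (K * τ * ‖h‖ ^ 2))]
  have happ' : ∀ p ∈ Metric.ball p₀ (r / 8), ∀ h : E, ∀ x,
      toBCF (fun x => fderiv ℂ (fun p => g p x) p h) x = fderiv ℂ (fun p => g p x) p h :=
    fun p hp h x => toBCF_apply (hcont p hp h) (hbd p hp h) x
  let G' : E → E →L[ℂ] (α →ᵇ ℂ) := fun p =>
    open Classical in
    if hp : p ∈ Metric.ball p₀ (r / 8) then
      LinearMap.mkContinuous
        { toFun := fun h => toBCF (fun x => fderiv ℂ (fun p => g p x) p h)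
          map_add' := fun h₁ h₂ => by
            ext x
            change toBCF _ x = toBCF _ x + toBCF _ x
            rw [happ' p hp, happ' p hp, happ' p hp, map_add]
          map_smul' := fun c h => by
            ext x
            change toBCF _ x = c • toBCF _ x
            rw [happ' p hp, happ' p hp, map_smul] }
        (32 * M / r + K * r) (fun h => by
          refine (norm_le (by positivity)).2 fun x => ?_
          simpa [happ' p hp] using hbd p hp h x)
    else 0
  have hG' : ∀ p ∈ Metric.ball p₀ (r / 8), ∀ h x, G' p h x = fderiv ℂ (fun p => g p x) p h := by
    intro p hp h x
    simp only [G', dif_pos hp]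
    exact happ' p hp h x
  refine contDiffAt_of_taylor (G' := G') (r := r / 8) (K := K) (by positivity) hK ?_
  intro p hp h hh
  refine (norm_le (by positivity)).2 fun x => ?_
  have hph : p + h ∈ Metric.ball p₀ r := hsub p hp (by
    simp only [Metric.mem_ball, dist_self_add_left]; linarith)
  rw [BoundedContinuousFunction.sub_apply, BoundedContinuousFunction.sub_apply, happ _ hph, happ p (Metric.ball_subset_ball (by linarith) hp),
    hG' p hp]
  exact tay p hp h hh x

end

/-! ### Superposition and integral operators on bounded continuous functions. -/

section

open BoundedContinuousFunction MeasureTheory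

/-- Superposition with a holomorphic function is continuously differentiable on bounded
continuous functions. -/
theorem contDiffAt_comp_toBCF {α : Type*} [TopologicalSpace α] {θ : ℂ → ℂ} {O K : Set ℂ}
    (hO : IsOpen O) (hθ : DifferentiableOn ℂ θ O) (hK : IsCompact K) (hKO : K ⊆ O)
    {f₀ : α →ᵇ ℂ} (hf₀ : ∀ x, f₀ x ∈ K) :
    ContDiffAt ℂ 1 (fun f : α →ᵇ ℂ => toBCF fun x => θ (f x)) f₀ := by
  -- A compact thickening of K inside O contains all values of every f in a ball around f₀, so θ ∘ f
  -- is a bounded holomorphic family there.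
  obtain ⟨δ, hδ, hsub⟩ := hK.exists_cthickening_subset_open hO hKO
  obtain ⟨M, hM⟩ := hK.cthickening (r := δ) |>.exists_bound_of_continuousOn
    (hθ.continuousOn.mono hsub)
  refine contDiffAt_toBCF (g := fun f : α →ᵇ ℂ => fun x => θ (f x)) (M := M) ?_
  filter_upwards [Metric.ball_mem_nhds f₀ hδ] with f hf
  have hmem : ∀ x, f x ∈ Metric.cthickening δ K := fun x =>
    Metric.mem_cthickening_of_dist_le _ _ _ _ (hf₀ x)
      ((dist_coe_le_dist x).trans (Metric.mem_ball.1 hf).le)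
  refine ⟨hθ.continuousOn.comp_continuous f.continuous fun x => hsub (hmem x), fun x => ⟨?_, ?_⟩⟩
  · exact DifferentiableAt.comp (𝕜 := ℂ) (g := θ) (f := fun f : α →ᵇ ℂ => f x) f
      (hθ.differentiableAt (hO.mem_nhds (hsub (hmem x))))
      (evalCLM ℂ x : (α →ᵇ ℂ) →L[ℂ] ℂ).differentiableAt
  · exact hM _ (hmem x)

theorem comp_toBCF_apply {α : Type*} [TopologicalSpace α] {θ : ℂ → ℂ} {K : Set ℂ}
    (hθ : ContinuousOn θ K) (hK : IsCompact K) {f : α →ᵇ ℂ} (hf : ∀ x, f x ∈ K) (x : α) :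
    toBCF (fun x => θ (f x)) x = θ (f x) := by
  obtain ⟨M, hM⟩ := hK.exists_bound_of_continuousOn hθ
  exact toBCF_apply (hθ.comp_continuous f.continuous hf) (fun x => hM _ (hf x)) x

/-- Precomposition with a continuous map. -/
def compCLM {α γ : Type*} [TopologicalSpace α] [TopologicalSpace γ] (φ : C(γ, α)) :
    (α →ᵇ ℂ) →L[ℂ] (γ →ᵇ ℂ) :=
  LinearMap.mkContinuous
    { toFun := fun f => f.compContinuous φ
      map_add' := fun _ _ => rfl
      map_smul' := fun _ _ => rfl } 1 fun f =>
        (norm_le (by positivity)).2 fun x => by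
          rw [one_mul]
          exact f.norm_coe_le_norm (φ x)

@[simp] theorem compCLM_apply {α γ : Type*} [TopologicalSpace α] [TopologicalSpace γ]
    (φ : C(γ, α)) (f : α →ᵇ ℂ) (x : γ) : compCLM φ f x = f (φ x) := rfl

/-- Integration in the second variable against a finite measure. -/
def integralCLM {α : Type*} [TopologicalSpace α] [FirstCountableTopology α] (ρ : Measure ℝ)
    [IsFiniteMeasure ρ] : (α × ℝ →ᵇ ℂ) →L[ℂ] (α →ᵇ ℂ) :=
  have hint : ∀ (f : α × ℝ →ᵇ ℂ) (x : α), Integrable (fun s => f (x, s)) ρ := fun f x =>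
    (integrable_const ‖f‖).mono' (f.continuous.comp (by fun_prop)).aestronglyMeasurable
      (ae_of_all _ fun s => f.norm_coe_le_norm _)
  have hbd : ∀ (f : α × ℝ →ᵇ ℂ) (x : α), ‖∫ s, f (x, s) ∂ρ‖ ≤ ρ.real Set.univ * ‖f‖ :=
    fun f x => by
      rw [mul_comm]
      exact norm_integral_le_of_norm_le_const (ae_of_all _ fun s => f.norm_coe_le_norm _)
  LinearMap.mkContinuous
    { toFun := fun f => BoundedContinuousFunction.ofNormedAddCommGroup
        (fun x => ∫ s, f (x, s) ∂ρ)
        (continuous_of_dominated (bound := fun _ => ‖f‖)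
          (fun x => (hint f x).aestronglyMeasurable)
          (fun x => ae_of_all _ fun s => f.norm_coe_le_norm _) (integrable_const _)
          (ae_of_all _ fun s => f.continuous.comp (by fun_prop)))
        (ρ.real Set.univ * ‖f‖) (hbd f)
      map_add' := fun f g => by
        ext x
        exact integral_add (hint f x) (hint g x)
      map_smul' := fun c f => by
        ext x
        exact integral_const_mul c _ }
    (ρ.real Set.univ) fun f => (norm_le (by positivity)).2 (hbd f)

theorem integralCLM_apply {α : Type*} [TopologicalSpace α] [FirstCountableTopology α]
    (ρ : Measure ℝ) [IsFiniteMeasure ρ] (f : α × ℝ →ᵇ ℂ) (x : α) :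
    integralCLM ρ f x = ∫ s, f (x, s) ∂ρ := rfl

/-- Complex conjugation together with precomposition with a continuous map. -/
def conjComp {α : Type*} [TopologicalSpace α] (φ : C(α, α)) : (α →ᵇ ℂ) →L[ℝ] (α →ᵇ ℂ) :=
  LinearMap.mkContinuous
    { toFun := fun f => star (f.compContinuous φ)
      map_add' := fun f g => by ext x; simp
      map_smul' := fun c f => by ext x; simp } 1 fun f =>
        (norm_le (by positivity)).2 fun x => by simpa using f.norm_coe_le_norm (φ x)

theorem conjComp_apply {α : Type*} [TopologicalSpace α] (φ : C(α, α)) (f : α →ᵇ ℂ) (x : α) :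
    conjComp φ f x = (starRingEnd ℂ) (f (φ x)) := rfl

/-- Holomorphy makes hypotheses on the derivative superfluous: Cauchy's estimate converts the
majorant of f into one for its derivative. -/
theorem hasDerivAt_integral_of_differentiableOn {S : Type*} [MeasurableSpace S] {ρ : Measure S}
    {U : Set ℂ} (hU : IsOpen U) {f : ℂ → S → ℂ} {bound : S → ℝ}
    (hm : ∀ z ∈ U, AEStronglyMeasurable (f z) ρ)
    (hd : ∀ᵐ s ∂ρ, DifferentiableOn ℂ (fun z => f z s) U)
    (hb : ∀ᵐ s ∂ρ, ∀ z ∈ U, ‖f z s‖ ≤ bound s) (hint : Integrable bound ρ) {z₀ : ℂ} (hz₀ : z₀ ∈ U) :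
    Integrable (fun s => deriv (fun z => f z s) z₀) ρ ∧
      HasDerivAt (fun z => ∫ s, f z s ∂ρ) (∫ s, deriv (fun z => f z s) z₀ ∂ρ) z₀ := by
  obtain ⟨r, hr, hsub⟩ := Metric.nhds_basis_closedBall.mem_iff.1 (hU.mem_nhds hz₀)
  have hball : ∀ z ∈ Metric.ball z₀ (r / 2), Metric.closedBall z (r / 2) ⊆ U := by
    intro z hz w hw
    refine hsub ?_
    have := dist_triangle w z z₀
    simp only [Metric.mem_ball, Metric.mem_closedBall] at *
    linarith
  refine hasDerivAt_integral_of_dominated_loc_of_deriv_le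
    (F := f) (F' := fun z s => deriv (fun z => f z s) z) (bound := fun s => bound s / (r / 2))
    (s := Metric.ball z₀ (r / 2)) (Metric.ball_mem_nhds _ (by positivity)) ?_ ?_ ?_ ?_ ?_ ?_
  · filter_upwards [hU.mem_nhds hz₀] with z hz using hm z hz
  · exact hint.mono' (hm _ hz₀) (hb.mono fun s hs => hs z₀ hz₀)
  -- The derivative is measurable in s as an almost everywhere limit of difference quotients along
  -- z₀ + r/(n+1), points that remain in U.
  · have hseq : ∀ n : ℕ, z₀ + ((r / (n + 1) : ℝ) : ℂ) ∈ U := fun n => hsub (by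
      simp only [Metric.mem_closedBall, dist_self_add_left, Complex.norm_real]
      rw [Real.norm_of_nonneg (by positivity)]
      exact div_le_self hr.le (by linarith [n.cast_nonneg (α := ℝ)]))
    refine aestronglyMeasurable_of_tendsto_ae (u := atTop)
      (f := fun (n : ℕ) s => ((r / (n + 1) : ℝ) : ℂ)⁻¹ *
        (f (z₀ + ((r / (n + 1) : ℝ) : ℂ)) s - f z₀ s)) (fun n => ?_) ?_
    · exact ((hm _ (hseq n)).sub (hm _ hz₀)).const_mul _
    · filter_upwards [hd] with s hs
      have h1 := (hs.differentiableAt (hU.mem_nhds hz₀)).hasDerivAt.tendsto_slope_zero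
      have h2 : Tendsto (fun n : ℕ => ((r / (n + 1) : ℝ) : ℂ)) atTop (𝓝[≠] 0) := by
        refine tendsto_nhdsWithin_iff.2 ⟨?_, Eventually.of_forall fun n => ?_⟩
        · have : Tendsto (fun n : ℕ => r * (1 / ((n : ℝ) + 1))) atTop (𝓝 (r * 0)) :=
            tendsto_one_div_add_atTop_nhds_zero_nat.const_mul r
          have h3 := (Complex.continuous_ofReal.tendsto _).comp this
          simpa [Function.comp_def, div_eq_mul_inv] using h3
        · have : r / ((n : ℝ) + 1) ≠ 0 := by positivity
          exact Complex.ofReal_ne_zero.2 this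
      exact h1.comp h2
  · filter_upwards [hb, hd] with s hs hds z hz
    refine Complex.norm_deriv_le_of_forall_mem_sphere_norm_le (by positivity)
      ((hds.mono (hball z hz)).diffContOnCl_ball subset_rfl) fun w hw => ?_
    exact hs w (hball z hz (Metric.sphere_subset_closedBall hw))
  · exact hint.div_const _
  · filter_upwards [hd] with s hs z hz
    exact (hs.differentiableAt (hU.mem_nhds
      (hball z hz (Metric.mem_closedBall_self (by positivity))))).hasDerivAt

end

section

open BoundedContinuousFunction MeasureTheory

/-! ### The integral `∫ e^{-s} s^{a-1} (1 + s y)^k` -/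

theorem cpow_eq_cpow_sub_one_mul {z : ℂ} (hz : z ≠ 0) (c : ℂ) : z ^ c = z ^ (c - 1) * z := by
  rw [Complex.cpow_sub _ _ hz, Complex.cpow_one]
  field_simp

/-- The half-plane Re u + Im u ≥ 0 contains the closed first quadrant, is stable under positive
scaling, and keeps 1 + u off the branch cut and at distance at least 1/2 from 0. It serves as the
domain for the argument y = 1/z throughout. -/
theorem one_add_mem_slitPlane {u : ℂ} (hu : 0 ≤ u.re + u.im) : 1 + u ∈ Complex.slitPlane := by
  rw [Complex.mem_slitPlane_iff]
  by_cases h : u.im = 0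
  · left; simp; linarith
  · right; simpa using h

theorem half_le_norm_one_add {u : ℂ} (hu : 0 ≤ u.re + u.im) : 1 / 2 ≤ ‖1 + u‖ := by
  have h1 := Complex.abs_re_le_norm (1 + u)
  have h2 := Complex.abs_im_le_norm (1 + u)
  have h3 := le_abs_self (1 + u).re
  have h4 := le_abs_self (1 + u).im
  simp at h1 h2 h3 h4
  linarith

/-- The number T = 2(1 + ‖u‖) dominates both ‖1 + u‖ and its inverse, which covers either sign of Re
k; the argument contributes at most the factor exp(πN). -/
theorem norm_one_add_cpow_le {u : ℂ} (hu : 0 ≤ u.re + u.im) (k : ℂ) {N : ℝ} (hk : ‖k‖ ≤ N) :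
    ‖(1 + u) ^ k‖ ≤ Real.exp (Real.pi * N) * (2 * (1 + ‖u‖)) ^ N := by
  have h0 : 1 + u ≠ 0 := Complex.slitPlane_ne_zero (one_add_mem_slitPlane hu)
  have hh := half_le_norm_one_add hu
  have hn : ‖1 + u‖ ≤ 1 + ‖u‖ := by simpa using norm_add_le 1 u
  set T := 2 * (1 + ‖u‖) with hT
  have hT1 : 1 ≤ T := by linarith [norm_nonneg u]
  have hpos : 0 < ‖1 + u‖ := by linarith
  rw [Complex.norm_cpow_of_ne_zero h0, div_eq_inv_mul, ← Real.exp_neg]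
  have e1 : -(Complex.arg (1 + u) * k.im) ≤ Real.pi * N := by
    refine (neg_le_abs _).trans ?_
    rw [abs_mul]
    exact mul_le_mul (Complex.abs_arg_le_pi _) ((Complex.abs_im_le_norm k).trans hk)
      (abs_nonneg _) Real.pi_pos.le
  have e2 : ‖1 + u‖ ^ k.re ≤ T ^ N := by
    have hre : |k.re| ≤ N := (Complex.abs_re_le_norm k).trans hk
    rcases le_total 0 k.re with h | h
    · exact (Real.rpow_le_rpow hpos.le (by linarith [norm_nonneg u]) h).trans
        (Real.rpow_le_rpow_of_exponent_le hT1 ((le_abs_self _).trans hre))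
    · have : ‖1 + u‖ ^ k.re = (‖1 + u‖⁻¹) ^ (-k.re) := by
        rw [Real.inv_rpow hpos.le, Real.rpow_neg hpos.le, inv_inv]
      rw [this]
      refine (Real.rpow_le_rpow (by positivity) (?_ : ‖1 + u‖⁻¹ ≤ T) (by linarith)).trans
        (Real.rpow_le_rpow_of_exponent_le hT1 ((neg_le_abs _).trans hre))
      rw [inv_le_comm₀ hpos (by linarith)]
      refine le_trans ?_ hh
      rw [inv_le_comm₀ (by linarith) (by norm_num)]
      norm_num
      linarith [norm_nonneg u]
  gcongr

/-- Comparison with exp(s/(4N)) makes polynomial growth cost exactly exp(s/4). Two such factors are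
affordable out of half of the weight exp(-s). -/
theorem one_add_mul_rpow_le {N Y s : ℝ} (hN : 0 < N) (hY : 0 ≤ Y) (hs : 0 ≤ s) :
    (1 + s * Y) ^ N ≤ (1 + 4 * N * Y) ^ N * Real.exp (s / 4) := by
  have h1 : 1 + s * Y ≤ (1 + 4 * N * Y) * Real.exp (s / (4 * N)) := by
    have h2 := Real.add_one_le_exp (s / (4 * N))
    have h3 : 0 ≤ s / (4 * N) := by positivity
    calc 1 + s * Y ≤ (1 + 4 * N * Y) * (s / (4 * N) + 1) := by
          have : 4 * N * Y * (s / (4 * N)) = s * Y := by field_simp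
          have h4 : 0 ≤ 4 * N * Y := by positivity
          nlinarith
      _ ≤ _ := by gcongr
  refine (Real.rpow_le_rpow (by positivity) h1 hN.le).trans (le_of_eq ?_)
  rw [Real.mul_rpow (by positivity) (by positivity), ← Real.exp_mul]
  congr 2
  field_simp

theorem rpow_sub_le {δ M r s : ℝ} (hδ : δ ≤ r) (hr : r ≤ M) (hM : 0 < M) (hδ0 : 0 ≤ δ)
    (hs : 0 < s) :
    s ^ (r - δ) ≤ (1 + 4 * M) ^ M * Real.exp (s / 4) := by
  have := one_add_mul_rpow_le hM zero_le_one hs.le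
  simp only [mul_one] at this
  refine le_trans ?_ this
  refine (Real.rpow_le_rpow hs.le (by linarith : s ≤ 1 + s) (by linarith)).trans ?_
  exact Real.rpow_le_rpow_of_exponent_le (by linarith) (by linarith)

/-- The integrand of `kummerJ`. -/
def kummerKernel (a k y : ℂ) (s : ℝ) : ℂ :=
  Complex.exp (-(s : ℂ)) * (s : ℂ) ^ (a - 1) * (1 + (s : ℂ) * y) ^ k

/-- The integral `∫ e^{-s} s^{a-1} (1 + s y)^k ds` over `(0, ∞)`. -/
def kummerJ (a k y : ℂ) : ℂ := ∫ s in Set.Ioi (0 : ℝ), kummerKernel a k y s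

theorem kummerU_eq (a b z : ℂ) :
    kummerU a b z = (Complex.Gamma a)⁻¹ * z ^ (-a) * kummerJ a (b - a - 1) z⁻¹ := rfl

/-- The constant in the bound for `kummerKernel`. -/
def kernelConst (M N Y : ℝ) : ℝ :=
  (1 + 4 * M) ^ M * (Real.exp (Real.pi * N) * (2 ^ N * (1 + 4 * N * Y) ^ N))

/-- Splitting s^{a-1} as s^{δ-1} s^{a-δ} leaves a fixed integrable singularity s^{δ-1} as long as δ
≤ Re a, so a single majorant works for all nearby parameters; the rest costs at most exp(s/2). -/
theorem kernel_aux {a k y : ℂ} {δ M N Y s : ℝ} (hδ0 : 0 ≤ δ) (hδ : δ ≤ a.re) (hM : a.re ≤ M)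
    (hM0 : 0 < M) (hN : 0 < N) (hk : ‖k‖ ≤ N) (hy : 0 ≤ y.re + y.im) (hY : ‖y‖ ≤ Y) (hs : 0 < s) :
    s ^ (a.re - δ) * ‖(1 + (s : ℂ) * y) ^ k‖ ≤ kernelConst M N Y * Real.exp (s / 2) := by
  have hY0 : 0 ≤ Y := (norm_nonneg _).trans hY
  have h1 := rpow_sub_le hδ hM hM0 hδ0 hs
  have hu : 0 ≤ ((s : ℂ) * y).re + ((s : ℂ) * y).im := by
    simp only [Complex.re_ofReal_mul, Complex.im_ofReal_mul, ← mul_add]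
    positivity
  have h2 := norm_one_add_cpow_le hu k hk
  have h3 : ‖(s : ℂ) * y‖ ≤ s * Y := by
    rw [norm_mul, Complex.norm_real, Real.norm_of_nonneg hs.le]; gcongr
  have h4 : (2 * (1 + ‖(s : ℂ) * y‖)) ^ N ≤ 2 ^ N * ((1 + 4 * N * Y) ^ N * Real.exp (s / 4)) := by
    rw [Real.mul_rpow (by norm_num) (by positivity)]
    gcongr
    exact (Real.rpow_le_rpow (by positivity) (by linarith) hN.le).trans
      (one_add_mul_rpow_le hN hY0 hs.le)
  calc s ^ (a.re - δ) * ‖(1 + (s : ℂ) * y) ^ k‖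
      ≤ ((1 + 4 * M) ^ M * Real.exp (s / 4)) *
        (Real.exp (Real.pi * N) * (2 ^ N * ((1 + 4 * N * Y) ^ N * Real.exp (s / 4)))) := by
        gcongr
        exact h2.trans (by gcongr)
    _ = kernelConst M N Y * (Real.exp (s / 4) * Real.exp (s / 4)) := by
        rw [kernelConst]; ring
    _ = _ := by rw [← Real.exp_add]; ring_nf

theorem norm_kummerKernel_le {a k y : ℂ} {δ M N Y s : ℝ} (hδ0 : 0 ≤ δ) (hδ : δ ≤ a.re)
    (hM : a.re ≤ M) (hM0 : 0 < M) (hN : 0 < N) (hk : ‖k‖ ≤ N) (hy : 0 ≤ y.re + y.im)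
    (hY : ‖y‖ ≤ Y) (hs : 0 < s) :
    ‖kummerKernel a k y s‖ ≤ kernelConst M N Y * (Real.exp (-s / 2) * s ^ (δ - 1)) := by
  have h := kernel_aux hδ0 hδ hM hM0 hN hk hy hY hs
  have e1 : ‖Complex.exp (-(s : ℂ))‖ = Real.exp (-s) := by
    rw [Complex.norm_exp]; simp
  have e2 : ‖(s : ℂ) ^ (a - 1)‖ = s ^ (δ - 1) * s ^ (a.re - δ) := by
    rw [Complex.norm_cpow_eq_rpow_re_of_pos hs, ← Real.rpow_add hs]
    simp
  rw [kummerKernel, norm_mul, norm_mul, e1, e2]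
  calc Real.exp (-s) * (s ^ (δ - 1) * s ^ (a.re - δ)) * ‖(1 + (s : ℂ) * y) ^ k‖
      = Real.exp (-s) * s ^ (δ - 1) * (s ^ (a.re - δ) * ‖(1 + (s : ℂ) * y) ^ k‖) := by ring
    _ ≤ Real.exp (-s) * s ^ (δ - 1) * (kernelConst M N Y * Real.exp (s / 2)) := by gcongr
    _ = kernelConst M N Y * ((Real.exp (-s) * Real.exp (s / 2)) * s ^ (δ - 1)) := by ring
    _ = _ := by rw [← Real.exp_add]; ring_nf

theorem integrableOn_kernelBound {δ : ℝ} (hδ : 0 < δ) :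
    IntegrableOn (fun s : ℝ => Real.exp (-s / 2) * s ^ (δ - 1)) (Set.Ioi 0) := by
  have := integrableOn_rpow_mul_exp_neg_mul_rpow (s := δ - 1) (p := 1) (b := 1 / 2) (by linarith)
    one_pos (by norm_num)
  refine this.congr_fun (fun s hs => ?_) measurableSet_Ioi
  simp only [Real.rpow_one]
  rw [mul_comm]
  ring_nf

theorem measurable_kummerKernel (a k y : ℂ) : Measurable (kummerKernel a k y) := by
  unfold kummerKernel
  fun_prop

theorem integrableOn_kummerKernel {a k y : ℂ} (ha : 0 < a.re) (hy : 0 ≤ y.re + y.im) :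
    IntegrableOn (kummerKernel a k y) (Set.Ioi 0) :=
  ((integrableOn_kernelBound ha).const_mul (kernelConst a.re (‖k‖ + 1) ‖y‖)).mono'
    (measurable_kummerKernel a k y).aestronglyMeasurable
    ((ae_restrict_mem measurableSet_Ioi).mono fun s hs =>
      norm_kummerKernel_le ha.le le_rfl le_rfl ha (by positivity) (by linarith) hy le_rfl hs)

theorem kummerJ_zero (a k : ℂ) (ha : 0 < a.re) : kummerJ a k 0 = Complex.Gamma a := by
  rw [kummerJ, Complex.Gamma_eq_integral ha, Complex.GammaIntegral]
  refine setIntegral_congr_fun measurableSet_Ioi fun s hs => ?_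
  simp [kummerKernel]

theorem continuousOn_kummerJ :
    ContinuousOn (fun p : ℂ × ℂ × ℂ => kummerJ p.1 p.2.1 p.2.2)
      {p | 0 < p.1.re ∧ 0 ≤ p.2.2.re + p.2.2.im} := by
  rintro ⟨a, k, y⟩ ⟨ha, hy⟩
  simp only at ha hy
  refine continuousWithinAt_of_dominated
    (bound := fun s => kernelConst (a.re + 1) (‖k‖ + 1) (‖y‖ + 1) *
      (Real.exp (-s / 2) * s ^ (a.re / 2 - 1))) ?_ ?_ ?_ ?_
  · exact Eventually.of_forall fun p => (measurable_kummerKernel _ _ _).aestronglyMeasurable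
  · have h1 : ∀ᶠ p : ℂ × ℂ × ℂ in 𝓝 (a, k, y), a.re / 2 < p.1.re :=
      (Continuous.tendsto (by fun_prop) _).eventually_const_lt (by simp; linarith)
    have h2 : ∀ᶠ p : ℂ × ℂ × ℂ in 𝓝 (a, k, y), p.1.re < a.re + 1 :=
      (Continuous.tendsto (by fun_prop) _).eventually_lt_const (by simp)
    have h3 : ∀ᶠ p : ℂ × ℂ × ℂ in 𝓝 (a, k, y), ‖p.2.1‖ < ‖k‖ + 1 :=
      (Continuous.tendsto (by fun_prop) _).eventually_lt_const (by simp)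
    have h4 : ∀ᶠ p : ℂ × ℂ × ℂ in 𝓝 (a, k, y), ‖p.2.2‖ < ‖y‖ + 1 :=
      (Continuous.tendsto (by fun_prop) _).eventually_lt_const (by simp)
    filter_upwards [nhdsWithin_le_nhds h1, nhdsWithin_le_nhds h2, nhdsWithin_le_nhds h3,
      nhdsWithin_le_nhds h4, self_mem_nhdsWithin] with p h1 h2 h3 h4 h5
    refine (ae_restrict_mem measurableSet_Ioi).mono fun s hs => ?_
    exact norm_kummerKernel_le (by positivity) h1.le h2.le (by positivity) (by positivity) h3.le h5.2
      h4.le hs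
  · exact (integrableOn_kernelBound (by positivity)).const_mul _
  · refine (ae_restrict_mem measurableSet_Ioi).mono fun s (hs : 0 < s) => ?_
    have hs0 : (s : ℂ) ≠ 0 := by exact_mod_cast hs.ne'
    have hsl : 1 + (s : ℂ) * y ∈ Complex.slitPlane := one_add_mem_slitPlane (by
      simp only [Complex.re_ofReal_mul, Complex.im_ofReal_mul, ← mul_add]
      positivity)
    refine ContinuousAt.continuousWithinAt ?_
    unfold kummerKernel
    refine ContinuousAt.mul (ContinuousAt.mul continuousAt_const ?_) ?_
    · exact ContinuousAt.const_cpow (by fun_prop) (Or.inl hs0)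
    · exact ContinuousAt.cpow (by fun_prop) (by fun_prop) hsl

theorem hasDerivAt_kummerJ {a k y : ℂ} (ha : 0 < a.re) (hy : 0 < y.re + y.im) :
    HasDerivAt (fun y => kummerJ a k y) (k * kummerJ (a + 1) (k - 1) y) y := by
  -- A bounded neighbourhood of y, so that one integrable majorant is valid at all its points.
  set U : Set ℂ := {y | 0 < y.re + y.im} ∩ Metric.ball 0 (‖y‖ + 1) with hUdef
  have hU : IsOpen U :=
    (isOpen_lt continuous_const (Complex.continuous_re.add Complex.continuous_im)).inter
      Metric.isOpen_ball
  have hyU : y ∈ U := ⟨hy, by simp⟩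
  have hder : ∀ s : ℝ, 0 < s → ∀ z ∈ U, HasDerivAt (fun y => kummerKernel a k y s)
      (k * kummerKernel (a + 1) (k - 1) z s) z := by
    intro s hs z hz
    have hs0 : (s : ℂ) ≠ 0 := by exact_mod_cast hs.ne'
    have hz1 : 0 < z.re + z.im := hz.1
    have hsl : 1 + (s : ℂ) * z ∈ Complex.slitPlane := one_add_mem_slitPlane (by
      simp only [Complex.re_ofReal_mul, Complex.im_ofReal_mul, ← mul_add]
      positivity)
    have h1 := ((((hasDerivAt_id z).const_mul (s : ℂ)).const_add 1).cpow_const (c := k) hsl).const_mul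
      (Complex.exp (-(s : ℂ)) * (s : ℂ) ^ (a - 1))
    convert! h1 using 1
    have : (s : ℂ) ^ (a + 1 - 1) = (s : ℂ) ^ (a - 1) * s := by
      rw [add_sub_cancel_right, cpow_eq_cpow_sub_one_mul hs0]
    rw [kummerKernel, this]
    simp only [id]
    ring
  have key := (hasDerivAt_integral_of_differentiableOn (ρ := volume.restrict (Set.Ioi 0)) hU
    (f := fun y s => kummerKernel a k y s)
    (bound := fun s => kernelConst a.re (‖k‖ + 1) (‖y‖ + 1) *
      (Real.exp (-s / 2) * s ^ (a.re - 1)))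
    (fun z _ => (measurable_kummerKernel _ _ _).aestronglyMeasurable)
    ((ae_restrict_mem measurableSet_Ioi).mono fun s hs z hz =>
      (hder s hs z hz).differentiableAt.differentiableWithinAt)
    ((ae_restrict_mem measurableSet_Ioi).mono fun s hs z hz =>
      norm_kummerKernel_le ha.le le_rfl le_rfl ha (by positivity) (by linarith) (le_of_lt hz.1)
        (by simpa using (Metric.mem_ball.1 hz.2).le) hs)
    ((integrableOn_kernelBound ha).const_mul _) hyU).2
  convert! key using 1
  rw [kummerJ, ← integral_const_mul]
  exact setIntegral_congr_fun measurableSet_Ioi fun s hs => (hder s hs y hyU).deriv.symm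

theorem kummerJ_eq_add {a k y : ℂ} (ha : 0 < a.re) (hy : 0 ≤ y.re + y.im) :
    kummerJ a k y = kummerJ a (k - 1) y + y * kummerJ (a + 1) (k - 1) y := by
  rw [kummerJ, kummerJ, kummerJ, ← integral_const_mul, ← integral_add
    (integrableOn_kummerKernel ha hy)
    ((integrableOn_kummerKernel (by simp; linarith) hy).const_mul _)]
  refine setIntegral_congr_fun measurableSet_Ioi fun s (hs : 0 < s) => ?_
  have hs0 : (s : ℂ) ≠ 0 := by exact_mod_cast hs.ne'
  have hsl : 1 + (s : ℂ) * y ≠ 0 := Complex.slitPlane_ne_zero (one_add_mem_slitPlane (by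
    simp only [Complex.re_ofReal_mul, Complex.im_ofReal_mul, ← mul_add]
    positivity))
  have h1 : (s : ℂ) ^ (a + 1 - 1) = (s : ℂ) ^ (a - 1) * s := by
    rw [add_sub_cancel_right, cpow_eq_cpow_sub_one_mul hs0]
  have h2 : (1 + (s : ℂ) * y) ^ k = (1 + (s : ℂ) * y) ^ (k - 1) * (1 + (s : ℂ) * y) :=
    cpow_eq_cpow_sub_one_mul hsl k
  simp only [kummerKernel]
  rw [h1, h2]
  ring

/-- This is the vanishing integral of the derivative of e^{-s} s^a (1 + sy)^k: the boundary terms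
are zero because Re a > 0 at the origin and because of exponential decay at infinity. -/
theorem kummerJ_by_parts {a k y : ℂ} (ha : 0 < a.re) (hy : 0 ≤ y.re + y.im) :
    a * kummerJ a k y - kummerJ (a + 1) k y + k * y * kummerJ (a + 1) (k - 1) y = 0 := by
  have ha1 : 0 < (a + 1).re := by simp; linarith
  have hsl : ∀ s : ℝ, 0 ≤ s → 1 + (s : ℂ) * y ∈ Complex.slitPlane := fun s hs =>
    one_add_mem_slitPlane (by
      simp only [Complex.re_ofReal_mul, Complex.im_ofReal_mul, ← mul_add]
      positivity)
  have hi1 := (integrableOn_kummerKernel (k := k) ha hy).const_mul a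
  have hi2 := integrableOn_kummerKernel (k := k) ha1 hy
  have hi3 := (integrableOn_kummerKernel (k := k - 1) ha1 hy).const_mul (k * y)
  have hint : a * kummerJ a k y - kummerJ (a + 1) k y + k * y * kummerJ (a + 1) (k - 1) y
      = ∫ s in Set.Ioi (0 : ℝ), (a * kummerKernel a k y s - kummerKernel (a + 1) k y s
        + k * y * kummerKernel (a + 1) (k - 1) y s) := by
    have e1 := integral_add (hi1.sub hi2) hi3
    have e2 := integral_sub hi1 hi2
    rw [integral_const_mul] at e1 e2
    simp only [Pi.sub_apply] at e1
    rw [e1, e2]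
    rfl
  rw [hint]
  set f : ℝ → ℂ := fun s => kummerKernel (a + 1) k y s with hf
  have hderiv : ∀ s ∈ Set.Ioi (0 : ℝ), HasDerivAt f (a * kummerKernel a k y s
      - kummerKernel (a + 1) k y s + k * y * kummerKernel (a + 1) (k - 1) y s) s := by
    intro s hs
    have hs0 : (s : ℂ) ≠ 0 := by exact_mod_cast (ne_of_gt hs)
    have e1 : HasDerivAt (fun s : ℂ => Complex.exp (-s)) (-Complex.exp (-(s : ℂ))) (s : ℂ) := by
      simpa using (hasDerivAt_id (s : ℂ)).neg.cexp
    have e2 : HasDerivAt (fun s : ℂ => s ^ a) (a * (s : ℂ) ^ (a - 1)) (s : ℂ) := by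
      simpa using (hasDerivAt_id (s : ℂ)).cpow_const (c := a) (Complex.ofReal_mem_slitPlane.2 hs)
    have e3 : HasDerivAt (fun s : ℂ => (1 + s * y) ^ k)
        (k * (1 + (s : ℂ) * y) ^ (k - 1) * y) (s : ℂ) := by
      simpa using (((hasDerivAt_id (s : ℂ)).mul_const y).const_add 1).cpow_const (c := k)
        (hsl s (le_of_lt hs))
    have e4 := ((e1.mul e2).mul e3).comp_ofReal
    have h1 : (s : ℂ) ^ a = (s : ℂ) ^ (a - 1) * s :=
      cpow_eq_cpow_sub_one_mul hs0 a
    convert! e4 using 1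
    · ext t; simp [hf, kummerKernel]
    · simp only [kummerKernel, add_sub_cancel_right, Pi.mul_apply]
      ring
  have hcont : ContinuousWithinAt f (Set.Ici 0) 0 := by
    refine ContinuousAt.continuousWithinAt ?_
    have h0 : ContinuousAt (fun s : ℝ => (s : ℂ) ^ a) 0 :=
      Complex.continuousAt_ofReal_cpow_const 0 a (Or.inl ha)
    have h1 : ContinuousAt (fun s : ℝ => (1 + (s : ℂ) * y) ^ k) 0 :=
      ContinuousAt.cpow (by fun_prop) continuousAt_const (hsl 0 le_rfl)
    have h2 : ContinuousAt (fun s : ℝ => Complex.exp (-(s : ℂ))) 0 := by fun_prop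
    simpa [hf, kummerKernel] using! (h2.mul h0).mul h1
  have hlim : Tendsto f atTop (𝓝 0) := by
    refine squeeze_zero_norm' (a := fun s => kernelConst (a + 1).re (‖k‖ + 1) ‖y‖ *
      (Real.exp (-s / 2) * s ^ ((a + 1).re - 1))) ?_ ?_
    · filter_upwards [eventually_gt_atTop 0] with s hs
      exact norm_kummerKernel_le ha1.le le_rfl le_rfl ha1 (by positivity) (by linarith) hy le_rfl hs
    · have := tendsto_rpow_mul_exp_neg_mul_atTop_nhds_zero ((a + 1).re - 1) (1 / 2) (by norm_num)
      have h2 := this.const_mul (kernelConst (a + 1).re (‖k‖ + 1) ‖y‖)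
      rw [mul_zero] at h2
      refine h2.congr fun s => ?_
      rw [mul_comm (s ^ _)]
      ring_nf
  rw [integral_Ioi_of_hasDerivAt_of_tendsto hcont hderiv ((hi1.sub hi2).add hi3) hlim]
  simp [hf, kummerKernel, ne_of_apply_ne Complex.re (by simpa using ha.ne' : a.re ≠ (0 : ℂ).re)]

/-- Kummer's equation, in terms of contiguous integrals. -/
theorem kummerJ_contiguous {a k y : ℂ} (ha : 0 < a.re) (hy : 0 ≤ y.re + y.im) :
    (k - 1) * y ^ 2 * kummerJ (a + 2) (k - 2) y + ((1 + a - k) * y + 1) * kummerJ (a + 1) (k - 1) y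
      - a * kummerJ a k y = 0 := by
  have ha1 : 0 < (a + 1).re := by simp; linarith
  -- Since the y-derivative of J(a, k) is k J(a+1, k-1), the claim multiplied by k is the second
  -- order equation of J in y. It is a linear combination of two splittings of the power (1 + sy)^k
  -- and one integration by parts.
  have h1 := kummerJ_eq_add (k := k) ha hy
  have h2 := kummerJ_by_parts (k := k - 1) ha hy
  have h3 := kummerJ_eq_add (k := k - 1) ha1 hy
  have e1 : a + 1 + 1 = a + 2 := by ring
  have e2 : k - 1 - 1 = k - 2 := by ring
  rw [e1, e2] at h3
  rw [e2] at h2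
  linear_combination -a * h1 - h2 - (k - 1) * y * h3

end

section

open BoundedContinuousFunction MeasureTheory

/-! ### Absence of zeros -/

/-- A decaying solution of `w'' = V w` on the half line which vanishes at the origin is zero if the
real part of `V` exceeds the potential of the radial harmonic oscillator at its ground state. -/
theorem eq_zero_of_oscillator {w w₁ V : ℝ → ℂ} {D α : ℝ} (hα : 0 < α)
    (hw : ∀ s, 0 ≤ s → HasDerivAt w (w₁ s) s) (hw₁ : ∀ s, 0 ≤ s → HasDerivAt w₁ (V s * w s) s)
    (hV : ∀ s, 0 < s → s ^ 2 / 4 - D / 2 + 2 * α + (D - 1) * (D - 3) / (4 * s ^ 2) ≤ (V s).re)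
    (h0 : w 0 = 0) (hlim : Tendsto (fun s => s * ‖w s‖ ^ 2) atTop (𝓝 0))
    (hlim₁ : Tendsto (fun s => ‖w s‖ * ‖w₁ s‖) atTop (𝓝 0)) {s : ℝ} (hs : 0 < s) : w s = 0 := by
  -- The logarithmic derivative of the ground state s^{(D-1)/2} e^{-s²/4}; hence h² + h' is the
  -- potential minus the ground state energy.
  set h : ℝ → ℝ := fun s => (D - 1) / (2 * s) - s / 2 with hh
  -- With E = Re(conj w · w₁) - h |w|², completing the square gives E' = |w₁ - h w|² + (Re V - h² -
  -- h') |w|² ≥ 2α |w|².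
  set E : ℝ → ℝ := fun s => (w s).re * (w₁ s).re + (w s).im * (w₁ s).im
    - h s * ((w s).re ^ 2 + (w s).im ^ 2) with hE
  have hnorm : ∀ z : ℂ, ‖z‖ ^ 2 = z.re ^ 2 + z.im ^ 2 := fun z => by
    rw [Complex.sq_norm, Complex.normSq_apply]; ring
  have hre : ∀ {f : ℝ → ℂ} {f' : ℂ} {s : ℝ}, HasDerivAt f f' s →
      HasDerivAt (fun s => (f s).re) f'.re s := fun hf =>
    (Complex.reCLM.hasFDerivAt.comp_hasDerivAt _ hf)
  have him : ∀ {f : ℝ → ℂ} {f' : ℂ} {s : ℝ}, HasDerivAt f f' s →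
      HasDerivAt (fun s => (f s).im) f'.im s := fun hf =>
    (Complex.imCLM.hasFDerivAt.comp_hasDerivAt _ hf)
  have hder : ∀ s, 0 < s → ∃ E', HasDerivAt E E' s ∧
      2 * α * ((w s).re ^ 2 + (w s).im ^ 2) ≤ E' := by
    intro s hs
    have h1 : HasDerivAt h (-(D - 1) / (2 * s ^ 2) - 1 / 2) s := by
      have e1 := ((hasDerivAt_inv hs.ne').const_mul ((D - 1) / 2)).sub
        ((hasDerivAt_id s).div_const 2)
      convert! e1 using 1
      · ext t
        simp [hh, div_eq_mul_inv]
        ring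
      · field_simp
    have hp := hre (hw s hs.le)
    have hq := him (hw s hs.le)
    have hp1 := hre (hw₁ s hs.le)
    have hq1 := him (hw₁ s hs.le)
    refine ⟨_, ((hp.mul hp1).add (hq.mul hq1)).sub (h1.mul ((hp.pow 2).add (hq.pow 2))), ?_⟩
    have hVs := hV s hs
    simp only [Complex.mul_re, Complex.mul_im]
    set p := (w s).re
    set q := (w s).im
    set p1 := (w₁ s).re
    set q1 := (w₁ s).im
    have key := mul_le_mul_of_nonneg_right hVs (by positivity : 0 ≤ p ^ 2 + q ^ 2)
    have e2 : h s ^ 2 + (-(D - 1) / (2 * s ^ 2) - 1 / 2)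
        = s ^ 2 / 4 - D / 2 + (D - 1) * (D - 3) / (4 * s ^ 2) := by
      simp only [hh]; field_simp; ring
    norm_num
    have e3 : 0 ≤ (p1 - h s * p) ^ 2 + (q1 - h s * q) ^ 2 := by positivity
    have e4 : s ^ 2 / 4 - D / 2 + 2 * α + (D - 1) * (D - 3) / (4 * s ^ 2)
        = h s ^ 2 + (-(D - 1) / (2 * s ^ 2) - 1 / 2) + 2 * α := by rw [e2]; ring
    rw [e4] at key
    norm_num at key
    nlinarith [key, e3]
  have hmono : MonotoneOn E (Set.Ioi 0) := by
    refine monotoneOn_of_deriv_nonneg (convex_Ioi 0) (fun s hs => ?_) (fun s hs => ?_)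
      (fun s hs => ?_)
    · obtain ⟨E', h1, -⟩ := hder s hs
      exact h1.continuousAt.continuousWithinAt
    · obtain ⟨E', h1, -⟩ := hder s (interior_subset hs)
      exact h1.differentiableAt.differentiableWithinAt
    · obtain ⟨E', h1, h2⟩ := hder s (interior_subset hs)
      rw [h1.deriv]
      exact le_trans (by positivity) h2
  -- The singularity 1/s of h at the origin is harmless because w vanishes there to first order.
  have hdiv : Tendsto (fun s : ℝ => ‖w s‖ ^ 2 / s) (𝓝[>] 0) (𝓝 0) := by
    have h1 := (hw 0 le_rfl).tendsto_slope_zero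
    have h2 : Tendsto (fun t : ℝ => ‖t⁻¹ • (w (0 + t) - w 0)‖ ^ 2 * t) (𝓝[>] 0)
        (𝓝 (‖w₁ 0‖ ^ 2 * 0)) :=
      (((h1.mono_left (nhdsWithin_mono _ fun x (hx : 0 < x) => hx.ne')).norm).pow 2).mul
        (tendsto_id.mono_left nhdsWithin_le_nhds)
    rw [mul_zero] at h2
    refine h2.congr' ?_
    filter_upwards [self_mem_nhdsWithin] with t (ht : 0 < t)
    rw [zero_add, h0, sub_zero, norm_smul, norm_inv, Real.norm_of_nonneg ht.le]
    field_simp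
  have hE0 : Tendsto E (𝓝[>] 0) (𝓝 0) := by
    have c1 : Tendsto w (𝓝[>] 0) (𝓝 0) := by
      have := (hw 0 le_rfl).continuousAt.tendsto
      rw [h0] at this
      exact this.mono_left nhdsWithin_le_nhds
    have c2 : Tendsto w₁ (𝓝[>] 0) (𝓝 (w₁ 0)) :=
      (hw₁ 0 le_rfl).continuousAt.tendsto.mono_left nhdsWithin_le_nhds
    have r1 := (Complex.continuous_re.tendsto _).comp c1
    have i1 := (Complex.continuous_im.tendsto _).comp c1
    have r2 := (Complex.continuous_re.tendsto _).comp c2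
    have i2 := (Complex.continuous_im.tendsto _).comp c2
    have t1 := (r1.mul r2).add (i1.mul i2)
    have t2 := hdiv.const_mul ((D - 1) / 2)
    have t3 : Tendsto (fun s : ℝ => s / 2 * ‖w s‖ ^ 2) (𝓝[>] 0) (𝓝 (0 / 2 * ‖(0 : ℂ)‖ ^ 2)) :=
      ((tendsto_id.mono_left nhdsWithin_le_nhds).div_const 2).mul (c1.norm.pow 2)
    have t4 := (t1.sub t2).add t3
    simp only [Complex.zero_re, Complex.zero_im, zero_mul, mul_zero, add_zero, sub_zero,
      zero_div] at t4
    refine t4.congr fun s => ?_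
    simp only [hE, hh, Function.comp, ← hnorm]
    ring
  have hEinf : Tendsto E atTop (𝓝 0) := by
    have t1 : Tendsto (fun s => (w s).re * (w₁ s).re + (w s).im * (w₁ s).im) atTop (𝓝 0) := by
      refine squeeze_zero_norm (fun s => ?_) hlim₁
      have : (w s).re * (w₁ s).re + (w s).im * (w₁ s).im = ((starRingEnd ℂ) (w s) * w₁ s).re := by
        simp
      rw [this, Real.norm_eq_abs]
      refine (Complex.abs_re_le_norm _).trans ?_
      rw [norm_mul, RCLike.norm_conj]
    have t2 : Tendsto (fun s => h s * ‖w s‖ ^ 2) atTop (𝓝 0) := by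
      have : Tendsto (fun s : ℝ => ((D - 1) / 2 * (s⁻¹) ^ 2 - 1 / 2) * (s * ‖w s‖ ^ 2)) atTop
          (𝓝 (((D - 1) / 2 * 0 ^ 2 - 1 / 2) * 0)) :=
        (((tendsto_inv_atTop_zero.pow 2).const_mul _).sub_const _).mul hlim
      rw [mul_zero] at this
      refine this.congr' ?_
      filter_upwards [eventually_gt_atTop 0] with s hs
      simp only [hh]
      field_simp
    have t3 := t1.sub t2
    rw [sub_zero] at t3
    refine t3.congr fun s => ?_
    simp only [hE, ← hnorm]
  -- A monotone function with limit 0 at both ends vanishes; its zero derivative then bounds 2α |w|²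
  -- by 0.
  have hEz : ∀ s, 0 < s → E s = 0 := by
    intro s hs
    refine le_antisymm ?_ ?_
    · refine ge_of_tendsto hEinf ?_
      filter_upwards [eventually_ge_atTop s] with t ht
      exact hmono hs (lt_of_lt_of_le hs ht : (0 : ℝ) < t) ht
    · refine le_of_tendsto hE0 ?_
      filter_upwards [Ioo_mem_nhdsGT hs] with t ht
      exact hmono ht.1 hs ht.2.le
  obtain ⟨E', h1, h2⟩ := hder s hs
  have h3 : HasDerivAt E 0 s := by
    refine (hasDerivAt_const s (0 : ℝ)).congr_of_eventuallyEq ?_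
    filter_upwards [lt_mem_nhds hs] with t ht using hEz t ht
  rw [h1.unique h3, ← hnorm] at h2
  have : ‖w s‖ ^ 2 ≤ 0 := by nlinarith [sq_nonneg ‖w s‖]
  simpa using le_antisymm this (sq_nonneg _)

/-- The normal form `ζ^{b-1/2-2a} e^{-ζ²/4} ∫ e^{-s} s^{a-1} (1 + 2s/ζ²)^{b-a-1} ds`. -/
def weberW (a b ζ : ℂ) : ℂ :=
  ζ ^ (b - 1 / 2 - 2 * a) * Complex.exp (-ζ ^ 2 / 4) * kummerJ a (b - a - 1) (2 / ζ ^ 2)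

/-- The derivative of `weberW`. -/
def weberW' (a b ζ : ℂ) : ℂ :=
  ζ ^ (b - 1 / 2 - 2 * a) * Complex.exp (-ζ ^ 2 / 4) *
    (((b - 1 / 2 - 2 * a) / ζ - ζ / 2) * kummerJ a (b - a - 1) (2 / ζ ^ 2)
      - 4 / ζ ^ 3 * (b - a - 1) * kummerJ (a + 1) (b - a - 2) (2 / ζ ^ 2))

theorem hasDerivAt_kummerJ_comp {a k ζ : ℂ} (ha : 0 < a.re) (hζ : ζ ≠ 0)
    (hy : 0 < (2 / ζ ^ 2).re + (2 / ζ ^ 2).im) :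
    HasDerivAt (fun ζ => kummerJ a k (2 / ζ ^ 2))
      (-4 / ζ ^ 3 * k * kummerJ (a + 1) (k - 1) (2 / ζ ^ 2)) ζ := by
  have h1 : HasDerivAt (fun ζ : ℂ => 2 / ζ ^ 2) (-4 / ζ ^ 3) ζ := by
    have := ((hasDerivAt_pow 2 ζ).inv (pow_ne_zero 2 hζ)).const_mul 2
    convert! this using 1
    field_simp
    norm_num
  convert! (hasDerivAt_kummerJ (k := k) ha hy).comp ζ h1 using 1
  ring

theorem hasDerivAt_weberPrefactor {B ζ : ℂ} (hζ : ζ ∈ Complex.slitPlane) :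
    HasDerivAt (fun ζ : ℂ => ζ ^ B * Complex.exp (-ζ ^ 2 / 4))
      (ζ ^ B * Complex.exp (-ζ ^ 2 / 4) * (B / ζ - ζ / 2)) ζ := by
  have hζ0 := Complex.slitPlane_ne_zero hζ
  have e1 : HasDerivAt (fun ζ : ℂ => ζ ^ B) (B * ζ ^ (B - 1)) ζ := by
    simpa using (hasDerivAt_id ζ).cpow_const (c := B) hζ
  have e2 : HasDerivAt (fun ζ : ℂ => Complex.exp (-ζ ^ 2 / 4))
      (Complex.exp (-ζ ^ 2 / 4) * (-(2 * ζ) / 4)) ζ := by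
    simpa using (((hasDerivAt_pow 2 ζ).neg).div_const 4).cexp
  convert! e1.mul e2 using 1
  rw [cpow_eq_cpow_sub_one_mul hζ0 B]
  field_simp
  ring

theorem hasDerivAt_weberW {a b ζ : ℂ} (ha : 0 < a.re) (hζ : ζ ∈ Complex.slitPlane)
    (hy : 0 < (2 / ζ ^ 2).re + (2 / ζ ^ 2).im) : HasDerivAt (weberW a b) (weberW' a b ζ) ζ := by
  have h1 := (hasDerivAt_weberPrefactor (B := b - 1 / 2 - 2 * a) hζ).mul
    (hasDerivAt_kummerJ_comp (k := b - a - 1) ha (Complex.slitPlane_ne_zero hζ) hy)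
  convert! h1 using 1
  have : b - a - 1 - 1 = b - a - 2 := by ring
  rw [weberW', this]
  ring

/-- With z = ζ²/2, the function `weberW` is a constant times ζ^{b-1/2} e^{-ζ²/4} U(a, b, z). This is
the Liouville normal form of Kummer's equation: the prefactor removes the first order term and
leaves a Schrödinger equation of oscillator type. -/
theorem hasDerivAt_weberW' {a b ζ : ℂ} (ha : 0 < a.re) (hζ : ζ ∈ Complex.slitPlane)
    (hy : 0 < (2 / ζ ^ 2).re + (2 / ζ ^ 2).im) :
    HasDerivAt (weberW' a b)
      ((ζ ^ 2 / 4 - b + 2 * a + (b - 1 / 2) * (b - 3 / 2) / ζ ^ 2) * weberW a b ζ) ζ := by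
  have hζ0 := Complex.slitPlane_ne_zero hζ
  have ha1 : 0 < (a + 1).re := by simp; linarith
  have d1 : HasDerivAt (fun ζ : ℂ => (b - 1 / 2 - 2 * a) / ζ - ζ / 2)
      (-(b - 1 / 2 - 2 * a) / ζ ^ 2 - 1 / 2) ζ := by
    have := ((hasDerivAt_inv hζ0).const_mul (b - 1 / 2 - 2 * a)).sub
      ((hasDerivAt_id ζ).div_const 2)
    convert! this using 1
    ring
  have d2 : HasDerivAt (fun ζ : ℂ => 4 / ζ ^ 3 * (b - a - 1)) (-12 / ζ ^ 4 * (b - a - 1)) ζ := by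
    have := (((hasDerivAt_pow 3 ζ).inv (pow_ne_zero 3 hζ0)).const_mul 4).mul_const (b - a - 1)
    convert! this using 1
    field_simp
    norm_num
    ring
  have h0 := hasDerivAt_kummerJ_comp (k := b - a - 1) ha hζ0 hy
  have h1 := hasDerivAt_kummerJ_comp (k := b - a - 2) ha1 hζ0 hy
  have e1 : b - a - 1 - 1 = b - a - 2 := by ring
  have e2 : b - a - 2 - 1 = b - a - 1 - 2 := by ring
  have e3 : a + 1 + 1 = a + 2 := by ring
  rw [e1] at h0
  rw [e2, e3] at h1
  have hc := kummerJ_contiguous (k := b - a - 1) ha hy.le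
  rw [e1] at hc
  convert! (hasDerivAt_weberPrefactor (B := b - 1 / 2 - 2 * a) hζ).mul
    ((d1.mul h0).sub (d2.mul h1)) using 1
  simp only [weberW, Pi.sub_apply, Pi.mul_apply]
  set K0 := kummerJ a (b - a - 1) (2 / ζ ^ 2)
  set K1 := kummerJ (a + 1) (b - a - 2) (2 / ζ ^ 2)
  set K2 := kummerJ (a + 2) (b - a - 1 - 2) (2 / ζ ^ 2)
  set g := ζ ^ (b - 1 / 2 - 2 * a) * Complex.exp (-ζ ^ 2 / 4)
  have hc' : (b - a - 2) * 4 * K2 + ((1 + a - (b - a - 1)) * 2 * ζ ^ 2 + ζ ^ 4) * K1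
      - a * ζ ^ 4 * K0 = 0 := by
    have : ζ ^ 4 * ((b - a - 2) * (2 / ζ ^ 2) ^ 2 * K2
        + ((1 + a - (b - a - 1)) * (2 / ζ ^ 2) + 1) * K1 - a * K0) = 0 := by rw [hc, mul_zero]
    rw [← this]
    field_simp
    ring
  field_simp
  linear_combination (-64 * g * (b - a - 1)) * hc'

/-- The real part of (ζ₀ + s)² is at least s², so the Gaussian factor beats every power; comparison
with exp(-s) is enough. -/
theorem tendsto_weberPrefactor (B ζ₀ : ℂ) (h1 : 0 < ζ₀.re) (h2 : 0 ≤ (ζ₀ ^ 2).re) :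
    Tendsto (fun s : ℝ => (s : ℂ) * ((ζ₀ + s) ^ B * Complex.exp (-(ζ₀ + s) ^ 2 / 4))) atTop
      (𝓝 0) := by
  set N := ‖B‖
  have hlim := (tendsto_rpow_mul_exp_neg_mul_atTop_nhds_zero (N + 1) 1 one_pos).const_mul
    (Real.exp (Real.pi * N) * (2 * (3 + ‖ζ₀‖)) ^ N)
  rw [mul_zero] at hlim
  refine squeeze_zero_norm' ?_ hlim
  filter_upwards [eventually_ge_atTop 4, eventually_ge_atTop (1 - ζ₀.re - ζ₀.im)] with s hs hs'
  have hs0 : 0 < s := by linarith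
  have hu : 0 ≤ (ζ₀ + s - 1).re + (ζ₀ + s - 1).im := by simp; linarith
  have e1 := norm_one_add_cpow_le hu B le_rfl
  rw [add_sub_cancel] at e1
  have e2 : 2 * (1 + ‖ζ₀ + s - 1‖) ≤ 2 * (3 + ‖ζ₀‖) * s := by
    have := norm_sub_le (ζ₀ + s) 1
    have h3 := norm_add_le ζ₀ (s : ℂ)
    rw [Complex.norm_real, Real.norm_of_nonneg hs0.le] at h3
    rw [norm_one] at this
    nlinarith [norm_nonneg ζ₀]
  have e3 : ‖Complex.exp (-(ζ₀ + s) ^ 2 / 4)‖ ≤ Real.exp (-1 * s) := by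
    rw [Complex.norm_exp]
    refine Real.exp_le_exp.2 ?_
    have : (-(ζ₀ + s) ^ 2 / 4).re = -((ζ₀ ^ 2).re + 2 * s * ζ₀.re + s ^ 2) / 4 := by
      have : -(ζ₀ + s) ^ 2 / 4 = ((-1 / 4 : ℝ) : ℂ) * (ζ₀ ^ 2 + (2 * s : ℝ) * ζ₀ + (s ^ 2 : ℝ)) := by
        push_cast; ring
      rw [this, Complex.re_ofReal_mul, Complex.add_re, Complex.add_re, Complex.re_ofReal_mul,
        Complex.ofReal_re]
      ring
    rw [this]
    nlinarith [mul_pos hs0 h1]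
  rw [norm_mul, norm_mul, Complex.norm_real, Real.norm_of_nonneg hs0.le]
  have e4 : (2 * (1 + ‖ζ₀ + s - 1‖)) ^ N ≤ (2 * (3 + ‖ζ₀‖)) ^ N * s ^ N := by
    rw [← Real.mul_rpow (by positivity) hs0.le]
    exact Real.rpow_le_rpow (by positivity) e2 (norm_nonneg _)
  calc s * (‖(ζ₀ + s) ^ B‖ * ‖Complex.exp (-(ζ₀ + s) ^ 2 / 4)‖)
      ≤ s * ((Real.exp (Real.pi * N) * ((2 * (3 + ‖ζ₀‖)) ^ N * s ^ N)) * Real.exp (-1 * s)) := by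
        gcongr
        exact e1.trans (by gcongr)
    _ = Real.exp (Real.pi * N) * (2 * (3 + ‖ζ₀‖)) ^ N * (s ^ (N + 1) * Real.exp (-1 * s)) := by
        rw [Real.rpow_add hs0, Real.rpow_one]; ring

/-- Kummer's function has no zeros in the closed fourth quadrant, for the parameters at hand. -/
theorem kummerJ_ne_zero {d : ℕ} (hd₁ : 1 ≤ d) (hd₃ : d ≤ 3) {a y : ℂ} (ha : 0 < a.re)
    (hyr : 0 ≤ y.re) (hyi : 0 < y.im) : kummerJ a ((d : ℂ) / 2 - a - 1) y ≠ 0 := by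
  intro hzero
  have hy0 : y ≠ 0 := fun h => by simp [h] at hyi
  have hny : 0 < Complex.normSq y := Complex.normSq_pos.2 hy0
  -- For y in the first quadrant with Im y > 0, the root ζ₀ has argument in [-π/4, 0). The solution
  -- is followed along the horizontal ray ζ₀ + s, on which Re (ζ₀ + s)² ≥ s².
  obtain ⟨ζ₀, hζ₀, hre⟩ : ∃ ζ₀ : ℂ, ζ₀ ^ 2 = 2 / y ∧ 0 ≤ ζ₀.re := by
    obtain ⟨z, hz⟩ := IsAlgClosed.exists_pow_nat_eq (2 / y) (n := 2) (by norm_num)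
    rcases le_total 0 z.re with h | h
    · exact ⟨z, hz, h⟩
    · exact ⟨-z, by rw [neg_sq, hz], by simpa using h⟩
  have hsqre : (ζ₀ ^ 2).re = ζ₀.re ^ 2 - ζ₀.im ^ 2 := by simp [sq]
  have hsqim : (ζ₀ ^ 2).im = 2 * ζ₀.re * ζ₀.im := by simp [sq]; ring
  have h2re : 0 ≤ (ζ₀ ^ 2).re := by
    rw [hζ₀, Complex.div_re]; simp; positivity
  have h2im : (ζ₀ ^ 2).im < 0 := by
    rw [hζ₀, Complex.div_im]; simp; positivity
  have hrepos : 0 < ζ₀.re := by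
    rcases hre.eq_or_lt with h | h
    · rw [hsqim, ← h] at h2im; simp at h2im
    · exact h
  have himneg : ζ₀.im < 0 := by
    rw [hsqim] at h2im
    by_contra h
    push Not at h
    have : 0 ≤ 2 * ζ₀.re * ζ₀.im := by positivity
    linarith
  rw [hsqre] at h2re
  have hζs : ∀ s : ℝ, 0 ≤ s → ζ₀ + s ∈ Complex.slitPlane := fun s hs =>
    Complex.mem_slitPlane_iff.2 (Or.inl (by simp; linarith))
  have hrs : ∀ s : ℝ, ((ζ₀ + s) ^ 2).re = (ζ₀.re + s) ^ 2 - ζ₀.im ^ 2 := fun s => by simp [sq]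
  have his : ∀ s : ℝ, ((ζ₀ + s) ^ 2).im = 2 * (ζ₀.re + s) * ζ₀.im := fun s => by simp [sq]; ring
  have hys : ∀ s : ℝ, 0 ≤ s → 0 < (2 / (ζ₀ + s) ^ 2).re + (2 / (ζ₀ + s) ^ 2).im := by
    intro s hs
    have hn : 0 < Complex.normSq ((ζ₀ + s) ^ 2) :=
      Complex.normSq_pos.2 (pow_ne_zero 2 (Complex.slitPlane_ne_zero (hζs s hs)))
    rw [Complex.div_re, Complex.div_im, hrs, his]
    have h3 : 0 < 2 * ((ζ₀.re + s) ^ 2 - ζ₀.im ^ 2) - 2 * (2 * (ζ₀.re + s) * ζ₀.im) := by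
      nlinarith [mul_pos (by linarith : 0 < ζ₀.re + s) (neg_pos.2 himneg), mul_nonneg hs hrepos.le]
    have h4 := div_pos h3 hn
    simp only [Complex.re_ofNat, Complex.im_ofNat]
    rw [sub_div] at h4
    simpa using h4
  set b : ℂ := (d : ℂ) / 2 with hb
  set w : ℝ → ℂ := fun s => weberW a b (ζ₀ + s) with hwdef
  set w₁ : ℝ → ℂ := fun s => weberW' a b (ζ₀ + s) with hw₁def
  have hshift : ∀ {f : ℂ → ℂ} {f' : ℂ} {s : ℝ}, HasDerivAt f f' (ζ₀ + s) →
      HasDerivAt (fun s : ℝ => f (ζ₀ + s)) f' s := fun hf => (hf.comp_const_add ζ₀ _).comp_ofReal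
  have hyt : Tendsto (fun s : ℝ => 2 / (ζ₀ + s) ^ 2) atTop (𝓝 0) := by
    have h1 : Tendsto (fun s : ℝ => ‖ζ₀ + s‖) atTop atTop := by
      refine tendsto_atTop_mono (fun s => ?_) (tendsto_atTop_add_const_left atTop ζ₀.re tendsto_id)
      simpa using Complex.re_le_norm (ζ₀ + s)
    have h2 := (tendsto_norm_atTop_iff_cobounded.1 h1)
    have h3 := ((tendsto_inv₀_cobounded.comp h2).pow 2).const_mul 2
    simpa [Function.comp_def, div_eq_mul_inv] using h3
  have hJ : ∀ {a k : ℂ}, 0 < a.re →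
      Tendsto (fun s : ℝ => kummerJ a k (2 / (ζ₀ + s) ^ 2)) atTop (𝓝 (Complex.Gamma a)) := by
    intro a k ha
    have hc := continuousOn_kummerJ (a, k, 0) ⟨ha, by simp⟩
    have hc' : Tendsto (fun s : ℝ => (a, k, 2 / (ζ₀ + s) ^ 2)) atTop
        (𝓝[{p : ℂ × ℂ × ℂ | 0 < p.1.re ∧ 0 ≤ p.2.2.re + p.2.2.im}] (a, k, 0)) := by
      refine tendsto_nhdsWithin_iff.2 ⟨?_, ?_⟩
      · exact tendsto_const_nhds.prodMk_nhds (tendsto_const_nhds.prodMk_nhds hyt)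
      · filter_upwards [eventually_ge_atTop 0] with s hs using ⟨ha, (hys s hs).le⟩
    have := hc.tendsto.comp hc'
    rwa [kummerJ_zero a k ha] at this
  set pf : ℝ → ℂ := fun s => (ζ₀ + s) ^ (b - 1 / 2 - 2 * a) * Complex.exp (-(ζ₀ + s) ^ 2 / 4)
    with hpf
  have hpft : Tendsto (fun s : ℝ => (s : ℂ) * pf s) atTop (𝓝 0) :=
    tendsto_weberPrefactor _ ζ₀ hrepos (by rw [hsqre]; exact h2re)
  have hwt : Tendsto (fun s : ℝ => (s : ℂ) * w s) atTop (𝓝 0) := by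
    have := hpft.mul (hJ (k := b - a - 1) ha)
    rw [zero_mul] at this
    refine this.congr fun s => ?_
    simp only [hwdef, weberW, hpf]
    ring
  have hw1t : Tendsto w₁ atTop (𝓝 0) := by
    have ht : Tendsto (fun s : ℝ => ((s : ℂ))⁻¹) atTop (𝓝 0) := by
      have := (Complex.continuous_ofReal.tendsto 0).comp tendsto_inv_atTop_zero
      simpa [Function.comp_def] using this
    have hζt : Tendsto (fun s : ℝ => (ζ₀ + s)⁻¹) atTop (𝓝 0) := by
      have h1 : Tendsto (fun s : ℝ => ‖ζ₀ + s‖) atTop atTop := by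
        refine tendsto_atTop_mono (fun s => ?_)
          (tendsto_atTop_add_const_left atTop ζ₀.re tendsto_id)
        simpa using Complex.re_le_norm (ζ₀ + s)
      exact tendsto_inv₀_cobounded.comp (tendsto_norm_atTop_iff_cobounded.1 h1)
    have hA := (((hζt.mul ht).const_mul (b - 1 / 2 - 2 * a)).sub
      ((ht.const_mul ζ₀).add_const 1 |>.div_const 2)).mul (hJ (k := b - a - 1) ha)
    have hB := ((((hζt.pow 3).mul ht).const_mul (4 * (b - a - 1)))).mul
      (hJ (a := a + 1) (k := b - a - 2) (by simp; linarith))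
    have hC := hpft.mul (hA.sub hB)
    rw [zero_mul] at hC
    refine hC.congr' ?_
    filter_upwards [eventually_gt_atTop 0] with s hs
    have hs0 : (s : ℂ) ≠ 0 := by exact_mod_cast hs.ne'
    have hz0 := Complex.slitPlane_ne_zero (hζs s hs.le)
    simp only [hw₁def, weberW', hpf]
    field_simp
  have hwz : ∀ s : ℝ, 0 < s → w s = 0 := by
    intro s hs
    -- The excess of the potential comes from the term 2a. For 1 ≤ d ≤ 3 the coefficient
    -- (d-1)(d-3)/4 is nonpositive, so the upper bound s⁻² for Re (ζ₀ + s)⁻² becomes a lower bound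
    -- for the potential.
    refine eq_zero_of_oscillator (D := d) (α := a.re)
      (V := fun s => (ζ₀ + s) ^ 2 / 4 - b + 2 * a + (b - 1 / 2) * (b - 3 / 2) / (ζ₀ + s) ^ 2) (w₁ := w₁)
      ha (fun s hs => hshift (hasDerivAt_weberW ha (hζs s hs) (hys s hs)))
      (fun s hs => hshift (hasDerivAt_weberW' ha (hζs s hs) (hys s hs))) ?_ ?_ ?_ ?_ hs
    · intro s hs
      have hn : 0 < Complex.normSq ((ζ₀ + s) ^ 2) :=
        Complex.normSq_pos.2 (pow_ne_zero 2 (Complex.slitPlane_ne_zero (hζs s hs.le)))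
      have e1 : (ζ₀ + s) ^ 2 / 4 - b + 2 * a + (b - 1 / 2) * (b - 3 / 2) / (ζ₀ + s) ^ 2
          = ((1 / 4 : ℝ) : ℂ) * (ζ₀ + s) ^ 2 - ((d / 2 : ℝ) : ℂ) + ((2 : ℝ) : ℂ) * a
            + (((d - 1) * (d - 3) / 4 : ℝ) : ℂ) * ((ζ₀ + s) ^ 2)⁻¹ := by
        rw [hb]; push_cast; ring
      simp only [e1, Complex.add_re, Complex.sub_re, Complex.re_ofReal_mul, Complex.ofReal_re]
      have hd : ((d : ℝ) - 1) * (d - 3) ≤ 0 := by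
        have h1 : (1 : ℝ) ≤ d := by exact_mod_cast hd₁
        have h3 : (d : ℝ) ≤ 3 := by exact_mod_cast hd₃
        nlinarith
      have e2 : (((ζ₀ + s) ^ 2)⁻¹).re ≤ 1 / s ^ 2 := by
        refine (Complex.re_le_norm _).trans ?_
        rw [norm_inv, norm_pow, inv_eq_one_div]
        have : s ≤ ‖ζ₀ + s‖ := by
          refine le_trans ?_ (Complex.re_le_norm (ζ₀ + s))
          simp; linarith
        gcongr
      have e3 : s ^ 2 ≤ ((ζ₀ + s) ^ 2).re := by
        rw [hrs]; nlinarith [mul_pos hs hrepos]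
      have e4 : ((d : ℝ) - 1) * (d - 3) / (4 * s ^ 2) = (d - 1) * (d - 3) / 4 * (1 / s ^ 2) := by
        field_simp
      rw [e4]
      nlinarith [mul_le_mul_of_nonpos_left e2 (by linarith : ((d : ℝ) - 1) * (d - 3) / 4 ≤ 0)]
    · have : 2 / ζ₀ ^ 2 = y := by rw [hζ₀]; field_simp
      simp [weberW, this, hzero]
    · have h1 := hwt.norm.pow 2
      simp only [norm_zero] at h1
      norm_num at h1
      refine squeeze_zero' (by
        filter_upwards [eventually_ge_atTop 0] with s hs using by positivity) ?_ h1
      filter_upwards [eventually_ge_atTop 1] with s hs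
      rw [abs_of_nonneg (by linarith : (0 : ℝ) ≤ s), mul_pow]
      gcongr
      nlinarith
    · have h1 := hwt.norm.mul hw1t.norm
      rw [norm_zero, zero_mul] at h1
      refine squeeze_zero' (Eventually.of_forall fun s => by positivity) ?_ h1
      filter_upwards [eventually_ge_atTop 1] with s hs
      rw [norm_mul, Complex.norm_real, Real.norm_of_nonneg (by linarith)]
      gcongr
      exact le_mul_of_one_le_left (norm_nonneg _) hs
  -- A solution vanishing on the whole ray contradicts the limit Γ(a) ≠ 0 of the integral as its
  -- argument tends to 0.
  have hGz : Tendsto (fun s : ℝ => kummerJ a (b - a - 1) (2 / (ζ₀ + s) ^ 2)) atTop (𝓝 0) := by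
    refine tendsto_const_nhds.congr' ?_
    filter_upwards [eventually_gt_atTop 0] with s hs
    have h1 := hwz s hs
    have h2 : (ζ₀ + s) ^ (b - 1 / 2 - 2 * a) ≠ 0 := by
      simp [Complex.cpow_eq_zero_iff, Complex.slitPlane_ne_zero (hζs s hs.le)]
    simp only [hwdef, weberW, mul_eq_zero, h2, Complex.exp_ne_zero, false_or] at h1
    exact h1.symm
  exact Complex.Gamma_ne_zero_of_re_pos ha (tendsto_nhds_unique (hJ ha) hGz)

end

section

open BoundedContinuousFunction MeasureTheory

/-! ### Asymptotic expansions in sectors -/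

/-- The filter of points tending to infinity in the sector `|Im x| ≤ t Re x`. -/
def sectorFilter (t : ℝ) : Filter ℂ := comap Complex.re atTop ⊓ 𝓟 {x | |x.im| ≤ t * x.re}

theorem eventually_sectorFilter {t : ℝ} {p : ℂ → Prop} :
    (∀ᶠ x in sectorFilter t, p x) ↔ ∃ R : ℝ, ∀ x : ℂ, R ≤ x.re → |x.im| ≤ t * x.re → p x := by
  rw [sectorFilter, eventually_inf_principal, eventually_comap, eventually_atTop]
  constructor
  · rintro ⟨R, hR⟩
    exact ⟨R, fun x hx hx' => hR x.re hx x rfl hx'⟩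
  · rintro ⟨R, hR⟩
    exact ⟨R, fun r hr x hx hx' => hR x (hx ▸ hr) hx'⟩

theorem eventually_re_ge (t R : ℝ) : ∀ᶠ x in sectorFilter t, R ≤ x.re :=
  eventually_sectorFilter.2 ⟨R, fun _ hx _ => hx⟩

theorem eventually_ne_zero_sectorFilter (t : ℝ) : ∀ᶠ x in sectorFilter t, x ≠ 0 := by
  filter_upwards [eventually_re_ge t 1] with x hx h0
  simp [h0] at hx
  linarith

theorem tendsto_inv_sectorFilter (t : ℝ) : Tendsto (fun x : ℂ => x⁻¹) (sectorFilter t) (𝓝 0) := by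
  refine tendsto_inv₀_cobounded.comp (tendsto_norm_atTop_iff_cobounded.1 ?_)
  refine tendsto_atTop_mono Complex.re_le_norm ?_
  exact tendsto_comap.mono_left inf_le_left

theorem tendsto_ofReal_sectorFilter {t : ℝ} (ht : 0 < t) :
    Tendsto (fun r : ℝ => (r : ℂ)) atTop (sectorFilter t) := by
  refine tendsto_inf.2 ⟨tendsto_comap_iff.2 (tendsto_id.congr fun r => by simp),
    tendsto_principal.2 ?_⟩
  filter_upwards [eventually_ge_atTop 0] with r hr
  simp
  positivity

/-- `f(x) = O(x^{-m})` at infinity in all strict subsectors of `|Im x| < t Re x`. -/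
def SectorO (t : ℝ) (m : ℕ) (f : ℂ → ℂ) : Prop :=
  ∀ t', 0 < t' → t' < t → f =O[sectorFilter t'] fun x => x⁻¹ ^ m

/-- `f` is holomorphic near infinity in all strict subsectors of `|Im x| < t Re x`. -/
def SectorHolo (t : ℝ) (f : ℂ → ℂ) : Prop :=
  ∀ t', 0 < t' → t' < t → ∀ᶠ x in sectorFilter t', DifferentiableAt ℂ f x

/-- `f` and `g` agree near infinity in all strict subsectors of `|Im x| < t Re x`. -/
def SectorEq (t : ℝ) (f g : ℂ → ℂ) : Prop :=
  ∀ t', 0 < t' → t' < t → ∀ᶠ x in sectorFilter t', f x = g x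

/-- `f` has an asymptotic expansion in powers of `x⁻¹` up to the order `x^{-m}`. -/
def HasExp (t : ℝ) (m : ℕ) (f : ℂ → ℂ) : Prop :=
  ∃ P : Polynomial ℂ, SectorO t m fun x => f x - P.eval x⁻¹

variable {t : ℝ} {m n : ℕ} {f g : ℂ → ℂ}

theorem SectorO.add (hf : SectorO t m f) (hg : SectorO t m g) :
    SectorO t m fun x => f x + g x := fun t' h h' => (hf t' h h').add (hg t' h h')

theorem SectorO.sub (hf : SectorO t m f) (hg : SectorO t m g) :
    SectorO t m fun x => f x - g x := fun t' h h' => (hf t' h h').sub (hg t' h h')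

theorem SectorO.mul (hf : SectorO t m f) (hg : SectorO t n g) :
    SectorO t (m + n) fun x => f x * g x := fun t' h h' => by
  simpa only [pow_add] using (hf t' h h').mul (hg t' h h')

theorem SectorO.const_mul (c : ℂ) (hf : SectorO t m f) : SectorO t m fun x => c * f x :=
  fun t' h h' => (hf t' h h').const_mul_left c

theorem SectorO.congr (hf : SectorO t m f) (h : SectorEq t f g) : SectorO t m g :=
  fun t' h1 h2 => (hf t' h1 h2).congr' (h t' h1 h2) EventuallyEq.rfl

theorem sectorO_inv_pow (m : ℕ) : SectorO t m fun x => x⁻¹ ^ m := fun _ _ _ => isBigO_refl _ _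

theorem sectorO_inv : SectorO t 1 fun x => x⁻¹ := by simpa using sectorO_inv_pow (t := t) 1

theorem SectorO.mono (hf : SectorO t n f) (h : m ≤ n) : SectorO t m f := fun t' h1 h2 => by
  refine (hf t' h1 h2).trans (IsBigO.of_bound 1 ?_)
  filter_upwards [eventually_re_ge t' 1] with x hx
  rw [one_mul, norm_pow, norm_pow]
  refine pow_le_pow_of_le_one (norm_nonneg _) ?_ h
  rw [norm_inv]
  exact inv_le_one_of_one_le₀ (hx.trans (Complex.re_le_norm x))

theorem sectorO_eval (P : Polynomial ℂ) : SectorO t 0 fun x => P.eval x⁻¹ := fun t' _ _ => by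
  have := (P.continuous.tendsto 0).comp (tendsto_inv_sectorFilter t')
  simpa using! this.isBigO_one ℂ

theorem HasExp.sectorO (hf : HasExp t m f) : SectorO t 0 f := by
  obtain ⟨P, hP⟩ := hf
  simpa using (hP.mono m.zero_le).add (sectorO_eval P)

theorem hasExp_zero_iff : HasExp t 0 f ↔ SectorO t 0 f :=
  ⟨HasExp.sectorO, fun h => ⟨0, by simpa using h⟩⟩

theorem HasExp.congr (hf : HasExp t m f) (h : SectorEq t f g) : HasExp t m g := by
  obtain ⟨P, hP⟩ := hf
  exact ⟨P, hP.congr fun t' h1 h2 => (h t' h1 h2).mono fun x hx => by simp only [hx]⟩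

theorem SectorO.hasExp (hf : SectorO t m f) : HasExp t m f := ⟨0, by simpa using hf⟩

theorem hasExp_eval (P : Polynomial ℂ) : HasExp t m fun x => P.eval x⁻¹ :=
  ⟨P, fun t' _ _ => by simpa using! isBigO_zero _ _⟩

theorem hasExp_const (c : ℂ) : HasExp t m fun _ => c := by
  simpa using hasExp_eval (t := t) (m := m) (Polynomial.C c)

theorem HasExp.add (hf : HasExp t m f) (hg : HasExp t m g) : HasExp t m fun x => f x + g x := by
  obtain ⟨P, hP⟩ := hf
  obtain ⟨Q, hQ⟩ := hg
  refine ⟨P + Q, ?_⟩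
  have := hP.add hQ
  simp only [Polynomial.eval_add]
  convert! this using 2
  ring

theorem HasExp.mul (hf : HasExp t m f) (hg : HasExp t m g) : HasExp t m fun x => f x * g x := by
  have hf' := hf.sectorO
  obtain ⟨P, hP⟩ := hf
  obtain ⟨Q, hQ⟩ := hg
  refine ⟨P * Q, ?_⟩
  have h1 := hf'.mul hQ
  have h2 := hP.mul (sectorO_eval (t := t) Q)
  rw [zero_add] at h1
  rw [add_zero] at h2
  have := h1.add h2
  simp only [Polynomial.eval_mul]
  convert! this using 2
  ring

theorem HasExp.const_mul (c : ℂ) (hf : HasExp t m f) : HasExp t m fun x => c * f x :=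
  (hasExp_const c).mul hf

theorem HasExp.pow (hf : HasExp t m f) (n : ℕ) : HasExp t m fun x => f x ^ n := by
  induction n with
  | zero => simpa using hasExp_const 1
  | succ n ih => simpa only [pow_succ] using ih.mul hf

theorem HasExp.sum {ι : Type*} (s : Finset ι) {F : ι → ℂ → ℂ} (h : ∀ i ∈ s, HasExp t m (F i)) :
    HasExp t m fun x => ∑ i ∈ s, F i x := by
  classical
  induction s using Finset.induction_on with
  | empty => simpa using hasExp_const 0
  | insert i s hi ih =>
    simp only [Finset.sum_insert hi]
    exact (h i (by simp)).add (ih fun j hj => h j (by simp [hj]))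

theorem HasExp.exists_limit (hf : HasExp t (m + 1) f) : ∃ c, SectorO t 1 fun x => f x - c := by
  obtain ⟨P, hP⟩ := hf
  refine ⟨P.eval 0, ?_⟩
  have h1 : SectorO t 1 fun x => x⁻¹ * P.divX.eval x⁻¹ := by
    simpa using sectorO_inv.mul (sectorO_eval (t := t) P.divX)
  have h2 := (hP.mono (by omega : 1 ≤ m + 1)).add h1
  convert! h2 using 2 with x
  have h3 := congrArg (Polynomial.eval x⁻¹) P.divX_mul_X_add
  simp only [Polynomial.eval_add, Polynomial.eval_mul, Polynomial.eval_X, Polynomial.eval_C] at h3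
  rw [← h3, ← Polynomial.coeff_zero_eq_eval_zero]
  ring

theorem SectorO.tendsto (hf : SectorO t 1 f) {t' : ℝ} (h : 0 < t') (h' : t' < t) :
    Tendsto f (sectorFilter t') (𝓝 0) := by
  have := hf t' h h'
  simp only [pow_one] at this
  exact this.trans_tendsto (tendsto_inv_sectorFilter t')

/-- Up to O(x^{-m}), θ ∘ f is a Taylor polynomial of θ in f - c, because f - c = O(1/x); polynomials
in f inherit the expansion. -/
theorem HasExp.comp_analyticAt {θ : ℂ → ℂ} {c : ℂ} (hf : HasExp t m f)
    (hc : SectorO t 1 fun x => f x - c) (hθ : AnalyticAt ℂ θ c) : HasExp t m fun x => θ (f x) := by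
  obtain ⟨p, hp⟩ := hθ
  have h1 := hp.isBigO_sub_partialSum_pow m
  have h2 : SectorO t m fun x => θ (f x) - p.partialSum m (f x - c) := by
    intro t' ht ht'
    have h3 := h1.comp_tendsto (hc.tendsto ht ht')
    have h4 := (hc t' ht ht').norm_left.pow m
    simp only [pow_one] at h4
    simpa [Function.comp_def] using h3.trans h4
  have h3 : HasExp t m fun x => p.partialSum m (f x - c) := by
    simp only [FormalMultilinearSeries.partialSum,
      FormalMultilinearSeries.apply_eq_pow_smul_coeff, smul_eq_mul]
    refine HasExp.sum _ fun i _ => ((?_ : HasExp t m fun x => f x - c).pow i).mul (hasExp_const _)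
    simpa [sub_eq_add_neg] using hf.add (hasExp_const (-c))
  simpa using h2.hasExp.add h3

/-- The sectors are symmetric about the real axis, so the reflected function conj f(conj x) obeys
the same bounds; it is needed for the continuation of |g|^{2σ}. -/
theorem SectorO.star (hf : SectorO t m f) :
    SectorO t m fun x => (starRingEnd ℂ) (f ((starRingEnd ℂ) x)) := by
  intro t' h h'
  have h1 : Tendsto (starRingEnd ℂ) (sectorFilter t') (sectorFilter t') := by
    intro s hs
    obtain ⟨R, hR⟩ := eventually_sectorFilter.1 hs
    exact eventually_sectorFilter.2 ⟨R, fun x hx hx' => hR _ (by simpa using hx) (by simpa using hx')⟩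
  have h2 := ((hf t' h h').comp_tendsto h1).norm_norm
  refine IsBigO.of_norm_norm ?_
  simpa [Function.comp_def, ← map_inv₀] using h2

theorem HasExp.star (hf : HasExp t m f) :
    HasExp t m fun x => (starRingEnd ℂ) (f ((starRingEnd ℂ) x)) := by
  obtain ⟨P, hP⟩ := hf
  refine ⟨P.map (starRingEnd ℂ), ?_⟩
  convert! hP.star using 2 with x
  have h := Polynomial.eval_map_apply (p := P) (f := starRingEnd ℂ) ((starRingEnd ℂ) x)⁻¹
  rw [map_inv₀, Complex.conj_conj] at h
  rw [map_sub, h]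

/-- Cauchy's estimate on discs of radius proportional to Re x gains a factor 1/x. The discs require
a slightly wider sector, which is the reason for quantifying over all strict subsectors in
`SectorO`. -/
theorem SectorO.deriv (hd : SectorHolo t f) (hf : SectorO t m f) :
    SectorO t (m + 1) (deriv f) := by
  intro t' ht' htt
  set t₂ := (t' + t) / 2 with ht₂
  have ht₂0 : 0 < t₂ := by rw [ht₂]; linarith
  -- The solution of t' + η = t₂ (1 - η): the disc of radius η Re x around a point of aperture t'
  -- then lies in the sector of aperture t₂.
  set η := (t₂ - t') / (1 + t₂) with hη
  have hη0 : 0 < η := div_pos (by rw [ht₂]; linarith) (by positivity)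
  have hη1 : η < 1 := by rw [hη, div_lt_one (by positivity)]; linarith
  have hηe : t' + η = t₂ * (1 - η) := by rw [hη]; field_simp; ring
  obtain ⟨C, hC⟩ := (hf t₂ ht₂0 (by rw [ht₂]; linarith)).bound
  obtain ⟨R, hR⟩ := eventually_sectorFilter.1 (hC.and (hd t₂ ht₂0 (by rw [ht₂]; linarith)))
  refine IsBigO.of_bound (|C| * ((1 - η)⁻¹) ^ m * η⁻¹ * (1 + t') ^ (m + 1)) ?_
  refine eventually_sectorFilter.2 ⟨max 1 (R / (1 - η)), fun x hx hx' => ?_⟩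
  have hx1 : 1 ≤ x.re := (le_max_left _ _).trans hx
  have hxR : R ≤ (1 - η) * x.re := by
    have := (le_max_right _ _).trans hx
    rwa [div_le_iff₀ (by linarith), mul_comm] at this
  have hsub : ∀ y ∈ Metric.closedBall x (η * x.re), (1 - η) * x.re ≤ y.re ∧ |y.im| ≤ t₂ * y.re := by
    intro y hy
    rw [Metric.mem_closedBall, dist_eq_norm] at hy
    have h1 := (Complex.abs_re_le_norm _).trans hy
    have h2 := (Complex.abs_im_le_norm _).trans hy
    simp only [Complex.sub_re, Complex.sub_im, abs_le] at h1 h2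
    have h3 : (1 - η) * x.re ≤ y.re := by linarith [h1.1]
    refine ⟨h3, ?_⟩
    have h4 : t₂ * ((1 - η) * x.re) ≤ t₂ * y.re := by gcongr
    rw [← mul_assoc, ← hηe] at h4
    rw [abs_le] at hx' ⊢
    constructor <;> linarith [h2.1, h2.2, hx'.1, hx'.2]
  have hpos : 0 < (1 - η) * x.re := mul_pos (by linarith) (by linarith)
  have hbd : ‖_root_.deriv f x‖ ≤ |C| * (((1 - η) * x.re)⁻¹) ^ m / (η * x.re) := by
    refine Complex.norm_deriv_le_of_forall_mem_sphere_norm_le (by positivity)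
      (DifferentiableOn.diffContOnCl_ball (U := Metric.closedBall x (η * x.re))
        (fun y hy => ?_) subset_rfl) fun y hy => ?_
    · obtain ⟨h1, h2⟩ := hsub y hy
      exact (hR y (hxR.trans h1) h2).2.differentiableWithinAt
    · obtain ⟨h1, h2⟩ := hsub y (Metric.sphere_subset_closedBall hy)
      refine (hR y (hxR.trans h1) h2).1.trans ?_
      rw [norm_pow, norm_inv]
      have h3 : (1 - η) * x.re ≤ ‖y‖ := h1.trans (Complex.re_le_norm y)
      gcongr
      exact le_abs_self C
  refine hbd.trans ?_
  have hxn : ‖x‖ ≤ (1 + t') * x.re := by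
    have := Complex.norm_le_abs_re_add_abs_im x
    rw [abs_of_nonneg (by linarith : (0 : ℝ) ≤ x.re)] at this
    linarith
  have hxn0 : 0 < ‖x‖ := by linarith [Complex.re_le_norm x]
  rw [norm_pow, norm_inv]
  have h5 : (x.re)⁻¹ ≤ (1 + t') * ‖x‖⁻¹ := by
    rw [inv_le_iff_one_le_mul₀ (by linarith)]
    field_simp
    linarith
  calc |C| * (((1 - η) * x.re)⁻¹) ^ m / (η * x.re)
      = |C| * ((1 - η)⁻¹) ^ m * η⁻¹ * (x.re⁻¹) ^ (m + 1) := by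
        rw [mul_inv, mul_pow, pow_succ]; field_simp
    _ ≤ |C| * ((1 - η)⁻¹) ^ m * η⁻¹ * ((1 + t') * ‖x‖⁻¹) ^ (m + 1) := by
        have : 0 ≤ (1 - η)⁻¹ := by rw [inv_nonneg]; linarith
        gcongr
    _ = _ := by rw [mul_pow]; ring

theorem norm_sub_le_of_deriv_tail {f f' : ℝ → ℂ} {R C : ℝ} {c : ℂ} (hR : 0 < R) (hC0 : 0 ≤ C)
    (hd : ∀ r, R ≤ r → HasDerivAt f (f' r) r)
    (hm : AEStronglyMeasurable f' (volume.restrict (Set.Ioi R)))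
    (hC : ∀ r, R ≤ r → ‖f' r‖ ≤ C * (r⁻¹) ^ (m + 2)) (hc : Tendsto f atTop (𝓝 c)) {r : ℝ}
    (hr : R ≤ r) : ‖f r - c‖ ≤ C * (r⁻¹) ^ (m + 1) := by
  have hr0 : 0 < r := hR.trans_le hr
  have hexp : -((m : ℝ) + 2) < -1 := by linarith [m.cast_nonneg (α := ℝ)]
  have hpow : ∀ s : ℝ, 0 < s → (s⁻¹) ^ (m + 2) = s ^ (-((m : ℝ) + 2)) := by
    intro s hs
    rw [Real.rpow_neg hs.le, inv_pow, ← Real.rpow_natCast]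
    norm_num
  have hint : IntegrableOn (fun s : ℝ => C * s ^ (-((m : ℝ) + 2))) (Set.Ioi r) :=
    (integrableOn_Ioi_rpow_of_lt hexp hr0).const_mul C
  have hbd : ∀ᵐ s ∂(volume.restrict (Set.Ioi r)), ‖f' s‖ ≤ C * s ^ (-((m : ℝ) + 2)) := by
    filter_upwards [ae_restrict_mem measurableSet_Ioi] with s (hs : r < s)
    rw [← hpow s (hr0.trans hs)]
    exact hC s (hr.trans hs.le)
  have hfi : IntegrableOn f' (Set.Ioi r) :=
    hint.mono' (hm.mono_measure (Measure.restrict_mono (Set.Ioi_subset_Ioi hr) le_rfl)) hbd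
  have h1 := integral_Ioi_of_hasDerivAt_of_tendsto' (fun s hs => hd s (hr.trans hs)) hfi hc
  rw [norm_sub_rev, ← h1]
  refine (norm_integral_le_of_norm_le hint hbd).trans ?_
  rw [integral_const_mul, integral_Ioi_rpow_of_lt hexp hr0]
  refine mul_le_mul_of_nonneg_left ?_ hC0
  have e1 : -((m : ℝ) + 2) + 1 = -((m : ℝ) + 1) := by ring
  have e2 : r ^ (-((m : ℝ) + 1)) = (r⁻¹) ^ (m + 1) := by
    rw [Real.rpow_neg hr0.le, inv_pow, ← Real.rpow_natCast]
    norm_num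
  rw [e1, e2, neg_div_neg_eq]
  exact div_le_self (by positivity) (by linarith [m.cast_nonneg (α := ℝ)])

theorem SectorHolo.eventually_nhds (hd : SectorHolo t f) {t' : ℝ} (ht' : 0 < t') (h : t' < t) :
    ∀ᶠ x in sectorFilter t', ∀ᶠ y in 𝓝 x, DifferentiableAt ℂ f y := by
  obtain ⟨R, hR⟩ := eventually_sectorFilter.1 (hd ((t' + t) / 2) (by linarith) (by linarith))
  refine eventually_sectorFilter.2 ⟨max R 0 + 1, fun x hx hx' => ?_⟩
  have h1 := le_max_left R 0
  have h2 := le_max_right R 0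
  have h3 : |x.im| < (t' + t) / 2 * x.re :=
    hx'.trans_lt (mul_lt_mul_of_pos_right (by linarith) (by linarith))
  have o1 : IsOpen {y : ℂ | R < y.re} := isOpen_lt continuous_const Complex.continuous_re
  have o2 : IsOpen {y : ℂ | |y.im| < (t' + t) / 2 * y.re} :=
    isOpen_lt Complex.continuous_im.abs (continuous_const.mul Complex.continuous_re)
  filter_upwards [o1.mem_nhds (show R < x.re by linarith), o2.mem_nhds h3] with y hy hy'
  exact hR y (le_of_lt hy) (le_of_lt hy')

theorem SectorHolo.deriv (hd : SectorHolo t f) : SectorHolo t (_root_.deriv f) := by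
  intro t' ht' h
  filter_upwards [hd.eventually_nhds ht' h] with x hx
  exact (Complex.analyticAt_iff_eventually_differentiableAt.2 hx).deriv.differentiableAt

/-- The constant is the limit along the positive axis. A point x is joined to Re x by a vertical
segment of length at most t' Re x, which costs the same order x^{-m-1} as the tail integral. -/
theorem SectorO.integrate (hd : SectorHolo t f) (ht : 0 < t)
    (hf : SectorO t (m + 2) (_root_.deriv f)) : ∃ c, SectorO t (m + 1) fun x => f x - c := by
  have hreal : ∀ t', 0 < t' → t' < t → ∃ R > 0, ∃ C ≥ 0, ∀ x : ℂ, R ≤ x.re → |x.im| ≤ t' * x.re →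
      DifferentiableAt ℂ f x ∧ ‖_root_.deriv f x‖ ≤ C * ((x.re)⁻¹) ^ (m + 2) ∧
      DifferentiableAt ℂ (_root_.deriv f) x := by
    intro t' ht' h
    obtain ⟨C, hC⟩ := (hf t' ht' h).bound
    obtain ⟨R, hR⟩ := eventually_sectorFilter.1 (hC.and ((hd t' ht' h).and (hd.deriv t' ht' h)))
    refine ⟨max R 1, by positivity, |C|, abs_nonneg C, fun x hx hx' => ?_⟩
    have h1 : 1 ≤ x.re := (le_max_right _ _).trans hx
    obtain ⟨e1, e2, e3⟩ := hR x ((le_max_left _ _).trans hx) hx'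
    refine ⟨e2, e1.trans ?_, e3⟩
    rw [norm_pow, norm_inv]
    have := Complex.re_le_norm x
    gcongr
    exact le_abs_self C
  have hax : ∀ r : ℝ, 0 < r → ∀ t', 0 < t' → |(r : ℂ).im| ≤ t' * (r : ℂ).re := fun r hr t' ht' => by
    simp; positivity
  obtain ⟨c, hc⟩ : ∃ c, Tendsto (fun r : ℝ => f r) atTop (𝓝 c) := by
    obtain ⟨R, hR, C, hC, H⟩ := hreal (t / 2) (by positivity) (by linarith)
    have hd' : ∀ r ∈ Set.Ioi R, HasDerivAt (fun r : ℝ => f r) (_root_.deriv f r) r := fun r hr =>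
      (H r (by simpa using le_of_lt hr) (hax r (hR.trans hr) _ (by positivity))).1.hasDerivAt.comp_ofReal
    refine ⟨_, tendsto_limUnder_of_hasDerivAt_of_integrableOn_Ioi hd' ?_⟩
    have hexp : -((m : ℝ) + 2) < -1 := by linarith [m.cast_nonneg (α := ℝ)]
    refine ((integrableOn_Ioi_rpow_of_lt hexp hR).const_mul C).mono' ?_ ?_
    · refine ContinuousOn.aestronglyMeasurable (fun r hr => ?_) measurableSet_Ioi
      exact ((H r (by simpa using le_of_lt hr) (hax r (hR.trans hr) _ (by positivity))).2.2.continuousAt.comp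
        Complex.continuous_ofReal.continuousAt).continuousWithinAt
    · filter_upwards [ae_restrict_mem measurableSet_Ioi] with r hr
      have := (H r (by simpa using le_of_lt hr) (hax r (hR.trans hr) _ (by positivity))).2.1
      have hr0 : 0 < r := hR.trans hr
      rw [Real.rpow_neg hr0.le]
      rw [Complex.ofReal_re, inv_pow, ← Real.rpow_natCast] at this
      simpa using this
  refine ⟨c, fun t' ht' h => ?_⟩
  obtain ⟨R, hR, C, hC, H⟩ := hreal t' ht' h
  refine IsBigO.of_bound (C * (t' + 1) * (1 + t') ^ (m + 1)) ?_
  refine eventually_sectorFilter.2 ⟨R, fun x hx hx' => ?_⟩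
  have hx0 : 0 < x.re := hR.trans_le hx
  have e1 : ‖f x.re - c‖ ≤ C * ((x.re)⁻¹) ^ (m + 1) := by
    refine norm_sub_le_of_deriv_tail (f := fun r : ℝ => f r) (f' := fun r : ℝ => _root_.deriv f r)
      hR hC (fun r hr => ?_) ?_ (fun r hr => ?_) hc hx
    · exact (H r (by simpa using hr) (hax r (hR.trans_le hr) _ ht')).1.hasDerivAt.comp_ofReal
    · refine ContinuousOn.aestronglyMeasurable (fun r hr => ?_) measurableSet_Ioi
      exact ((H r (by simpa using le_of_lt hr) (hax r (hR.trans hr) _ ht')).2.2.continuousAt.comp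
        Complex.continuous_ofReal.continuousAt).continuousWithinAt
    · simpa using (H r (by simpa using hr) (hax r (hR.trans_le hr) _ ht')).2.1
  have e2 : ‖f x - f x.re‖ ≤ C * ((x.re)⁻¹) ^ (m + 2) * (t' * x.re) := by
    have hconv : Convex ℝ {y : ℂ | y.re = x.re ∧ |y.im| ≤ t' * x.re} := by
      have h1 : {y : ℂ | y.re = x.re ∧ |y.im| ≤ t' * x.re}
          = Complex.reLm ⁻¹' {x.re} ∩ Complex.imLm ⁻¹' (Set.Icc (-(t' * x.re)) (t' * x.re)) := by
        ext y; simp [abs_le]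
      rw [h1]
      exact ((convex_singleton _).linear_preimage _).inter ((convex_Icc _ _).linear_preimage _)
    have h2 := Convex.norm_image_sub_le_of_norm_hasDerivWithin_le (f := f) (f' := _root_.deriv f)
      (s := {y : ℂ | y.re = x.re ∧ |y.im| ≤ t' * x.re})
      (C := C * ((x.re)⁻¹) ^ (m + 2)) (x := x.re) (y := x)
      (fun y hy => (H y (hy.1 ▸ hx) (by rw [hy.1]; exact hy.2)).1.hasDerivAt.hasDerivWithinAt)
      (fun y hy => by
        have := (H y (hy.1 ▸ hx) (by rw [hy.1]; exact hy.2)).2.1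
        rwa [hy.1] at this)
      hconv ⟨by simp, by simp; positivity⟩ ⟨rfl, hx'⟩
    refine h2.trans ?_
    gcongr
    have : x - x.re = x.im * Complex.I := by
      apply Complex.ext <;> simp
    rw [this, norm_mul, Complex.norm_I, mul_one, Complex.norm_real]
    exact hx'
  have e3 : ‖f x - c‖ ≤ C * (t' + 1) * ((x.re)⁻¹) ^ (m + 1) := by
    have := norm_add_le (f x - f x.re) (f x.re - c)
    rw [sub_add_sub_cancel] at this
    have e4 : C * ((x.re)⁻¹) ^ (m + 2) * (t' * x.re) = C * t' * ((x.re)⁻¹) ^ (m + 1) := by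
      rw [pow_succ _ (m + 1)]; field_simp
    rw [e4] at e2
    linarith
  refine e3.trans ?_
  have hxn : ‖x‖ ≤ (1 + t') * x.re := by
    have := Complex.norm_le_abs_re_add_abs_im x
    rw [abs_of_nonneg hx0.le] at this
    linarith
  have hxn0 : 0 < ‖x‖ := by linarith [Complex.re_le_norm x]
  rw [norm_pow, norm_inv, mul_assoc (C * (t' + 1)), ← mul_pow]
  gcongr
  rw [inv_le_iff_one_le_mul₀ hx0]
  field_simp
  linarith

theorem hasDerivAt_eval_inv (P : Polynomial ℂ) {x : ℂ} (hx : x ≠ 0) :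
    HasDerivAt (fun x => P.eval x⁻¹) (-(x⁻¹ ^ 2 * P.derivative.eval x⁻¹)) x := by
  have := (P.hasDerivAt x⁻¹).comp x (hasDerivAt_inv hx)
  convert! this using 1
  rw [inv_pow]
  ring

theorem HasExp.exists_deriv (hd : SectorHolo t f) (hf : HasExp t m f) :
    ∃ R : Polynomial ℂ, SectorO t (m + 1) fun x => _root_.deriv f x - x⁻¹ ^ 2 * R.eval x⁻¹ := by
  obtain ⟨P, hP⟩ := hf
  refine ⟨-P.derivative, (SectorO.deriv ?_ hP).congr ?_⟩
  · intro t' ht' h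
    filter_upwards [hd t' ht' h, eventually_ne_zero_sectorFilter t'] with x h1 h2
    exact h1.sub (hasDerivAt_eval_inv P h2).differentiableAt
  · intro t' ht' h
    filter_upwards [hd t' ht' h, eventually_ne_zero_sectorFilter t'] with x h1 h2
    have := (h1.hasDerivAt.sub (hasDerivAt_eval_inv P h2)).deriv
    refine this.trans ?_
    simp

theorem exists_derivative_eq (Z : Polynomial ℂ) : ∃ Y : Polynomial ℂ, Y.derivative = Z := by
  induction Z using Polynomial.induction_on' with
  | add p q hp hq =>
    obtain ⟨P, rfl⟩ := hp
    obtain ⟨Q, rfl⟩ := hq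
    exact ⟨P + Q, by simp⟩
  | monomial n a =>
    refine ⟨Polynomial.monomial (n + 1) (a / (n + 1)), ?_⟩
    have : (n : ℂ) + 1 ≠ 0 := by exact_mod_cast n.succ_ne_zero
    rw [Polynomial.derivative_monomial]
    congr 1
    push_cast
    field_simp

/-- A solution of `u'' + (A/x - μ) u' + N/x² = 0` has one more term in its expansion than `u` and
the inhomogeneity `N`. -/
theorem HasExp.succ_of_ode {u N : ℂ → ℂ} {A μ : ℂ} (ht : 0 < t) (hμ : μ ≠ 0)
    (hd : SectorHolo t u) (hode : SectorEq t (fun x => _root_.deriv (_root_.deriv u) x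
      + (A * x⁻¹ - μ) * _root_.deriv u x + x⁻¹ ^ 2 * N x) fun _ => 0)
    (hu : HasExp t m u) (hN : HasExp t m N) : HasExp t (m + 1) u := by
  -- Solve the equation for u' = μ⁻¹ (u'' + (A/x) u' + N/x²). Each derivative of the expansion of u
  -- gains an order, so every term on the right is known up to O(x^{-m-2}), and integration gives u
  -- up to O(x^{-m-1}).
  obtain ⟨R, hR⟩ := hu.exists_deriv hd
  have hu1 : HasExp t (m + 1) (_root_.deriv u) := ⟨Polynomial.X ^ 2 * R, by simpa using hR⟩
  obtain ⟨R₂, hR₂⟩ := hu1.exists_deriv hd.deriv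
  obtain ⟨Q, hQ⟩ := hN
  -- Y(1/x) is a primitive of the known part of u'; the sign comes from (Y(1/x))' = -x⁻² Y'(1/x).
  obtain ⟨Y, hY⟩ := exists_derivative_eq
    (-(Polynomial.C μ⁻¹ * (R₂ + Polynomial.C A * Polynomial.X * R + Q)))
  have hrem : SectorO t (m + 2) fun x => μ⁻¹ * ((_root_.deriv (_root_.deriv u) x
      - x⁻¹ ^ 2 * R₂.eval x⁻¹) + A * (x⁻¹ * (_root_.deriv u x - x⁻¹ ^ 2 * R.eval x⁻¹))
      + x⁻¹ ^ 2 * (N x - Q.eval x⁻¹)) := by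
    refine SectorO.const_mul _ ((hR₂.add (SectorO.const_mul _ ?_)).add ?_)
    · have := sectorO_inv.mul hR
      rwa [show 1 + (m + 1) = m + 2 by ring] at this
    · have := (sectorO_inv_pow 2).mul hQ
      rwa [add_comm 2 m] at this
  have hholo : SectorHolo t fun x => u x - Y.eval x⁻¹ := by
    intro t' ht' h
    filter_upwards [hd t' ht' h, eventually_ne_zero_sectorFilter t'] with x h1 h2
    exact h1.sub (hasDerivAt_eval_inv Y h2).differentiableAt
  obtain ⟨c, hc⟩ := SectorO.integrate hholo ht (hrem.congr (fun t' ht' h => by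
    filter_upwards [hd t' ht' h, eventually_ne_zero_sectorFilter t', hode t' ht' h] with x h1 h2 h3
    have := (h1.hasDerivAt.sub (hasDerivAt_eval_inv Y h2)).deriv
    rw [show (fun x => u x - Y.eval x⁻¹) = (u - fun x => Y.eval x⁻¹) from rfl, this, hY]
    simp only [Polynomial.eval_neg, Polynomial.eval_mul, Polynomial.eval_C, Polynomial.eval_add,
      Polynomial.eval_X]
    have h4 : _root_.deriv u x = μ⁻¹ * (μ * _root_.deriv u x) := by field_simp
    have h5 : μ * _root_.deriv u x = _root_.deriv (_root_.deriv u) x + A * x⁻¹ * _root_.deriv u x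
      + x⁻¹ ^ 2 * N x := by linear_combination -h3
    rw [h5] at h4
    linear_combination -h4))
  refine ⟨Y + Polynomial.C c, ?_⟩
  convert! hc using 2 with x
  simp
  ring

/-- Coefficients of a full asymptotic expansion. -/
theorem exists_expansion (ht : 0 < t) (hf : ∀ m, HasExp t m f) :
    ∃ a : ℕ → ℂ, ∀ m, SectorO t m fun x => f x - ∑ l ∈ Finset.range m, a l * x⁻¹ ^ l := by
  choose P hP using hf
  -- The polynomials P m are chosen independently of each other, and P m determines only its
  -- coefficients below order m; hence a_l is read off from P (l + 1).
  refine ⟨fun l => (P (l + 1)).coeff l, fun m => ?_⟩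
  induction m with
  | zero => simpa using HasExp.sectorO ⟨P 0, hP 0⟩
  | succ m ih =>
    set S : Polynomial ℂ := ∑ l ∈ Finset.range m, Polynomial.monomial l ((P (l + 1)).coeff l) with hS
    have hSe : ∀ z : ℂ, S.eval z = ∑ l ∈ Finset.range m, (P (l + 1)).coeff l * z ^ l := fun z => by
      simp [hS, Polynomial.eval_finsetSum]
    have hSc : ∀ l, m ≤ l → S.coeff l = 0 := fun l hl => by
      simp only [hS, Polynomial.finsetSum_coeff, Polynomial.coeff_monomial]
      refine Finset.sum_eq_zero fun i hi => if_neg ?_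
      have := Finset.mem_range.1 hi
      omega
    set D := P (m + 1) - S with hD
    have hDO : SectorO t m fun x => D.eval x⁻¹ := by
      have := ih.sub ((hP (m + 1)).mono m.le_succ)
      refine this.congr fun t' _ _ => Eventually.of_forall fun x => ?_
      simp only [hD, Polynomial.eval_sub, hSe]
      ring
    -- Otherwise the lowest term of D, of some order j < m, would dominate on the positive axis and
    -- contradict D(1/x) = O(x^{-m}).
    have hDdvd : Polynomial.X ^ m ∣ D := by
      by_contra hnd
      have hD0 : D ≠ 0 := fun h => hnd (h ▸ dvd_zero _)
      obtain ⟨E, hE, hE0⟩ : ∃ E : Polynomial ℂ, D = Polynomial.X ^ D.natTrailingDegree * E ∧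
          E.coeff 0 ≠ 0 := by
        obtain ⟨E, hE⟩ := Polynomial.X_pow_dvd_iff.2
          (fun i (hi : i < D.natTrailingDegree) => Polynomial.coeff_eq_zero_of_lt_natTrailingDegree hi)
        refine ⟨E, hE, ?_⟩
        have h1 : D.coeff D.natTrailingDegree ≠ 0 := by
          simpa [Polynomial.trailingCoeff] using Polynomial.trailingCoeff_nonzero_iff_nonzero.2 hD0
        revert h1 hE
        generalize D.natTrailingDegree = j
        rintro hE h1
        rw [hE, Polynomial.coeff_X_pow_mul'] at h1
        simpa using h1
      set j := D.natTrailingDegree with hj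
      have hjm : j < m := by
        by_contra h
        push Not at h
        exact hnd (hE ▸ (pow_dvd_pow _ h).trans (dvd_mul_right _ _))
      have h1 := (hDO (t / 2) (by positivity) (by linarith)).comp_tendsto
        (tendsto_ofReal_sectorFilter (t := t / 2) (by positivity))
      have h2 : (fun r : ℝ => E.eval ((r : ℂ)⁻¹)) =O[atTop] fun r : ℝ => (r : ℂ)⁻¹ ^ (m - j) := by
        obtain ⟨C, hC⟩ := h1.bound
        refine IsBigO.of_bound C ?_
        filter_upwards [hC, eventually_gt_atTop 0] with r hr hr0
        have hr' : 0 < ‖(r : ℂ)⁻¹ ^ j‖ := norm_pos_iff.2 (pow_ne_zero _ (by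
          simpa using hr0.ne'))
        simp only [Function.comp] at hr
        rw [hE, Polynomial.eval_mul, Polynomial.eval_pow, Polynomial.eval_X,
          ← Nat.sub_add_cancel hjm.le, pow_add, norm_mul, norm_mul, mul_comm, ← mul_assoc] at hr
        exact le_of_mul_le_mul_right hr hr'
      have h3 : Tendsto (fun r : ℝ => (r : ℂ)⁻¹) atTop (𝓝 0) :=
        (tendsto_inv_sectorFilter (t / 2)).comp (tendsto_ofReal_sectorFilter (by positivity))
      have h4 : Tendsto (fun r : ℝ => (r : ℂ)⁻¹ ^ (m - j)) atTop (𝓝 0) := by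
        have := h3.pow (m - j)
        rwa [zero_pow (by omega)] at this
      have h5 := (E.continuous.tendsto 0).comp h3
      rw [← Polynomial.coeff_zero_eq_eval_zero] at h5
      exact hE0 (tendsto_nhds_unique h5 (h2.trans_tendsto h4))
    obtain ⟨E, hE⟩ := hDdvd
    have hcoef : E.coeff 0 = (P (m + 1)).coeff m := by
      have h1 : D.coeff m = (P (m + 1)).coeff m := by
        rw [hD, Polynomial.coeff_sub, hSc m le_rfl, sub_zero]
      rw [← h1, hE, Polynomial.coeff_X_pow_mul']
      simp
    have h6 : SectorO t (m + 1) fun x => x⁻¹ ^ (m + 1) * E.divX.eval x⁻¹ := by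
      simpa using (sectorO_inv_pow (m + 1)).mul (sectorO_eval (t := t) E.divX)
    refine ((hP (m + 1)).add h6).congr fun t' _ _ => Eventually.of_forall fun x => ?_
    have h7 : (P (m + 1)).eval x⁻¹ = S.eval x⁻¹ + x⁻¹ ^ m * E.eval x⁻¹ := by
      have : P (m + 1) = S + Polynomial.X ^ m * E := by rw [← hE, hD]; ring
      rw [this]; simp
    have h8 := congrArg (Polynomial.eval x⁻¹) E.divX_mul_X_add
    simp only [Polynomial.eval_add, Polynomial.eval_mul, Polynomial.eval_X, Polynomial.eval_C,
      hcoef] at h8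
    simp only [h7, ← h8, hSe, Finset.sum_range_succ]
    ring

end

section

open BoundedContinuousFunction MeasureTheory

/-! ### Joint holomorphy of the Kummer integral -/

/-- The kernel is factored into a finite measure e^{-s/2} s^{δ-1} ds, fixed once δ = Re a / 2 is
chosen, and a family of bounded functions of s holomorphic in all three parameters. The integral is
a bounded linear functional of that family, so `contDiffAt_toBCF` applies. -/
theorem differentiableAt_kummerJ {a k y : ℂ} (ha : 0 < a.re) (hy : 0 < y.re + y.im) :
    DifferentiableAt ℂ (fun p : ℂ × ℂ × ℂ => kummerJ p.1 p.2.1 p.2.2) (a, k, y) := by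
  set δ := a.re / 2 with hδ
  have hδ0 : 0 < δ := by positivity
  -- The absolute value makes g a function on all of ℝ; at s = 0 it is continuous and equal to 0
  -- because Re (p.1 - δ) > 0.
  set g : ℂ × ℂ × ℂ → ℝ → ℂ := fun p s =>
    Real.exp (-|s| / 2) * ((|s| : ℝ) : ℂ) ^ (p.1 - δ) * (1 + ((|s| : ℝ) : ℂ) * p.2.2) ^ p.2.1 with hg
  set M := kernelConst (a.re + 1) (‖k‖ + 1) (‖y‖ + 1) with hM
  have h1 : ∀ᶠ p : ℂ × ℂ × ℂ in 𝓝 (a, k, y), δ < p.1.re :=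
    (Continuous.tendsto (by fun_prop) _).eventually_const_lt (by simp; linarith)
  have h2 : ∀ᶠ p : ℂ × ℂ × ℂ in 𝓝 (a, k, y), p.1.re < a.re + 1 :=
    (Continuous.tendsto (by fun_prop) _).eventually_lt_const (by simp)
  have h3 : ∀ᶠ p : ℂ × ℂ × ℂ in 𝓝 (a, k, y), ‖p.2.1‖ < ‖k‖ + 1 :=
    (Continuous.tendsto (by fun_prop) _).eventually_lt_const (by simp)
  have h4 : ∀ᶠ p : ℂ × ℂ × ℂ in 𝓝 (a, k, y), ‖p.2.2‖ < ‖y‖ + 1 :=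
    (Continuous.tendsto (by fun_prop) _).eventually_lt_const (by simp)
  have h5 : ∀ᶠ p : ℂ × ℂ × ℂ in 𝓝 (a, k, y), 0 < p.2.2.re + p.2.2.im :=
    (Continuous.tendsto (by fun_prop) _).eventually_const_lt (by simpa using hy)
  have hsl : ∀ (p : ℂ × ℂ × ℂ) (s : ℝ), 0 < p.2.2.re + p.2.2.im →
      1 + ((|s| : ℝ) : ℂ) * p.2.2 ∈ Complex.slitPlane := fun p s h5 => one_add_mem_slitPlane (by
    simp only [Complex.re_ofReal_mul, Complex.im_ofReal_mul, ← mul_add]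
    positivity)
  have hprop : ∀ᶠ p in 𝓝 (a, k, y), Continuous (g p) ∧
      ∀ s, DifferentiableAt ℂ (fun p => g p s) p ∧ ‖g p s‖ ≤ M := by
    filter_upwards [h1, h2, h3, h4, h5] with p h1 h2 h3 h4 h5
    refine ⟨?_, fun s => ⟨?_, ?_⟩⟩
    · refine continuous_iff_continuousAt.2 fun s => (ContinuousAt.mul (by fun_prop) ?_).mul ?_
      · exact ContinuousAt.comp (f := fun s : ℝ => |s|) (g := fun r : ℝ => (r : ℂ) ^ (p.1 - δ))
          (Complex.continuousAt_ofReal_cpow_const _ _ (Or.inl (by simpa using h1)))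
          continuous_abs.continuousAt
      · exact ContinuousAt.cpow (by fun_prop) (by fun_prop) (hsl p s h5)
    · rcases eq_or_ne s 0 with rfl | hs
      · have : (fun p => g p 0) =ᶠ[𝓝 p] fun _ => 0 := by
          have : ∀ᶠ q : ℂ × ℂ × ℂ in 𝓝 p, δ < q.1.re :=
            (Continuous.tendsto (by fun_prop) _).eventually_const_lt h1
          filter_upwards [this] with q hq
          have : q.1 - δ ≠ 0 := fun h => by
            have := congrArg Complex.re h
            simp at this
            linarith
          simp [hg, Complex.zero_cpow this]
        exact (differentiableAt_const _).congr_of_eventuallyEq this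
      · have hs0 : ((|s| : ℝ) : ℂ) ≠ 0 := by simpa using hs
        refine DifferentiableAt.mul (DifferentiableAt.mul (by fun_prop) ?_) ?_
        · exact DifferentiableAt.const_cpow (by fun_prop) (Or.inl hs0)
        · exact DifferentiableAt.cpow (by fun_prop) (by fun_prop) (hsl p s h5)
    · rcases eq_or_ne s 0 with rfl | hs
      · have : p.1 - δ ≠ 0 := fun h => by
          have := congrArg Complex.re h
          simp at this
          linarith
        simp only [hg, abs_zero, Complex.ofReal_zero, Complex.zero_cpow this, mul_zero, zero_mul,
          norm_zero]
        rw [hM, kernelConst]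
        positivity
      · have hs0 : 0 < |s| := abs_pos.2 hs
        have := kernel_aux hδ0.le h1.le h2.le (by positivity) (N := ‖k‖ + 1) (by positivity) h3.le
          h5.le h4.le hs0
        simp only [hg, norm_mul, Complex.norm_real, Real.norm_eq_abs, Real.abs_exp,
          Complex.norm_cpow_eq_rpow_re_of_pos hs0, Complex.sub_re, Complex.ofReal_re]
        rw [mul_assoc]
        calc _ ≤ Real.exp (-|s| / 2) * (M * Real.exp (|s| / 2)) := by gcongr
          _ = M * (Real.exp (-|s| / 2) * Real.exp (|s| / 2)) := by ring
          _ = M := by rw [← Real.exp_add]; ring_nf; simp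
  have hC := contDiffAt_toBCF hprop
  set ρ : Measure ℝ := (volume.restrict (Set.Ioi 0)).withDensity
    (fun s => ENNReal.ofReal (Real.exp (-s / 2) * s ^ (δ - 1))) with hρ
  have : IsFiniteMeasure ρ := isFiniteMeasure_withDensity_ofReal (integrableOn_kernelBound hδ0).2
  set L : (ℝ →ᵇ ℂ) →L[ℂ] ℂ := (evalCLM ℂ () : (Unit →ᵇ ℂ) →L[ℂ] ℂ).comp
    ((integralCLM (α := Unit) ρ).comp (compCLM ⟨Prod.snd, continuous_snd⟩)) with hL
  have hmain := (L.contDiff.contDiffAt.comp _ hC).differentiableAt one_ne_zero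
  refine hmain.congr_of_eventuallyEq ?_
  filter_upwards [hprop, h1] with p hp h1
  have e1 : ∀ s, toBCF (g p) s = g p s := toBCF_apply hp.1 fun s => (hp.2 s).2
  change _ = ∫ s, toBCF (g p) s ∂ρ
  simp only [e1]
  rw [hρ, integral_withDensity_eq_integral_toReal_smul₀ (by
    exact ((by fun_prop : Measurable fun s : ℝ => Real.exp (-s / 2) * s ^ (δ - 1)).ennreal_ofReal).aemeasurable)
    (by simp), kummerJ]
  refine setIntegral_congr_fun measurableSet_Ioi fun s (hs : 0 < s) => ?_
  have hs0 : (s : ℂ) ≠ 0 := by exact_mod_cast hs.ne'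
  rw [ENNReal.toReal_ofReal (by positivity)]
  simp only [hg, abs_of_pos hs, kummerKernel, Complex.real_smul, Complex.ofReal_mul]
  have e2 : Complex.exp (-(s : ℂ)) = (Real.exp (-s / 2) : ℂ) * (Real.exp (-s / 2) : ℂ) := by
    rw [← Complex.ofReal_mul, ← Real.exp_add]
    push_cast
    ring_nf
  have e3 : (s : ℂ) ^ (p.1 - 1) = ((s ^ (δ - 1) : ℝ) : ℂ) * (s : ℂ) ^ (p.1 - δ) := by
    rw [Complex.ofReal_cpow hs.le, ← Complex.cpow_add _ _ hs0]
    congr 1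
    push_cast
    ring
  rw [e2, e3]
  ring

/-! ### Lower bounds on a sector -/

/-- On the real axis the product is |J|², which is positive by `kummerJ_ne_zero`. Compactness in the
parameters and in 1/x gives a uniform lower bound, which persists in a thin sector by uniform
continuity. A positive real part, rather than mere nonvanishing, is what permits complex powers of
the product. -/
theorem exists_kummerJ_bounds {d : ℕ} (hd₁ : 1 ≤ d) (hd₃ : d ≤ 3) {K : Set (ℂ × ℂ)}
    (hK : IsCompact K) (hne : K.Nonempty)
    (hpos : ∀ p ∈ K, 0 < p.1.re ∧ 0 ≤ p.2.re ∧ 0 < p.2.im) :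
    ∃ t c C : ℝ, 0 < t ∧ t ≤ 1 / 2 ∧ 0 < c ∧ 0 < C ∧ ∀ p ∈ K, ∀ x : ℂ, 1 ≤ x.re → |x.im| ≤ t * x.re →
      c ≤ (kummerJ p.1 ((d : ℂ) / 2 - p.1 - 1) (p.2 / x) *
        (starRingEnd ℂ) (kummerJ p.1 ((d : ℂ) / 2 - p.1 - 1) (p.2 / (starRingEnd ℂ) x))).re ∧
      ‖kummerJ p.1 ((d : ℂ) / 2 - p.1 - 1) (p.2 / x)‖ ≤ C := by
  -- The coordinates 1/x = r(1 + iτ) compactify the sector; infinity is r = 0, where J equals Γ(a),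
  -- and reflection is τ ↦ -τ.
  set J : (ℂ × ℂ) × ℝ × ℝ → ℂ := fun q => kummerJ q.1.1 ((d : ℂ) / 2 - q.1.1 - 1)
    (q.1.2 * (q.2.1 * (1 + q.2.2 * Complex.I))) with hJ
  set S : Set ((ℂ × ℂ) × ℝ × ℝ) := K ×ˢ (Set.Icc 0 1 ×ˢ Set.Icc (-(1 / 2)) (1 / 2)) with hS
  have hSc : IsCompact S := hK.prod (isCompact_Icc.prod isCompact_Icc)
  have hJc : ContinuousOn J S := by
    refine continuousOn_kummerJ.comp (f := fun q : (ℂ × ℂ) × ℝ × ℝ => (q.1.1, (d : ℂ) / 2 - q.1.1 - 1,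
      q.1.2 * (q.2.1 * (1 + q.2.2 * Complex.I)))) (by fun_prop) ?_
    rintro ⟨⟨a, ν⟩, r, τ⟩ ⟨h1, ⟨h2, h2'⟩, h3, h3'⟩
    obtain ⟨g1, g2, g3⟩ := hpos _ h1
    refine ⟨g1, ?_⟩
    simp only at *
    have : (ν * (r * (1 + τ * Complex.I))).re + (ν * (r * (1 + τ * Complex.I))).im
        = r * (ν.re * (1 + τ) + ν.im * (1 - τ)) := by
      simp; ring
    rw [this]
    have e1 : 0 ≤ 1 + τ := by linarith
    have e2 : 0 ≤ 1 - τ := by linarith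
    positivity
  set σ : (ℂ × ℂ) × ℝ × ℝ → (ℂ × ℂ) × ℝ × ℝ := fun q => (q.1, q.2.1, -q.2.2) with hσ
  set f : (ℂ × ℂ) × ℝ × ℝ → ℝ := fun q => (J q * (starRingEnd ℂ) (J (σ q))).re with hf
  have hσS : Set.MapsTo σ S S := by
    rintro ⟨p, r, τ⟩ ⟨h1, h2, h3, h3'⟩
    exact ⟨h1, h2, by simp at *; linarith, by simp at *; linarith⟩
  have hfc : ContinuousOn f S := by
    refine Complex.continuous_re.comp_continuousOn (hJc.mul ?_)
    exact Complex.continuous_conj.comp_continuousOn (hJc.comp (by fun_prop) hσS)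
  obtain ⟨C, hC⟩ := hSc.exists_bound_of_continuousOn hJc
  have hS0 : IsCompact (K ×ˢ (Set.Icc (0 : ℝ) 1 ×ˢ {(0 : ℝ)})) :=
    hK.prod (isCompact_Icc.prod isCompact_singleton)
  have hsub : K ×ˢ (Set.Icc (0 : ℝ) 1 ×ˢ {(0 : ℝ)}) ⊆ S :=
    Set.prod_mono subset_rfl (Set.prod_mono subset_rfl (by simp))
  obtain ⟨q₀, hq₀, hmin⟩ := hS0.exists_isMinOn (hne.prod ⟨(0, 0), by simp⟩) (hfc.mono hsub)
  have hq₀pos : 0 < f q₀ := by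
    obtain ⟨⟨a, ν⟩, r, τ⟩ := q₀
    obtain ⟨h1, ⟨h2, h2'⟩, h3⟩ := hq₀
    simp only [Set.mem_singleton_iff] at h3
    subst h3
    obtain ⟨g1, g2, g3⟩ := hpos _ h1
    have hJ0 : J ((a, ν), r, 0) ≠ 0 := by
      rcases eq_or_lt_of_le h2 with h | h
      · simp only at h
        simp only [hJ, ← h]
        simp only [Complex.ofReal_zero, zero_mul, mul_zero]
        rw [kummerJ_zero _ _ g1]
        exact Complex.Gamma_ne_zero_of_re_pos g1
      · simp only at h
        refine kummerJ_ne_zero hd₁ hd₃ g1 ?_ ?_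
        · simp at *; positivity
        · simp at *; positivity
    simp only [hf, hσ, neg_zero, Complex.mul_conj, Complex.ofReal_re]
    exact Complex.normSq_pos.2 hJ0
  have hunif := hSc.uniformContinuousOn_of_continuous hfc
  obtain ⟨η, hη, hu⟩ := Metric.uniformContinuousOn_iff.1 hunif (f q₀ / 2) (by positivity)
  refine ⟨min (1 / 2) (η / 2), f q₀ / 2, |C| + 1, by positivity, min_le_left _ _, by positivity,
    by positivity, ?_⟩
  rintro ⟨a, ν⟩ hp x hx hxt
  have hx0 : 0 < x.re := by linarith
  set τ : ℝ := -x.im / x.re with hτ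
  set r : ℝ := x.re / Complex.normSq x with hr
  have hn : x.re ^ 2 ≤ Complex.normSq x := by rw [Complex.normSq_apply]; nlinarith [sq_nonneg x.im]
  have hn0 : 0 < Complex.normSq x := lt_of_lt_of_le (by positivity) hn
  have hτt : |τ| ≤ min (1 / 2) (η / 2) := by
    rw [hτ, abs_div, abs_neg, abs_of_pos hx0, div_le_iff₀ hx0]; exact hxt
  have hr0 : 0 ≤ r := by positivity
  have hr1 : r ≤ 1 := by rw [hr, div_le_one hn0]; nlinarith
  have hxinv : x⁻¹ = r * (1 + τ * Complex.I) := by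
    apply Complex.ext
    · simp [hr]
    · simp [hr, hτ]; field_simp
  have hxinv' : ((starRingEnd ℂ) x)⁻¹ = r * (1 + ((-τ : ℝ) : ℂ) * Complex.I) := by
    rw [← map_inv₀, hxinv]; simp
  have hmem : (((a, ν), r, τ) : (ℂ × ℂ) × ℝ × ℝ) ∈ S :=
    ⟨hp, ⟨hr0, hr1⟩, abs_le.1 (hτt.trans (min_le_left _ _))⟩
  have hmem0 : (((a, ν), r, 0) : (ℂ × ℂ) × ℝ × ℝ) ∈ K ×ˢ (Set.Icc (0 : ℝ) 1 ×ˢ {(0 : ℝ)}) :=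
    ⟨hp, ⟨hr0, hr1⟩, rfl⟩
  have e1 : kummerJ a ((d : ℂ) / 2 - a - 1) (ν / x) = J ((a, ν), r, τ) := by
    simp only [hJ, div_eq_mul_inv ν, hxinv]
  have e2 : kummerJ a ((d : ℂ) / 2 - a - 1) (ν / (starRingEnd ℂ) x) = J (σ ((a, ν), r, τ)) := by
    simp only [hJ, hσ, div_eq_mul_inv ν, hxinv']
  simp only [e1, e2]
  refine ⟨?_, (hC _ hmem).trans ((le_abs_self C).trans (by linarith))⟩
  have h1 := hu _ hmem _ (hsub hmem0) (by
    rw [dist_eq_norm]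
    have := hτt.trans (min_le_right _ _)
    simp only [Prod.mk_sub_mk, sub_self, sub_zero, Prod.norm_def,
      norm_zero, Real.norm_eq_abs]
    exact max_lt hη (max_lt hη (by linarith)))
  have h2 : f q₀ ≤ f ((a, ν), r, 0) := hmin hmem0
  rw [Real.dist_eq] at h1
  have h3 := (abs_lt.1 h1).1
  change f q₀ / 2 ≤ f ((a, ν), r, τ)
  linarith

end

/-! ### Integral kernels and holomorphic families on a complex cone. -/

section

open BoundedContinuousFunction MeasureTheory

/-! ### Integration against a density on a half-line -/

/-- Integration in the second variable over `(0, ∞)` against an integrable density. -/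
def densityCLM {α : Type*} [TopologicalSpace α] [FirstCountableTopology α] {f : ℝ → ℝ}
    (hf : IntegrableOn f (Set.Ioi 0)) : (α × ℝ →ᵇ ℂ) →L[ℂ] (α →ᵇ ℂ) :=
  have : IsFiniteMeasure ((volume.restrict (Set.Ioi 0)).withDensity fun s => ENNReal.ofReal (f s)) :=
    isFiniteMeasure_withDensity_ofReal hf.2
  integralCLM ((volume.restrict (Set.Ioi 0)).withDensity fun s => ENNReal.ofReal (f s))

section

variable {α : Type*} [TopologicalSpace α] [FirstCountableTopology α] {f : ℝ → ℝ}

theorem densityCLM_apply (hf : IntegrableOn f (Set.Ioi 0)) (hm : Measurable f)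
    (h0 : ∀ s, 0 < s → 0 ≤ f s) (g : α × ℝ →ᵇ ℂ) (x : α) :
    densityCLM hf g x = ∫ s in Set.Ioi (0 : ℝ), (f s : ℂ) * g (x, s) := by
  have : IsFiniteMeasure ((volume.restrict (Set.Ioi 0)).withDensity fun s => ENNReal.ofReal (f s)) :=
    isFiniteMeasure_withDensity_ofReal hf.2
  rw [densityCLM, integralCLM_apply, integral_withDensity_eq_integral_toReal_smul₀
    hm.ennreal_ofReal.aemeasurable (by simp)]
  refine setIntegral_congr_fun measurableSet_Ioi fun s (hs : 0 < s) => ?_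
  simp only [ENNReal.toReal_ofReal (h0 s hs), Complex.real_smul]

theorem norm_densityCLM_le (hf : IntegrableOn f (Set.Ioi 0)) (hm : Measurable f)
    (h0 : ∀ s, 0 < s → 0 ≤ f s) (g : α × ℝ →ᵇ ℂ) :
    ‖(densityCLM hf g : α →ᵇ ℂ)‖ ≤ (∫ s in Set.Ioi (0 : ℝ), f s) * ‖g‖ := by
  have hpos : 0 ≤ ∫ s in Set.Ioi (0 : ℝ), f s := setIntegral_nonneg measurableSet_Ioi h0
  refine (norm_le (by positivity)).2 fun x => ?_
  rw [densityCLM_apply hf hm h0, ← integral_mul_const]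
  refine norm_integral_le_of_norm_le (hf.mul_const _) ?_
  filter_upwards [ae_restrict_mem measurableSet_Ioi] with s hs
  rw [norm_mul, Complex.norm_real, Real.norm_of_nonneg (h0 s hs)]
  gcongr
  · exact h0 s hs
  · exact g.norm_coe_le_norm _

end

theorem integrableOn_exp_neg_mul {η : ℝ} (hη : 0 < η) :
    IntegrableOn (fun s => Real.exp (-(η * s))) (Set.Ioi 0) := by
  simpa using integrableOn_exp_mul_Ioi (neg_lt_zero.2 hη) 0

theorem integral_exp_neg_mul {η : ℝ} (hη : 0 < η) :
    ∫ s in Set.Ioi (0 : ℝ), Real.exp (-(η * s)) = η⁻¹ := by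
  have := integral_exp_mul_Ioi (neg_lt_zero.2 hη) 0
  simp at this
  simpa using this

/-- The total mass is 1 for every X. This is the source of the uniformity in ξ₁. -/
theorem integral_div_add_sq {X : ℝ} (hX : 0 < X) :
    IntegrableOn (fun s => X / (X + s) ^ 2) (Set.Ioi 0) ∧
      ∫ s in Set.Ioi (0 : ℝ), X / (X + s) ^ 2 = 1 := by
  have hd : ∀ s ∈ Set.Ici (0 : ℝ), HasDerivAt (fun s => -(X / (X + s))) (X / (X + s) ^ 2) s := by
    intro s (hs : 0 ≤ s)
    have h1 : X + s ≠ 0 := by positivity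
    have := (((hasDerivAt_id s).const_add X).inv h1).const_mul (-X)
    convert! this using 1
    · funext s; simp [div_eq_mul_inv]
    · simp only [id]; field_simp
  have hlim : Tendsto (fun s => -(X / (X + s))) atTop (𝓝 0) := by
    have : Tendsto (fun s => X / (X + s)) atTop (𝓝 0) :=
      tendsto_const_nhds.div_atTop (tendsto_atTop_add_const_left _ _ tendsto_id)
    simpa using this.neg
  have hnn : ∀ s ∈ Set.Ioi (0 : ℝ), 0 ≤ X / (X + s) ^ 2 := fun s hs => by positivity
  refine ⟨integrableOn_Ioi_deriv_of_nonneg' hd hnn hlim, ?_⟩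
  rw [integral_Ioi_of_hasDerivAt_of_nonneg' hd hnn hlim]
  field_simp
  simp

/-! ### Cones -/

/-- The closed convex cone of aperture `t` around the positive axis. -/
def Cone (t : ℝ) : Set ℂ := {w | |w.im| ≤ t * w.re}

theorem Cone.add_mem {t : ℝ} {w v : ℂ} (hw : w ∈ Cone t) (hv : v ∈ Cone t) : w + v ∈ Cone t := by
  simp only [Cone, Set.mem_ofPred_eq, Complex.add_im, Complex.add_re] at *
  linarith [abs_add_le w.im v.im]

theorem Cone.smul_mem {t : ℝ} {w : ℂ} (hw : w ∈ Cone t) {s : ℝ} (hs : 0 ≤ s) : (s : ℂ) * w ∈ Cone t := by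
  simp only [Cone, Set.mem_ofPred_eq, Complex.re_ofReal_mul, Complex.im_ofReal_mul, abs_mul,
    abs_of_nonneg hs] at *
  nlinarith

theorem Cone.star_mem {t : ℝ} {w : ℂ} (hw : w ∈ Cone t) : (starRingEnd ℂ) w ∈ Cone t := by
  simpa [Cone] using hw

theorem Cone.re_nonneg {t : ℝ} (ht : 0 < t) {w : ℂ} (hw : w ∈ Cone t) : 0 ≤ w.re := by
  have h : |w.im| ≤ t * w.re := hw
  exact nonneg_of_mul_nonneg_right ((abs_nonneg _).trans h) ht

theorem Cone.ofReal_mem {t : ℝ} (ht : 0 < t) {s : ℝ} (hs : 0 ≤ s) : (s : ℂ) ∈ Cone t := by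
  simp [Cone]; positivity

theorem Cone.add_re_le {t X : ℝ} (ht : 0 < t) (hX : 1 ≤ X) {w : ℂ} (hw : w ∈ Cone t) :
    1 ≤ (X + w).re ∧ |((X : ℂ) + w).im| ≤ t * (X + w).re := by
  have h1 := Cone.re_nonneg ht hw
  have h : |w.im| ≤ t * w.re := hw
  simp only [Complex.add_re, Complex.ofReal_re, Complex.add_im, Complex.ofReal_im, zero_add]
  exact ⟨by linarith, by nlinarith⟩

theorem Cone.add_ne_zero {t X : ℝ} (ht : 0 < t) (hX : 1 ≤ X) {w : ℂ} (hw : w ∈ Cone t) :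
    (X : ℂ) + w ≠ 0 := fun h => by
  have := (Cone.add_re_le ht hX hw).1
  rw [h] at this
  norm_num at this

/-- Conjugation on a cone. -/
def coneConj (t : ℝ) : C(Cone t, Cone t) :=
  ⟨fun w => ⟨(starRingEnd ℂ) w, Cone.star_mem w.2⟩, by fun_prop⟩

/-- The translations of a cone along a ray. -/
def coneShift {t : ℝ} {c : ℂ} (hc : c ∈ Cone t) : C(Cone t × ℝ, Cone t) :=
  ⟨fun p => ⟨p.1 + ((|p.2| : ℝ) : ℂ) * c, Cone.add_mem p.1.2 (Cone.smul_mem hc (abs_nonneg _))⟩,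
    by fun_prop⟩

/-- For `x` in a sector of aperture `1/2`, `v/x` lies in the half-plane where the Kummer kernel is
controlled. -/
theorem div_re_add_im_pos {v x : ℂ} (hv : |v.im - v.re| < 2 * (v.re + v.im)) (hx : 0 < x.re)
    (hxt : |x.im| ≤ 1 / 2 * x.re) : 0 < (v / x).re + (v / x).im := by
  have hn : 0 < Complex.normSq x := Complex.normSq_pos.2 fun h => by simp [h] at hx
  rw [Complex.div_re, Complex.div_im]
  have : v.re * x.re / Complex.normSq x + v.im * x.im / Complex.normSq x +
      (v.im * x.re / Complex.normSq x - v.re * x.im / Complex.normSq x)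
      = ((v.re + v.im) * x.re + (v.im - v.re) * x.im) / Complex.normSq x := by ring
  rw [this]
  refine div_pos ?_ hn
  have h1 : |(v.im - v.re) * x.im| ≤ |v.im - v.re| * (1 / 2 * x.re) := by
    rw [abs_mul]; gcongr
  have h2 := neg_abs_le ((v.im - v.re) * x.im)
  nlinarith

/-! ### The Kummer integral as a family of bounded functions on a cone -/

theorem norm_kummerJ_le {a k y : ℂ} {δ M N Y : ℝ} (hδ0 : 0 < δ) (hδ : δ ≤ a.re)
    (hM : a.re ≤ M) (hN : 0 < N) (hk : ‖k‖ ≤ N) (hy : 0 ≤ y.re + y.im) (hY : ‖y‖ ≤ Y) :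
    ‖kummerJ a k y‖ ≤
      kernelConst M N Y * ∫ s in Set.Ioi (0 : ℝ), Real.exp (-s / 2) * s ^ (δ - 1) := by
  rw [← integral_const_mul]
  exact norm_integral_le_of_norm_le ((integrableOn_kernelBound hδ0).const_mul _)
    ((ae_restrict_mem measurableSet_Ioi).mono fun s hs =>
      norm_kummerKernel_le hδ0.le hδ hM (by linarith) hN hk hy hY hs)

/-- `w ↦ J(a, b - a - 1, ν / (X + w))` as a function of `p = (a, ν)`. -/
def kummerBCF (t X : ℝ) (b : ℂ) (p : ℂ × ℂ) : Cone t →ᵇ ℂ :=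
  toBCF fun w => kummerJ p.1 (b - p.1 - 1) (p.2 / (X + w))

theorem kummerBCF_aux {t X : ℝ} (ht : 0 < t) (ht' : t ≤ 1 / 2) (hX : 1 ≤ X) (b : ℂ) {p : ℂ × ℂ}
    (ha : 0 < p.1.re) (hν : |p.2.im - p.2.re| < 2 * (p.2.re + p.2.im)) :
    ∃ M, ∀ᶠ q : ℂ × ℂ in 𝓝 p,
      Continuous (fun w : Cone t => kummerJ q.1 (b - q.1 - 1) (q.2 / (X + w))) ∧
      ∀ w : Cone t, DifferentiableAt ℂ (fun q : ℂ × ℂ => kummerJ q.1 (b - q.1 - 1) (q.2 / (X + w))) q ∧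
        ‖kummerJ q.1 (b - q.1 - 1) (q.2 / (X + w))‖ ≤ M := by
  refine ⟨kernelConst (p.1.re + 1) (‖b - p.1 - 1‖ + 1) (‖p.2‖ + 1) *
    ∫ s in Set.Ioi (0 : ℝ), Real.exp (-s / 2) * s ^ (p.1.re / 2 - 1), ?_⟩
  have h1 : ∀ᶠ q : ℂ × ℂ in 𝓝 p, p.1.re / 2 < q.1.re :=
    (Continuous.tendsto (by fun_prop) _).eventually_const_lt (by linarith)
  have h2 : ∀ᶠ q : ℂ × ℂ in 𝓝 p, q.1.re < p.1.re + 1 :=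
    (Continuous.tendsto (by fun_prop) _).eventually_lt_const (by simp)
  have h3 : ∀ᶠ q : ℂ × ℂ in 𝓝 p, ‖b - q.1 - 1‖ < ‖b - p.1 - 1‖ + 1 :=
    (Continuous.tendsto (by fun_prop) _).eventually_lt_const (by simp)
  have h4 : ∀ᶠ q : ℂ × ℂ in 𝓝 p, ‖q.2‖ < ‖p.2‖ + 1 :=
    (Continuous.tendsto (by fun_prop) _).eventually_lt_const (by simp)
  have h5 : ∀ᶠ q : ℂ × ℂ in 𝓝 p, 0 < 2 * (q.2.re + q.2.im) - |q.2.im - q.2.re| :=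
    (Continuous.tendsto (by fun_prop) _).eventually_const_lt (by linarith)
  filter_upwards [h1, h2, h3, h4, h5] with q h1 h2 h3 h4 h5
  have hne : ∀ w : Cone t, (X : ℂ) + w ≠ 0 := fun w => Cone.add_ne_zero ht hX w.2
  have hy : ∀ w : Cone t, 0 < (q.2 / (X + w)).re + (q.2 / (X + w)).im := fun w => by
    obtain ⟨g1, g2⟩ := Cone.add_re_le ht hX w.2
    refine div_re_add_im_pos (by linarith) (by linarith) (g2.trans ?_)
    gcongr
  have hq : 0 < q.1.re := by linarith
  refine ⟨?_, fun w => ⟨?_, ?_⟩⟩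
  · refine continuous_iff_continuousAt.2 fun w => ?_
    refine ContinuousAt.comp (f := fun w : Cone t => q.2 / (X + w))
      (hasDerivAt_kummerJ hq (hy w)).continuousAt ?_
    exact ContinuousAt.div (by fun_prop) (by fun_prop) (hne w)
  · refine DifferentiableAt.comp (f := fun q : ℂ × ℂ => (q.1, b - q.1 - 1, q.2 / (X + w)))
      (g := fun r : ℂ × ℂ × ℂ => kummerJ r.1 r.2.1 r.2.2) q
      (differentiableAt_kummerJ hq (hy w)) ?_
    exact DifferentiableAt.prodMk (by fun_prop) (DifferentiableAt.prodMk (by fun_prop)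
      (by simpa only [div_eq_mul_inv] using differentiableAt_snd.mul_const (𝔸 := ℂ) _))
  · refine norm_kummerJ_le (by positivity) h1.le h2.le (by positivity) h3.le (hy w).le ?_
    rw [norm_div]
    have : 1 ≤ ‖(X : ℂ) + w‖ := (Cone.add_re_le ht hX w.2).1.trans (Complex.re_le_norm _)
    exact (div_le_self (norm_nonneg _) this).trans h4.le

theorem contDiffAt_kummerBCF {t X : ℝ} (ht : 0 < t) (ht' : t ≤ 1 / 2) (hX : 1 ≤ X) (b : ℂ)
    {p : ℂ × ℂ} (ha : 0 < p.1.re) (hν : |p.2.im - p.2.re| < 2 * (p.2.re + p.2.im)) :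
    ContDiffAt ℂ 1 (kummerBCF t X b) p := by
  obtain ⟨M, hM⟩ := kummerBCF_aux ht ht' hX b ha hν
  exact contDiffAt_toBCF hM

theorem kummerBCF_apply {t X : ℝ} (ht : 0 < t) (ht' : t ≤ 1 / 2) (hX : 1 ≤ X) (b : ℂ)
    {p : ℂ × ℂ} (ha : 0 < p.1.re) (hν : |p.2.im - p.2.re| < 2 * (p.2.re + p.2.im)) (w : Cone t) :
    kummerBCF t X b p w = kummerJ p.1 (b - p.1 - 1) (p.2 / (X + w)) := by
  obtain ⟨M, hM⟩ := kummerBCF_aux ht ht' hX b ha hν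
  have := hM.self_of_nhds
  exact toBCF_apply this.1 (fun w => (this.2 w).2) w

/-! ### The resolvent kernel -/

/-- The kernel `c e^{(η - μc)|s|} (1 + c|s|/(X + w))^{A-2}`, as a function of `p = (A, μ)`. -/
def resolventKernel (X η : ℝ) (c : ℂ) (p : ℂ × ℂ) (w : ℂ) (s : ℝ) : ℂ :=
  c * Complex.exp ((η - p.2 * c) * (|s| : ℝ)) * (1 + (|s| : ℝ) * (c / (X + w))) ^ (p.1 - 2)

/-- The resolvent kernel as a bounded continuous function. -/
def resolventBCF (t X η : ℝ) (c : ℂ) (p : ℂ × ℂ) : Cone t × ℝ →ᵇ ℂ :=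
  toBCF fun x => resolventKernel X η c p x.1 x.2

/-- The bound for the resolvent kernel. -/
def resolventConst (N η : ℝ) : ℝ := 2 * (Real.exp (Real.pi * N) * (2 ^ N * (1 + 4 * N * η⁻¹) ^ N))

/-- The direction of integration of the resolvent kernel. -/
def rayDir (t : ℝ) : ℂ := ⟨1, t⟩

theorem rayDir_mem {t : ℝ} (ht : 0 < t) : rayDir t ∈ Cone t := by
  simp [Cone, rayDir, abs_of_pos ht]

theorem rayDir_div_pos {t X : ℝ} (ht : 0 < t) (ht' : t ≤ 1 / 2) (hX : 1 ≤ X) {w : ℂ}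
    (hw : w ∈ Cone t) : 0 < (rayDir t / (X + w)).re + (rayDir t / (X + w)).im := by
  obtain ⟨g1, g2⟩ := Cone.add_re_le ht hX hw
  refine div_re_add_im_pos ?_ (by linarith) (g2.trans ?_)
  · simp only [rayDir]
    rw [abs_lt]
    constructor <;> linarith
  · gcongr

theorem norm_rayDir_le {t : ℝ} (ht : 0 < t) (ht' : t ≤ 1 / 2) : ‖rayDir t‖ ≤ 2 := by
  refine (Complex.norm_le_abs_re_add_abs_im _).trans ?_
  simp only [rayDir, abs_one, abs_of_pos ht]
  linarith

theorem one_add_mem_slitPlane_of_cone {t X : ℝ} (ht : 0 < t) (ht' : t ≤ 1 / 2) (hX : 1 ≤ X) {w : ℂ}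
    (hw : w ∈ Cone t) {s : ℝ} (hs : 0 ≤ s) :
    0 ≤ ((s : ℂ) * (rayDir t / (X + w))).re + ((s : ℂ) * (rayDir t / (X + w))).im := by
  rw [Complex.re_ofReal_mul, Complex.im_ofReal_mul, ← mul_add]
  exact mul_nonneg hs (rayDir_div_pos ht ht' hX hw).le

/-- The exponential leaves e^{-η|s|/2}, and the power grows by at most e^{η|s|/2} up to a constant.
The factor 3/2 in the hypothesis, against 2 in the later ones, is the room needed for a
neighbourhood of parameters. -/
theorem norm_resolventKernel_le {t X η N : ℝ} (ht : 0 < t) (ht' : t ≤ 1 / 2) (hX : 1 ≤ X)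
    (hη : 0 < η) {p : ℂ × ℂ} (hp : 3 / 2 * η ≤ (p.2 * rayDir t).re) (hN : 0 < N)
    (hA : ‖p.1 - 2‖ ≤ N) {w : ℂ} (hw : w ∈ Cone t) (s : ℝ) :
    ‖resolventKernel X η (rayDir t) p w s‖ ≤ resolventConst N η := by
  have hs := abs_nonneg s
  rw [resolventKernel, norm_mul, norm_mul, Complex.norm_exp]
  have h1 : ((η - p.2 * rayDir t) * (|s| : ℝ)).re ≤ -(η / 2 * |s|) := by
    rw [Complex.re_mul_ofReal, Complex.sub_re, Complex.ofReal_re]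
    nlinarith
  have h2 := norm_one_add_cpow_le (one_add_mem_slitPlane_of_cone ht ht' hX hw hs) _ hA
  have h3 : ‖((|s| : ℝ) : ℂ) * (rayDir t / (X + w))‖ ≤ (2 * η * |s|) * η⁻¹ := by
    have : 1 ≤ ‖(X : ℂ) + w‖ := (Cone.add_re_le ht hX hw).1.trans (Complex.re_le_norm _)
    rw [norm_mul, Complex.norm_real, Real.norm_of_nonneg hs, norm_div]
    calc |s| * (‖rayDir t‖ / ‖(X : ℂ) + w‖) ≤ |s| * 2 := by
          gcongr
          exact (div_le_self (norm_nonneg _) this).trans (norm_rayDir_le ht ht')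
      _ = _ := by field_simp
  have h4 := one_add_mul_rpow_le (N := N) (Y := η⁻¹) (s := 2 * η * |s|) hN (by positivity)
    (by positivity)
  calc ‖rayDir t‖ * Real.exp _ * ‖_‖
      ≤ 2 * Real.exp (-(η / 2 * |s|)) * (Real.exp (Real.pi * N) *
        (2 ^ N * ((1 + 4 * N * η⁻¹) ^ N * Real.exp (2 * η * |s| / 4)))) := by
        gcongr
        · exact norm_rayDir_le ht ht'
        · refine h2.trans ?_
          gcongr
          rw [Real.mul_rpow (by norm_num) (by positivity)]
          gcongr
          exact (Real.rpow_le_rpow (by positivity) (by linarith) hN.le).trans h4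
    _ = resolventConst N η * (Real.exp (-(η / 2 * |s|)) * Real.exp (2 * η * |s| / 4)) := by
        rw [resolventConst]; ring
    _ = _ := by rw [← Real.exp_add]; ring_nf; simp

theorem resolventBCF_aux {t X η : ℝ} (ht : 0 < t) (ht' : t ≤ 1 / 2) (hX : 1 ≤ X)
    (hη : 0 < η) {p : ℂ × ℂ} (hp : 2 * η ≤ (p.2 * rayDir t).re) :
    ∃ M, ∀ᶠ q : ℂ × ℂ in 𝓝 p,
      Continuous (fun x : Cone t × ℝ => resolventKernel X η (rayDir t) q x.1 x.2) ∧
      ∀ x : Cone t × ℝ,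
        DifferentiableAt ℂ (fun q : ℂ × ℂ => resolventKernel X η (rayDir t) q x.1 x.2) q ∧
        ‖resolventKernel X η (rayDir t) q x.1 x.2‖ ≤ M := by
  refine ⟨resolventConst (‖p.1 - 2‖ + 1) η, ?_⟩
  have h1 : ∀ᶠ q : ℂ × ℂ in 𝓝 p, 3 / 2 * η < (q.2 * rayDir t).re :=
    (Continuous.tendsto (by fun_prop) _).eventually_const_lt (by linarith)
  have h2 : ∀ᶠ q : ℂ × ℂ in 𝓝 p, ‖q.1 - 2‖ < ‖p.1 - 2‖ + 1 :=
    (Continuous.tendsto (by fun_prop) _).eventually_lt_const (by simp)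
  filter_upwards [h1, h2] with q h1 h2
  have hsl : ∀ x : Cone t × ℝ, 1 + ((|x.2| : ℝ) : ℂ) * (rayDir t / (X + x.1)) ∈ Complex.slitPlane :=
    fun x => one_add_mem_slitPlane (one_add_mem_slitPlane_of_cone ht ht' hX x.1.2 (abs_nonneg _))
  have hne : ∀ x : Cone t × ℝ, (X : ℂ) + x.1 ≠ 0 := fun x => Cone.add_ne_zero ht hX x.1.2
  refine ⟨continuous_iff_continuousAt.2 fun x => ?_, fun x => ⟨?_, ?_⟩⟩
  · unfold resolventKernel
    refine ContinuousAt.mul (by fun_prop) (ContinuousAt.cpow ?_ (by fun_prop) (hsl x))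
    have := ContinuousAt.div (f := fun _ => rayDir t) (g := fun x : Cone t × ℝ => (X : ℂ) + x.1)
      (a := x) (by fun_prop) (by fun_prop) (hne x)
    fun_prop
  · unfold resolventKernel
    exact DifferentiableAt.mul (by fun_prop)
      (DifferentiableAt.const_cpow (by fun_prop) (Or.inl (Complex.slitPlane_ne_zero (hsl x))))
  · exact norm_resolventKernel_le ht ht' hX hη h1.le (by positivity) h2.le x.1.2 x.2

theorem contDiffAt_resolventBCF {t X η : ℝ} (ht : 0 < t) (ht' : t ≤ 1 / 2) (hX : 1 ≤ X)
    (hη : 0 < η) {p : ℂ × ℂ} (hp : 2 * η ≤ (p.2 * rayDir t).re) :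
    ContDiffAt ℂ 1 (resolventBCF t X η (rayDir t)) p := by
  obtain ⟨M, hM⟩ := resolventBCF_aux ht ht' hX hη hp
  exact contDiffAt_toBCF hM

theorem resolventBCF_apply {t X η : ℝ} (ht : 0 < t) (ht' : t ≤ 1 / 2) (hX : 1 ≤ X)
    (hη : 0 < η) {p : ℂ × ℂ} (hp : 2 * η ≤ (p.2 * rayDir t).re) (x : Cone t × ℝ) :
    resolventBCF t X η (rayDir t) p x = resolventKernel X η (rayDir t) p x.1 x.2 := by
  obtain ⟨M, hM⟩ := resolventBCF_aux ht ht' hX hη hp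
  have := hM.self_of_nhds
  exact toBCF_apply this.1 (fun w => (this.2 w).2) x

theorem norm_resolventBCF_le {t X η N : ℝ} (ht : 0 < t) (ht' : t ≤ 1 / 2) (hX : 1 ≤ X)
    (hη : 0 < η) {p : ℂ × ℂ} (hp : 2 * η ≤ (p.2 * rayDir t).re) (hN : 0 < N)
    (hA : ‖p.1 - 2‖ ≤ N) : ‖resolventBCF t X η (rayDir t) p‖ ≤ resolventConst N η := by
  refine (norm_le (by rw [resolventConst]; positivity)).2 fun x => ?_
  rw [resolventBCF_apply ht ht' hX hη hp]
  exact norm_resolventKernel_le ht ht' hX hη (by linarith) hN hA x.1.2 x.2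

end

section

open BoundedContinuousFunction MeasureTheory

/-! ### Differentiable dependence of fixed points -/

/-- The implicit function theorem for φ - T(p, φ) = 0 provides a C¹ branch on a full neighbourhood
of each point, and the contraction property identifies it with u on S. The set S is arbitrary, so
derivatives up to the boundary are covered. -/
theorem contDiffOn_fixedPoint {P B : Type*} [NormedAddCommGroup P] [NormedSpace ℝ P]
    [CompleteSpace P] [NormedAddCommGroup B] [NormedSpace ℝ B] [CompleteSpace B]
    {T : P × B → B} {S : Set P} {r r' : ℝ} (hr : r' < r) {u : P → B}
    (hu : ∀ p ∈ S, T (p, u p) = u p ∧ ‖u p‖ ≤ r')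
    (hlip : ∀ p ∈ S, ∀ φ ψ, ‖φ‖ ≤ r → ‖ψ‖ ≤ r → ‖T (p, φ) - T (p, ψ)‖ ≤ 1 / 2 * ‖φ - ψ‖)
    (hT : ∀ p ∈ S, ContDiffAt ℝ 1 T (p, u p)) : ContDiffOn ℝ 1 u S := by
  intro p hp
  set f : P × B → B := fun v => v.2 - T v with hf
  have hfc : ContDiffAt ℝ 1 f (p, u p) := contDiffAt_snd.sub (hT p hp)
  have hball : Metric.ball (0 : B) r ∈ 𝓝 (u p) :=
    Metric.isOpen_ball.mem_nhds (by simpa using (hu p hp).2.trans_lt hr)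
  -- The Lipschitz constant 1/2 bounds the partial derivative in φ, so 1 minus that derivative is
  -- invertible by a Neumann series.
  have hnorm : ‖fderiv ℝ T (p, u p) ∘L .inr ℝ P B‖ ≤ 1 / 2 := by
    have h1 : HasFDerivAt (fun φ => T (p, φ)) (fderiv ℝ T (p, u p) ∘L .inr ℝ P B) (u p) :=
      ((hT p hp).differentiableAt one_ne_zero).hasFDerivAt.comp (u p) (hasFDerivAt_prodMk_right _ _)
    refine h1.le_of_lip' (by norm_num) ?_
    filter_upwards [hball] with φ hφ
    exact hlip p hp _ _ (by simpa using (Metric.mem_ball.1 hφ).le) ((hu p hp).2.trans hr.le)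
  have hinv : (fderiv ℝ f (p, u p) ∘L .inr ℝ P B).IsInvertible := by
    have h1 : fderiv ℝ f (p, u p) ∘L .inr ℝ P B = 1 - fderiv ℝ T (p, u p) ∘L .inr ℝ P B := by
      have h2 : HasFDerivAt f (ContinuousLinearMap.snd ℝ P B - fderiv ℝ T (p, u p)) (p, u p) :=
        hasFDerivAt_snd.sub ((hT p hp).differentiableAt one_ne_zero).hasFDerivAt
      rw [h2.fderiv]
      ext x
      simp
    obtain ⟨v, hv⟩ := isUnit_one_sub_of_norm_lt_one (hnorm.trans_lt (by norm_num))
    rw [h1, ← hv]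
    exact ContinuousLinearMap.IsInvertible.of_inverse (g := (↑v⁻¹ : B →L[ℝ] B)) v.mul_inv v.inv_mul
  set g := hfc.implicitFunction one_ne_zero hinv with hg
  have hgc : ContDiffAt ℝ 1 g p := hfc.contDiffAt_implicitFunction one_ne_zero hinv
  have hg0 : g p = u p := hfc.implicitFunction_apply_self one_ne_zero hinv
  have hgf := hfc.eventually_apply_implicitFunction one_ne_zero hinv
  have hgb : ∀ᶠ q in 𝓝 p, g q ∈ Metric.ball (0 : B) r := hgc.continuousAt (hg0 ▸ hball)
  refine hgc.contDiffWithinAt.congr_of_eventuallyEq ?_ hg0.symm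
  filter_upwards [nhdsWithin_le_nhds hgf, nhdsWithin_le_nhds hgb, self_mem_nhdsWithin] with q h1 h2 hq
  have h3 : T (q, g q) = g q := by
    have : g q - T (q, g q) = u p - T (p, u p) := h1
    rw [(hu p hp).1, sub_self] at this
    exact (sub_eq_zero.1 this).symm
  -- Two fixed points in the ball of radius r coincide, since their distance is at most half of
  -- itself.
  have h4 := hlip q hq (u q) (g q) ((hu q hq).2.trans hr.le) (by simpa using (Metric.mem_ball.1 h2).le)
  rw [(hu q hq).1, h3] at h4
  have h5 : ‖u q - g q‖ ≤ 0 := by linarith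
  exact sub_eq_zero.1 (norm_le_zero_iff.1 h5)

/-! ### The nonlinearity -/

theorem one_add_mem_slitPlane_of_norm {z : ℂ} (hz : ‖z‖ < 1) : 1 + z ∈ Complex.slitPlane :=
  Complex.mem_slitPlane_of_norm_lt_one hz

theorem differentiableOn_one_add_cpow (c : ℂ) :
    DifferentiableOn ℂ (fun z : ℂ => (1 + z) ^ c) (Metric.ball 0 1) := fun z hz =>
  (DifferentiableAt.cpow (by fun_prop) (by fun_prop)
    (one_add_mem_slitPlane_of_norm (by simpa using hz))).differentiableWithinAt

theorem exists_one_add_cpow_bounds (c : ℂ) : ∃ C : ℝ, 0 < C ∧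
    (∀ z ∈ Metric.closedBall (0 : ℂ) (1 / 2), ‖(1 + z) ^ c‖ ≤ C) ∧
    ∀ z ∈ Metric.closedBall (0 : ℂ) (1 / 2), ∀ z' ∈ Metric.closedBall (0 : ℂ) (1 / 2),
      ‖(1 + z) ^ c - (1 + z') ^ c‖ ≤ C * ‖z - z'‖ := by
  have hd := differentiableOn_one_add_cpow c
  have hsub : Metric.closedBall (0 : ℂ) (1 / 2) ⊆ Metric.ball 0 1 :=
    Metric.closedBall_subset_ball (by norm_num)
  have hK : IsCompact (Metric.closedBall (0 : ℂ) (1 / 2)) := isCompact_closedBall _ _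
  obtain ⟨C₁, h₁⟩ := hK.exists_bound_of_continuousOn (hd.continuousOn.mono hsub)
  obtain ⟨C₂, h₂⟩ := hK.exists_bound_of_continuousOn
    ((hd.deriv Metric.isOpen_ball).continuousOn.mono hsub)
  refine ⟨max 1 (max C₁ C₂), by positivity, fun z hz => (h₁ z hz).trans (by simp), fun z hz z' hz' => ?_⟩
  refine (convex_closedBall (0 : ℂ) (1 / 2)).norm_image_sub_le_of_norm_deriv_le (𝕜 := ℂ)
    (f := fun z => (1 + z) ^ c) (fun y hy => ?_) (fun y hy => ?_) hz' hz
  · exact hd.differentiableAt (Metric.isOpen_ball.mem_nhds (hsub hy))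
  · exact (h₂ y hy).trans (by simp)

variable {t : ℝ}

/-- `φ ↦ (1 + φ)^{σ+1} (1 + φ*)^σ`, where `φ*(w) = conj φ(conj w)`. -/
def nonlin (σ : ℝ) (φ : Cone t →ᵇ ℂ) : Cone t →ᵇ ℂ :=
  (toBCF fun w => (1 + φ w) ^ ((σ : ℂ) + 1)) * toBCF fun w => (1 + conjComp (coneConj t) φ w) ^ (σ : ℂ)

theorem norm_conjComp_le (φ : Cone t →ᵇ ℂ) : ‖conjComp (coneConj t) φ‖ ≤ ‖φ‖ :=
  (norm_le (norm_nonneg _)).2 fun x => by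
    rw [conjComp_apply, RCLike.norm_conj]
    exact φ.norm_coe_le_norm _

theorem apply_mem_closedBall {φ : Cone t →ᵇ ℂ} {r : ℝ} (hφ : ‖φ‖ ≤ r) (w : Cone t) :
    φ w ∈ Metric.closedBall (0 : ℂ) r := by
  simpa using (φ.norm_coe_le_norm w).trans hφ

theorem toBCF_one_add_cpow_apply (c : ℂ) {φ : Cone t →ᵇ ℂ} (hφ : ‖φ‖ ≤ 1 / 2) (w : Cone t) :
    toBCF (fun w => (1 + φ w) ^ c) w = (1 + φ w) ^ c :=
  comp_toBCF_apply (θ := fun z => (1 + z) ^ c) ((differentiableOn_one_add_cpow c).continuousOn.mono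
    (Metric.closedBall_subset_ball (by norm_num))) (isCompact_closedBall 0 (1 / 2))
    (apply_mem_closedBall hφ) w

theorem nonlin_apply (σ : ℝ) {φ : Cone t →ᵇ ℂ} (hφ : ‖φ‖ ≤ 1 / 2) (w : Cone t) :
    nonlin σ φ w = (1 + φ w) ^ ((σ : ℂ) + 1) * (1 + conjComp (coneConj t) φ w) ^ (σ : ℂ) := by
  rw [nonlin, mul_apply, toBCF_one_add_cpow_apply _ hφ,
    toBCF_one_add_cpow_apply _ ((norm_conjComp_le φ).trans hφ)]

theorem contDiffAt_nonlin (σ : ℝ) {φ : Cone t →ᵇ ℂ} (hφ : ‖φ‖ ≤ 1 / 2) :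
    ContDiffAt ℝ 1 (nonlin (t := t) σ) φ := by
  have key : ∀ (c : ℂ) (ψ : Cone t →ᵇ ℂ), ‖ψ‖ ≤ 1 / 2 →
      ContDiffAt ℝ 1 (fun ψ : Cone t →ᵇ ℂ => toBCF fun w => (1 + ψ w) ^ c) ψ := fun c ψ hψ =>
    (contDiffAt_comp_toBCF Metric.isOpen_ball (differentiableOn_one_add_cpow c)
      (isCompact_closedBall 0 (1 / 2)) (Metric.closedBall_subset_ball (by norm_num))
      (apply_mem_closedBall hψ)).restrict_scalars ℝ
  exact (key _ φ hφ).mul ((key _ _ ((norm_conjComp_le φ).trans hφ)).comp φ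
    (conjComp (coneConj t)).contDiff.contDiffAt)

/-- Both estimates are pointwise on the disc of radius 1/2, hence the constant depends neither on
the aperture nor on the base point of the cone. -/
theorem exists_nonlin_bounds (σ : ℝ) : ∃ C : ℝ, 0 < C ∧ ∀ (t : ℝ) (φ ψ : Cone t →ᵇ ℂ), ‖φ‖ ≤ 1 / 2 →
    ‖ψ‖ ≤ 1 / 2 → ‖nonlin σ φ‖ ≤ C ∧ ‖nonlin σ φ - nonlin σ ψ‖ ≤ C * ‖φ - ψ‖ := by
  obtain ⟨C₁, h₁, h₁', h₁''⟩ := exists_one_add_cpow_bounds ((σ : ℂ) + 1)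
  obtain ⟨C₂, h₂, h₂', h₂''⟩ := exists_one_add_cpow_bounds (σ : ℂ)
  refine ⟨2 * (C₁ * C₂), by positivity, fun t φ ψ hφ hψ => ⟨?_, ?_⟩⟩
  · refine (norm_le (by positivity)).2 fun w => ?_
    rw [nonlin_apply σ hφ, norm_mul]
    have e1 := h₁' _ (apply_mem_closedBall hφ w)
    have e2 := h₂' _ (apply_mem_closedBall ((norm_conjComp_le φ).trans hφ) w)
    calc _ ≤ C₁ * C₂ := by gcongr
      _ ≤ _ := by nlinarith [mul_pos h₁ h₂]
  · refine (norm_le (by positivity)).2 fun w => ?_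
    rw [BoundedContinuousFunction.sub_apply, nonlin_apply σ hφ, nonlin_apply σ hψ]
    set φ' := conjComp (coneConj t) φ
    set ψ' := conjComp (coneConj t) ψ
    have hφ' : ‖φ'‖ ≤ 1 / 2 := (norm_conjComp_le φ).trans hφ
    have hψ' : ‖ψ'‖ ≤ 1 / 2 := (norm_conjComp_le ψ).trans hψ
    have d1 : ‖φ w - ψ w‖ ≤ ‖φ - ψ‖ := (φ - ψ).norm_coe_le_norm w
    have d2 : ‖φ' w - ψ' w‖ ≤ ‖φ - ψ‖ := by
      have := (φ' - ψ').norm_coe_le_norm w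
      rw [show φ' - ψ' = conjComp (coneConj t) (φ - ψ) from (map_sub _ _ _).symm] at this
      exact (le_of_eq (by simp [φ', ψ'])).trans (this.trans (norm_conjComp_le _))
    have e1 := h₁'' _ (apply_mem_closedBall hφ w) _ (apply_mem_closedBall hψ w)
    have e2 := h₂'' _ (apply_mem_closedBall hφ' w) _ (apply_mem_closedBall hψ' w)
    have e3 := h₂' _ (apply_mem_closedBall hφ' w)
    have e4 := h₁' _ (apply_mem_closedBall hψ w)
    calc _ = ‖((1 + φ w) ^ ((σ : ℂ) + 1) - (1 + ψ w) ^ ((σ : ℂ) + 1)) * (1 + φ' w) ^ (σ : ℂ)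
          + (1 + ψ w) ^ ((σ : ℂ) + 1) * ((1 + φ' w) ^ (σ : ℂ) - (1 + ψ' w) ^ (σ : ℂ))‖ := by ring_nf
      _ ≤ C₁ * ‖φ - ψ‖ * C₂ + C₁ * (C₂ * ‖φ - ψ‖) := by
          refine (norm_add_le _ _).trans ?_
          rw [norm_mul, norm_mul]
          gcongr
          · exact e1.trans (by gcongr)
          · exact e2.trans (by gcongr)
      _ = _ := by ring

/-! ### The fixed point map -/

/-- `(V k)(w) = ∫₀^∞ k(w + r) X/(X + w + r)² dr`. -/
def tailCLM (t : ℝ) {X : ℝ} (hX : 0 < X) (h1 : (1 : ℂ) ∈ Cone t) : (Cone t →ᵇ ℂ) →L[ℂ] (Cone t →ᵇ ℂ) :=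
  (densityCLM (integral_div_add_sq hX).1).comp
    ((ContinuousLinearMap.mul ℂ (Cone t × ℝ →ᵇ ℂ)
      (toBCF fun p => (((X : ℂ) + (|p.2| : ℝ)) / (X + p.1 + (|p.2| : ℝ))) ^ 2)).comp
      (compCLM (coneShift h1)))

theorem norm_add_div_le (ht : 0 < t) {X : ℝ} (hX : 1 ≤ X) {w : ℂ} (hw : w ∈ Cone t) {s : ℝ} (hs : 0 ≤ s) :
    ‖((X : ℂ) + s) / (X + w + s)‖ ≤ 1 := by
  have h1 := Cone.re_nonneg ht hw
  have h2 := Complex.re_le_norm ((X : ℂ) + w + s)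
  simp only [Complex.add_re, Complex.ofReal_re] at h2
  rw [norm_div, div_le_one (by linarith)]
  have : ((X : ℂ) + s) = ((X + s : ℝ) : ℂ) := by push_cast; rfl
  rw [this, Complex.norm_real, Real.norm_of_nonneg (by linarith)]
  linarith

theorem tailFactor_apply (ht : 0 < t) {X : ℝ} (hX : 1 ≤ X) (p : Cone t × ℝ) :
    (toBCF fun p : Cone t × ℝ => (((X : ℂ) + (|p.2| : ℝ)) / (X + p.1 + (|p.2| : ℝ))) ^ 2) p =
      (((X : ℂ) + (|p.2| : ℝ)) / (X + p.1 + (|p.2| : ℝ))) ^ 2 := by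
  refine toBCF_apply (C := 1) (f := fun p : Cone t × ℝ =>
    (((X : ℂ) + (|p.2| : ℝ)) / (X + p.1 + (|p.2| : ℝ))) ^ 2) ?_ (fun p => ?_) p
  · refine Continuous.pow (Continuous.div (by fun_prop) (by fun_prop) fun p => ?_) 2
    rw [add_assoc]
    exact Cone.add_ne_zero ht hX (Cone.add_mem p.1.2 (Cone.ofReal_mem ht (abs_nonneg _)))
  · rw [norm_pow]
    exact pow_le_one₀ (norm_nonneg _) (norm_add_div_le ht hX p.1.2 (abs_nonneg _))

theorem tailCLM_apply (ht : 0 < t) {X : ℝ} (hX : 1 ≤ X) (h1 : (1 : ℂ) ∈ Cone t) (f : Cone t →ᵇ ℂ)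
    (w : Cone t) : tailCLM t (zero_lt_one.trans_le hX) h1 f w =
      ∫ s in Set.Ioi (0 : ℝ), (X : ℂ) / (X + w + s) ^ 2 * f (coneShift h1 (w, s)) := by
  have hX0 : 0 < X := by linarith
  rw [tailCLM, ContinuousLinearMap.comp_apply, densityCLM_apply _ (by fun_prop)
    (fun s hs => by positivity)]
  refine setIntegral_congr_fun measurableSet_Ioi fun s (hs : 0 < s) => ?_
  simp only [ContinuousLinearMap.comp_apply, ContinuousLinearMap.mul_apply', mul_apply,
    tailFactor_apply ht hX, compCLM_apply, abs_of_pos hs]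
  have e1 : (X : ℂ) + w + s ≠ 0 := by
    rw [add_assoc]
    exact Cone.add_ne_zero ht hX (Cone.add_mem w.2 (Cone.ofReal_mem ht hs.le))
  have e2 : (X : ℂ) + s ≠ 0 := by
    have : X + s ≠ 0 := by positivity
    exact_mod_cast this
  push_cast
  field_simp

theorem norm_tailCLM_le (ht : 0 < t) {X : ℝ} (hX : 1 ≤ X) (h1 : (1 : ℂ) ∈ Cone t) (f : Cone t →ᵇ ℂ) :
    ‖tailCLM t (zero_lt_one.trans_le hX) h1 f‖ ≤ ‖f‖ := by
  have hX0 : 0 < X := by linarith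
  refine (norm_densityCLM_le (integral_div_add_sq hX0).1 (by fun_prop) (fun s hs => by positivity)
    _).trans ?_
  rw [(integral_div_add_sq hX0).2, one_mul]
  refine (norm_le (norm_nonneg _)).2 fun p => ?_
  change ‖(toBCF (fun p : Cone t × ℝ => (((X : ℂ) + (|p.2| : ℝ)) / (X + p.1 + (|p.2| : ℝ))) ^ 2)) p *
    f (coneShift h1 p)‖ ≤ _
  rw [tailFactor_apply ht hX, norm_mul, norm_pow]
  have e1 := norm_add_div_le ht hX p.1.2 (abs_nonneg p.2)
  have e2 := f.norm_coe_le_norm (coneShift h1 p)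
  calc _ ≤ 1 ^ 2 * ‖f‖ := by gcongr
    _ = _ := by simp

theorem zero_mem_cone (t : ℝ) : (0 : ℂ) ∈ Cone t := by simp [Cone]

theorem one_mem_cone (ht : 0 < t) : (1 : ℂ) ∈ Cone t := by simp [Cone]; exact ht.le

/-- `f ↦ f(0) - f`. -/
def tipSub (t : ℝ) : (Cone t →ᵇ ℂ) →L[ℂ] (Cone t →ᵇ ℂ) :=
  (ContinuousLinearMap.smulRight (evalCLM ℂ ⟨0, zero_mem_cone t⟩ : (Cone t →ᵇ ℂ) →L[ℂ] ℂ) 1) - 1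

theorem tipSub_apply (f : Cone t →ᵇ ℂ) (w : Cone t) :
    tipSub t f w = f ⟨0, zero_mem_cone t⟩ - f w := by
  simp [tipSub]

theorem norm_tipSub_le (f : Cone t →ᵇ ℂ) : ‖tipSub t f‖ ≤ 2 * ‖f‖ := by
  refine (norm_le (by positivity)).2 fun w => ?_
  rw [tipSub_apply]
  refine (norm_sub_le _ _).trans ?_
  linarith [f.norm_coe_le_norm ⟨0, zero_mem_cone t⟩, f.norm_coe_le_norm w]

section

variable (ht : 0 < t) {X η : ℝ} (hX : 1 ≤ X) (hη : 0 < η) (σ : ℝ)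

/-- The density `k` in `φ' = ν X x⁻² k`. -/
def profileDensity (Q G : Cone t →ᵇ ℂ) (R : Cone t × ℝ →ᵇ ℂ) (φ : Cone t →ᵇ ℂ) : Cone t →ᵇ ℂ :=
  Q * densityCLM (integrableOn_exp_neg_mul hη) (R * compCLM (coneShift (rayDir_mem ht)) (G * nonlin σ φ))

/-- The map whose fixed point is the correction to the linear profile. -/
def profileMap (ν : ℂ) (Q G : Cone t →ᵇ ℂ) (R : Cone t × ℝ →ᵇ ℂ) (φ : Cone t →ᵇ ℂ) : Cone t →ᵇ ℂ :=
  ν • tipSub t (tailCLM t (zero_lt_one.trans_le hX) (one_mem_cone ht)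
    (profileDensity ht hη σ Q G R φ))

theorem norm_compCLM_le {α γ : Type*} [TopologicalSpace α] [TopologicalSpace γ]
    (φ : C(γ, α)) (f : α →ᵇ ℂ) : ‖compCLM φ f‖ ≤ ‖f‖ :=
  (norm_le (norm_nonneg _)).2 fun _ => f.norm_coe_le_norm _

/-- Stated for an arbitrary f in place of the nonlinearity: by linearity the same bound gives the
size of the map and its Lipschitz constant. -/
theorem norm_profile_aux (ν : ℂ) (Q G : Cone t →ᵇ ℂ) (R : Cone t × ℝ →ᵇ ℂ) (f : Cone t →ᵇ ℂ) :
    ‖ν • tipSub t (tailCLM t (zero_lt_one.trans_le hX) (one_mem_cone ht)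
      (Q * densityCLM (integrableOn_exp_neg_mul hη)
        (R * compCLM (coneShift (rayDir_mem ht)) (G * f))))‖
      ≤ ‖ν‖ * (2 * (‖Q‖ * (η⁻¹ * (‖R‖ * (‖G‖ * ‖f‖))))) := by
  rw [norm_smul]
  gcongr
  refine (norm_tipSub_le _).trans ?_
  gcongr
  refine (norm_tailCLM_le ht hX _ _).trans ((norm_mul_le _ _).trans ?_)
  gcongr
  refine (norm_densityCLM_le (integrableOn_exp_neg_mul hη) (by fun_prop) (fun s hs => by positivity)
    _).trans ?_
  rw [integral_exp_neg_mul hη]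
  gcongr
  refine (norm_mul_le _ _).trans ?_
  gcongr
  exact (norm_compCLM_le _ _).trans (norm_mul_le _ _)

theorem norm_profileMap_le (ν : ℂ) (Q G : Cone t →ᵇ ℂ) (R : Cone t × ℝ →ᵇ ℂ) (φ : Cone t →ᵇ ℂ) :
    ‖profileMap ht hX hη σ ν Q G R φ‖ ≤ ‖ν‖ * (2 * (‖Q‖ * (η⁻¹ * (‖R‖ * (‖G‖ * ‖nonlin σ φ‖))))) :=
  norm_profile_aux ht hX hη ν Q G R _

theorem norm_profileMap_sub_le (ν : ℂ) (Q G : Cone t →ᵇ ℂ) (R : Cone t × ℝ →ᵇ ℂ) (φ ψ : Cone t →ᵇ ℂ) :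
    ‖profileMap ht hX hη σ ν Q G R φ - profileMap ht hX hη σ ν Q G R ψ‖
      ≤ ‖ν‖ * (2 * (‖Q‖ * (η⁻¹ * (‖R‖ * (‖G‖ * ‖nonlin σ φ - nonlin σ ψ‖))))) := by
  have := norm_profile_aux ht hX hη ν Q G R (nonlin σ φ - nonlin σ ψ)
  rw [mul_sub, map_sub, mul_sub, map_sub, mul_sub, map_sub, map_sub, smul_sub] at this
  exact this

theorem contDiffAt_profileDensity {E : Type*} [NormedAddCommGroup E] [NormedSpace ℝ E]
    {Q G φ : E → Cone t →ᵇ ℂ} {R : E → Cone t × ℝ →ᵇ ℂ} {e : E} {s : Set E}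
    (hQ : ContDiffWithinAt ℝ 1 Q s e) (hG : ContDiffWithinAt ℝ 1 G s e)
    (hR : ContDiffWithinAt ℝ 1 R s e) (hφ : ContDiffWithinAt ℝ 1 φ s e) (hφe : ‖φ e‖ ≤ 1 / 2) :
    ContDiffWithinAt ℝ 1 (fun e => profileDensity ht hη σ (Q e) (G e) (R e) (φ e)) s e := by
  unfold profileDensity
  refine hQ.mul (((densityCLM (α := Cone t) (integrableOn_exp_neg_mul hη)).restrictScalars
    ℝ).contDiff.comp_contDiffWithinAt (hR.mul
    (((compCLM (coneShift (rayDir_mem ht))).restrictScalars ℝ).contDiff.comp_contDiffWithinAt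
      (hG.mul ((contDiffAt_nonlin σ hφe).comp_contDiffWithinAt e hφ)))))

theorem contDiffAt_profileMap {E : Type*} [NormedAddCommGroup E] [NormedSpace ℝ E] {ν : E → ℂ}
    {Q G φ : E → Cone t →ᵇ ℂ} {R : E → Cone t × ℝ →ᵇ ℂ} {e : E} {s : Set E}
    (hν : ContDiffWithinAt ℝ 1 ν s e)
    (hQ : ContDiffWithinAt ℝ 1 Q s e) (hG : ContDiffWithinAt ℝ 1 G s e)
    (hR : ContDiffWithinAt ℝ 1 R s e) (hφ : ContDiffWithinAt ℝ 1 φ s e) (hφe : ‖φ e‖ ≤ 1 / 2) :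
    ContDiffWithinAt ℝ 1 (fun e => profileMap ht hX hη σ (ν e) (Q e) (G e) (R e) (φ e)) s e := by
  unfold profileMap
  exact hν.smul (((tipSub t).restrictScalars ℝ).contDiff.comp_contDiffWithinAt
    (((tailCLM t (zero_lt_one.trans_le hX) (one_mem_cone ht)).restrictScalars
      ℝ).contDiff.comp_contDiffWithinAt (contDiffAt_profileDensity ht hη σ hQ hG hR hφ hφe)))

end

end

section

open BoundedContinuousFunction MeasureTheory

/-! ### Integrals along rays -/

/-- Differentiate under the integral and integrate by parts along the ray: d/ds of e^{-μcs} N(x +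
sc) equals the differentiated integrand minus μ times the original one. The case μ = 0, c = 1 gives
the derivative of a tail integral. -/
theorem hasDerivAt_rayIntegral {μ c : ℂ} (hc : c ≠ 0) {N : ℂ → ℂ} {D V : Set ℂ} (hD : IsOpen D)
    (hV : IsOpen V) (hN : DifferentiableOn ℂ N D)
    (hVD : ∀ x ∈ V, ∀ s : ℝ, 0 ≤ s → x + s * c ∈ D) {bound : ℝ → ℝ}
    (hint : IntegrableOn bound (Set.Ioi 0))
    (hb : ∀ x ∈ V, ∀ s : ℝ, 0 < s → ‖c * Complex.exp (-(μ * c) * s) * N (x + s * c)‖ ≤ bound s)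
    {x : ℂ} (hx : x ∈ V) :
    HasDerivAt (fun x => ∫ s in Set.Ioi (0 : ℝ), c * Complex.exp (-(μ * c) * s) * N (x + s * c))
      (μ * (∫ s in Set.Ioi (0 : ℝ), c * Complex.exp (-(μ * c) * s) * N (x + s * c)) - N x) x := by
  have hcont : ∀ x ∈ V, ContinuousOn (fun s : ℝ => c * Complex.exp (-(μ * c) * s) * N (x + s * c))
      (Set.Ioi 0) := fun x hx => by
    refine ContinuousOn.mul (by fun_prop) (hN.continuousOn.comp (by fun_prop) fun s hs => ?_)
    exact hVD x hx s (le_of_lt hs)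
  have hND : ∀ x ∈ V, ∀ s : ℝ, 0 ≤ s → HasDerivAt N (deriv N (x + s * c)) (x + s * c) :=
    fun x hx s hs => (hN.differentiableAt (hD.mem_nhds (hVD x hx s hs))).hasDerivAt
  have hder : ∀ x ∈ V, ∀ s : ℝ, 0 ≤ s →
      HasDerivAt (fun x => c * Complex.exp (-(μ * c) * s) * N (x + s * c))
        (c * Complex.exp (-(μ * c) * s) * deriv N (x + s * c)) x := fun x hx s hs =>
    ((hND x hx s hs).comp_add_const x _).const_mul _
  have key := hasDerivAt_integral_of_differentiableOn (ρ := volume.restrict (Set.Ioi 0)) hV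
    (f := fun x (s : ℝ) => c * Complex.exp (-(μ * c) * s) * N (x + s * c)) (bound := bound)
    (fun z hz => (hcont z hz).aestronglyMeasurable measurableSet_Ioi)
    ((ae_restrict_mem measurableSet_Ioi).mono fun s hs z hz =>
      (hder z hz s (le_of_lt hs)).differentiableAt.differentiableWithinAt)
    ((ae_restrict_mem measurableSet_Ioi).mono fun s hs z hz => hb z hz s hs) hint hx
  have e1 : ∀ s ∈ Set.Ioi (0 : ℝ), deriv (fun x => c * Complex.exp (-(μ * c) * s) * N (x + s * c)) x
      = c * Complex.exp (-(μ * c) * s) * deriv N (x + s * c) := fun s hs => (hder x hx s (le_of_lt hs)).deriv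
  have hI0 : IntegrableOn (fun s : ℝ => c * Complex.exp (-(μ * c) * s) * N (x + s * c)) (Set.Ioi 0) :=
    hint.mono' ((hcont x hx).aestronglyMeasurable measurableSet_Ioi)
      ((ae_restrict_mem measurableSet_Ioi).mono fun s hs => hb x hx s hs)
  have hI1 : IntegrableOn (fun s : ℝ => c * Complex.exp (-(μ * c) * s) * deriv N (x + s * c))
      (Set.Ioi 0) := IntegrableOn.congr_fun key.1 e1 measurableSet_Ioi
  have hψ : ∀ s ∈ Set.Ici (0 : ℝ), HasDerivAt (fun s : ℝ => Complex.exp (-(μ * c) * s) * N (x + s * c))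
      (c * Complex.exp (-(μ * c) * s) * deriv N (x + s * c)
        - μ * (c * Complex.exp (-(μ * c) * s) * N (x + s * c))) s := by
    intro s hs
    have h1 : HasDerivAt (fun s : ℝ => Complex.exp (-(μ * c) * s))
        (Complex.exp (-(μ * c) * s) * (-(μ * c))) s := by
      have := (((hasDerivAt_id (s : ℂ)).const_mul (-(μ * c))).cexp).comp_ofReal
      simpa using this
    have h2 : HasDerivAt (fun s : ℝ => N (x + s * c)) (deriv N (x + s * c) * c) s := by
      have h3 : HasDerivAt (fun z : ℂ => x + z * c) c (s : ℂ) := by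
        simpa using ((hasDerivAt_id (s : ℂ)).mul_const c).const_add x
      exact (HasDerivAt.comp (s : ℂ) (hND x hx s hs) h3).comp_ofReal
    convert! h1.mul h2 using 1
    ring
  have hψint : IntegrableOn (fun s : ℝ => Complex.exp (-(μ * c) * s) * N (x + s * c)) (Set.Ioi 0) := by
    refine IntegrableOn.congr_fun (hI0.const_mul c⁻¹) (fun s _ => ?_) measurableSet_Ioi
    field_simp
  have hψ'int := hI1.sub (hI0.const_mul μ)
  -- No decay of N is assumed: a function that is integrable together with its derivative tends to 0
  -- at infinity.
  have hlim := tendsto_zero_of_hasDerivAt_of_integrableOn_Ioi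
    (fun s hs => hψ s (Set.mem_Ici_of_Ioi hs)) hψ'int hψint
  have hFTC := integral_Ioi_of_hasDerivAt_of_tendsto' hψ hψ'int hlim
  rw [integral_sub hI1 (hI0.const_mul μ), integral_const_mul] at hFTC
  convert! key.2 using 1
  rw [setIntegral_congr_fun measurableSet_Ioi e1]
  simp only [Complex.ofReal_zero, zero_mul, mul_zero, add_zero, Complex.exp_zero, one_mul,
    zero_sub] at hFTC
  linear_combination -hFTC

/-! ### Functions on a cone as functions on a sector of the plane -/

variable {t X : ℝ}

/-- The function on `X + Cone t` (extended by zero) defined by a function on `Cone t`. -/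
def ext (X : ℝ) (f : Cone t →ᵇ ℂ) (x : ℂ) : ℂ :=
  open scoped Classical in if h : x - X ∈ Cone t then f ⟨x - X, h⟩ else 0

/-- The open cone with tip `X`. -/
def OpenCone (t X : ℝ) : Set ℂ := {x | |x.im| < t * (x.re - X)}

theorem isOpen_openCone : IsOpen (OpenCone t X) := isOpen_lt (by fun_prop) (by fun_prop)

theorem sub_mem_cone {x : ℂ} (hx : x ∈ OpenCone t X) : x - X ∈ Cone t := by
  have : |x.im| < t * (x.re - X) := hx
  simpa [Cone] using this.le

theorem OpenCone.add_mem {x v : ℂ} (hx : x ∈ OpenCone t X) (hv : v ∈ Cone t) :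
    x + v ∈ OpenCone t X := by
  have h1 : |x.im| < t * (x.re - X) := hx
  have h2 : |v.im| ≤ t * v.re := hv
  change |(x + v).im| < t * ((x + v).re - X)
  rw [Complex.add_im, Complex.add_re]
  linarith [abs_add_le x.im v.im]

theorem OpenCone.star_mem {x : ℂ} (hx : x ∈ OpenCone t X) : (starRingEnd ℂ) x ∈ OpenCone t X := by
  simpa [OpenCone] using hx

theorem OpenCone.lt_re (ht : 0 < t) {x : ℂ} (hx : x ∈ OpenCone t X) : X < x.re := by
  have h1 : |x.im| < t * (x.re - X) := hx
  have := pos_of_mul_pos_right ((abs_nonneg _).trans_lt h1) ht.le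
  linarith

theorem OpenCone.ofReal_mem (ht : 0 < t) {r : ℝ} (hr : X < r) : (r : ℂ) ∈ OpenCone t X := by
  have : 0 < r - X := by linarith
  simp [OpenCone]
  positivity

theorem OpenCone.ne_zero (ht : 0 < t) (hX : 1 ≤ X) {x : ℂ} (hx : x ∈ OpenCone t X) : x ≠ 0 := by
  rintro rfl
  have := OpenCone.lt_re ht hx
  simp at this
  linarith

theorem OpenCone.mem_slitPlane (ht : 0 < t) (hX : 1 ≤ X) {x : ℂ} (hx : x ∈ OpenCone t X) :
    x ∈ Complex.slitPlane := Or.inl (by have := OpenCone.lt_re ht hx; linarith)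

theorem ext_of_mem (f : Cone t →ᵇ ℂ) {x : ℂ} (hx : x ∈ OpenCone t X) :
    ext X f x = f ⟨x - X, sub_mem_cone hx⟩ := dif_pos _

theorem ext_mul (f g : Cone t →ᵇ ℂ) (x : ℂ) : ext X (f * g) x = ext X f x * ext X g x := by
  unfold ext; split_ifs <;> simp

theorem ext_smul (c : ℂ) (f : Cone t →ᵇ ℂ) (x : ℂ) : ext X (c • f) x = c * ext X f x := by
  unfold ext; split_ifs <;> simp

theorem norm_ext_le (f : Cone t →ᵇ ℂ) (x : ℂ) : ‖ext X f x‖ ≤ ‖f‖ := by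
  unfold ext
  split_ifs
  · exact f.norm_coe_le_norm _
  · simp

theorem ext_sub (f g : Cone t →ᵇ ℂ) (x : ℂ) : ext X (f - g) x = ext X f x - ext X g x := by
  unfold ext; split_ifs <;> simp

theorem ext_conjComp (f : Cone t →ᵇ ℂ) {x : ℂ} (hx : x ∈ OpenCone t X) :
    ext X (conjComp (coneConj t) f) x = (starRingEnd ℂ) (ext X f ((starRingEnd ℂ) x)) := by
  rw [ext_of_mem _ hx, ext_of_mem _ (OpenCone.star_mem hx), conjComp_apply]
  congr 2
  exact Subtype.ext (by simp [coneConj])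

/-- Holomorphy in the interior of the cone. -/
def Holo (X : ℝ) (f : Cone t →ᵇ ℂ) : Prop := DifferentiableOn ℂ (ext X f) (OpenCone t X)

theorem Holo.mul {f g : Cone t →ᵇ ℂ} (hf : Holo X f) (hg : Holo X g) : Holo X (f * g) := by
  unfold Holo
  simp only [funext (ext_mul f g)]
  exact DifferentiableOn.mul hf hg

theorem Holo.conj {f : Cone t →ᵇ ℂ} (hf : Holo X f) : Holo X (conjComp (coneConj t) f) := by
  intro x hx
  have h1 : DifferentiableAt ℂ (ext X f) ((starRingEnd ℂ) x) :=
    hf.differentiableAt (isOpen_openCone.mem_nhds (OpenCone.star_mem hx))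
  have h2 := h1.conj_conj
  rw [Complex.conj_conj] at h2
  refine (h2.congr_of_eventuallyEq ?_).differentiableWithinAt
  filter_upwards [isOpen_openCone.mem_nhds hx] with z hz
  exact ext_conjComp f hz

/-- Weierstrass' theorem on uniform limits; it allows the contraction principle to be run inside the
holomorphic functions. -/
theorem isClosed_holo : IsClosed {f : Cone t →ᵇ ℂ | Holo X f} := by
  refine isClosed_of_closure_subset fun f hf => ?_
  obtain ⟨u, hu, hlim⟩ := mem_closure_iff_seq_limit.1 hf
  refine TendstoLocallyUniformlyOn.differentiableOn (φ := atTop) (F := fun n => ext X (u n)) ?_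
    (Eventually.of_forall hu) isOpen_openCone
  refine TendstoUniformlyOn.tendstoLocallyUniformlyOn ?_
  refine Metric.tendstoUniformlyOn_iff.2 fun ε hε => ?_
  filter_upwards [Metric.tendsto_nhds.1 hlim ε hε] with n hn x hx
  rw [dist_eq_norm, ← ext_sub]
  refine (norm_ext_le _ _).trans_lt ?_
  rwa [← dist_eq_norm, dist_comm]

theorem hasDerivAt_tailCLM (ht : 0 < t) (hX : 1 ≤ X) {f : Cone t →ᵇ ℂ} (hf : Holo X f) {x : ℂ}
    (hx : x ∈ OpenCone t X) :
    HasDerivAt (ext X (tailCLM t (zero_lt_one.trans_le hX) (one_mem_cone ht) f))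
      (-(X * (x ^ 2)⁻¹ * ext X f x)) x := by
  have hX0 : 0 < X := by linarith
  have hmem : ∀ z ∈ OpenCone t X, ∀ s : ℝ, 0 ≤ s → z + s * 1 ∈ OpenCone t X := fun z hz s hs =>
    OpenCone.add_mem hz (Cone.smul_mem (one_mem_cone ht) hs)
  have h1 := hasDerivAt_rayIntegral (μ := 0) (c := 1) one_ne_zero
    (N := fun x => X * (x ^ 2)⁻¹ * ext X f x) (D := OpenCone t X) (V := OpenCone t X)
    isOpen_openCone isOpen_openCone (fun z hz => ?_) hmem
    (bound := fun s => X / (X + s) ^ 2 * ‖f‖) ((integral_div_add_sq hX0).1.mul_const _)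
    (fun z hz s hs => ?_) hx
  · convert! h1.congr_of_eventuallyEq ?_ using 1
    · simp
    · filter_upwards [isOpen_openCone.mem_nhds hx] with z hz
      rw [ext_of_mem _ hz, tailCLM_apply ht hX]
      refine setIntegral_congr_fun measurableSet_Ioi fun s (hs : 0 < s) => ?_
      rw [ext_of_mem _ (hmem z hz s hs.le)]
      simp only [zero_mul, neg_zero, Complex.exp_zero, mul_one, one_mul, div_eq_mul_inv]
      congr 2
      · ring
      · exact Subtype.ext (by simp [coneShift, abs_of_pos hs]; ring)
  · have hz0 : z ^ 2 ≠ 0 := pow_ne_zero _ (OpenCone.ne_zero ht hX hz)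
    exact (((differentiableAt_id.pow 2).inv hz0).const_mul (X : ℂ)).differentiableWithinAt.mul (hf z hz)
  · have hz' := (hmem z hz s hs.le)
    have h2 : X + s ≤ ‖z + s‖ := by
      have := Complex.re_le_norm (z + s)
      have h3 := OpenCone.lt_re ht hz
      simp at this
      linarith
    simp only [zero_mul, neg_zero, Complex.exp_zero, mul_one, one_mul, norm_mul, norm_inv, norm_pow,
      Complex.norm_real, Real.norm_of_nonneg hX0.le, div_eq_mul_inv]
    gcongr
    exact norm_ext_le _ _

/-- Both x and x(1 + u) lie in the right half-plane, so their arguments differ by less than π and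
the principal logarithm is additive. -/
theorem cpow_mul_one_add {x u : ℂ} (hx : 0 < x.re) (hxu : 0 < (x * (1 + u)).re) (p : ℂ) :
    x ^ p * (1 + u) ^ p = (x * (1 + u)) ^ p := by
  have hx0 : x ≠ 0 := fun h => by simp [h] at hx
  have hu0 : 1 + u ≠ 0 := fun h => by simp [h] at hxu
  have h2 := Complex.abs_arg_lt_pi_div_two_iff.2 (Or.inl hx)
  have h3 := Complex.abs_arg_lt_pi_div_two_iff.2 (Or.inl hxu)
  rw [abs_lt] at h2 h3
  have hlog : Complex.log (x * (1 + u)) - Complex.log x = Complex.log (1 + u) := by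
    have e1 : Complex.exp (Complex.log (x * (1 + u)) - Complex.log x) = 1 + u := by
      rw [Complex.exp_sub, Complex.exp_log (mul_ne_zero hx0 hu0), Complex.exp_log hx0]
      field_simp
    refine (Complex.log_exp ?_ ?_).symm.trans (congrArg Complex.log e1) <;>
    · rw [Complex.sub_im, Complex.log_im, Complex.log_im]; linarith
  rw [Complex.cpow_def_of_ne_zero hx0, Complex.cpow_def_of_ne_zero hu0,
    Complex.cpow_def_of_ne_zero (mul_ne_zero hx0 hu0), ← hlog, ← Complex.exp_add]
  ring_nf

/-- Multiplication by the integrating factor z^{A-2} turns the kernel into a pure exponential ray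
integral, whose equation is `hasDerivAt_rayIntegral`; dividing the factor out again produces the
term (A-2)/x. -/
theorem hasDerivAt_resolvent (ht : 0 < t) (ht' : t ≤ 1 / 2) (hX : 1 ≤ X) {η : ℝ} (hη : 0 < η)
    {A μ : ℂ} (hμ : 2 * η ≤ (μ * rayDir t).re) {M : Cone t →ᵇ ℂ} (hM : Holo X M) {x : ℂ}
    (hx : x ∈ OpenCone t X) :
    HasDerivAt (ext X (densityCLM (integrableOn_exp_neg_mul hη) (resolventBCF t X η (rayDir t) (A, μ) *
      compCLM (coneShift (rayDir_mem ht)) M)))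
      ((μ - (A - 2) / x) * ext X (densityCLM (integrableOn_exp_neg_mul hη)
        (resolventBCF t X η (rayDir t) (A, μ) * compCLM (coneShift (rayDir_mem ht)) M)) x
        - ext X M x) x := by
  set c := rayDir t with hc
  have hcC : c ∈ Cone t := rayDir_mem ht
  have hc0 : c ≠ 0 := fun h => by
    have := congrArg Complex.re h
    simp [hc, rayDir] at this
  set W := densityCLM (integrableOn_exp_neg_mul hη) (resolventBCF t X η c (A, μ) *
      compCLM (coneShift (rayDir_mem ht)) M) with hW
  have hmem : ∀ z ∈ OpenCone t X, ∀ s : ℝ, 0 ≤ s → z + s * c ∈ OpenCone t X := fun z hz s hs =>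
    OpenCone.add_mem hz (Cone.smul_mem hcC hs)
  have hzdiff : ∀ p : ℂ, ∀ z ∈ OpenCone t X, HasDerivAt (fun z : ℂ => z ^ p) (p * z ^ (p - 1)) z :=
    fun p z hz => by simpa using (hasDerivAt_id z).cpow_const (c := p) (OpenCone.mem_slitPlane ht hX hz)
  have hprod : ∀ z ∈ OpenCone t X, ∀ s : ℝ, 0 ≤ s →
      (z + s * c) ^ (A - 2) = z ^ (A - 2) * (1 + s * (c / z)) ^ (A - 2) := fun z hz s hs => by
    have hz0 := OpenCone.ne_zero ht hX hz
    have e1 : z * (1 + s * (c / z)) = z + s * c := by field_simp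
    rw [cpow_mul_one_add (by have := OpenCone.lt_re ht hz; linarith)
      (by rw [e1]; have := OpenCone.lt_re ht (hmem z hz s hs); linarith), e1]
  have hWz : ∀ z ∈ OpenCone t X, z ^ (A - 2) * ext X W z =
      ∫ s in Set.Ioi (0 : ℝ), c * Complex.exp (-(μ * c) * s) * ((z + s * c) ^ (A - 2) *
        ext X M (z + s * c)) := fun z hz => by
    rw [ext_of_mem _ hz, hW, densityCLM_apply _ (by fun_prop) (fun s _ => by positivity),
      ← integral_const_mul]
    refine setIntegral_congr_fun measurableSet_Ioi fun s (hs : 0 < s) => ?_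
    simp only [mul_apply, compCLM_apply]
    rw [resolventBCF_apply ht ht' hX hη hμ, ext_of_mem _ (hmem z hz s hs.le), hprod z hz s hs.le]
    simp only [resolventKernel, abs_of_pos hs]
    have e2 : (X : ℂ) + (z - X) = z := by ring
    have e3 : coneShift (rayDir_mem ht) (⟨z - X, sub_mem_cone hz⟩, s)
        = ⟨z + s * c - X, sub_mem_cone (hmem z hz s hs.le)⟩ :=
      Subtype.ext (by simp [coneShift, abs_of_pos hs]; ring)
    have e4 : Complex.exp (-(μ * c) * s) =
        (Real.exp (-(η * s)) : ℂ) * Complex.exp ((η - μ * c) * s) := by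
      rw [Complex.ofReal_exp, ← Complex.exp_add]
      congr 1
      push_cast
      ring
    rw [e2, e3, e4]
    ring
  set B := ‖x ^ (A - 2)‖ + 1 with hB
  -- Domination is needed only near x, where the integrating factor is bounded by B; over the whole
  -- cone it may be unbounded.
  set V : Set ℂ := OpenCone t X ∩ (fun z : ℂ => z ^ (A - 2)) ⁻¹' Metric.ball 0 B with hVdef
  have hVo : IsOpen V := by
    refine ContinuousOn.isOpen_inter_preimage (fun z hz => ?_) isOpen_openCone Metric.isOpen_ball
    exact (hzdiff _ z hz).continuousAt.continuousWithinAt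
  have hxV : x ∈ V := ⟨hx, by simp [hB]⟩
  have h1 := hasDerivAt_rayIntegral (μ := μ) (c := c) hc0
    (N := fun z => z ^ (A - 2) * ext X M z) (D := OpenCone t X) (V := V)
    isOpen_openCone hVo (fun z hz => ?_) (fun z hz => hmem z hz.1)
    (bound := fun s => Real.exp (-(η * s)) * (B * resolventConst (‖A - 2‖ + 1) η * ‖M‖))
    ((integrableOn_exp_neg_mul hη).mul_const _) (fun z hz s hs => ?_) hxV
  · have h2 : HasDerivAt (fun z => z ^ (A - 2) * ext X W z)
        (μ * (x ^ (A - 2) * ext X W x) - x ^ (A - 2) * ext X M x) x := by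
      rw [hWz x hx]
      refine h1.congr_of_eventuallyEq ?_
      filter_upwards [isOpen_openCone.mem_nhds hx] with z hz using hWz z hz
    have h3 := (hzdiff (2 - A) x hx).mul h2
    have hcan : ∀ z ∈ OpenCone t X, z ^ (2 - A) * z ^ (A - 2) = 1 := fun z hz => by
      rw [← Complex.cpow_add _ _ (OpenCone.ne_zero ht hX hz)]
      ring_nf
      exact Complex.cpow_zero _
    have h4 := h3.congr_of_eventuallyEq (f₁ := ext X W) (by
      filter_upwards [isOpen_openCone.mem_nhds hx] with z hz
      simp only [Pi.mul_apply]
      rw [← mul_assoc, hcan z hz, one_mul])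
    convert! h4 using 1
    have hx0 := OpenCone.ne_zero ht hX hx
    have e5 : x ^ (2 - A - 1) = x ^ (2 - A) * x⁻¹ := by
      rw [cpow_eq_cpow_sub_one_mul hx0 (2 - A)]; field_simp
    rw [e5]
    have := hcan x hx
    linear_combination (-((μ - (A - 2) / x) * ext X W x - ext X M x)) * this
  · exact ((hzdiff _ z hz).differentiableAt.differentiableWithinAt).mul (hM z hz)
  · have hz1 : ‖z ^ (A - 2)‖ ≤ B := by simpa using (Metric.mem_ball.1 hz.2).le
    have h2 := norm_resolventKernel_le ht ht' hX hη (p := (A, μ)) (by simp only; linarith)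
      (N := ‖A - 2‖ + 1) (by positivity) (by simp) (sub_mem_cone hz.1) s
    have e2 : (X : ℂ) + (z - X) = z := by ring
    rw [hprod z hz.1 s hs.le]
    rw [resolventKernel, e2, abs_of_pos hs, ← hc] at h2
    simp only at h2
    have e4 : Complex.exp (-(μ * c) * s) =
        (Real.exp (-(η * s)) : ℂ) * Complex.exp ((η - μ * c) * s) := by
      rw [Complex.ofReal_exp, ← Complex.exp_add]
      congr 1
      push_cast
      ring
    calc ‖c * Complex.exp (-(μ * c) * s) * (z ^ (A - 2) * (1 + s * (c / z)) ^ (A - 2) *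
          ext X M (z + s * c))‖
        = Real.exp (-(η * s)) * (‖z ^ (A - 2)‖ * ‖c * Complex.exp ((η - μ * c) * s) *
          (1 + s * (c / z)) ^ (A - 2)‖ * ‖ext X M (z + s * c)‖) := by
          rw [e4]
          simp only [norm_mul, Complex.norm_real, Real.norm_eq_abs, Real.abs_exp]
          ring
      _ ≤ _ := by
          have hpos : 0 ≤ resolventConst (‖A - 2‖ + 1) η := by rw [resolventConst]; positivity
          gcongr
          exact norm_ext_le _ _

end

section

open BoundedContinuousFunction MeasureTheory

/-! ### The parameters -/

/-- The parameters `(β, κ, ω, ε, δ)`. -/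
abbrev Param := ℂ × ℝ × ℝ × ℝ × ℝ

/-- The parameter `a` of the Kummer function. -/
def paramA (σ : ℝ) (p : Param) : ℂ := 1 / 2 * (1 / (σ : ℂ) + Complex.I * p.2.2.1 / p.2.1)

/-- The factor `ν` in `1/z = ν/x`. -/
def paramV (p : Param) : ℂ := 2 * (p.2.2.2.1 + Complex.I) / p.2.1

/-- The factor `μ` in `z = μ x`. -/
def paramMu (p : Param) : ℂ := -Complex.I * p.2.1 / (2 * (1 - Complex.I * p.2.2.2.1))

/-- The coefficient of the nonlinearity. -/
def paramL (p : Param) : ℂ := (1 + Complex.I * p.2.2.2.2) / (4 * (1 - Complex.I * p.2.2.2.1))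

theorem one_sub_I_mul_ne_zero (ε : ℝ) : (1 : ℂ) - Complex.I * ε ≠ 0 := fun h => by
  have := congrArg Complex.re h
  simp at this

theorem paramMu_mul_paramV {p : Param} (hκ : 0 < p.2.1) : paramMu p * paramV p = 1 := by
  have h1 := one_sub_I_mul_ne_zero p.2.2.2.1
  have h2 : (p.2.1 : ℂ) ≠ 0 := by exact_mod_cast hκ.ne'
  rw [paramMu, paramV]
  field_simp
  linear_combination -Complex.I_sq

/-- Uniform control of the linear profile at the parameter `p`. -/
structure Controlled (d : ℕ) (σ t η c C N : ℝ) (p : Param) : Prop where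
  kappa_pos : 0 < p.2.1
  eps_nonneg : 0 ≤ p.2.2.2.1
  kummer : ∀ x : ℂ, 1 ≤ x.re → |x.im| ≤ t * x.re →
    c ≤ (kummerJ (paramA σ p) ((d : ℂ) / 2 - paramA σ p - 1) (paramV p / x) *
      (starRingEnd ℂ) (kummerJ (paramA σ p) ((d : ℂ) / 2 - paramA σ p - 1)
        (paramV p / (starRingEnd ℂ) x))).re ∧
    ‖kummerJ (paramA σ p) ((d : ℂ) / 2 - paramA σ p - 1) (paramV p / x)‖ ≤ C
  mu : 2 * η ≤ (paramMu p * rayDir t).re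
  normA : ‖(d : ℂ) / 2 - 2 * paramA σ p - 2‖ ≤ N
  normL : ‖paramL p‖ ≤ N

/-- Constants for the cone and the estimates of the linear profile. -/
structure Constants (t η c C N : ℝ) : Prop where
  t_pos : 0 < t
  t_le : t ≤ 1 / 2
  eta_pos : 0 < η
  c_pos : 0 < c
  C_pos : 0 < C
  N_pos : 0 < N

theorem continuousOn_paramA (σ : ℝ) : ContinuousOn (paramA σ) {p | 0 < p.2.1} := by
  unfold paramA
  refine ContinuousOn.mul (by fun_prop) (ContinuousOn.add (by fun_prop)
    (ContinuousOn.div (by fun_prop) (by fun_prop) fun p (hp : 0 < p.2.1) => ?_))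
  exact_mod_cast hp.ne'

theorem continuousOn_paramV : ContinuousOn paramV {p | 0 < p.2.1} := by
  unfold paramV
  refine ContinuousOn.div (by fun_prop) (by fun_prop) fun p (hp : 0 < p.2.1) => ?_
  exact_mod_cast hp.ne'

theorem continuous_paramL : Continuous paramL := by
  unfold paramL
  exact Continuous.div (by fun_prop) (by fun_prop) fun p =>
    mul_ne_zero (by norm_num) (one_sub_I_mul_ne_zero _)

theorem re_paramA {σ : ℝ} (p : Param) : (paramA σ p).re = 1 / (2 * σ) := by
  have h : paramA σ p = ((1 / (2 * σ) : ℝ) : ℂ) + ((p.2.2.1 / p.2.1 / 2 : ℝ) : ℂ) * Complex.I := by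
    rw [paramA]; push_cast; ring
  rw [h]; simp

theorem paramV_eq (p : Param) :
    paramV p = ((2 * p.2.2.2.1 / p.2.1 : ℝ) : ℂ) + ((2 / p.2.1 : ℝ) : ℂ) * Complex.I := by
  rw [paramV]; push_cast; ring

theorem re_paramV (p : Param) : (paramV p).re = 2 * p.2.2.2.1 / p.2.1 := by
  rw [paramV_eq]; simp

theorem im_paramV (p : Param) : (paramV p).im = 2 / p.2.1 := by
  rw [paramV_eq]; simp

/-- At ε = 0 the real part of μ is 0. Tilting the direction to 1 + it adds t to ε in the numerator,
so the decay rate stays positive uniformly on the parameter box. -/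
theorem re_paramMu_mul (t : ℝ) (p : Param) :
    (paramMu p * rayDir t).re = p.2.1 * (p.2.2.2.1 + t) / (2 * (1 + p.2.2.2.1 ^ 2)) := by
  have h1 := one_sub_I_mul_ne_zero p.2.2.2.1
  have h2 : (1 : ℂ) + p.2.2.2.1 ^ 2 ≠ 0 := by
    have : (1 : ℝ) + p.2.2.2.1 ^ 2 ≠ 0 := by positivity
    exact_mod_cast this
  have h : paramMu p * rayDir t = ((p.2.1 * (p.2.2.2.1 + t) / (2 * (1 + p.2.2.2.1 ^ 2)) : ℝ) : ℂ)
      + ((p.2.1 * (p.2.2.2.1 * t - 1) / (2 * (1 + p.2.2.2.1 ^ 2)) : ℝ) : ℂ) * Complex.I := by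
    have h3 : rayDir t = 1 + t * Complex.I := by apply Complex.ext <;> simp [rayDir]
    rw [paramMu, h3]
    push_cast
    field_simp
    ring_nf
    simp only [Complex.I_sq]
    ring
  rw [h, Complex.add_re, Complex.re_ofReal_mul, Complex.I_re, mul_zero, add_zero, Complex.ofReal_re]

theorem exists_constants {d : ℕ} (hd₁ : 1 ≤ d) (hd₃ : d ≤ 3) {σ : ℝ} (hσ : 0 < σ)
    {κ₁ κ₂ ω₁ ω₂ ε₁ δ₁ δ₂ : ℝ} (hκ₁ : 0 < κ₁) (hκ : κ₁ < κ₂) (hω : ω₁ < ω₂)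
    (hε : 0 < ε₁) (hδ : δ₁ < δ₂) :
    ∃ t η c C N : ℝ, Constants t η c C N ∧ ∀ p : Param,
      p.2 ∈ Set.Icc κ₁ κ₂ ×ˢ Set.Icc ω₁ ω₂ ×ˢ Set.Icc 0 ε₁ ×ˢ Set.Icc δ₁ δ₂ →
      Controlled d σ t η c C N p := by
  -- The linear profile and the coefficients do not involve β, so this coordinate is frozen at 0 for
  -- the compactness argument.
  set S : Set Param :=
    {(0 : ℂ)} ×ˢ Set.Icc κ₁ κ₂ ×ˢ Set.Icc ω₁ ω₂ ×ˢ Set.Icc 0 ε₁ ×ˢ Set.Icc δ₁ δ₂ with hS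
  have hSc : IsCompact S := isCompact_singleton.prod
    (isCompact_Icc.prod (isCompact_Icc.prod (isCompact_Icc.prod isCompact_Icc)))
  have hSκ : S ⊆ {p | 0 < p.2.1} := fun p hp => hκ₁.trans_le hp.2.1.1
  have hne : S.Nonempty := ⟨(0, κ₁, ω₁, 0, δ₁), rfl, by simp [hκ.le], by simp [hω.le], by simp [hε.le],
    by simp [hδ.le]⟩
  have hcont : ContinuousOn (fun p => (paramA σ p, paramV p)) S :=
    ((continuousOn_paramA σ).prodMk continuousOn_paramV).mono hSκ
  obtain ⟨t, c, C, ht, ht', hc, hC, H⟩ := exists_kummerJ_bounds hd₁ hd₃ (hSc.image_of_continuousOn hcont)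
    (hne.image _) (by
      rintro _ ⟨p, hp, rfl⟩
      have h1 : 0 < p.2.1 := hSκ hp
      have h2 : 0 ≤ p.2.2.2.1 := hp.2.2.2.1.1
      simp only [re_paramA, re_paramV, im_paramV]
      exact ⟨by positivity, by positivity, by positivity⟩)
  obtain ⟨N₁, hN₁⟩ := hSc.exists_bound_of_continuousOn
    (f := fun p => (d : ℂ) / 2 - 2 * paramA σ p - 2)
    ((continuousOn_const.sub (continuousOn_const.mul ((continuousOn_paramA σ).mono hSκ))).sub
      continuousOn_const)
  obtain ⟨N₂, hN₂⟩ := hSc.exists_bound_of_continuousOn continuous_paramL.continuousOn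
  refine ⟨t, κ₁ * t / (4 * (1 + ε₁ ^ 2)), c, C, max 1 (max N₁ N₂),
    ⟨ht, ht', by positivity, hc, hC, by positivity⟩, fun p hp => ?_⟩
  have hp' : ((0, p.2) : Param) ∈ S := ⟨rfl, hp⟩
  have h1 : κ₁ ≤ p.2.1 := hp.1.1
  have h2 : 0 ≤ p.2.2.2.1 := hp.2.2.1.1
  have h3 : p.2.2.2.1 ≤ ε₁ := hp.2.2.1.2
  refine ⟨by linarith, h2, fun x hx hx' => H _ ⟨_, hp', rfl⟩ x hx hx', ?_,
    (hN₁ _ hp').trans (by simp), (hN₂ _ hp').trans (by simp)⟩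
  rw [re_paramMu_mul]
  calc 2 * (κ₁ * t / (4 * (1 + ε₁ ^ 2))) = κ₁ * (0 + t) / (2 * (1 + ε₁ ^ 2)) := by field_simp; norm_num
    _ ≤ _ := by
      have h4 : 0 ≤ p.2.1 := hκ₁.le.trans h1
      have h5 : 0 ≤ p.2.2.2.1 + t := by positivity
      gcongr

/-! ### The ingredients of the fixed point map -/

variable {d : ℕ} {σ t η c C N X : ℝ} {p : Param}

/-- The linear profile on the cone. -/
def profileQ (d : ℕ) (σ t X : ℝ) (p : Param) : Cone t →ᵇ ℂ :=
  kummerBCF t X ((d : ℂ) / 2) (paramA σ p, paramV p)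

/-- `q q*`, the continuation of `|q|²`. -/
def profileSq (d : ℕ) (σ t X : ℝ) (p : Param) : Cone t →ᵇ ℂ :=
  profileQ d σ t X p * conjComp (coneConj t) (profileQ d σ t X p)

/-- `q² (q q*)^σ`. -/
def profileG (d : ℕ) (σ t X : ℝ) (p : Param) : Cone t →ᵇ ℂ :=
  profileQ d σ t X p * profileQ d σ t X p * toBCF fun w => profileSq d σ t X p w ^ (σ : ℂ)

/-- `q⁻²`. -/
def profileInvSq (d : ℕ) (σ t X : ℝ) (p : Param) : Cone t →ᵇ ℂ :=
  toBCF fun w => (profileQ d σ t X p w ^ 2)⁻¹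

/-- The coefficient `|β|^{2σ} (1+iδ) / (4 (1-iε) |q(X)|^{2σ})`. -/
def profileCoeff (d : ℕ) (σ t X : ℝ) (p : Param) : ℂ :=
  ((‖p.1‖ ^ (2 * σ) : ℝ) : ℂ) * paramL p * profileSq d σ t X p ⟨0, zero_mem_cone t⟩ ^ (-σ : ℂ)

theorem Controlled.re_paramA_pos (hσ : 0 < σ) : 0 < (paramA σ p).re := by
  rw [re_paramA]; positivity

theorem Controlled.paramV_lt (h : Controlled d σ t η c C N p) :
    |(paramV p).im - (paramV p).re| < 2 * ((paramV p).re + (paramV p).im) := by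
  have h1 := h.kappa_pos
  have h2 := h.eps_nonneg
  have e1 : 0 ≤ (paramV p).re := by rw [re_paramV]; positivity
  have e2 : 0 < (paramV p).im := by rw [im_paramV]; positivity
  rw [abs_lt]
  constructor <;> linarith

section

variable (hc : Constants t η c C N) (hσ : 0 < σ) (hX : 1 ≤ X) (h : Controlled d σ t η c C N p)

include hc hσ hX h

theorem Controlled.profileQ_apply (w : Cone t) : profileQ d σ t X p w =
    kummerJ (paramA σ p) ((d : ℂ) / 2 - paramA σ p - 1) (paramV p / (X + w)) :=
  kummerBCF_apply hc.t_pos hc.t_le hX _ (Controlled.re_paramA_pos hσ) h.paramV_lt w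

theorem Controlled.norm_profileQ_apply_le (w : Cone t) : ‖profileQ d σ t X p w‖ ≤ C := by
  rw [h.profileQ_apply hc hσ hX]
  obtain ⟨h1, h2⟩ := Cone.add_re_le hc.t_pos hX w.2
  exact (h.kummer _ h1 h2).2

/-- The positive real part keeps q q* in the slit plane, so its complex powers are holomorphic on
the cone and smooth in the parameters. -/
theorem Controlled.le_re_profileSq (w : Cone t) : c ≤ (profileSq d σ t X p w).re := by
  rw [profileSq, mul_apply, conjComp_apply, h.profileQ_apply hc hσ hX, h.profileQ_apply hc hσ hX]
  obtain ⟨h1, h2⟩ := Cone.add_re_le hc.t_pos hX w.2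
  have := (h.kummer _ h1 h2).1
  simpa [coneConj] using this

theorem Controlled.norm_profileSq_apply_le (w : Cone t) : ‖profileSq d σ t X p w‖ ≤ C ^ 2 := by
  have hC := hc.C_pos
  rw [profileSq, mul_apply, conjComp_apply, norm_mul, RCLike.norm_conj, sq]
  gcongr <;> exact h.norm_profileQ_apply_le hc hσ hX _

theorem Controlled.le_norm_profileQ_apply (w : Cone t) : c / C ≤ ‖profileQ d σ t X p w‖ := by
  have hC := hc.C_pos
  have h1 := (h.le_re_profileSq hc hσ hX w).trans (Complex.re_le_norm _)
  rw [profileSq, mul_apply, conjComp_apply, norm_mul, RCLike.norm_conj] at h1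
  have h2 := h.norm_profileQ_apply_le hc hσ hX (coneConj t w)
  rw [div_le_iff₀ hC]
  exact h1.trans (by gcongr)

theorem Controlled.profileQ_apply_ne_zero (w : Cone t) : profileQ d σ t X p w ≠ 0 := by
  have h1 := h.le_norm_profileQ_apply hc hσ hX w
  have h2 : 0 < c / C := div_pos hc.c_pos hc.C_pos
  exact norm_pos_iff.1 (h2.trans_le h1)

theorem Controlled.profileSq_apply_mem (w : Cone t) : profileSq d σ t X p w ∈
    {z : ℂ | c ≤ z.re} ∩ Metric.closedBall 0 (C ^ 2) :=
  ⟨h.le_re_profileSq hc hσ hX w, by simpa using h.norm_profileSq_apply_le hc hσ hX w⟩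

theorem Controlled.profileQ_apply_mem (w : Cone t) : profileQ d σ t X p w ∈
    {z : ℂ | c / C ≤ ‖z‖} ∩ Metric.closedBall 0 C :=
  ⟨h.le_norm_profileQ_apply hc hσ hX w, by simpa using h.norm_profileQ_apply_le hc hσ hX w⟩

end

theorem isCompact_halfDisc : IsCompact ({z : ℂ | c ≤ z.re} ∩ Metric.closedBall 0 (C ^ 2)) :=
  (isCompact_closedBall _ _).inter_left (isClosed_le continuous_const Complex.continuous_re)

theorem isCompact_annulus : IsCompact ({z : ℂ | c / C ≤ ‖z‖} ∩ Metric.closedBall 0 C) :=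
  (isCompact_closedBall _ _).inter_left (isClosed_le continuous_const continuous_norm)

theorem differentiableOn_cpow_slitPlane (s : ℂ) :
    DifferentiableOn ℂ (fun z : ℂ => z ^ s) Complex.slitPlane := fun z hz =>
  (DifferentiableAt.cpow (by fun_prop) (by fun_prop) hz).differentiableWithinAt

theorem differentiableOn_inv_sq : DifferentiableOn ℂ (fun z : ℂ => (z ^ 2)⁻¹) {0}ᶜ := fun _ hz =>
  ((differentiableAt_id.pow 2).inv (pow_ne_zero 2 hz)).differentiableWithinAt

theorem halfDisc_subset (hc : 0 < c) :
    {z : ℂ | c ≤ z.re} ∩ Metric.closedBall 0 (C ^ 2) ⊆ Complex.slitPlane := fun _ hz =>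
  Or.inl (hc.trans_le hz.1)

theorem annulus_subset (hc : 0 < c) (hC : 0 < C) :
    {z : ℂ | c / C ≤ ‖z‖} ∩ Metric.closedBall 0 C ⊆ {0}ᶜ := fun _ hz =>
  norm_pos_iff.1 ((div_pos hc hC).trans_le hz.1)

section

variable (hc : Constants t η c C N) (hσ : 0 < σ) (hX : 1 ≤ X) (h : Controlled d σ t η c C N p)

include hc hσ hX h

theorem Controlled.profilePow_apply (w : Cone t) :
    toBCF (fun w => profileSq d σ t X p w ^ (σ : ℂ)) w = profileSq d σ t X p w ^ (σ : ℂ) :=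
  comp_toBCF_apply (θ := fun z => z ^ (σ : ℂ)) ((differentiableOn_cpow_slitPlane _).continuousOn.mono
    (halfDisc_subset hc.c_pos)) isCompact_halfDisc (h.profileSq_apply_mem hc hσ hX) w

theorem Controlled.profileG_apply (w : Cone t) : profileG d σ t X p w =
    profileQ d σ t X p w ^ 2 * profileSq d σ t X p w ^ (σ : ℂ) := by
  rw [profileG, mul_apply, mul_apply, h.profilePow_apply hc hσ hX, sq]

theorem Controlled.profileInvSq_apply (w : Cone t) : profileInvSq d σ t X p w =
    (profileQ d σ t X p w ^ 2)⁻¹ :=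
  comp_toBCF_apply (θ := fun z => (z ^ 2)⁻¹) (differentiableOn_inv_sq.continuousOn.mono
    (annulus_subset hc.c_pos hc.C_pos)) isCompact_annulus (h.profileQ_apply_mem hc hσ hX) w

theorem Controlled.norm_profileG_le : ‖profileG d σ t X p‖ ≤ C ^ 2 * (C ^ 2) ^ σ := by
  have hC := hc.C_pos
  refine (norm_le (by positivity)).2 fun w => ?_
  rw [h.profileG_apply hc hσ hX, norm_mul, norm_pow, Complex.norm_cpow_real]
  gcongr
  · exact h.norm_profileQ_apply_le hc hσ hX w
  · exact h.norm_profileSq_apply_le hc hσ hX w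

theorem Controlled.norm_profileInvSq_le : ‖profileInvSq d σ t X p‖ ≤ ((c / C) ^ 2)⁻¹ := by
  have h2 : 0 < c / C := div_pos hc.c_pos hc.C_pos
  refine (norm_le (by positivity)).2 fun w => ?_
  rw [h.profileInvSq_apply hc hσ hX, norm_inv, norm_pow]
  gcongr
  exact h.le_norm_profileQ_apply hc hσ hX w

theorem Controlled.norm_profileCoeff_le :
    ‖profileCoeff d σ t X p‖ ≤ ‖p.1‖ ^ (2 * σ) * (N * c ^ (-σ)) := by
  have hcp := hc.c_pos
  have hN := hc.N_pos
  rw [profileCoeff, norm_mul, norm_mul, Complex.norm_real, Real.norm_of_nonneg (by positivity), mul_assoc]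
  gcongr
  · exact h.normL
  · have h1 := (h.le_re_profileSq hc hσ hX ⟨0, zero_mem_cone t⟩).trans (Complex.re_le_norm _)
    rw [← Complex.ofReal_neg, Complex.norm_cpow_real]
    exact Real.rpow_le_rpow_of_nonpos hcp h1 (by linarith)

omit hσ in
theorem Controlled.norm_resolvent_le : ‖resolventBCF t X η (rayDir t)
    ((d : ℂ) / 2 - 2 * paramA σ p, paramMu p)‖ ≤ resolventConst N η :=
  norm_resolventBCF_le hc.t_pos hc.t_le hX hc.eta_pos h.mu hc.N_pos h.normA

end

/-! ### Smooth dependence of the ingredients -/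

theorem contDiff_ofReal_comp {f : Param → ℝ} (hf : ContDiff ℝ 1 f) :
    ContDiff ℝ 1 fun p => (f p : ℂ) := Complex.ofRealCLM.contDiff.comp hf

theorem contDiffAt_div_complex {E : Type*} [NormedAddCommGroup E] [NormedSpace ℝ E] {f g : E → ℂ}
    {x : E} (hf : ContDiffAt ℝ 1 f x) (hg : ContDiffAt ℝ 1 g x) (h : g x ≠ 0) :
    ContDiffAt ℝ 1 (fun x => f x / g x) x := by
  simp only [div_eq_mul_inv]
  exact hf.mul (hg.inv h)

theorem contDiffAt_paramA (hκ : 0 < p.2.1) : ContDiffAt ℝ 1 (paramA σ) p := by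
  unfold paramA
  have h1 := (contDiff_ofReal_comp (f := fun p => p.2.2.1) (by fun_prop)).contDiffAt (x := p)
  have h2 := (contDiff_ofReal_comp (f := fun p => p.2.1) (by fun_prop)).contDiffAt (x := p)
  exact contDiffAt_const.mul (contDiffAt_const.add (contDiffAt_div_complex (contDiffAt_const.mul h1) h2
    (by exact_mod_cast hκ.ne')))

theorem contDiffAt_paramV (hκ : 0 < p.2.1) : ContDiffAt ℝ 1 paramV p := by
  unfold paramV
  have h1 := (contDiff_ofReal_comp (f := fun p => p.2.2.2.1) (by fun_prop)).contDiffAt (x := p)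
  have h2 := (contDiff_ofReal_comp (f := fun p => p.2.1) (by fun_prop)).contDiffAt (x := p)
  exact contDiffAt_div_complex (contDiffAt_const.mul (h1.add contDiffAt_const)) h2
    (by exact_mod_cast hκ.ne')

theorem contDiffAt_paramMu : ContDiffAt ℝ 1 paramMu p := by
  unfold paramMu
  have h1 := (contDiff_ofReal_comp (f := fun p => p.2.2.2.1) (by fun_prop)).contDiffAt (x := p)
  have h2 := (contDiff_ofReal_comp (f := fun p => p.2.1) (by fun_prop)).contDiffAt (x := p)
  exact contDiffAt_div_complex (contDiffAt_const.mul h2)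
    (contDiffAt_const.mul (contDiffAt_const.sub (contDiffAt_const.mul h1)))
    (mul_ne_zero (by norm_num) (one_sub_I_mul_ne_zero _))

theorem contDiffAt_paramL : ContDiffAt ℝ 1 paramL p := by
  unfold paramL
  have h1 := (contDiff_ofReal_comp (f := fun p => p.2.2.2.1) (by fun_prop)).contDiffAt (x := p)
  have h2 := (contDiff_ofReal_comp (f := fun p => p.2.2.2.2) (by fun_prop)).contDiffAt (x := p)
  exact contDiffAt_div_complex (contDiffAt_const.add (contDiffAt_const.mul h2))
    (contDiffAt_const.mul (contDiffAt_const.sub (contDiffAt_const.mul h1)))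
    (mul_ne_zero (by norm_num) (one_sub_I_mul_ne_zero _))

section

variable (hc : Constants t η c C N) (hσ : 0 < σ) (hX : 1 ≤ X) (h : Controlled d σ t η c C N p)

include hc hσ hX h

theorem Controlled.contDiffAt_profileQ : ContDiffAt ℝ 1 (profileQ d σ t X) p :=
  ((contDiffAt_kummerBCF hc.t_pos hc.t_le hX _ (p := (paramA σ p, paramV p))
    (Controlled.re_paramA_pos hσ) h.paramV_lt).restrict_scalars ℝ).comp p
    ((contDiffAt_paramA h.kappa_pos).prodMk (contDiffAt_paramV h.kappa_pos))

theorem Controlled.contDiffAt_profileSq : ContDiffAt ℝ 1 (profileSq d σ t X) p :=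
  (h.contDiffAt_profileQ hc hσ hX).mul
    ((conjComp (coneConj t)).contDiff.contDiffAt.comp p (h.contDiffAt_profileQ hc hσ hX))

theorem Controlled.contDiffAt_profileG : ContDiffAt ℝ 1 (profileG d σ t X) p :=
  ((h.contDiffAt_profileQ hc hσ hX).mul (h.contDiffAt_profileQ hc hσ hX)).mul
    (((contDiffAt_comp_toBCF Complex.isOpen_slitPlane (differentiableOn_cpow_slitPlane (σ : ℂ))
      isCompact_halfDisc (halfDisc_subset hc.c_pos)
      (h.profileSq_apply_mem hc hσ hX)).restrict_scalars ℝ).comp p (h.contDiffAt_profileSq hc hσ hX))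

theorem Controlled.contDiffAt_profileInvSq : ContDiffAt ℝ 1 (profileInvSq d σ t X) p :=
  ((contDiffAt_comp_toBCF isOpen_compl_singleton differentiableOn_inv_sq
    isCompact_annulus (annulus_subset hc.c_pos hc.C_pos)
    (h.profileQ_apply_mem hc hσ hX)).restrict_scalars ℝ).comp p (h.contDiffAt_profileQ hc hσ hX)

omit hσ in
theorem Controlled.contDiffAt_resolvent : ContDiffAt ℝ 1 (fun p => resolventBCF t X η (rayDir t)
    ((d : ℂ) / 2 - 2 * paramA σ p, paramMu p)) p :=
  ((contDiffAt_resolventBCF hc.t_pos hc.t_le hX hc.eta_pos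
    (p := ((d : ℂ) / 2 - 2 * paramA σ p, paramMu p)) h.mu).restrict_scalars ℝ).comp
    (g := resolventBCF t X η (rayDir t)) p
    ((contDiffAt_const.sub (contDiffAt_const.mul (contDiffAt_paramA h.kappa_pos))).prodMk
      contDiffAt_paramMu)

/-- The condition 1 < 2σ makes |β|^{2σ} continuously differentiable across β = 0. Differentiability
is over the reals here, since neither |β| nor conjugation is holomorphic. -/
theorem Controlled.contDiffAt_profileCoeff (hσ' : 1 < 2 * σ) :
    ContDiffAt ℝ 1 (profileCoeff d σ t X) p := by
  unfold profileCoeff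
  have h1 : ContDiff ℝ 1 fun p : Param => ((‖p.1‖ ^ (2 * σ) : ℝ) : ℂ) :=
    contDiff_ofReal_comp ((contDiff_norm_rpow (E := ℂ) hσ').comp contDiff_fst)
  have h2 : ContDiffAt ℝ 1 (fun p => profileSq d σ t X p ⟨0, zero_mem_cone t⟩) p :=
    ((evalCLM ℂ ⟨0, zero_mem_cone t⟩ : (Cone t →ᵇ ℂ) →L[ℂ] ℂ).restrictScalars
      ℝ).contDiff.contDiffAt.comp p (h.contDiffAt_profileSq hc hσ hX)
  have h3 : ContDiffAt ℝ 1 (fun z : ℂ => z ^ (-σ : ℂ)) (profileSq d σ t X p ⟨0, zero_mem_cone t⟩) := by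
    have hm := halfDisc_subset hc.c_pos (h.profileSq_apply_mem hc hσ hX ⟨0, zero_mem_cone t⟩)
    have := (differentiableOn_cpow_slitPlane (-σ : ℂ)).analyticAt (Complex.isOpen_slitPlane.mem_nhds hm)
    exact (this.contDiffAt (n := 1)).restrict_scalars ℝ
  exact (h1.contDiffAt.mul contDiffAt_paramL).mul (ContDiffAt.comp (g := fun z : ℂ => z ^ (-σ : ℂ)) p h3 h2)

end

end

section

open BoundedContinuousFunction MeasureTheory

variable {d : ℕ} {σ t η c C N X : ℝ} {p : Param}

/-! ### Existence of the fixed point -/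

/-- The density `k` attached to the correction `φ` at the parameter `p`. -/
def profileK (d : ℕ) (σ : ℝ) (hc : Constants t η c C N) (X : ℝ) (p : Param) (φ : Cone t →ᵇ ℂ) :
    Cone t →ᵇ ℂ :=
  profileDensity hc.t_pos hc.eta_pos σ (profileInvSq d σ t X p) (profileG d σ t X p)
    (resolventBCF t X η (rayDir t) ((d : ℂ) / 2 - 2 * paramA σ p, paramMu p)) φ

/-- The fixed point map at the parameter `p`. -/
def profileT (d : ℕ) (σ : ℝ) (hc : Constants t η c C N) (hX : 1 ≤ X) (p : Param) (φ : Cone t →ᵇ ℂ) :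
    Cone t →ᵇ ℂ :=
  profileMap hc.t_pos hX hc.eta_pos σ (profileCoeff d σ t X p) (profileInvSq d σ t X p)
    (profileG d σ t X p) (resolventBCF t X η (rayDir t) ((d : ℂ) / 2 - 2 * paramA σ p, paramMu p)) φ

/-- A bound for the Lipschitz constant of the fixed point map, up to the factor `|β|^{2σ}`. -/
def contractConst (σ η c C N B : ℝ) : ℝ :=
  N * c ^ (-σ) * (2 * (((c / C) ^ 2)⁻¹ * (η⁻¹ * (resolventConst N η * (C ^ 2 * (C ^ 2) ^ σ * B)))))

theorem contractConst_pos (hc : Constants t η c C N) {B : ℝ} (hB : 0 < B) :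
    0 < contractConst σ η c C N B := by
  obtain ⟨h1, h2, h3, h4, h5, h6⟩ := hc
  rw [contractConst, resolventConst]
  positivity

theorem Controlled.profile_bound (hc : Constants t η c C N) (hσ : 0 < σ) (hX : 1 ≤ X)
    (h : Controlled d σ t η c C N p) {B s : ℝ} (hs : 0 ≤ s) (hB : s ≤ B) :
    ‖profileCoeff d σ t X p‖ * (2 * (‖profileInvSq d σ t X p‖ * (η⁻¹ * (‖resolventBCF t X η (rayDir t)
      ((d : ℂ) / 2 - 2 * paramA σ p, paramMu p)‖ * (‖profileG d σ t X p‖ * s))))) ≤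
      ‖p.1‖ ^ (2 * σ) * contractConst σ η c C N B := by
  have hη := hc.eta_pos
  have hN := hc.N_pos
  have hcp := hc.c_pos
  have hres : 0 ≤ resolventConst N η := by rw [resolventConst]; positivity
  rw [contractConst, ← mul_assoc (‖p.1‖ ^ (2 * σ))]
  gcongr
  · exact h.norm_profileCoeff_le hc hσ hX
  · exact h.norm_profileInvSq_le hc hσ hX
  · exact h.norm_resolvent_le hc hX
  · exact h.norm_profileG_le hc hσ hX

/-! ### Equations and holomorphy of the linear profile and of the fixed point map. -/

theorem ext_tipSub {f : Cone t →ᵇ ℂ} {x : ℂ} (hx : x ∈ OpenCone t X) :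
    ext X (tipSub t f) x = f ⟨0, zero_mem_cone t⟩ - ext X f x := by
  rw [ext_of_mem _ hx, ext_of_mem _ hx, tipSub_apply]

theorem OpenCone.add_sub_eq (X : ℝ) (x : ℂ) : (X : ℂ) + (x - X) = x := by ring

/-- The linear profile as a function of `x`. -/
def linProfile (d : ℕ) (σ : ℝ) (p : Param) (x : ℂ) : ℂ :=
  kummerJ (paramA σ p) ((d : ℂ) / 2 - paramA σ p - 1) (paramV p / x)

/-- The derivative of the linear profile. -/
def linProfile' (d : ℕ) (σ : ℝ) (p : Param) (x : ℂ) : ℂ :=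
  -(paramV p / x ^ 2) * (((d : ℂ) / 2 - paramA σ p - 1) *
    kummerJ (paramA σ p + 1) ((d : ℂ) / 2 - paramA σ p - 1 - 1) (paramV p / x))

theorem Controlled.paramV_div_pos (h : Controlled d σ t η c C N p) {x : ℂ} (hx : 0 < x.re)
    (hx' : |x.im| ≤ 1 / 2 * x.re) : 0 < (paramV p / x).re + (paramV p / x).im :=
  div_re_add_im_pos h.paramV_lt hx hx'

theorem OpenCone.im_le (ht : 0 < t) (ht' : t ≤ 1 / 2) (hX : 1 ≤ X) {x : ℂ} (hx : x ∈ OpenCone t X) :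
    |x.im| ≤ 1 / 2 * x.re := by
  have h1 := OpenCone.lt_re ht hx
  have h2 : |x.im| < t * (x.re - X) := hx
  nlinarith

section

variable (hc : Constants t η c C N) (hσ : 0 < σ) (hX : 1 ≤ X) (h : Controlled d σ t η c C N p)

include hσ h

theorem Controlled.hasDerivAt_linProfile {x : ℂ} (hx : 0 < x.re) (hx' : |x.im| ≤ 1 / 2 * x.re) :
    HasDerivAt (linProfile d σ p) (linProfile' d σ p x) x := by
  have hx0 : x ≠ 0 := fun h => by simp [h] at hx
  have h1 := (hasDerivAt_kummerJ (k := (d : ℂ) / 2 - paramA σ p - 1)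
    (Controlled.re_paramA_pos (p := p) hσ) (h.paramV_div_pos hx hx')).comp x
    ((hasDerivAt_inv hx0).const_mul (paramV p))
  convert! h1 using 1
  rw [linProfile', div_eq_mul_inv]
  ring

theorem Controlled.hasDerivAt_linProfile' {x : ℂ} (hx : 0 < x.re) (hx' : |x.im| ≤ 1 / 2 * x.re) :
    HasDerivAt (linProfile' d σ p) (-(((d : ℂ) / 2 - 2 * paramA σ p) / x - paramMu p) *
      linProfile' d σ p x - paramA σ p * (paramA σ p + 1 - (d : ℂ) / 2) / x ^ 2 * linProfile d σ p x) x := by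
  have hx0 : x ≠ 0 := fun h => by simp [h] at hx
  have ha := Controlled.re_paramA_pos (p := p) hσ
  have hy := h.paramV_div_pos hx hx'
  have h1 := (hasDerivAt_kummerJ (a := paramA σ p + 1) (k := (d : ℂ) / 2 - paramA σ p - 1 - 1)
    (by simp; linarith) hy).comp x ((hasDerivAt_inv hx0).const_mul (paramV p))
  have h2 := (((hasDerivAt_id x).pow 2).inv (pow_ne_zero 2 hx0)).const_mul (-paramV p)
  have h3 := h2.mul (h1.const_mul ((d : ℂ) / 2 - paramA σ p - 1))
  have hcont := kummerJ_contiguous (k := (d : ℂ) / 2 - paramA σ p - 1) ha hy.le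
  have hμ := paramMu_mul_paramV h.kappa_pos
  convert! h3 using 1
  · funext z
    simp [linProfile', div_eq_mul_inv]
  · rw [linProfile', linProfile]
    rw [show paramA σ p + 1 + 1 = paramA σ p + 2 by ring,
      show (d : ℂ) / 2 - paramA σ p - 1 - 1 - 1 = (d : ℂ) / 2 - paramA σ p - 1 - 2 by ring]
    simp only [id, Function.comp, Pi.pow_apply, Pi.inv_apply, ← div_eq_mul_inv] at *
    set J₀ := kummerJ (paramA σ p) ((d : ℂ) / 2 - paramA σ p - 1) (paramV p / x)
    set J₁ := kummerJ (paramA σ p + 1) ((d : ℂ) / 2 - paramA σ p - 1 - 1) (paramV p / x)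
    set J₂ := kummerJ (paramA σ p + 2) ((d : ℂ) / 2 - paramA σ p - 1 - 2) (paramV p / x)
    generalize paramA σ p = a at *
    generalize paramV p = v at *
    generalize paramMu p = μ at *
    generalize (d : ℂ) / 2 = b at *
    have hv : v ≠ 0 := right_ne_zero_of_mul (hμ.trans_ne one_ne_zero)
    obtain rfl : μ = v⁻¹ := by field_simp; linear_combination hμ
    field_simp at hcont ⊢
    linear_combination (-(b - a - 1)) * hcont

include hc hX

theorem Controlled.ext_profileQ {x : ℂ} (hx : x ∈ OpenCone t X) :
    ext X (profileQ d σ t X p) x = linProfile d σ p x := by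
  rw [ext_of_mem _ hx, h.profileQ_apply hc hσ hX]
  simp only [OpenCone.add_sub_eq, linProfile]

theorem Controlled.holo_profileQ : Holo X (profileQ d σ t X p) := fun x hx => by
  have h1 := OpenCone.lt_re hc.t_pos hx
  have h2 := h.hasDerivAt_linProfile hσ (x := x) (by linarith) (OpenCone.im_le hc.t_pos hc.t_le hX hx)
  refine (h2.differentiableAt.congr_of_eventuallyEq ?_).differentiableWithinAt
  filter_upwards [isOpen_openCone.mem_nhds hx] with z hz using h.ext_profileQ hc hσ hX hz

theorem Controlled.ext_profileInvSq {x : ℂ} (hx : x ∈ OpenCone t X) :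
    ext X (profileInvSq d σ t X p) x = (linProfile d σ p x ^ 2)⁻¹ := by
  rw [ext_of_mem _ hx, h.profileInvSq_apply hc hσ hX, ← ext_of_mem _ hx, h.ext_profileQ hc hσ hX hx]

theorem Controlled.linProfile_ne_zero {x : ℂ} (hx : x ∈ OpenCone t X) : linProfile d σ p x ≠ 0 := by
  rw [← h.ext_profileQ hc hσ hX hx, ext_of_mem _ hx]
  exact h.profileQ_apply_ne_zero hc hσ hX _

theorem Controlled.holo_profileInvSq : Holo X (profileInvSq d σ t X p) := by
  have hq := h.holo_profileQ hc hσ hX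
  refine DifferentiableOn.congr (f := fun x => (ext X (profileQ d σ t X p) x ^ 2)⁻¹) ?_ fun x hx => ?_
  · refine (hq.pow 2).inv fun x hx => pow_ne_zero 2 ?_
    rw [h.ext_profileQ hc hσ hX hx]
    exact h.linProfile_ne_zero hc hσ hX hx
  · rw [h.ext_profileInvSq hc hσ hX hx, h.ext_profileQ hc hσ hX hx]

theorem Controlled.profileSq_mem_slitPlane {x : ℂ} (hx : x ∈ OpenCone t X) :
    ext X (profileSq d σ t X p) x ∈ Complex.slitPlane := by
  rw [ext_of_mem _ hx]
  exact halfDisc_subset hc.c_pos (h.profileSq_apply_mem hc hσ hX _)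

theorem Controlled.ext_profileG {x : ℂ} (hx : x ∈ OpenCone t X) :
    ext X (profileG d σ t X p) x =
      linProfile d σ p x ^ 2 * ext X (profileSq d σ t X p) x ^ (σ : ℂ) := by
  rw [ext_of_mem _ hx, h.profileG_apply hc hσ hX, ← ext_of_mem _ hx, ← ext_of_mem _ hx,
    h.ext_profileQ hc hσ hX hx]

theorem Controlled.holo_profileSq : Holo X (profileSq d σ t X p) :=
  (h.holo_profileQ hc hσ hX).mul (h.holo_profileQ hc hσ hX).conj

theorem Controlled.holo_profileG : Holo X (profileG d σ t X p) := by
  have hq := h.holo_profileQ hc hσ hX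
  refine DifferentiableOn.congr (f := fun x => ext X (profileQ d σ t X p) x ^ 2 *
    ext X (profileSq d σ t X p) x ^ (σ : ℂ)) ?_ fun x hx => ?_
  · exact (hq.pow 2).mul ((h.holo_profileSq hc hσ hX).cpow (differentiableOn_const _)
      fun x hx => h.profileSq_mem_slitPlane hc hσ hX hx)
  · rw [h.ext_profileG hc hσ hX hx, h.ext_profileQ hc hσ hX hx]

end

theorem one_add_ext_mem_slitPlane {φ : Cone t →ᵇ ℂ} (hφ : ‖φ‖ ≤ 1 / 2) (x : ℂ) :
    1 + ext X φ x ∈ Complex.slitPlane :=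
  one_add_mem_slitPlane_of_norm (((norm_ext_le φ x).trans hφ).trans_lt (by norm_num))

theorem ext_nonlin {φ : Cone t →ᵇ ℂ} (hφ : ‖φ‖ ≤ 1 / 2) {x : ℂ} (hx : x ∈ OpenCone t X) :
    ext X (nonlin σ φ) x = (1 + ext X φ x) ^ ((σ : ℂ) + 1) *
      (1 + ext X (conjComp (coneConj t) φ) x) ^ (σ : ℂ) := by
  rw [ext_of_mem _ hx, ext_of_mem _ hx, ext_of_mem _ hx, nonlin_apply σ hφ]

theorem holo_nonlin {φ : Cone t →ᵇ ℂ} (hφ : ‖φ‖ ≤ 1 / 2) (hh : Holo X φ) : Holo X (nonlin σ φ) := by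
  refine DifferentiableOn.congr (f := fun x => (1 + ext X φ x) ^ ((σ : ℂ) + 1) *
      (1 + ext X (conjComp (coneConj t) φ) x) ^ (σ : ℂ)) ?_ fun x hx => ext_nonlin hφ hx
  exact (DifferentiableOn.cpow (hh.const_add 1) (differentiableOn_const _)
      fun x _ => one_add_ext_mem_slitPlane hφ x).mul
    (DifferentiableOn.cpow (hh.conj.const_add 1) (differentiableOn_const _)
      fun x _ => one_add_ext_mem_slitPlane ((norm_conjComp_le φ).trans hφ) x)

section

variable (hc : Constants t η c C N) (hσ : 0 < σ) (hX : 1 ≤ X) (h : Controlled d σ t η c C N p)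

include hσ hX h

theorem Controlled.holo_profileK {φ : Cone t →ᵇ ℂ} (hφ : ‖φ‖ ≤ 1 / 2) (hh : Holo X φ) :
    Holo X (profileK d σ hc X p φ) := by
  refine Holo.mul (h.holo_profileInvSq hc hσ hX) fun x hx => ?_
  exact (hasDerivAt_resolvent hc.t_pos hc.t_le hX hc.eta_pos h.mu
    ((h.holo_profileG hc hσ hX).mul (holo_nonlin hφ hh)) hx).differentiableAt.differentiableWithinAt

theorem Controlled.hasDerivAt_profileT {φ : Cone t →ᵇ ℂ} (hφ : ‖φ‖ ≤ 1 / 2) (hh : Holo X φ) {x : ℂ}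
    (hx : x ∈ OpenCone t X) :
    HasDerivAt (ext X (profileT d σ hc hX p φ))
      (profileCoeff d σ t X p * (X * (x ^ 2)⁻¹ * ext X (profileK d σ hc X p φ) x)) x := by
  have h1 := (hasDerivAt_tailCLM hc.t_pos hX (h.holo_profileK hc hσ hX hφ hh) hx).const_sub
    (tailCLM t (zero_lt_one.trans_le hX) (one_mem_cone hc.t_pos) (profileK d σ hc X p φ)
      ⟨0, zero_mem_cone t⟩)
  have h2 := (h1.const_mul (profileCoeff d σ t X p)).congr_of_eventuallyEq
    (f₁ := ext X (profileT d σ hc hX p φ)) (by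
      filter_upwards [isOpen_openCone.mem_nhds hx] with z hz
      rw [profileT, profileMap, ext_smul, ext_tipSub hz]
      rfl)
  simpa using h2

theorem Controlled.holo_profileT {φ : Cone t →ᵇ ℂ} (hφ : ‖φ‖ ≤ 1 / 2) (hh : Holo X φ) :
    Holo X (profileT d σ hc hX p φ) := fun _ hx =>
  (h.hasDerivAt_profileT hc hσ hX hφ hh hx).differentiableAt.differentiableWithinAt

end

/-! ### Solution of the fixed point equation. -/

theorem exists_profile (hc : Constants t η c C N) (hσ : 1 < 2 * σ) (d : ℕ) :
    ∃ ρ B : ℝ, 0 < ρ ∧ ∀ (X : ℝ) (hX : 1 ≤ X), ∃ u : Param → Cone t →ᵇ ℂ,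
      (∀ p, Controlled d σ t η c C N p → ‖p.1‖ ≤ ρ →
        profileT d σ hc hX p (u p) = u p ∧ ‖u p‖ ≤ 1 / 4 ∧ Holo X (u p) ∧ ‖u p‖ ≤ B * ‖p.1‖ ^ (2 * σ)) ∧
      ContDiffOn ℝ 1 u {p | Controlled d σ t η c C N p ∧ ‖p.1‖ ≤ ρ} := by
  have hσ0 : 0 < σ := by linarith
  obtain ⟨B₀, hB₀, hnl⟩ := exists_nonlin_bounds σ
  set B := contractConst σ η c C N B₀ with hB
  have hBpos : 0 < B := contractConst_pos hc hB₀
  -- With B |β|^{2σ} ≤ 1/4 the map sends the ball of radius 1/2 into that of radius 1/4 and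
  -- contracts by at least 1/2. The constant B does not involve X, hence neither does ρ.
  obtain ⟨ρ, hρ, hρB⟩ : ∃ ρ : ℝ, 0 < ρ ∧ ρ ^ (2 * σ) * B ≤ 1 / 4 := by
    refine ⟨(1 / (4 * B)) ^ (1 / (2 * σ)), by positivity, ?_⟩
    rw [← Real.rpow_mul (by positivity), one_div_mul_cancel (by positivity), Real.rpow_one]
    field_simp
    norm_num
  refine ⟨ρ, B, hρ, fun X hX => ?_⟩
  have hpρ : ∀ p : Param, ‖p.1‖ ≤ ρ → ‖p.1‖ ^ (2 * σ) * B ≤ 1 / 4 := fun p hp =>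
    le_trans (by gcongr) hρB
  have hbd : ∀ p, Controlled d σ t η c C N p → ∀ φ : Cone t →ᵇ ℂ, ‖φ‖ ≤ 1 / 2 →
      ‖profileT d σ hc hX p φ‖ ≤ ‖p.1‖ ^ (2 * σ) * B := fun p h φ hφ =>
    (norm_profileMap_le _ _ _ _ _ _ _ _ _).trans
      (h.profile_bound hc hσ0 hX (norm_nonneg _) (hnl t φ φ hφ hφ).1)
  have hlip : ∀ p, Controlled d σ t η c C N p → ‖p.1‖ ≤ ρ → ∀ φ ψ : Cone t →ᵇ ℂ, ‖φ‖ ≤ 1 / 2 →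
      ‖ψ‖ ≤ 1 / 2 → ‖profileT d σ hc hX p φ - profileT d σ hc hX p ψ‖ ≤ 1 / 2 * ‖φ - ψ‖ := by
    intro p h hp φ ψ hφ hψ
    refine (norm_profileMap_sub_le _ _ _ _ _ _ _ _ _ _).trans ((h.profile_bound hc hσ0 hX
      (norm_nonneg _) (hnl t φ ψ hφ hψ).2).trans ?_)
    have e1 : contractConst σ η c C N (B₀ * ‖φ - ψ‖) = B * ‖φ - ψ‖ := by
      rw [hB, contractConst, contractConst]; ring
    rw [e1, ← mul_assoc]
    gcongr
    linarith [hpρ p hp]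
  have hex : ∀ p, ∃ φ : Cone t →ᵇ ℂ, Controlled d σ t η c C N p → ‖p.1‖ ≤ ρ →
      profileT d σ hc hX p φ = φ ∧ ‖φ‖ ≤ 1 / 4 ∧ Holo X φ ∧ ‖φ‖ ≤ B * ‖p.1‖ ^ (2 * σ) := by
    intro p
    by_cases hpp : Controlled d σ t η c C N p ∧ ‖p.1‖ ≤ ρ
    swap
    · exact ⟨0, fun h1 h2 => absurd ⟨h1, h2⟩ hpp⟩
    obtain ⟨h, hp⟩ := hpp
    -- Holomorphic functions form a closed set preserved by the map, so the fixed point found here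
    -- is holomorphic in the cone.
    set S : Set (Cone t →ᵇ ℂ) := Metric.closedBall 0 (1 / 2) ∩ {φ | Holo X φ} with hS
    have hSc : IsComplete S := (Metric.isClosed_closedBall.inter isClosed_holo).isComplete
    have hmaps : Set.MapsTo (profileT d σ hc hX p) S S := fun φ hφ => by
      have hφ' : ‖φ‖ ≤ 1 / 2 := by simpa using hφ.1
      refine ⟨?_, h.holo_profileT hc hσ0 hX hφ' hφ.2⟩
      simp only [Metric.mem_closedBall, dist_zero_right]
      linarith [hbd p h φ hφ', hpρ p hp]
    have h0 : (0 : Cone t →ᵇ ℂ) ∈ S := by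
      refine ⟨by simp, ?_⟩
      refine DifferentiableOn.congr (differentiableOn_const (0 : ℂ)) fun x hx => ?_
      rw [ext_of_mem _ hx]; rfl
    have hK : ContractingWith (1 / 2) (hmaps.restrict (profileT d σ hc hX p) S S) := by
      refine ⟨by norm_num, LipschitzWith.of_dist_le_mul fun φ ψ => ?_⟩
      have := hlip p h hp φ ψ (by simpa using φ.2.1) (by simpa using ψ.2.1)
      rw [Subtype.dist_eq, Subtype.dist_eq, dist_eq_norm, dist_eq_norm]
      simpa using this
    obtain ⟨φ, hφS, hfix, -⟩ := hK.exists_fixedPoint' hSc hmaps h0 (edist_ne_top _ _)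
    have hφ' : ‖φ‖ ≤ 1 / 2 := by simpa using hφS.1
    have hle := hbd p h φ hφ'
    -- At the fixed point the bound on the map becomes φ = O(|β|^{2σ}), which is what the derivative
    -- at β = 0 requires.
    rw [hfix.eq] at hle
    exact ⟨φ, fun _ _ => ⟨hfix.eq, hle.trans (hpρ p hp), hφS.2, by rwa [mul_comm]⟩⟩
  choose u hu using hex
  refine ⟨u, hu, ?_⟩
  refine contDiffOn_fixedPoint (T := fun v : Param × (Cone t →ᵇ ℂ) => profileT d σ hc hX v.1 v.2)
    (r := 1 / 2) (r' := 1 / 4) (by norm_num) (fun p hp => ?_) (fun p hp φ ψ hφ hψ => ?_) (fun p hp => ?_)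
  · exact ⟨(hu p hp.1 hp.2).1, (hu p hp.1 hp.2).2.1⟩
  · exact hlip p hp.1 hp.2 φ ψ hφ hψ
  · have hfst : ContDiffAt ℝ 1 (Prod.fst : Param × (Cone t →ᵇ ℂ) → Param) (p, u p) := contDiffAt_fst
    have := contDiffAt_profileMap (s := Set.univ) (e := (p, u p)) hc.t_pos hX hc.eta_pos σ
      ((hp.1.contDiffAt_profileCoeff hc hσ0 hX hσ).comp (p, u p) hfst).contDiffWithinAt
      ((hp.1.contDiffAt_profileInvSq hc hσ0 hX).comp (p, u p) hfst).contDiffWithinAt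
      ((hp.1.contDiffAt_profileG hc hσ0 hX).comp (p, u p) hfst).contDiffWithinAt
      ((hp.1.contDiffAt_resolvent hc hX).comp (p, u p) hfst).contDiffWithinAt
      (φ := Prod.snd) contDiffAt_snd.contDiffWithinAt
      (by have := (hu p hp.1 hp.2).2.1; simp only; linarith)
    rw [contDiffWithinAt_univ] at this
    exact this

end

section

open BoundedContinuousFunction MeasureTheory

/-! ### Sector asymptotics of superpositions -/

theorem neBot_sectorFilter {t : ℝ} (ht : 0 < t) : (sectorFilter t).NeBot :=
  (tendsto_ofReal_sectorFilter ht).neBot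

/-- The compact set K ensures that the limit of f lies where θ is holomorphic, without knowing that
limit. At order 0 there need be no limit, and boundedness of θ on K suffices. -/
theorem HasExp.comp_of_isCompact {t : ℝ} {m : ℕ} {f θ : ℂ → ℂ} {K O : Set ℂ} (ht : 0 < t)
    (hf : HasExp t m f) (hK : IsCompact K) (hO : IsOpen O) (hKO : K ⊆ O)
    (hθ : DifferentiableOn ℂ θ O) (hfK : ∀ t', 0 < t' → t' < t → ∀ᶠ x in sectorFilter t', f x ∈ K) :
    HasExp t m fun x => θ (f x) := by
  cases m with
  | zero =>
    obtain ⟨M, hM⟩ := hK.exists_bound_of_continuousOn (hθ.continuousOn.mono hKO)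
    refine hasExp_zero_iff.2 fun t' h1 h2 => IsBigO.of_bound M ?_
    filter_upwards [hfK t' h1 h2] with x hx
    simpa using hM _ hx
  | succ m =>
    obtain ⟨c, hc⟩ := hf.exists_limit
    have hne := neBot_sectorFilter (t := t / 2) (by positivity)
    have h1 := (hc.tendsto (t' := t / 2) (by positivity) (by linarith)).add_const c
    simp only [sub_add_cancel, zero_add] at h1
    have hcK : c ∈ K := hK.isClosed.mem_of_tendsto h1 (hfK _ (by positivity) (by linarith))
    exact hf.comp_analyticAt hc (hθ.analyticAt (hO.mem_nhds (hKO hcK)))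

theorem SectorO.of_bounded {t B : ℝ} {f : ℂ → ℂ}
    (h : ∀ t', 0 < t' → t' < t → ∀ᶠ x in sectorFilter t', ‖f x‖ ≤ B) : SectorO t 0 f :=
  fun t' h1 h2 => IsBigO.of_bound B (by
    filter_upwards [h t' h1 h2] with x hx
    simpa using hx)

theorem eventually_mem_openCone {t t' : ℝ} (h : t' < t) (X : ℝ) :
    ∀ᶠ x in sectorFilter t', x ∈ OpenCone t X := by
  refine eventually_sectorFilter.2 ⟨t * X / (t - t') + 1, fun x hx hx' => ?_⟩
  have h1 : 0 < t - t' := by linarith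
  have h2 : t * X / (t - t') < x.re := by linarith
  rw [div_lt_iff₀ h1] at h2
  change |x.im| < t * (x.re - X)
  nlinarith

variable {d : ℕ} {σ t η c C N X : ℝ} {p : Param}

/-! ### The expansion at infinity -/

theorem Controlled.eventually_linProfile (hc : Constants t η c C N) (hσ : 0 < σ)
    (h : Controlled d σ t η c C N p) {t' : ℝ} (ht' : t' < t) :
    ∀ᶠ x in sectorFilter t', linProfile d σ p x ∈ {z : ℂ | c / C ≤ ‖z‖} ∩ Metric.closedBall 0 C := by
  filter_upwards [eventually_mem_openCone ht' 1] with x hx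
  have := h.profileQ_apply_mem hc hσ le_rfl (X := 1) ⟨x - (1 : ℝ), sub_mem_cone hx⟩
  rwa [← ext_of_mem _ hx, h.ext_profileQ hc hσ le_rfl hx] at this

/-- Bootstrap from boundedness: the linear equation in x gains one order at each step. -/
theorem Controlled.hasExp_linProfile (hc : Constants t η c C N) (hσ : 0 < σ)
    (h : Controlled d σ t η c C N p) (m : ℕ) : HasExp t m (linProfile d σ p) := by
  have hev : ∀ t', 0 < t' → t' < t → ∀ᶠ x in sectorFilter t', 0 < x.re ∧ |x.im| ≤ 1 / 2 * x.re := by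
    intro t' _ h2
    filter_upwards [eventually_mem_openCone h2 1] with x hx
    exact ⟨by linarith [OpenCone.lt_re hc.t_pos hx], OpenCone.im_le hc.t_pos hc.t_le le_rfl hx⟩
  have hd : SectorHolo t (linProfile d σ p) := fun t' h1 h2 => by
    filter_upwards [hev t' h1 h2] with x hx
    exact (h.hasDerivAt_linProfile hσ hx.1 hx.2).differentiableAt
  induction m with
  | zero =>
    refine hasExp_zero_iff.2 (SectorO.of_bounded (B := C) fun t' h1 h2 => ?_)
    filter_upwards [h.eventually_linProfile hc hσ h2] with x hx
    simpa using hx.2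
  | succ m ih =>
    refine HasExp.succ_of_ode (A := (d : ℂ) / 2 - 2 * paramA σ p) (μ := paramMu p)
      (N := fun x => paramA σ p * (paramA σ p + 1 - (d : ℂ) / 2) * linProfile d σ p x) hc.t_pos
      (left_ne_zero_of_mul (paramMu_mul_paramV h.kappa_pos |>.trans_ne one_ne_zero)) hd ?_ ih
      (ih.const_mul _)
    intro t' h1 h2
    filter_upwards [eventually_mem_openCone h2 1] with x hx
    have hO : ∀ z ∈ OpenCone t 1, 0 < z.re ∧ |z.im| ≤ 1 / 2 * z.re := fun z hz =>
      ⟨by linarith [OpenCone.lt_re hc.t_pos hz], OpenCone.im_le hc.t_pos hc.t_le le_rfl hz⟩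
    have e1 : deriv (linProfile d σ p) =ᶠ[𝓝 x] linProfile' d σ p := by
      filter_upwards [isOpen_openCone.mem_nhds hx] with z hz
      exact (h.hasDerivAt_linProfile hσ (hO z hz).1 (hO z hz).2).deriv
    rw [e1.deriv_eq, e1.eq_of_nhds, (h.hasDerivAt_linProfile' hσ (hO x hx).1 (hO x hx).2).deriv]
    have hx0 := OpenCone.ne_zero hc.t_pos le_rfl hx
    field_simp
    ring

theorem isCompact_closedBall_one : IsCompact (Metric.closedBall (1 : ℂ) (1 / 4)) :=
  isCompact_closedBall _ _

theorem closedBall_one_subset : Metric.closedBall (1 : ℂ) (1 / 4) ⊆ Complex.slitPlane := fun z hz => by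
  have h1 : ‖z - 1‖ ≤ 1 / 4 := by simpa [dist_eq_norm] using hz
  have := one_add_mem_slitPlane_of_norm (h1.trans_lt (by norm_num))
  simpa using this

theorem cpow_mul_conj_cpow {z : ℂ} (hz : z ∈ Complex.slitPlane) (σ : ℝ) :
    z ^ (σ : ℂ) * (starRingEnd ℂ) z ^ (σ : ℂ) = ((‖z‖ ^ (2 * σ) : ℝ) : ℂ) := by
  have h1 : (starRingEnd ℂ) z ^ (σ : ℂ) = (starRingEnd ℂ) (z ^ (σ : ℂ)) := by
    rw [Complex.conj_cpow _ _ (Complex.slitPlane_arg_ne_pi hz), Complex.conj_ofReal]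
  rw [h1, Complex.mul_conj, Complex.normSq_eq_norm_sq, Complex.norm_cpow_real, mul_comm 2 σ,
    Real.rpow_mul (norm_nonneg _)]
  norm_num

/-! ### The profile equation in the variable `x = ξ²` -/

/-- `φ` is the correction to the linear profile at the parameter `p`. -/
structure IsCorrection (d : ℕ) (σ : ℝ) (hc : Constants t η c C N) (hX : 1 ≤ X) (p : Param)
    (φ : Cone t →ᵇ ℂ) : Prop where
  fixed : profileT d σ hc hX p φ = φ
  norm_le : ‖φ‖ ≤ 1 / 4
  holo : Holo X φ

/-- The profile without its power factor. -/
def profileFun (d : ℕ) (σ X : ℝ) (p : Param) (φ : Cone t →ᵇ ℂ) (x : ℂ) : ℂ :=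
  linProfile d σ p x * (1 + ext X φ x)

/-- The nonlinear term. -/
def profileNonlin (d : ℕ) (σ X : ℝ) (p : Param) (φ : Cone t →ᵇ ℂ) (x : ℂ) : ℂ :=
  ext X (profileSq d σ t X p) x ^ (σ : ℂ) * ((1 + ext X φ x) ^ (σ : ℂ) *
    (1 + ext X (conjComp (coneConj t) φ) x) ^ (σ : ℂ)) * profileFun d σ X p φ x

section

variable {hc : Constants t η c C N} (hσ : 0 < σ) {hX : 1 ≤ X} (h : Controlled d σ t η c C N p)
  {φ : Cone t →ᵇ ℂ} (hφ : IsCorrection d σ hc hX p φ)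

include hσ h hφ

omit hσ h in
theorem IsCorrection.norm_le_half : ‖φ‖ ≤ 1 / 2 := by linarith [hφ.norm_le]

theorem IsCorrection.hasDerivAt_ext {x : ℂ} (hx : x ∈ OpenCone t X) : HasDerivAt (ext X φ)
    (profileCoeff d σ t X p * (X * (x ^ 2)⁻¹ * ext X (profileK d σ hc X p φ) x)) x := by
  have := h.hasDerivAt_profileT hc hσ hX hφ.norm_le_half hφ.holo hx
  rwa [hφ.fixed] at this

theorem IsCorrection.hasDerivAt_profileFun {x : ℂ} (hx : x ∈ OpenCone t X) :
    HasDerivAt (profileFun d σ X p φ) (linProfile' d σ p x * (1 + ext X φ x) + linProfile d σ p x *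
      (profileCoeff d σ t X p * (X * (x ^ 2)⁻¹ * ext X (profileK d σ hc X p φ) x))) x := by
  have h1 := OpenCone.lt_re hc.t_pos hx
  exact (h.hasDerivAt_linProfile hσ (x := x) (by linarith)
    (OpenCone.im_le hc.t_pos hc.t_le hX hx)).mul ((hφ.hasDerivAt_ext hσ h hx).const_add 1)

/-- Reduction of order read backwards: with q²φ' = γ X x⁻² W, the equation of W makes g = q(1 + φ)
satisfy the nonlinear equation in x. The exponent A - 2 in W accounts for differentiating x⁻². -/
theorem IsCorrection.hasDerivAt_deriv_profileFun {x : ℂ} (hx : x ∈ OpenCone t X) :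
    HasDerivAt (deriv (profileFun d σ X p φ))
      (-((((d : ℂ) / 2 - 2 * paramA σ p) / x - paramMu p) * deriv (profileFun d σ X p φ) x)
        - paramA σ p * (paramA σ p + 1 - (d : ℂ) / 2) / x ^ 2 * profileFun d σ X p φ x
        - profileCoeff d σ t X p * X / x ^ 2 * profileNonlin d σ X p φ x) x := by
  have h1 := OpenCone.lt_re hc.t_pos hx
  have hx0 := OpenCone.ne_zero hc.t_pos hX hx
  have him := OpenCone.im_le hc.t_pos hc.t_le hX hx
  have hφ' := hφ.norm_le_half
  have hev : deriv (profileFun d σ X p φ) =ᶠ[𝓝 x] fun x => linProfile' d σ p x * (1 + ext X φ x) +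
      linProfile d σ p x * (profileCoeff d σ t X p * (X * (x ^ 2)⁻¹ *
        ((linProfile d σ p x ^ 2)⁻¹ * ext X (densityCLM (integrableOn_exp_neg_mul hc.eta_pos)
          (resolventBCF t X η (rayDir t) ((d : ℂ) / 2 - 2 * paramA σ p, paramMu p) *
            compCLM (coneShift (rayDir_mem hc.t_pos)) (profileG d σ t X p * nonlin σ φ))) x))) := by
    filter_upwards [isOpen_openCone.mem_nhds hx] with z hz
    rw [(hφ.hasDerivAt_profileFun hσ h hz).deriv, profileK, profileDensity, ext_mul,
      h.ext_profileInvSq hc hσ hX hz]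
  have hq := h.linProfile_ne_zero hc hσ hX hx
  have hφd := hφ.hasDerivAt_ext hσ h hx
  have hqd := h.hasDerivAt_linProfile hσ (x := x) (by linarith) him
  have hqd' := h.hasDerivAt_linProfile' hσ (x := x) (by linarith) him
  have hWd := hasDerivAt_resolvent (A := (d : ℂ) / 2 - 2 * paramA σ p) hc.t_pos hc.t_le hX hc.eta_pos h.mu
    ((h.holo_profileG hc hσ hX).mul (holo_nonlin (σ := σ) hφ' hφ.holo)) hx
  rw [hev.eq_of_nhds]
  -- The source in the equation for q²φ' is q times the nonlinear term of g; this explains the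
  -- factor q² and the exponent σ + 1.
  have hM : ext X (profileG d σ t X p * nonlin σ φ) x =
      linProfile d σ p x * profileNonlin d σ X p φ x := by
    rw [ext_mul, h.ext_profileG hc hσ hX hx, ext_nonlin hφ' hx, profileNonlin, profileFun,
      cpow_eq_cpow_sub_one_mul (Complex.slitPlane_ne_zero (one_add_ext_mem_slitPlane hφ' x))
        ((σ : ℂ) + 1), add_sub_cancel_right]
    ring
  rw [hM] at hWd
  have hinv := ((hasDerivAt_id x).pow 2).inv (pow_ne_zero 2 hx0)
  have hqinv := (hqd.pow 2).inv (pow_ne_zero 2 hq)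
  have hfull := (hqd'.mul (hφd.const_add 1)).add (hqd.mul (((hinv.const_mul (X : ℂ)).mul
    (hqinv.mul hWd)).const_mul (profileCoeff d σ t X p)))
  refine (hfull.congr_of_eventuallyEq hev).congr_deriv ?_
  rw [profileK, profileDensity, ext_mul, h.ext_profileInvSq hc hσ hX hx]
  simp only [id, Pi.mul_apply, Pi.pow_apply, Pi.inv_apply]
  rw [profileFun]
  set W := ext X (densityCLM (integrableOn_exp_neg_mul hc.eta_pos)
          (resolventBCF t X η (rayDir t) ((d : ℂ) / 2 - 2 * paramA σ p, paramMu p) *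
            compCLM (coneShift (rayDir_mem hc.t_pos)) (profileG d σ t X p * nonlin σ φ))) x
  set q := linProfile d σ p x
  set q' := linProfile' d σ p x
  set f := ext X φ x
  set Nl := profileNonlin d σ X p φ x
  field_simp
  push_cast
  ring

omit hσ h in
theorem IsCorrection.one_add_mem (x : ℂ) : 1 + ext X φ x ∈ Metric.closedBall (1 : ℂ) (1 / 4) := by
  simpa using (norm_ext_le φ x).trans hφ.norm_le

/-- The nonlinear term inherits the expansion of g to the same order, because it is built from g, q
and their reflections by powers that stay in compact parts of the slit plane. The factor x⁻² in the
equation then yields one further order for g. -/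
theorem IsCorrection.hasExp_profileFun (m : ℕ) : HasExp t m (profileFun d σ X p φ) := by
  have ht := hc.t_pos
  have hd : SectorHolo t (profileFun d σ X p φ) := fun t' h1 h2 => by
    filter_upwards [eventually_mem_openCone h2 X] with x hx
    exact (hφ.hasDerivAt_profileFun hσ h hx).differentiableAt
  induction m with
  | zero =>
    refine hasExp_zero_iff.2 (SectorO.of_bounded (B := C * (5 / 4)) fun t' h1 h2 => ?_)
    filter_upwards [h.eventually_linProfile hc hσ h2] with x hx
    rw [profileFun, norm_mul]
    have e1 : ‖linProfile d σ p x‖ ≤ C := by simpa using hx.2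
    have e2 : ‖1 + ext X φ x‖ ≤ 5 / 4 := by
      refine (norm_add_le _ _).trans ?_
      have := (norm_ext_le (X := X) φ x).trans hφ.norm_le
      rw [norm_one]
      linarith
    have := hc.C_pos
    gcongr
  | succ m ih =>
    have hq := h.hasExp_linProfile hc hσ m
    have hqK : ∀ t', 0 < t' → t' < t → ∀ᶠ x in sectorFilter t', linProfile d σ p x ∈
      {z : ℂ | c / C ≤ ‖z‖} ∩ Metric.closedBall 0 C := fun t' _ h2 => h.eventually_linProfile hc hσ h2
    have hqinv : HasExp t m fun x => (linProfile d σ p x)⁻¹ :=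
      hq.comp_of_isCompact ht isCompact_annulus isOpen_compl_singleton
        (annulus_subset hc.c_pos hc.C_pos) (θ := fun z => z⁻¹)
        (fun z hz => (differentiableAt_inv hz).differentiableWithinAt) hqK
    -- The expansion of 1 + φ is recovered as g/q, so the induction needs no separate statement
    -- about φ.
    have hf : HasExp t m fun x => 1 + ext X φ x := (ih.mul hqinv).congr fun t' _ h2 => by
      filter_upwards [eventually_mem_openCone h2 X] with x hx
      have := h.linProfile_ne_zero hc hσ hX hx
      rw [profileFun]
      field_simp
    have hfpow : HasExp t m fun x => (1 + ext X φ x) ^ (σ : ℂ) :=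
      hf.comp_of_isCompact ht isCompact_closedBall_one Complex.isOpen_slitPlane closedBall_one_subset
        (differentiableOn_cpow_slitPlane _) fun _ _ _ => Eventually.of_forall hφ.one_add_mem
    have hfs : HasExp t m fun x => 1 + ext X (conjComp (coneConj t) φ) x := hf.star.congr
      fun t' _ h2 => by
        filter_upwards [eventually_mem_openCone h2 X] with x hx
        rw [ext_conjComp φ hx]
        simp
    have hfspow : HasExp t m fun x => (1 + ext X (conjComp (coneConj t) φ) x) ^ (σ : ℂ) :=
      hfs.comp_of_isCompact ht isCompact_closedBall_one Complex.isOpen_slitPlane closedBall_one_subset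
        (differentiableOn_cpow_slitPlane _) fun _ _ _ => Eventually.of_forall fun x => by
          simpa using (norm_ext_le _ x).trans ((norm_conjComp_le φ).trans hφ.norm_le)
    have hsq : HasExp t m (ext X (profileSq d σ t X p)) := (hq.mul hq.star).congr fun t' _ h2 => by
      filter_upwards [eventually_mem_openCone h2 X] with x hx
      rw [profileSq, ext_mul, ext_conjComp _ hx, h.ext_profileQ hc hσ hX hx,
        h.ext_profileQ hc hσ hX (OpenCone.star_mem hx)]
    have hsqpow : HasExp t m fun x => ext X (profileSq d σ t X p) x ^ (σ : ℂ) :=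
      hsq.comp_of_isCompact ht isCompact_halfDisc Complex.isOpen_slitPlane (halfDisc_subset hc.c_pos)
        (differentiableOn_cpow_slitPlane _) fun t' _ h2 => by
          filter_upwards [eventually_mem_openCone h2 X] with x hx
          rw [ext_of_mem _ hx]
          exact h.profileSq_apply_mem hc hσ hX _
    have hN : HasExp t m (profileNonlin d σ X p φ) := (hsqpow.mul (hfpow.mul hfspow)).mul ih
    refine HasExp.succ_of_ode (A := (d : ℂ) / 2 - 2 * paramA σ p) (μ := paramMu p)
      (N := fun x => paramA σ p * (paramA σ p + 1 - (d : ℂ) / 2) * profileFun d σ X p φ x +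
        profileCoeff d σ t X p * X * profileNonlin d σ X p φ x) hc.t_pos
      (left_ne_zero_of_mul (paramMu_mul_paramV h.kappa_pos |>.trans_ne one_ne_zero)) hd ?_ ih
      ((ih.const_mul _).add (hN.const_mul _))
    intro t' h1 h2
    filter_upwards [eventually_mem_openCone h2 X] with x hx
    rw [(hφ.hasDerivAt_deriv_profileFun hσ h hx).deriv]
    have hx0 := OpenCone.ne_zero hc.t_pos hX hx
    field_simp
    ring

/-- On the real axis g* is the conjugate of g, so the holomorphic continuation reduces to the true
nonlinearity |g|^{2σ} g. -/
theorem IsCorrection.profileNonlin_ofReal {r : ℝ} (hr : X < r) :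
    profileNonlin d σ X p φ r =
      ((‖profileFun d σ X p φ r‖ ^ (2 * σ) : ℝ) : ℂ) * profileFun d σ X p φ r := by
  have hx := OpenCone.ofReal_mem hc.t_pos hr
  have h1 : ext X (profileSq d σ t X p) r = ((‖linProfile d σ p r‖ ^ 2 : ℝ) : ℂ) := by
    rw [profileSq, ext_mul, ext_conjComp _ hx, Complex.conj_ofReal, h.ext_profileQ hc hσ hX hx,
      Complex.mul_conj, Complex.normSq_eq_norm_sq]
  rw [profileNonlin, ext_conjComp _ hx, Complex.conj_ofReal, h1]
  have h2 : 1 + (starRingEnd ℂ) (ext X φ r) = (starRingEnd ℂ) (1 + ext X φ r) := by simp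
  rw [h2, cpow_mul_conj_cpow (one_add_ext_mem_slitPlane hφ.norm_le_half _),
    ← Complex.ofReal_cpow (by positivity), ← Complex.ofReal_mul]
  congr 2
  rw [profileFun, norm_mul, Real.mul_rpow (norm_nonneg _) (norm_nonneg _),
    Real.rpow_mul (norm_nonneg (linProfile d σ p r)) 2 σ, Real.rpow_two]

end

end

section

open BoundedContinuousFunction MeasureTheory

variable {d : ℕ} {σ t η c C N ξ₁ : ℝ} {p : Param}

/-! ### The solution -/

/-- The constant factor `β ξ₁^{2a} / q(ξ₁²)` of the solution. -/
def solCoeff (d : ℕ) (σ ξ₁ : ℝ) (p : Param) : ℂ :=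
  p.1 * (ξ₁ : ℂ) ^ (2 * paramA σ p) / linProfile d σ p ((ξ₁ ^ 2 : ℝ) : ℂ)

/-- The solution as a function of a complex variable. -/
def sol (d : ℕ) (σ ξ₁ : ℝ) (p : Param) (φ : Cone t →ᵇ ℂ) (z : ℂ) : ℂ :=
  solCoeff d σ ξ₁ p * (z ^ (-(2 * paramA σ p)) * profileFun d σ (ξ₁ ^ 2) p φ (z ^ 2))

/-- The domain of holomorphy of the solution. -/
def SolDom (t ξ₁ : ℝ) : Set ℂ := {z | 0 < z.re} ∩ (fun z => z ^ 2) ⁻¹' OpenCone t (ξ₁ ^ 2)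

theorem isOpen_solDom : IsOpen (SolDom t ξ₁) :=
  (isOpen_lt continuous_const Complex.continuous_re).inter
    (isOpen_openCone.preimage (continuous_id.pow 2))

theorem ofReal_mem_solDom (ht : 0 < t) (hξ₁ : 1 ≤ ξ₁) {ξ : ℝ} (hξ : ξ₁ < ξ) : (ξ : ℂ) ∈ SolDom t ξ₁ := by
  refine ⟨by simp; linarith, ?_⟩
  change (ξ : ℂ) ^ 2 ∈ OpenCone t (ξ₁ ^ 2)
  rw [← Complex.ofReal_pow]
  exact OpenCone.ofReal_mem ht (by gcongr)

theorem hasDerivAt_neg_cpow {z a : ℂ} (hz : 0 < z.re) :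
    HasDerivAt (fun z : ℂ => z ^ (-(2 * a))) (-(2 * a) / z * z ^ (-(2 * a))) z := by
  have hz0 : z ≠ 0 := fun h => by simp [h] at hz
  have := (hasDerivAt_id z).cpow_const (c := -(2 * a)) (Or.inl hz)
  convert! this using 1
  have e : z ^ (-(2 * a)) = z ^ (-(2 * a) - 1) * z := cpow_eq_cpow_sub_one_mul hz0 _
  simp only [id]
  rw [e]
  field_simp

theorem cpow_mul_cpow_neg {ξ : ℝ} (hξ : 0 < ξ) (s : ℂ) : (ξ : ℂ) ^ s * (ξ : ℂ) ^ (-s) = 1 := by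
  rw [← Complex.cpow_add _ _ (by exact_mod_cast hξ.ne')]
  simp

section

variable {hc : Constants t η c C N} (hσ : 0 < σ) (hξ₁ : 1 ≤ ξ₁) {hX : 1 ≤ ξ₁ ^ 2}
  (h : Controlled d σ t η c C N p) {φ : Cone t →ᵇ ℂ} (hφ : IsCorrection d σ hc hX p φ)

include hσ h hφ

theorem IsCorrection.hasDerivAt_sol {z : ℂ} (hz : z ∈ SolDom t ξ₁) :
    HasDerivAt (sol d σ ξ₁ p φ) (solCoeff d σ ξ₁ p * (z ^ (-(2 * paramA σ p)) *
      (-(2 * paramA σ p) / z * profileFun d σ (ξ₁ ^ 2) p φ (z ^ 2) +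
        2 * z * deriv (profileFun d σ (ξ₁ ^ 2) p φ) (z ^ 2)))) z := by
  have hz0 : z ≠ 0 := fun h => by have := hz.1; simp [h] at this
  have h1 := (hφ.hasDerivAt_profileFun hσ h hz.2).differentiableAt.hasDerivAt.comp z (hasDerivAt_pow 2 z)
  have h2 := ((hasDerivAt_neg_cpow (a := paramA σ p) hz.1).mul h1).const_mul (solCoeff d σ ξ₁ p)
  refine h2.congr_deriv ?_
  simp only [Function.comp]
  push_cast
  ring

theorem IsCorrection.hasDerivAt_deriv_sol {z : ℂ} (hz : z ∈ SolDom t ξ₁) :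
    HasDerivAt (deriv (sol d σ ξ₁ p φ)) (solCoeff d σ ξ₁ p * (z ^ (-(2 * paramA σ p)) *
      ((2 * paramA σ p + 4 * paramA σ p ^ 2) / z ^ 2 * profileFun d σ (ξ₁ ^ 2) p φ (z ^ 2) +
        (2 - 8 * paramA σ p) * deriv (profileFun d σ (ξ₁ ^ 2) p φ) (z ^ 2) +
        4 * z ^ 2 * deriv (deriv (profileFun d σ (ξ₁ ^ 2) p φ)) (z ^ 2)))) z := by
  have hz0 : z ≠ 0 := fun h => by have := hz.1; simp [h] at this
  have hev : deriv (sol d σ ξ₁ p φ) =ᶠ[𝓝 z] fun z => solCoeff d σ ξ₁ p * (z ^ (-(2 * paramA σ p)) *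
      (-(2 * paramA σ p) * z⁻¹ * profileFun d σ (ξ₁ ^ 2) p φ (z ^ 2) +
        2 * z * deriv (profileFun d σ (ξ₁ ^ 2) p φ) (z ^ 2))) := by
    filter_upwards [isOpen_solDom.mem_nhds hz] with w hw
    rw [(hφ.hasDerivAt_sol hσ h hw).deriv, div_eq_mul_inv]
  have h1 := (hφ.hasDerivAt_profileFun hσ h hz.2).differentiableAt.hasDerivAt.comp z (hasDerivAt_pow 2 z)
  have h2 := (hφ.hasDerivAt_deriv_profileFun hσ h hz.2).differentiableAt.hasDerivAt.comp z
    (hasDerivAt_pow 2 z)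
  have h3 := ((hasDerivAt_neg_cpow (a := paramA σ p) hz.1).mul
    ((((hasDerivAt_inv hz0).const_mul (-(2 * paramA σ p))).mul h1).add
      (((hasDerivAt_id z).const_mul 2).mul h2))).const_mul (solCoeff d σ ξ₁ p)
  refine (h3.congr_of_eventuallyEq hev).congr_deriv ?_
  simp only [Function.comp, id, Pi.mul_apply, Pi.add_apply]
  field_simp
  push_cast
  ring

theorem IsCorrection.differentiableOn_sol :
    DifferentiableOn ℂ (sol d σ ξ₁ p φ) (SolDom t ξ₁) := fun _ hz =>
  (hφ.hasDerivAt_sol hσ h hz).differentiableAt.differentiableWithinAt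

end

theorem Controlled.profileCoeff_eq (hc : Constants t η c C N) (hσ : 0 < σ) {X : ℝ} (hX : 1 ≤ X)
    (h : Controlled d σ t η c C N p) : profileCoeff d σ t X p =
      ((‖p.1‖ ^ (2 * σ) * ‖linProfile d σ p X‖ ^ (-(2 * σ)) : ℝ) : ℂ) * paramL p := by
  have h1 : profileSq d σ t X p ⟨0, zero_mem_cone t⟩ = ((‖linProfile d σ p X‖ ^ 2 : ℝ) : ℂ) := by
    rw [profileSq, mul_apply, conjComp_apply, h.profileQ_apply hc hσ hX, h.profileQ_apply hc hσ hX]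
    simp only [coneConj, ContinuousMap.coe_mk, map_zero, add_zero]
    rw [Complex.mul_conj, Complex.normSq_eq_norm_sq]
    rfl
  rw [profileCoeff, h1, ← Complex.ofReal_neg, ← Complex.ofReal_cpow (by positivity)]
  have h2 : (‖linProfile d σ p X‖ ^ 2) ^ (-σ) = ‖linProfile d σ p X‖ ^ (-(2 * σ)) := by
    rw [show -(2 * σ) = 2 * (-σ) by ring, Real.rpow_mul (norm_nonneg _), Real.rpow_two]
  rw [h2]
  push_cast
  ring

theorem neg_two_mul_re_paramA (hσ : 0 < σ) : (-(2 * paramA σ p)).re = -1 / σ := by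
  have : (-(2 * paramA σ p)) = ((-2 : ℝ) : ℂ) * paramA σ p := by push_cast; ring
  rw [this, Complex.re_ofReal_mul, re_paramA]
  field_simp

theorem Controlled.linProfile_tip_ne_zero (hc : Constants t η c C N) (hσ : 0 < σ) {X : ℝ} (hX : 1 ≤ X)
    (h : Controlled d σ t η c C N p) : linProfile d σ p X ≠ 0 := by
  have := h.profileQ_apply_ne_zero hc hσ hX ⟨0, zero_mem_cone t⟩
  rw [h.profileQ_apply hc hσ hX, add_zero] at this
  exact this

section

variable {hc : Constants t η c C N} (hσ : 0 < σ) (hξ₁ : 1 ≤ ξ₁) {hX : 1 ≤ ξ₁ ^ 2}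
  (h : Controlled d σ t η c C N p) {φ : Cone t →ᵇ ℂ} (hφ : IsCorrection d σ hc hX p φ)

/-- The real part of 2a is 1/σ, so the modulus of (ξ₁/ξ)^{2a} to the power 2σ is exactly ξ₁²/ξ².
This is the weight X/x that makes the nonlinear term integrable at infinity. -/
theorem norm_sol_rpow (hσ : 0 < σ) (hξ₁ : 1 ≤ ξ₁) (φ : Cone t →ᵇ ℂ) {ξ : ℝ} (hξ : 0 < ξ) :
    ‖sol d σ ξ₁ p φ ξ‖ ^ (2 * σ) =
      ‖p.1‖ ^ (2 * σ) * ‖linProfile d σ p ((ξ₁ ^ 2 : ℝ) : ℂ)‖ ^ (-(2 * σ)) * (ξ₁ ^ 2 / ξ ^ 2) *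
        ‖profileFun d σ (ξ₁ ^ 2) p φ ((ξ : ℂ) ^ 2)‖ ^ (2 * σ) := by
  have hξ₁0 : 0 < ξ₁ := by linarith
  have e1 : ‖(ξ₁ : ℂ) ^ (2 * paramA σ p)‖ = ξ₁ ^ (1 / σ) := by
    rw [Complex.norm_cpow_eq_rpow_re_of_pos hξ₁0]
    congr 1
    have := neg_two_mul_re_paramA (p := p) hσ
    rw [Complex.neg_re] at this
    rw [neg_eq_iff_eq_neg.1 this]
    ring
  have e2 : ‖(ξ : ℂ) ^ (-(2 * paramA σ p))‖ = ξ ^ (-1 / σ) := by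
    rw [Complex.norm_cpow_eq_rpow_re_of_pos hξ, neg_two_mul_re_paramA hσ]
  have e3 : (ξ₁ ^ (1 / σ)) ^ (2 * σ) = ξ₁ ^ 2 := by
    rw [← Real.rpow_mul hξ₁0.le, show 1 / σ * (2 * σ) = 2 by field_simp, Real.rpow_two]
  have e4 : (ξ ^ (-1 / σ)) ^ (2 * σ) = (ξ ^ 2)⁻¹ := by
    rw [← Real.rpow_mul hξ.le, show -1 / σ * (2 * σ) = -2 by field_simp, Real.rpow_neg hξ.le,
      Real.rpow_two]
  rw [sol, solCoeff, norm_mul, norm_mul, norm_div, norm_mul, e1, e2]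
  rw [Real.mul_rpow (by positivity) (by positivity), Real.mul_rpow (by positivity) (by positivity),
    Real.div_rpow (by positivity) (by positivity), Real.mul_rpow (by positivity) (by positivity), e3, e4,
    Real.rpow_neg (norm_nonneg _)]
  ring

include hσ hξ₁ h hφ

theorem IsCorrection.sol_equation {ξ : ℝ} (hξ : ξ₁ < ξ) :
    (1 - Complex.I * p.2.2.2.1) * (deriv (deriv (sol d σ ξ₁ p φ)) ξ +
        ((d : ℂ) - 1) / ξ * deriv (sol d σ ξ₁ p φ) ξ)
      + Complex.I * p.2.1 * ξ * deriv (sol d σ ξ₁ p φ) ξ + Complex.I * p.2.1 / σ * sol d σ ξ₁ p φ ξ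
      - p.2.2.1 * sol d σ ξ₁ p φ ξ
      + (1 + Complex.I * p.2.2.2.2) * ((‖sol d σ ξ₁ p φ ξ‖ ^ (2 * σ) : ℝ) : ℂ) * sol d σ ξ₁ p φ ξ = 0 := by
  have hξ0 : 0 < ξ := by linarith
  have hz := ofReal_mem_solDom hc.t_pos hξ₁ hξ
  have hXr : ξ₁ ^ 2 < ξ ^ 2 := by gcongr
  have h2 := (hφ.hasDerivAt_deriv_profileFun hσ h hz.2).deriv
  have h3 := hφ.profileNonlin_ofReal hσ h hXr
  rw [(hφ.hasDerivAt_deriv_sol hσ h hz).deriv, (hφ.hasDerivAt_sol hσ h hz).deriv,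
    norm_sol_rpow hσ hξ₁ φ hξ0]
  rw [h.profileCoeff_eq hc hσ hX] at h2
  simp only [Complex.ofReal_pow] at h2 h3 ⊢
  rw [h2, h3, sol]
  have hκ : (p.2.1 : ℂ) ≠ 0 := by exact_mod_cast h.kappa_pos.ne'
  have hσ' : (σ : ℂ) ≠ 0 := by exact_mod_cast hσ.ne'
  have hε := one_sub_I_mul_ne_zero p.2.2.2.1
  have hz0 : (ξ : ℂ) ≠ 0 := by exact_mod_cast hξ0.ne'
  -- The power ξ^{-2a} solves the transport part iκξQ' + (iκ/σ - ω)Q = 0; this cancellation removes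
  -- the zeroth order term without decay.
  have ha : Complex.I * p.2.1 / σ - p.2.2.1 = 2 * Complex.I * p.2.1 * paramA σ p := by
    rw [paramA]
    field_simp
    linear_combination (-(p.2.2.1 : ℂ)) * σ * Complex.I_sq
  push_cast
  rw [paramMu, paramL]
  set g := profileFun d σ (ξ₁ ^ 2) p φ ((ξ : ℂ) ^ 2)
  set g' := deriv (profileFun d σ (ξ₁ ^ 2) p φ) ((ξ : ℂ) ^ 2)
  generalize ((‖g‖ ^ (2 * σ) : ℝ) : ℂ) = n
  generalize ((‖p.1‖ ^ (2 * σ) : ℝ) : ℂ) = S₁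
  generalize ((‖linProfile d σ p ((ξ₁ : ℂ) ^ 2)‖ ^ (-(2 * σ)) : ℝ) : ℂ) = S₂
  generalize solCoeff d σ ξ₁ p = T
  generalize (ξ : ℂ) ^ (-(2 * paramA σ p)) = E
  generalize paramA σ p = a at *
  generalize (p.2.1 : ℂ) = κ at *
  generalize (p.2.2.1 : ℂ) = ω at *
  generalize (p.2.2.2.1 : ℂ) = ε at *
  generalize (p.2.2.2.2 : ℂ) = δ at *
  clear_value g g'
  rw [show ∀ A Y B : ℂ, A + Complex.I * κ / σ * Y - ω * Y + B = A + (Complex.I * κ / σ - ω) * Y + B by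
    intros; ring, ha]
  clear ha h2 h3
  field_simp
  ring

end

end

section

open BoundedContinuousFunction MeasureTheory

/-! ### Restrictions of holomorphic functions to the real line -/

theorem iteratedDeriv_comp_ofReal {W : Set ℂ} (hW : IsOpen W) (k : ℕ) {f : ℂ → ℂ}
    (hf : DifferentiableOn ℂ f W) {ξ : ℝ} (hξ : (ξ : ℂ) ∈ W) :
    iteratedDeriv k (fun ξ : ℝ => f ξ) ξ = iteratedDeriv k f ξ := by
  induction k generalizing f with
  | zero => simp
  | succ k ih =>
    rw [iteratedDeriv_succ', iteratedDeriv_succ', ← ih (hf.deriv hW)]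
    refine Filter.EventuallyEq.iteratedDeriv_eq k ?_
    filter_upwards [(hW.preimage Complex.continuous_ofReal).mem_nhds hξ] with x hx
    exact ((hf.differentiableAt (hW.mem_nhds hx)).hasDerivAt.comp_ofReal).deriv

theorem contDiffOn_comp_ofReal {W : Set ℂ} (hW : IsOpen W) {n : WithTop ℕ∞} {f : ℂ → ℂ}
    (hf : DifferentiableOn ℂ f W) {s : Set ℝ} (hs : ∀ ξ ∈ s, (ξ : ℂ) ∈ W) :
    ContDiffOn ℝ n (fun ξ : ℝ => f ξ) s :=
  ((hf.contDiffOn hW).restrict_scalars ℝ).comp (g := f) Complex.ofRealCLM.contDiff.contDiffOn hs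

variable {d : ℕ} {σ t η c C N ξ₁ : ℝ} {p : Param}

/-- The map `ξ ↦ ξ² - ξ₁²` into the cone. -/
def coneSq (ht : 0 < t) (hξ₁ : 1 ≤ ξ₁) : C(Set.Ici ξ₁, Cone t) where
  toFun ξ := ⟨((ξ ^ 2 - ξ₁ ^ 2 : ℝ) : ℂ), Cone.ofReal_mem ht (by
    have : ξ₁ ≤ ξ := ξ.2
    nlinarith)⟩
  continuous_toFun := by fun_prop

theorem ext_sq (ht : 0 < t) (hξ₁ : 1 ≤ ξ₁) (f : Cone t →ᵇ ℂ) (ξ : Set.Ici ξ₁) :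
    ext (ξ₁ ^ 2) f (((ξ : ℝ) : ℂ) ^ 2) = f (coneSq ht hξ₁ ξ) := by
  have e : (((ξ : ℝ) : ℂ) ^ 2 - ((ξ₁ ^ 2 : ℝ) : ℂ)) = ((ξ ^ 2 - ξ₁ ^ 2 : ℝ) : ℂ) := by push_cast; ring
  have h : (((ξ : ℝ) : ℂ) ^ 2 - ((ξ₁ ^ 2 : ℝ) : ℂ)) ∈ Cone t := by
    rw [e]; exact (coneSq ht hξ₁ ξ).2
  rw [ext, dif_pos h]
  congr 1
  exact Subtype.ext e

theorem coneSq_self (ht : 0 < t) (hξ₁ : 1 ≤ ξ₁) :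
    coneSq ht hξ₁ ⟨ξ₁, Set.self_mem_Ici⟩ = ⟨0, zero_mem_cone t⟩ := by
  apply Subtype.ext
  simp [coneSq]

theorem neg_two_mul_paramA (σ : ℝ) (p : Param) :
    -(2 * paramA σ p) = -1 / (σ : ℂ) - Complex.I * p.2.2.1 / p.2.1 := by
  rw [paramA]; ring

theorem solCoeff_zero (h : p.1 = 0) : solCoeff d σ ξ₁ p = 0 := by simp [solCoeff, h]

section

variable {hc : Constants t η c C N} (hσ : 0 < σ) (hξ₁ : 1 ≤ ξ₁) {hX : 1 ≤ ξ₁ ^ 2}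
  (h : Controlled d σ t η c C N p) {φ : Cone t →ᵇ ℂ} (hφ : IsCorrection d σ hc hX p φ)

include hσ h

theorem Controlled.profileFun_sq (hc : Constants t η c C N) (hξ₁ : 1 ≤ ξ₁) (φ : Cone t →ᵇ ℂ)
    (ξ : Set.Ici ξ₁) : profileFun d σ (ξ₁ ^ 2) p φ (((ξ : ℝ) : ℂ) ^ 2) =
      (profileQ d σ t (ξ₁ ^ 2) p * (1 + φ)) (coneSq hc.t_pos hξ₁ ξ) := by
  rw [profileFun, ext_sq hc.t_pos hξ₁, mul_apply, h.profileQ_apply hc hσ (one_le_pow₀ hξ₁), linProfile]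
  have : ((ξ₁ ^ 2 : ℝ) : ℂ) + (coneSq hc.t_pos hξ₁ ξ : ℂ) = ((ξ : ℝ) : ℂ) ^ 2 := by
    simp [coneSq]
  rw [this]
  rfl

theorem Controlled.continuousOn_profileFun_sq (hc : Constants t η c C N) (hξ₁ : 1 ≤ ξ₁) (φ : Cone t →ᵇ ℂ) :
    ContinuousOn (fun ξ : ℝ => profileFun d σ (ξ₁ ^ 2) p φ ((ξ : ℂ) ^ 2)) (Set.Ici ξ₁) := by
  rw [continuousOn_iff_continuous_domRestrict]
  have : (Set.Ici ξ₁).domRestrict (fun ξ : ℝ => profileFun d σ (ξ₁ ^ 2) p φ ((ξ : ℂ) ^ 2)) =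
      fun ξ => (profileQ d σ t (ξ₁ ^ 2) p * (1 + φ)) (coneSq hc.t_pos hξ₁ ξ) := by
    funext ξ
    exact h.profileFun_sq hσ hc hξ₁ φ ξ
  rw [this]
  fun_prop

include hφ

-- Subtraction of the value at the tip in the fixed point map forces φ to vanish there; hence the
-- value at ξ₁ is exactly β.
omit hσ h in
theorem IsCorrection.apply_zero : φ ⟨0, zero_mem_cone t⟩ = 0 := by
  have := congrArg (fun f : Cone t →ᵇ ℂ => f ⟨0, zero_mem_cone t⟩) hφ.fixed
  simpa [profileT, profileMap, tipSub_apply] using this.symm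

theorem IsCorrection.sol_self (hξ₁ : 1 ≤ ξ₁) : sol d σ ξ₁ p φ ξ₁ = p.1 := by
  have hξ0 : 0 < ξ₁ := by linarith
  have e1 := ext_sq hc.t_pos hξ₁ φ ⟨ξ₁, Set.self_mem_Ici⟩
  rw [coneSq_self, hφ.apply_zero] at e1
  have e2 := cpow_mul_cpow_neg hξ0 (2 * paramA σ p)
  have e3 := h.linProfile_tip_ne_zero hc hσ hX
  rw [sol, solCoeff, profileFun, e1, add_zero, mul_one, ← Complex.ofReal_pow]
  field_simp
  rw [mul_assoc, e2, mul_one]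

omit hφ in
theorem Controlled.continuousOn_sol (hc : Constants t η c C N) (hξ₁ : 1 ≤ ξ₁) (φ : Cone t →ᵇ ℂ) :
    ContinuousOn (fun ξ : ℝ => sol d σ ξ₁ p φ ξ) (Set.Ici ξ₁) := by
  refine continuousOn_const.mul (ContinuousOn.mul (fun ξ (hξ : ξ₁ ≤ ξ) => ?_)
    (h.continuousOn_profileFun_sq hσ hc hξ₁ φ))
  exact ((hasDerivAt_neg_cpow (z := (ξ : ℂ)) (by simp; linarith)).continuousAt.comp
    Complex.continuous_ofReal.continuousAt).continuousWithinAt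

theorem IsCorrection.contDiffOn_sol (hξ₁ : 1 ≤ ξ₁) {n : WithTop ℕ∞} :
    ContDiffOn ℝ n (fun ξ : ℝ => sol d σ ξ₁ p φ ξ) (Set.Ioi ξ₁) :=
  contDiffOn_comp_ofReal isOpen_solDom (hφ.differentiableOn_sol hσ h) fun _ hξ =>
    ofReal_mem_solDom hc.t_pos hξ₁ hξ

theorem IsCorrection.le_norm_profileFun (hξ₁ : 1 ≤ ξ₁) {ξ : ℝ} (hξ : ξ₁ ≤ ξ) :
    c / C * (3 / 4) ≤ ‖profileFun d σ (ξ₁ ^ 2) p φ ((ξ : ℂ) ^ 2)‖ := by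
  have h2 : 0 < c / C := div_pos hc.c_pos hc.C_pos
  have h1 := h.profileFun_sq hσ hc hξ₁ φ ⟨ξ, hξ⟩
  simp only at h1
  rw [h1, mul_apply, norm_mul]
  gcongr
  · exact h.le_norm_profileQ_apply hc hσ hX _
  · have h3 := (φ.norm_coe_le_norm (coneSq hc.t_pos hξ₁ ⟨ξ, hξ⟩)).trans hφ.norm_le
    have h4 := norm_sub_norm_le (1 : ℂ) (-φ (coneSq hc.t_pos hξ₁ ⟨ξ, hξ⟩))
    rw [norm_one, norm_neg, sub_neg_eq_add] at h4
    change 3 / 4 ≤ ‖(1 : ℂ) + φ _‖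
    linarith

theorem IsCorrection.isEquivalent_sol (hξ₁ : 1 ≤ ξ₁) :
    ∃ b : ℂ, (fun ξ : ℝ => sol d σ ξ₁ p φ ξ) ~[atTop] fun ξ => b * profilePower σ p.2.1 p.2.2.1 ξ := by
  obtain ⟨b, hb⟩ := (hφ.hasExp_profileFun hσ h 1).exists_limit
  have h1 : Tendsto (fun ξ : ℝ => profileFun d σ (ξ₁ ^ 2) p φ ((ξ : ℂ) ^ 2)) atTop (𝓝 b) := by
    have := (hb.tendsto (half_pos hc.t_pos) (half_lt_self hc.t_pos)).comp
      ((tendsto_ofReal_sectorFilter (by linarith [hc.t_pos])).comp (tendsto_pow_atTop two_ne_zero))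
    simpa [Function.comp_def] using this.add_const b
  -- The limit of g is nonzero because |q| ≥ c/C and |1 + φ| ≥ 3/4; asymptotic equivalence would
  -- fail for a zero limit. For β = 0 the coefficient and the solution vanish together.
  have hb0 : b ≠ 0 := by
    have h2 : 0 < c / C := div_pos hc.c_pos hc.C_pos
    have := ge_of_tendsto h1.norm (b := c / C * (3 / 4)) (by
      filter_upwards [eventually_ge_atTop ξ₁] with ξ hξ
      exact hφ.le_norm_profileFun hσ h hξ₁ hξ)
    exact norm_pos_iff.1 ((by positivity : 0 < c / C * (3 / 4)).trans_le this)
  refine ⟨solCoeff d σ ξ₁ p * b, ?_⟩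
  have h3 := (IsEquivalent.refl (u := fun _ : ℝ => solCoeff d σ ξ₁ p) (l := atTop)).mul
    ((IsEquivalent.refl (u := fun ξ : ℝ => (ξ : ℂ) ^ (-(2 * paramA σ p)))).mul
      ((isEquivalent_const_iff_tendsto hb0).2 h1))
  refine h3.congr_right (Eventually.of_forall fun ξ => ?_)
  simp only [Pi.mul_apply, profilePower, Function.const_apply]
  rw [neg_two_mul_paramA]
  ring

theorem IsCorrection.isProfile_sol (hξ₁ : 1 ≤ ξ₁) :
    IsProfile d σ p.2.1 p.2.2.1 p.2.2.2.1 p.2.2.2.2 ξ₁ p.1 fun ξ => sol d σ ξ₁ p φ ξ where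
  continuousOn := h.continuousOn_sol hσ hc hξ₁ φ
  contDiffOn := hφ.contDiffOn_sol hσ h hξ₁
  equation ξ hξ := by
    have h1 := ofReal_mem_solDom hc.t_pos hξ₁ hξ
    have h2 := hφ.differentiableOn_sol hσ h
    rw [← iteratedDeriv_one, iteratedDeriv_comp_ofReal isOpen_solDom 2 h2 h1,
      iteratedDeriv_comp_ofReal isOpen_solDom 1 h2 h1, iteratedDeriv_succ, iteratedDeriv_one]
    exact hφ.sol_equation hσ hξ₁ h hξ
  initial := hφ.sol_self hσ h hξ₁
  atInfinity := hφ.isEquivalent_sol hσ h hξ₁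

end

end

section

open BoundedContinuousFunction MeasureTheory

/-! ### Asymptotic expansions of the derivatives -/

/-- Squaring at most doubles the angle; the radius tξ/12 is small enough for the squared disc to
remain in the sector of aperture t/2. -/
theorem sq_mem_of_mem_closedBall {t ξ : ℝ} (ht : 0 < t) (ht' : t ≤ 1 / 2) (hξ : 0 < ξ) {z : ℂ}
    (hz : z ∈ Metric.closedBall (ξ : ℂ) (t / 12 * ξ)) :
    ξ / 2 ≤ z.re ∧ ξ ^ 2 / 2 ≤ (z ^ 2).re ∧ |(z ^ 2).im| ≤ t / 2 * (z ^ 2).re := by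
  rw [mem_closedBall_iff_norm] at hz
  have h1 := (Complex.abs_re_le_norm _).trans hz
  have h2 := (Complex.abs_im_le_norm _).trans hz
  simp only [Complex.sub_re, Complex.sub_im, Complex.ofReal_re, Complex.ofReal_im, sub_zero] at h1 h2
  have h3 : t / 12 * ξ ≤ ξ / 24 := by nlinarith
  have h4 := abs_le.1 (h1.trans h3)
  have e1 : (z ^ 2).re = z.re ^ 2 - z.im ^ 2 := by rw [sq, Complex.mul_re]; ring
  have e2 : (z ^ 2).im = 2 * z.re * z.im := by rw [sq, Complex.mul_im]; ring
  have h5 : z.im ^ 2 ≤ (ξ / 24) ^ 2 := by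
    rw [← sq_abs]; gcongr; exact h2.trans h3
  have h6 : (23 / 24 * ξ) ^ 2 ≤ z.re ^ 2 := by gcongr; linarith
  have h7 : 7 / 8 * ξ ^ 2 ≤ z.re ^ 2 - z.im ^ 2 := by nlinarith
  refine ⟨by linarith, by rw [e1]; nlinarith, ?_⟩
  rw [e1, e2, abs_mul, abs_of_pos (by linarith : 0 < 2 * z.re)]
  calc 2 * z.re * |z.im| ≤ 2 * (25 / 24 * ξ) * (t / 12 * ξ) := by gcongr; linarith
    _ ≤ t / 2 * (7 / 8 * ξ ^ 2) := by nlinarith [mul_pos ht (pow_pos hξ 2)]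
    _ ≤ _ := by gcongr

theorem norm_cpow_le_of_le_norm {z s : ℂ} {r : ℝ} (hr : 0 < r) (hz : r ≤ ‖z‖) (hs : s.re ≤ 0) :
    ‖z ^ s‖ ≤ r ^ s.re * Real.exp (Real.pi * |s.im|) := by
  refine (Complex.norm_cpow_le z s).trans ?_
  rw [div_eq_mul_inv, ← Real.exp_neg]
  refine mul_le_mul (Real.rpow_le_rpow_of_nonpos hr hz hs) (Real.exp_le_exp.2 ?_) (by positivity)
    (by positivity)
  refine (neg_le_abs _).trans ?_
  rw [abs_mul]
  gcongr
  exact Complex.abs_arg_le_pi z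

/-- Cauchy's estimate of order k on a disc of radius proportional to ξ costs ξ^{-k}. Thus bounds for
all derivatives of the remainder come from its size in a complex sector, not from differentiating
the expansion. -/
theorem isBigO_iteratedDeriv_of_sectorO {t ξ₁ : ℝ} (ht : 0 < t) (ht' : t ≤ 1 / 2) {m : ℕ} {R H : ℂ → ℂ}
    (hR : SectorO t m R) {s T : ℂ} (hs : s.re ≤ 0) (hH : DifferentiableOn ℂ H (SolDom t ξ₁))
    (hHR : ∀ z ∈ SolDom t ξ₁, H z = T * (z ^ s * R (z ^ 2))) (k : ℕ) :
    (fun ξ : ℝ => iteratedDeriv k H ξ) =O[atTop] fun ξ : ℝ => ξ ^ (s.re - 2 * m - k) := by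
  obtain ⟨M, hM⟩ := (hR (t / 2) (half_pos ht) (half_lt_self ht)).bound
  obtain ⟨B, hB⟩ := eventually_sectorFilter.1 (hM.and (eventually_mem_openCone (half_lt_self ht) (ξ₁ ^ 2)))
  have hpow : ∀ᶠ ξ : ℝ in atTop, B ≤ ξ ^ 2 / 2 :=
    ((tendsto_pow_atTop two_ne_zero).atTop_div_const two_pos).eventually_ge_atTop B
  set E := Real.exp (Real.pi * |s.im|)
  refine IsBigO.of_bound ((k.factorial : ℝ) * (‖T‖ * ((1 / 2) ^ s.re * E * (|M| * 2 ^ m))) / (t / 12) ^ k) ?_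
  filter_upwards [hpow, eventually_gt_atTop 0] with ξ hξ hξ0
  have hball : Metric.closedBall (ξ : ℂ) (t / 12 * ξ) ⊆ SolDom t ξ₁ := fun z hz => by
    obtain ⟨h1, h2, h3⟩ := sq_mem_of_mem_closedBall ht ht' hξ0 hz
    exact ⟨(by positivity : 0 < ξ / 2).trans_le h1, (hB _ (hξ.trans h2) h3).2⟩
  have hbd : ∀ z ∈ Metric.sphere (ξ : ℂ) (t / 12 * ξ),
      ‖H z‖ ≤ ‖T‖ * ((ξ / 2) ^ s.re * E * (|M| * (2 * (ξ ^ 2)⁻¹) ^ m)) := fun z hz => by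
    have hz' := Metric.sphere_subset_closedBall hz
    obtain ⟨h1, h2, h3⟩ := sq_mem_of_mem_closedBall ht ht' hξ0 hz'
    have h4 := (hB _ (hξ.trans h2) h3).1
    have h5 := h2.trans (Complex.re_le_norm _)
    rw [hHR z (hball hz'), norm_mul, norm_mul]
    gcongr
    · exact norm_cpow_le_of_le_norm (by positivity) (h1.trans (Complex.re_le_norm _)) hs
    · refine h4.trans ?_
      rw [norm_pow, norm_inv]
      gcongr
      · exact le_abs_self M
      · rw [show 2 * (ξ ^ 2)⁻¹ = (ξ ^ 2 / 2)⁻¹ by field_simp]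
        gcongr
  have hD : DiffContOnCl ℂ H (Metric.ball (ξ : ℂ) (t / 12 * ξ)) :=
    (hH.mono (Metric.closure_ball_subset_closedBall.trans hball)).diffContOnCl
  refine (Complex.norm_iteratedDeriv_le_of_forall_mem_sphere_norm_le k (by positivity) hD hbd).trans
    (le_of_eq ?_)
  have e1 : (ξ / 2) ^ s.re = (1 / 2) ^ s.re * ξ ^ s.re := by
    rw [← Real.mul_rpow (by norm_num) hξ0.le]; congr 1; ring
  have e2 : ξ ^ (s.re - 2 * m - k) = ξ ^ s.re * ((ξ ^ 2)⁻¹) ^ m * (ξ ^ k)⁻¹ := by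
    rw [Real.rpow_sub hξ0, Real.rpow_sub hξ0, Real.rpow_natCast, Real.rpow_mul hξ0.le, Real.rpow_two,
      Real.rpow_natCast, inv_pow]
    rfl
  rw [Real.norm_of_nonneg (by positivity), e1, e2, mul_pow, mul_pow]
  field_simp

variable {d : ℕ} {σ t η c C N ξ₁ : ℝ} {p : Param}

section

variable {hc : Constants t η c C N} (hσ : 0 < σ) {hX : 1 ≤ ξ₁ ^ 2}
  (h : Controlled d σ t η c C N p) {φ : Cone t →ᵇ ℂ} (hφ : IsCorrection d σ hc hX p φ)

include hσ h hφ

theorem IsCorrection.exists_expansion_sol (hξ₁ : 1 ≤ ξ₁) : ∃ a : ℕ → ℂ, ∀ n : ℕ,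
    ((fun ξ : ℝ => sol d σ ξ₁ p φ ξ / profilePower σ p.2.1 p.2.2.1 ξ
        - ∑ l ∈ Finset.range (n + 1), a l * (ξ : ℂ) ^ (-2 * (l : ℤ)))
      =O[atTop] fun ξ : ℝ => ξ ^ (-2 * ((n : ℝ) + 1))) ∧
    ∀ k : ℕ,
      (fun ξ : ℝ => iteratedDeriv k (fun ξ : ℝ => sol d σ ξ₁ p φ ξ) ξ
        - iteratedDeriv k (fun x : ℝ => profilePower σ p.2.1 p.2.2.1 x *
            ∑ l ∈ Finset.range (n + 1), a l * (x : ℂ) ^ (-2 * (l : ℤ))) ξ)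
        =O[atTop] fun ξ : ℝ => ξ ^ (-1 / σ - 2 * ((n : ℝ) + 1) - k) := by
  obtain ⟨a, ha⟩ := exists_expansion hc.t_pos (hφ.hasExp_profileFun hσ h)
  refine ⟨fun l => solCoeff d σ ξ₁ p * a l, fun n => ?_⟩
  have hzpow : ∀ (z : ℂ) (l : ℕ), z ^ (-2 * (l : ℤ)) = (z ^ 2)⁻¹ ^ l := fun z l => by
    rw [zpow_mul, zpow_natCast, zpow_neg]; rfl
  have hsum : ∀ z : ℂ, ∑ l ∈ Finset.range (n + 1), solCoeff d σ ξ₁ p * a l * z ^ (-2 * (l : ℤ)) =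
      solCoeff d σ ξ₁ p * ∑ l ∈ Finset.range (n + 1), a l * (z ^ 2)⁻¹ ^ l := fun z => by
    rw [Finset.mul_sum]
    exact Finset.sum_congr rfl fun l _ => by rw [hzpow]; ring
  have hpp : ∀ ξ : ℝ, profilePower σ p.2.1 p.2.2.1 ξ = (ξ : ℂ) ^ (-(2 * paramA σ p)) := fun ξ => by
    rw [neg_two_mul_paramA]; rfl
  simp only [hsum, hpp]
  constructor
  · have h1 := ((ha (n + 1) (t / 2) (half_pos hc.t_pos) (half_lt_self hc.t_pos)).comp_tendsto
      ((tendsto_ofReal_sectorFilter (half_pos hc.t_pos)).comp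
        (tendsto_pow_atTop two_ne_zero))).const_mul_left (solCoeff d σ ξ₁ p)
    refine h1.congr' ?_ EventuallyEq.rfl |>.trans (IsBigO.of_bound 1 ?_)
    · filter_upwards [eventually_gt_atTop 0] with ξ hξ
      have h2 : (ξ : ℂ) ^ (-(2 * paramA σ p)) ≠ 0 := by
        rw [Ne, Complex.cpow_eq_zero_iff]
        exact fun h => hξ.ne' (by exact_mod_cast h.1)
      simp only [Function.comp, sol, Complex.ofReal_pow]
      field_simp
    · filter_upwards [eventually_gt_atTop 0] with ξ hξ
      simp only [Function.comp, norm_pow, norm_inv, Complex.norm_real]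
      rw [Real.norm_of_nonneg (by positivity), Real.norm_of_nonneg (by positivity), one_mul,
        show -2 * ((n : ℝ) + 1) = (-2 : ℝ) * ((n + 1 : ℕ) : ℝ) by push_cast; ring, Real.rpow_mul hξ.le,
        Real.rpow_natCast, Real.rpow_neg hξ.le, Real.rpow_two]
  · intro k
    set S : ℂ → ℂ := fun z => z ^ (-(2 * paramA σ p)) *
      (solCoeff d σ ξ₁ p * ∑ l ∈ Finset.range (n + 1), a l * (z ^ 2)⁻¹ ^ l) with hS
    have hsol := hφ.differentiableOn_sol hσ h
    have hSd : DifferentiableOn ℂ S (SolDom t ξ₁) := fun z hz => by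
      have hz0 : z ≠ 0 := fun h => by have := hz.1; simp [h] at this
      refine DifferentiableAt.differentiableWithinAt ?_
      refine (hasDerivAt_neg_cpow hz.1).differentiableAt.mul ((DifferentiableAt.fun_sum fun l _ => ?_).const_mul _)
      exact (((differentiableAt_id.pow 2).inv (pow_ne_zero 2 hz0)).pow l).const_mul _
    have key := isBigO_iteratedDeriv_of_sectorO hc.t_pos hc.t_le (ha (n + 1)) (s := -(2 * paramA σ p))
      (T := solCoeff d σ ξ₁ p) (H := sol d σ ξ₁ p φ - S)
      (by rw [neg_two_mul_re_paramA hσ, neg_div]; simp; positivity) (hsol.sub hSd) (fun z _ => by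
        simp only [Pi.sub_apply, hS, sol]; ring) k
    rw [neg_two_mul_re_paramA hσ] at key
    refine key.congr' ?_ (Eventually.of_forall fun ξ => by push_cast; rfl)
    filter_upwards [eventually_gt_atTop ξ₁] with ξ hξ
    have hz := ofReal_mem_solDom hc.t_pos hξ₁ hξ
    have hz' := isOpen_solDom.mem_nhds hz
    rw [iteratedDeriv_comp_ofReal isOpen_solDom k hsol hz, iteratedDeriv_comp_ofReal (f := S) isOpen_solDom k hSd hz,
      iteratedDeriv_sub ((hsol.contDiffOn isOpen_solDom).contDiffAt hz')
        ((hSd.contDiffOn isOpen_solDom).contDiffAt hz')]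

end

end

section

open BoundedContinuousFunction MeasureTheory

variable {d : ℕ} {σ t η c C N ξ₁ : ℝ} {p : Param}

/-! ### The derivative with respect to `β` at `β = 0` -/

/-- The logarithm is additive for a positive factor, so the principal branch of (μξ²)^{-a} splits
without correction; also valid at z = 0 with the conventions for powers of 0. -/
theorem mul_ofReal_sq_cpow (z s : ℂ) {r : ℝ} (hr : 0 < r) :
    (z * (r : ℂ) ^ 2) ^ (-s) = z ^ (-s) * (r : ℂ) ^ (-(2 * s)) := by
  rcases eq_or_ne z 0 with rfl | hz
  · rcases eq_or_ne s 0 with rfl | hs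
    · simp
    · simp [Complex.zero_cpow (neg_ne_zero.2 hs)]
  · have h1 : (r : ℂ) ≠ 0 := by exact_mod_cast hr.ne'
    have h2 : (0 : ℝ) < r ^ 2 := by positivity
    rw [Complex.cpow_def_of_ne_zero (mul_ne_zero hz (pow_ne_zero 2 h1)), Complex.cpow_def_of_ne_zero hz,
      Complex.cpow_def_of_ne_zero h1, ← Complex.exp_add, ← Complex.ofReal_pow, mul_comm z,
      Complex.log_ofReal_mul h2 hz, ← Complex.ofReal_log hr.le, Real.log_pow]
    congr 1
    push_cast
    ring

theorem Controlled.kummerP_eq (h : Controlled d σ t η c C N p) {ξ : ℝ} (hξ : 0 < ξ) :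
    kummerP d σ p.2.1 p.2.2.1 p.2.2.2.1 ξ = (Complex.Gamma (paramA σ p))⁻¹ * paramMu p ^ (-paramA σ p) *
      ((ξ : ℂ) ^ (-(2 * paramA σ p)) * linProfile d σ p ((ξ : ℂ) ^ 2)) := by
  have h1 := one_sub_I_mul_ne_zero p.2.2.2.1
  have h2 : (ξ : ℂ) ≠ 0 := by exact_mod_cast hξ.ne'
  have e1 : -Complex.I * p.2.1 / (1 - Complex.I * p.2.2.2.1) * ((ξ : ℂ) ^ 2 / 2) =
      paramMu p * (ξ : ℂ) ^ 2 := by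
    rw [paramMu]
    field_simp
  have e2 : (paramMu p * (ξ : ℂ) ^ 2)⁻¹ = paramV p / (ξ : ℂ) ^ 2 := by
    have h3 := paramMu_mul_paramV h.kappa_pos
    have h4 : paramMu p ≠ 0 := left_ne_zero_of_mul_eq_one h3
    field_simp
    linear_combination -h3
  rw [kummerP, e1, kummerU_eq, e2, ← paramA, mul_ofReal_sq_cpow _ _ hξ, linProfile]
  ring

theorem Controlled.kummerP_ne_zero (hc : Constants t η c C N) (hσ : 0 < σ) (hξ₁ : 1 ≤ ξ₁)
    (h : Controlled d σ t η c C N p) : kummerP d σ p.2.1 p.2.2.1 p.2.2.2.1 ξ₁ ≠ 0 := by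
  have hξ0 : 0 < ξ₁ := by linarith
  have h1 := Complex.Gamma_ne_zero_of_re_pos (Controlled.re_paramA_pos (p := p) hσ)
  have h2 : paramMu p ≠ 0 := left_ne_zero_of_mul_eq_one (paramMu_mul_paramV h.kappa_pos)
  have h3 := h.linProfile_tip_ne_zero hc hσ (one_le_pow₀ hξ₁ (n := 2))
  rw [Complex.ofReal_pow] at h3
  rw [h.kummerP_eq hξ0]
  refine mul_ne_zero (mul_ne_zero (inv_ne_zero h1) ?_) (mul_ne_zero
    (left_ne_zero_of_mul_eq_one (b := (ξ₁ : ℂ) ^ (2 * paramA σ p)) ?_) h3)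
  · rw [Ne, Complex.cpow_eq_zero_iff]
    exact fun h => h2 h.1
  · rw [mul_comm]
    exact cpow_mul_cpow_neg hξ0 _

/-- The factors Γ(a)⁻¹ and μ^{-a} do not depend on ξ and cancel in the quotient, leaving the
normalisation of the solution. -/
theorem Controlled.kummerP_div (hc : Constants t η c C N) (hσ : 0 < σ) (hξ₁ : 1 ≤ ξ₁)
    (h : Controlled d σ t η c C N p) {ξ : ℝ} (hξ : 0 < ξ) :
    kummerP d σ p.2.1 p.2.2.1 p.2.2.2.1 ξ / kummerP d σ p.2.1 p.2.2.1 p.2.2.2.1 ξ₁ =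
      (ξ₁ : ℂ) ^ (2 * paramA σ p) / linProfile d σ p ((ξ₁ ^ 2 : ℝ) : ℂ) *
        ((ξ : ℂ) ^ (-(2 * paramA σ p)) * linProfile d σ p ((ξ : ℂ) ^ 2)) := by
  have hξ0 : 0 < ξ₁ := by linarith
  have h0 := h.kummerP_ne_zero hc hσ hξ₁
  have h3 := h.linProfile_tip_ne_zero hc hσ (one_le_pow₀ hξ₁ (n := 2))
  have h4 := cpow_mul_cpow_neg hξ0 (2 * paramA σ p)
  rw [div_eq_iff h0, h.kummerP_eq hξ, h.kummerP_eq hξ0]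
  rw [Complex.ofReal_pow] at h3 ⊢
  have e : ∀ A l E L G B : ℂ, l ≠ 0 → A / l * (E * L) * (G * (B * l)) = G * (E * L) * (A * B) :=
    fun A l E L G B hl => by field_simp
  rw [e _ _ _ _ _ _ h3, h4, mul_one]

theorem hasDerivAt_mul_of_continuousAt {G : ℂ → ℂ} (hG : ContinuousAt G 0) :
    HasDerivAt (fun z => z * G z) (G 0) 0 := by
  rw [hasDerivAt_iff_tendsto_slope_zero]
  refine (hG.tendsto.mono_left nhdsWithin_le_nhds).congr' ?_
  filter_upwards [self_mem_nhdsWithin] with z hz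
  have hz0 : z ≠ 0 := hz
  simp [hz0]

/-- The solution is β K (1 + φ) with K independent of β. Although φ depends on |β| and need not be
holomorphic in β, the explicit factor β gives a complex derivative at 0 as soon as φ tends to 0. -/
theorem hasDerivAt_sol_zero {u : Param → Cone t →ᵇ ℂ} {q : ℝ × ℝ × ℝ × ℝ} {ρ B : ℝ} (hρ : 0 < ρ)
    (hσ : 0 < σ) (hu : ∀ β : ℂ, ‖β‖ ≤ ρ → ‖u (β, q)‖ ≤ B * ‖β‖ ^ (2 * σ)) (ξ : ℝ) :
    HasDerivAt (fun β : ℂ => sol d σ ξ₁ (β, q) (u (β, q)) ξ)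
      ((ξ₁ : ℂ) ^ (2 * paramA σ (0, q)) / linProfile d σ (0, q) ((ξ₁ ^ 2 : ℝ) : ℂ) *
        ((ξ : ℂ) ^ (-(2 * paramA σ (0, q))) * linProfile d σ (0, q) ((ξ : ℂ) ^ 2))) 0 := by
  set K := (ξ₁ : ℂ) ^ (2 * paramA σ (0, q)) / linProfile d σ (0, q) ((ξ₁ ^ 2 : ℝ) : ℂ) *
        ((ξ : ℂ) ^ (-(2 * paramA σ (0, q))) * linProfile d σ (0, q) ((ξ : ℂ) ^ 2))
  have h0 : ext (ξ₁ ^ 2) (u (0, q)) ((ξ : ℂ) ^ 2) = 0 := by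
    have h1 := (norm_ext_le (X := ξ₁ ^ 2) (u (0, q)) ((ξ : ℂ) ^ 2)).trans (hu 0 (by simpa using hρ.le))
    rw [norm_zero, Real.zero_rpow (by positivity), mul_zero] at h1
    exact norm_le_zero_iff.1 h1
  have hcont : ContinuousAt (fun β : ℂ => K * (1 + ext (ξ₁ ^ 2) (u (β, q)) ((ξ : ℂ) ^ 2))) 0 := by
    refine continuousAt_const.mul (continuousAt_const.add ?_)
    rw [ContinuousAt, h0]
    have hlim : Tendsto (fun β : ℂ => B * ‖β‖ ^ (2 * σ)) (𝓝 0) (𝓝 0) := by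
      have : Continuous fun β : ℂ => B * ‖β‖ ^ (2 * σ) :=
        continuous_const.mul (continuous_norm.rpow_const fun _ => Or.inr (by positivity))
      simpa [Real.zero_rpow (by positivity : 2 * σ ≠ 0)] using this.tendsto 0
    refine squeeze_zero_norm' ?_ hlim
    filter_upwards [Metric.closedBall_mem_nhds (0 : ℂ) hρ] with β hβ
    exact (norm_ext_le _ _).trans (hu β (by simpa using hβ))
  have key := hasDerivAt_mul_of_continuousAt hcont
  rw [h0, add_zero, mul_one] at key
  convert! key using 1
  funext β
  change β * (ξ₁ : ℂ) ^ (2 * paramA σ (0, q)) / linProfile d σ (0, q) ((ξ₁ ^ 2 : ℝ) : ℂ) *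
    ((ξ : ℂ) ^ (-(2 * paramA σ (0, q))) * (linProfile d σ (0, q) ((ξ : ℂ) ^ 2) *
      (1 + ext (ξ₁ ^ 2) (u (β, q)) ((ξ : ℂ) ^ 2)))) = _
  ring

end

section

open BoundedContinuousFunction MeasureTheory

variable {d : ℕ} {σ t η c C N ξ₁ : ℝ} {p : Param}

/-! ### The one-sided derivative at `ξ₁` -/

/-- The derivative of the solution at `ξ₁`. -/
def solSlope (d : ℕ) (σ : ℝ) (hc : Constants t η c C N) (ξ₁ : ℝ) (p : Param) (φ : Cone t →ᵇ ℂ) : ℂ :=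
  p.1 * (-(2 * paramA σ p) / ξ₁ + 2 * ξ₁ * (-(paramV p / (ξ₁ : ℂ) ^ 4) * (((d : ℂ) / 2 - paramA σ p - 1) *
    kummerBCF t (ξ₁ ^ 2) ((d : ℂ) / 2) (paramA σ p + 1, paramV p) ⟨0, zero_mem_cone t⟩) /
      profileQ d σ t (ξ₁ ^ 2) p ⟨0, zero_mem_cone t⟩ +
    profileCoeff d σ t (ξ₁ ^ 2) p * (((ξ₁ : ℂ) ^ 2)⁻¹ *
      profileK d σ hc (ξ₁ ^ 2) p φ ⟨0, zero_mem_cone t⟩)))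

theorem continuousOn_ext_sq (ht : 0 < t) (hξ₁ : 1 ≤ ξ₁) (f : Cone t →ᵇ ℂ) :
    ContinuousOn (fun ξ : ℝ => ext (ξ₁ ^ 2) f ((ξ : ℂ) ^ 2)) (Set.Ici ξ₁) := by
  rw [continuousOn_iff_continuous_domRestrict]
  have : (Set.Ici ξ₁).domRestrict (fun ξ : ℝ => ext (ξ₁ ^ 2) f ((ξ : ℂ) ^ 2)) =
      fun ξ => f (coneSq ht hξ₁ ξ) := funext fun ξ => ext_sq ht hξ₁ f ξ
  rw [this]
  fun_prop

theorem ext_self_sq (ht : 0 < t) (hξ₁ : 1 ≤ ξ₁) (f : Cone t →ᵇ ℂ) :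
    ext (ξ₁ ^ 2) f ((ξ₁ : ℂ) ^ 2) = f ⟨0, zero_mem_cone t⟩ := by
  rw [ext_sq ht hξ₁ f ⟨ξ₁, Set.self_mem_Ici⟩, coneSq_self]

section

variable {hc : Constants t η c C N} (hσ : 0 < σ) {hX : 1 ≤ ξ₁ ^ 2}
  (h : Controlled d σ t η c C N p) {φ : Cone t →ᵇ ℂ} (hφ : IsCorrection d σ hc hX p φ)

include hσ h

theorem Controlled.continuousOn_linProfile'_sq (hξ₁ : 1 ≤ ξ₁) :
    ContinuousOn (fun ξ : ℝ => linProfile' d σ p ((ξ : ℂ) ^ 2)) (Set.Ici ξ₁) := fun ξ (hξ : ξ₁ ≤ ξ) => by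
  have hξ0 : 0 < ξ := by linarith
  have h1 := (h.hasDerivAt_linProfile' hσ (x := ((ξ ^ 2 : ℝ) : ℂ)) (by rw [Complex.ofReal_re]; positivity)
    (by rw [Complex.ofReal_im, Complex.ofReal_re, abs_zero]; positivity)).continuousAt
  rw [Complex.ofReal_pow] at h1
  exact (ContinuousAt.comp (f := fun ξ : ℝ => (ξ : ℂ) ^ 2) h1 (by fun_prop)).continuousWithinAt

include hφ

/-- Holomorphy is available only in the open cone, whose closure touches ξ₁² at the tip. The
one-sided derivative is obtained as the limit of the derivatives for ξ > ξ₁, which are given by an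
expression V continuous up to ξ₁. -/
theorem IsCorrection.hasDerivWithinAt_sol (hξ₁ : 1 ≤ ξ₁) :
    HasDerivWithinAt (fun ξ : ℝ => sol d σ ξ₁ p φ ξ) (solSlope d σ hc ξ₁ p φ) (Set.Ici ξ₁) ξ₁ := by
  have hξ0 : 0 < ξ₁ := by linarith
  have ht := hc.t_pos
  set V : ℝ → ℂ := fun ξ => solCoeff d σ ξ₁ p * ((ξ : ℂ) ^ (-(2 * paramA σ p)) *
    (-(2 * paramA σ p) / ξ * profileFun d σ (ξ₁ ^ 2) p φ ((ξ : ℂ) ^ 2) +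
      2 * ξ * (linProfile' d σ p ((ξ : ℂ) ^ 2) * (1 + ext (ξ₁ ^ 2) φ ((ξ : ℂ) ^ 2)) +
        ext (ξ₁ ^ 2) (profileQ d σ t (ξ₁ ^ 2) p) ((ξ : ℂ) ^ 2) *
        (profileCoeff d σ t (ξ₁ ^ 2) p * (((ξ₁ ^ 2 : ℝ) : ℂ) * (((ξ : ℂ) ^ 2) ^ 2)⁻¹ *
          ext (ξ₁ ^ 2) (profileK d σ hc (ξ₁ ^ 2) p φ) ((ξ : ℂ) ^ 2)))))) with hV
  have hne : ∀ ξ ∈ Set.Ici ξ₁, (ξ : ℂ) ≠ 0 := fun ξ (hξ : ξ₁ ≤ ξ) => by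
    exact_mod_cast (hξ0.trans_le hξ).ne'
  have hVc : ContinuousOn V (Set.Ici ξ₁) := by
    refine continuousOn_const.mul (ContinuousOn.mul (fun ξ (hξ : ξ₁ ≤ ξ) => ?_) ?_)
    · exact ((hasDerivAt_neg_cpow (z := (ξ : ℂ)) (by simp; linarith)).continuousAt.comp
        Complex.continuous_ofReal.continuousAt).continuousWithinAt
    · refine ((continuousOn_const.div (by fun_prop) hne).mul
        (h.continuousOn_profileFun_sq hσ hc hξ₁ φ)).add (ContinuousOn.mul (by fun_prop)
        (((h.continuousOn_linProfile'_sq hσ hξ₁).mul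
          (continuousOn_const.add (continuousOn_ext_sq ht hξ₁ φ))).add
          ((continuousOn_ext_sq ht hξ₁ _).mul (continuousOn_const.mul ((continuousOn_const.mul
            (ContinuousOn.inv₀ (by fun_prop) fun ξ hξ => pow_ne_zero 2 (pow_ne_zero 2 (hne ξ hξ)))).mul
              (continuousOn_ext_sq ht hξ₁ _))))))
  have hVd : ∀ ξ ∈ Set.Ioi ξ₁, HasDerivAt (fun ξ : ℝ => sol d σ ξ₁ p φ ξ) (V ξ) ξ := fun ξ hξ => by
    have h1 := ofReal_mem_solDom ht hξ₁ hξ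
    have h2 := (hφ.hasDerivAt_sol hσ h h1).comp_ofReal
    rwa [(hφ.hasDerivAt_profileFun hσ h h1.2).deriv, ← h.ext_profileQ hc hσ hX h1.2] at h2
  have hV1 : V ξ₁ = solSlope d σ hc ξ₁ p φ := by
    have e1 := cpow_mul_cpow_neg hξ0 (2 * paramA σ p)
    have e2 := h.profileQ_apply_ne_zero hc hσ hX ⟨0, zero_mem_cone t⟩
    have e3 : linProfile d σ p ((ξ₁ : ℂ) ^ 2) = profileQ d σ t (ξ₁ ^ 2) p ⟨0, zero_mem_cone t⟩ := by
      rw [h.profileQ_apply hc hσ hX, linProfile, add_zero, Complex.ofReal_pow]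
    have e4 : linProfile' d σ p ((ξ₁ : ℂ) ^ 2) = -(paramV p / (ξ₁ : ℂ) ^ 4) *
        (((d : ℂ) / 2 - paramA σ p - 1) *
        kummerBCF t (ξ₁ ^ 2) ((d : ℂ) / 2) (paramA σ p + 1, paramV p) ⟨0, zero_mem_cone t⟩) := by
      rw [kummerBCF_apply ht hc.t_le hX _ (by
        have := Controlled.re_paramA_pos (p := p) hσ
        simp; linarith) h.paramV_lt, linProfile', add_zero, Complex.ofReal_pow, ← pow_mul,
        show (d : ℂ) / 2 - (paramA σ p + 1) - 1 = (d : ℂ) / 2 - paramA σ p - 1 - 1 by ring]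
    have e5 := hne ξ₁ Set.self_mem_Ici
    simp only [hV, ext_self_sq ht hξ₁, profileFun, hφ.apply_zero, e4, solCoeff, solSlope,
      Complex.ofReal_pow, e3]
    generalize profileQ d σ t (ξ₁ ^ 2) p ⟨0, zero_mem_cone t⟩ = Q at *
    generalize kummerBCF t (ξ₁ ^ 2) ((d : ℂ) / 2) (paramA σ p + 1, paramV p) ⟨0, zero_mem_cone t⟩ = K
    generalize profileK d σ hc (ξ₁ ^ 2) p φ ⟨0, zero_mem_cone t⟩ = K'
    generalize (ξ₁ : ℂ) ^ (2 * paramA σ p) = A at *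
    generalize (ξ₁ : ℂ) ^ (-(2 * paramA σ p)) = A' at *
    have e6 : ∀ G : ℂ, p.1 * A / Q * (A' * G) = p.1 * (G / Q) := fun G => by
      field_simp
      linear_combination p.1 * G * e1
    rw [e6]
    congr 1
    field_simp
    ring
  rw [← hV1]
  refine hasDerivWithinAt_Ici_of_tendsto_deriv (s := Set.Ioi ξ₁)
    (fun ξ hξ => (hVd ξ hξ).differentiableAt.differentiableWithinAt)
    ((h.continuousOn_sol hσ hc hξ₁ φ _ Set.self_mem_Ici).mono Set.Ioi_subset_Ici_self) self_mem_nhdsWithin ?_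
  refine ((hVc ξ₁ Set.self_mem_Ici).mono_left (nhdsWithin_mono _ Set.Ioi_subset_Ici_self)).congr' ?_
  filter_upwards [self_mem_nhdsWithin] with ξ hξ
  exact ((hVd ξ hξ).deriv).symm

end

theorem contDiffWithinAt_bcf_apply {E : Type*} [NormedAddCommGroup E] [NormedSpace ℝ E]
    {f : E → Cone t →ᵇ ℂ} {s : Set E} {e : E} (hf : ContDiffWithinAt ℝ 1 f s e) (w : Cone t) :
    ContDiffWithinAt ℝ 1 (fun e => f e w) s e :=
  ((evalCLM ℂ w : (Cone t →ᵇ ℂ) →L[ℂ] ℂ).restrictScalars ℝ).contDiff.comp_contDiffWithinAt hf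

theorem contDiffWithinAt_div_complex {E : Type*} [NormedAddCommGroup E] [NormedSpace ℝ E] {f g : E → ℂ}
    {s : Set E} {x : E} (hf : ContDiffWithinAt ℝ 1 f s x) (hg : ContDiffWithinAt ℝ 1 g s x) (h : g x ≠ 0) :
    ContDiffWithinAt ℝ 1 (fun x => f x / g x) s x := by
  simp only [div_eq_mul_inv]
  exact hf.mul (hg.inv h)

theorem Controlled.contDiffWithinAt_solSlope (hc : Constants t η c C N) (hσ : 0 < σ) (hσ' : 1 < 2 * σ)
    (hξ₁ : 1 ≤ ξ₁) (h : Controlled d σ t η c C N p) {u : Param → Cone t →ᵇ ℂ} {S : Set Param}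
    (hu : ContDiffWithinAt ℝ 1 u S p) (hup : ‖u p‖ ≤ 1 / 2) :
    ContDiffWithinAt ℝ 1 (fun p => solSlope d σ hc ξ₁ p (u p)) S p := by
  have hX : 1 ≤ ξ₁ ^ 2 := one_le_pow₀ hξ₁
  have hA := (contDiffAt_paramA (σ := σ) h.kappa_pos).contDiffWithinAt (s := S)
  have hV := (contDiffAt_paramV h.kappa_pos).contDiffWithinAt (s := S)
  have hQ := contDiffWithinAt_bcf_apply ((h.contDiffAt_profileQ hc hσ hX).contDiffWithinAt (s := S))
    ⟨0, zero_mem_cone t⟩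
  have hK : ContDiffWithinAt ℝ 1 (fun p => kummerBCF t (ξ₁ ^ 2) ((d : ℂ) / 2) (paramA σ p + 1, paramV p)
      ⟨0, zero_mem_cone t⟩) S p := by
    refine contDiffWithinAt_bcf_apply ?_ _
    exact (((contDiffAt_kummerBCF hc.t_pos hc.t_le hX _ (p := (paramA σ p + 1, paramV p))
      (by have := Controlled.re_paramA_pos (p := p) hσ
          simp; linarith) h.paramV_lt).restrict_scalars ℝ).comp_contDiffWithinAt p
      (f := fun p => (paramA σ p + 1, paramV p)) ((hA.add contDiffWithinAt_const).prodMk hV))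
  have hK' : ContDiffWithinAt ℝ 1 (fun p => profileK d σ hc (ξ₁ ^ 2) p (u p) ⟨0, zero_mem_cone t⟩) S p :=
    contDiffWithinAt_bcf_apply (contDiffAt_profileDensity hc.t_pos hc.eta_pos σ
      (h.contDiffAt_profileInvSq hc hσ hX).contDiffWithinAt (h.contDiffAt_profileG hc hσ hX).contDiffWithinAt
      (h.contDiffAt_resolvent hc hX).contDiffWithinAt hu hup) _
  have hne := h.profileQ_apply_ne_zero hc hσ hX ⟨0, zero_mem_cone t⟩
  have hcf := (h.contDiffAt_profileCoeff hc hσ hX hσ').contDiffWithinAt (s := S)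
  simp only [solSlope, div_eq_mul_inv (paramV _), div_eq_mul_inv (-(2 * paramA σ _))]
  refine contDiff_fst.contDiffWithinAt.mul (((contDiffWithinAt_const.mul hA).neg.mul
    contDiffWithinAt_const).add (contDiffWithinAt_const.mul ((contDiffWithinAt_div_complex ?_ hQ hne).add
    (hcf.mul (contDiffWithinAt_const.mul hK')))))
  exact (hV.mul contDiffWithinAt_const).neg.mul
    (((contDiffWithinAt_const.sub hA).sub contDiffWithinAt_const).mul hK)

/-! ### The solution as an element of the weighted space -/

/-- Multiplication by `ξ^{ϑ - 1/σ}`. -/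
def weightCLM (σ ϑ : ℝ) (hξ₁ : 1 ≤ ξ₁) : (Set.Ici ξ₁ →ᵇ ℂ) →L[ℂ] WeightedSpace σ ϑ ξ₁ :=
  have hpos : ∀ ξ : Set.Ici ξ₁, 0 < (ξ : ℝ) := fun ξ => zero_lt_one.trans_le (hξ₁.trans ξ.2)
  have key : ∀ (f : Set.Ici ξ₁ →ᵇ ℂ) (ξ : Set.Ici ξ₁), |(ξ : ℝ)| ^ (1 / σ - ϑ) *
      ‖(((ξ : ℝ) ^ (ϑ - 1 / σ) : ℝ) : ℂ) * f ξ‖ ≤ ‖f‖ := fun f ξ => by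
    rw [norm_mul, Complex.norm_real, abs_of_pos (hpos ξ),
      Real.norm_of_nonneg (Real.rpow_nonneg (hpos ξ).le _), ← mul_assoc, ← Real.rpow_add (hpos ξ)]
    simpa using f.norm_coe_le_norm ξ
  LinearMap.mkContinuous
    { toFun := fun f => ⟨⟨fun ξ => (((ξ : ℝ) ^ (ϑ - 1 / σ) : ℝ) : ℂ) * f ξ,
        (Complex.continuous_ofReal.comp (continuous_subtype_val.rpow_const
          fun ξ => Or.inl (hpos ξ).ne')).mul f.continuous⟩,
        ⟨‖f‖, by rintro _ ⟨ξ, rfl⟩; exact key f ξ⟩⟩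
      map_add' := fun f g => Subtype.ext (ContinuousMap.ext fun ξ => mul_add _ _ _)
      map_smul' := fun z f => Subtype.ext (ContinuousMap.ext fun ξ => mul_left_comm _ _ _) } 1 fun f => by
        rw [one_mul, WeightedSpace.norm_def]
        exact Real.iSup_le (fun ξ => key f ξ) (norm_nonneg _)

theorem weightCLM_apply (σ ϑ : ℝ) (hξ₁ : 1 ≤ ξ₁) (f : Set.Ici ξ₁ →ᵇ ℂ) (ξ : Set.Ici ξ₁) :
    (weightCLM σ ϑ hξ₁ f).toFun ξ = (((ξ : ℝ) ^ (ϑ - 1 / σ) : ℝ) : ℂ) * f ξ := rfl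

/-- The bounded function `ξ ↦ ξ^{-s}`. -/
def powBCF (ξ₁ : ℝ) (s : ℂ) : Set.Ici ξ₁ →ᵇ ℂ := toBCF fun ξ => ((ξ : ℝ) : ℂ) ^ (-s)

theorem powBCF_aux (hξ₁ : 1 ≤ ξ₁) {s : ℂ} (hs : 0 < s.re) :
    Continuous (fun ξ : Set.Ici ξ₁ => ((ξ : ℝ) : ℂ) ^ (-s)) ∧
      ∀ ξ : Set.Ici ξ₁, DifferentiableAt ℂ (fun s : ℂ => ((ξ : ℝ) : ℂ) ^ (-s)) s ∧
        ‖((ξ : ℝ) : ℂ) ^ (-s)‖ ≤ 1 := by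
  have hpos : ∀ ξ : Set.Ici ξ₁, 0 < (ξ : ℝ) := fun ξ => zero_lt_one.trans_le (hξ₁.trans ξ.2)
  refine ⟨(Complex.continuous_ofReal.comp continuous_subtype_val).cpow continuous_const
    fun ξ => Or.inl (by simpa using hpos ξ), fun ξ => ⟨?_, ?_⟩⟩
  · have h0 : ((ξ : ℝ) : ℂ) ≠ 0 := by exact_mod_cast (hpos ξ).ne'
    exact differentiableAt_id.neg.const_cpow (Or.inl h0)
  · rw [Complex.norm_cpow_eq_rpow_re_of_pos (hpos ξ), Complex.neg_re]
    exact Real.rpow_le_one_of_one_le_of_nonpos (hξ₁.trans ξ.2) (by linarith)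

theorem powBCF_apply (hξ₁ : 1 ≤ ξ₁) {s : ℂ} (hs : 0 < s.re) (ξ : Set.Ici ξ₁) :
    powBCF ξ₁ s ξ = ((ξ : ℝ) : ℂ) ^ (-s) :=
  toBCF_apply (powBCF_aux hξ₁ hs).1 (fun ξ => ((powBCF_aux hξ₁ hs).2 ξ).2) ξ

theorem contDiffAt_powBCF (hξ₁ : 1 ≤ ξ₁) {s : ℂ} (hs : 0 < s.re) : ContDiffAt ℂ 1 (powBCF ξ₁) s :=
  contDiffAt_toBCF (((isOpen_lt continuous_const Complex.continuous_re).eventually_mem hs).mono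
    fun _ h => powBCF_aux hξ₁ h)

/-- The solution as an element of the weighted space. -/
def solWeighted (d : ℕ) (σ ϑ : ℝ) (ht : 0 < t) (hξ₁ : 1 ≤ ξ₁) (p : Param) (φ : Cone t →ᵇ ℂ) :
    WeightedSpace σ ϑ ξ₁ :=
  weightCLM σ ϑ hξ₁ ((p.1 * (ξ₁ : ℂ) ^ (2 * paramA σ p) /
    profileQ d σ t (ξ₁ ^ 2) p ⟨0, zero_mem_cone t⟩) • (powBCF ξ₁ (2 * paramA σ p + ((ϑ - 1 / σ : ℝ) : ℂ)) *
      compCLM (coneSq ht hξ₁) (profileQ d σ t (ξ₁ ^ 2) p * (1 + φ))))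

/-- After removal of the weight, the power has an exponent with real part -ϑ. Differentiating it in
ω/κ produces log ξ, which ξ^{-ϑ} absorbs; hence the loss of ϑ in the weighted norm. -/
theorem re_two_mul_paramA_add (hσ : 0 < σ) (ϑ : ℝ) (p : Param) :
    (2 * paramA σ p + ((ϑ - 1 / σ : ℝ) : ℂ)).re = ϑ := by
  have := neg_two_mul_re_paramA (p := p) hσ
  rw [Complex.neg_re] at this
  rw [Complex.add_re, Complex.ofReal_re]
  linear_combination -this

theorem Controlled.solWeighted_apply (hc : Constants t η c C N) (hσ : 0 < σ) (hξ₁ : 1 ≤ ξ₁)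
    (h : Controlled d σ t η c C N p) (φ : Cone t →ᵇ ℂ) {ϑ : ℝ} (hϑ : 0 < ϑ) (ξ : Set.Ici ξ₁) :
    (solWeighted d σ ϑ hc.t_pos hξ₁ p φ).toFun ξ = sol d σ ξ₁ p φ (ξ : ℝ) := by
  have hξ0 : 0 < (ξ : ℝ) := zero_lt_one.trans_le (hξ₁.trans ξ.2)
  have hX : 1 ≤ ξ₁ ^ 2 := one_le_pow₀ hξ₁
  have e3 : linProfile d σ p ((ξ₁ ^ 2 : ℝ) : ℂ) = profileQ d σ t (ξ₁ ^ 2) p ⟨0, zero_mem_cone t⟩ := by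
    rw [h.profileQ_apply hc hσ hX, linProfile, add_zero]
  have e4 : ((ξ : ℝ) : ℂ) ^ (-(2 * paramA σ p)) = (((ξ : ℝ) ^ (ϑ - 1 / σ) : ℝ) : ℂ) *
      ((ξ : ℝ) : ℂ) ^ (-(2 * paramA σ p + ((ϑ - 1 / σ : ℝ) : ℂ))) := by
    rw [Complex.ofReal_cpow hξ0.le, ← Complex.cpow_add _ _ (by exact_mod_cast hξ0.ne')]
    congr 1
    ring
  rw [solWeighted, weightCLM_apply, sol, solCoeff, e3, h.profileFun_sq hσ hc hξ₁, e4]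
  simp only [coe_smul, mul_apply, compCLM_apply, smul_eq_mul]
  rw [powBCF_apply hξ₁ (by rw [re_two_mul_paramA_add hσ]; exact hϑ)]
  ring

theorem Controlled.contDiffWithinAt_solWeighted (hc : Constants t η c C N) (hσ : 0 < σ)
    (hξ₁ : 1 ≤ ξ₁) (h : Controlled d σ t η c C N p) {u : Param → Cone t →ᵇ ℂ} {S : Set Param}
    (hu : ContDiffWithinAt ℝ 1 u S p) {ϑ : ℝ} (hϑ : 0 < ϑ) :
    ContDiffWithinAt ℝ 1 (fun p => solWeighted d σ ϑ hc.t_pos hξ₁ p (u p)) S p := by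
  have hX : 1 ≤ ξ₁ ^ 2 := one_le_pow₀ hξ₁
  have hA := (contDiffAt_paramA (σ := σ) h.kappa_pos).contDiffWithinAt (s := S)
  have hQ := (h.contDiffAt_profileQ hc hσ hX).contDiffWithinAt (s := S)
  have hne := h.profileQ_apply_ne_zero hc hσ hX ⟨0, zero_mem_cone t⟩
  have hpow : ContDiffWithinAt ℝ 1 (fun p : Param => (ξ₁ : ℂ) ^ (2 * paramA σ p)) S p := by
    have h1 : ContDiff ℝ 1 fun z : ℂ => (ξ₁ : ℂ) ^ z := by
      have : Differentiable ℂ fun z : ℂ => (ξ₁ : ℂ) ^ z := fun z =>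
        differentiableAt_id.const_cpow (Or.inl (by exact_mod_cast (by linarith : ξ₁ ≠ 0)))
      exact this.contDiff.restrict_scalars ℝ
    exact h1.comp_contDiffWithinAt (contDiffWithinAt_const.mul hA)
  have hB : ContDiffWithinAt ℝ 1
      (fun p => powBCF ξ₁ (2 * paramA σ p + ((ϑ - 1 / σ : ℝ) : ℂ))) S p :=
    ((contDiffAt_powBCF hξ₁ (s := 2 * paramA σ p + ((ϑ - 1 / σ : ℝ) : ℂ))
      (by rw [re_two_mul_paramA_add hσ]; exact hϑ)).restrict_scalars ℝ).comp_contDiffWithinAt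
      (g := powBCF ξ₁) (f := fun p => 2 * paramA σ p + ((ϑ - 1 / σ : ℝ) : ℂ)) p
      ((contDiffWithinAt_const.mul hA).add contDiffWithinAt_const)
  unfold solWeighted
  refine ((weightCLM σ ϑ hξ₁).restrictScalars ℝ).contDiff.comp_contDiffWithinAt
    (ContDiffWithinAt.smul (contDiffWithinAt_div_complex (contDiff_fst.contDiffWithinAt.mul hpow)
      (contDiffWithinAt_bcf_apply hQ _) hne) (hB.mul ?_))
  exact ((compCLM (coneSq hc.t_pos hξ₁)).restrictScalars ℝ).contDiff.comp_contDiffWithinAt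
    (hQ.mul (contDiffWithinAt_const.add hu))

end

end CGL

end

/-! ### Assembly of the main theorem. -/

theorem theorem1 (d : ℕ) (hd₁ : 1 ≤ d) (hd₃ : d ≤ 3)
    (σ : ℝ) (hσ₁ : 2 / (d : ℝ) < σ) (hσ₂ : σ < 2 / (d : ℝ) + 1 / 2)
    (κ₁ κ₂ ω₁ ω₂ ε₁ δ₁ δ₂ : ℝ) (hκ₁ : 0 < κ₁) (hκ : κ₁ < κ₂) (hω : ω₁ < ω₂)
    (hε : 0 < ε₁) (hδ : δ₁ < δ₂) :
    ∃ ρ₁ : ℝ, 0 < ρ₁ ∧ ∀ ξ₁ : ℝ, 1 ≤ ξ₁ →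
      ∃ F : ℂ × ℝ × ℝ × ℝ × ℝ → ℝ → ℂ,
        -- for all parameters, `F` solves the boundary value problem
        (∀ β κ ω ε δ, (β, κ, ω, ε, δ) ∈ CGL.paramBox ρ₁ κ₁ κ₂ ω₁ ω₂ ε₁ δ₁ δ₂ →
          CGL.IsProfile d σ κ ω ε δ ξ₁ β (F (β, κ, ω, ε, δ))) ∧
        -- (i) continuous differentiability, up to the boundary, into the weighted spaces
        (∀ ϑ : ℝ, 0 < ϑ → ∃ Φ : ℂ × ℝ × ℝ × ℝ × ℝ → CGL.WeightedSpace σ ϑ ξ₁,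
          (∀ p ∈ CGL.paramBox ρ₁ κ₁ κ₂ ω₁ ω₂ ε₁ δ₁ δ₂, ∀ ξ : Set.Ici ξ₁,
            (Φ p).toFun ξ = F p ξ) ∧
          ContDiffOn ℝ 1 Φ (CGL.paramBox ρ₁ κ₁ κ₂ ω₁ ω₂ ε₁ δ₁ δ₂)) ∧
        -- (ii) the (one-sided) derivative at `ξ₁` exists and is C¹ in the parameters
        (∃ D : ℂ × ℝ × ℝ × ℝ × ℝ → ℂ,
          (∀ p ∈ CGL.paramBox ρ₁ κ₁ κ₂ ω₁ ω₂ ε₁ δ₁ δ₂,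
            HasDerivWithinAt (F p) (D p) (Set.Ici ξ₁) ξ₁) ∧
          ContDiffOn ℝ 1 D (CGL.paramBox ρ₁ κ₁ κ₂ ω₁ ω₂ ε₁ δ₁ δ₂)) ∧
        -- (iii) smoothness and asymptotic expansions of `F` and of all its derivatives
        (∀ β κ ω ε δ, (β, κ, ω, ε, δ) ∈ CGL.paramBox ρ₁ κ₁ κ₂ ω₁ ω₂ ε₁ δ₁ δ₂ →
          ContDiffOn ℝ (⊤ : ℕ∞) (F (β, κ, ω, ε, δ)) (Set.Ioi ξ₁) ∧
          ∃ a : ℕ → ℂ, ∀ n : ℕ,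
            ((fun ξ : ℝ => F (β, κ, ω, ε, δ) ξ / CGL.profilePower σ κ ω ξ
                - ∑ l ∈ Finset.range (n + 1), a l * (ξ : ℂ) ^ (-2 * (l : ℤ)))
              =O[atTop] fun ξ : ℝ => ξ ^ (-2 * ((n : ℝ) + 1))) ∧
            ∀ k : ℕ,
              (fun ξ : ℝ => iteratedDeriv k (F (β, κ, ω, ε, δ)) ξ
                - iteratedDeriv k (fun x : ℝ => CGL.profilePower σ κ ω x *
                    ∑ l ∈ Finset.range (n + 1), a l * (x : ℂ) ^ (-2 * (l : ℤ))) ξ)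
                =O[atTop] fun ξ : ℝ => ξ ^ (-1 / σ - 2 * ((n : ℝ) + 1) - k)) ∧
        -- (iv) `F` at `β = 0` and its derivative in `β` there
        (∀ κ ∈ Set.Icc κ₁ κ₂, ∀ ω ∈ Set.Icc ω₁ ω₂, ∀ ε ∈ Set.Icc 0 ε₁, ∀ δ ∈ Set.Icc δ₁ δ₂,
          CGL.kummerP d σ κ ω ε ξ₁ ≠ 0 ∧
          ∀ ξ : ℝ, ξ₁ ≤ ξ →
            F (0, κ, ω, ε, δ) ξ = 0 ∧
            HasDerivAt (fun β : ℂ => F (β, κ, ω, ε, δ) ξ)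
              (CGL.kummerP d σ κ ω ε ξ / CGL.kummerP d σ κ ω ε ξ₁) 0) := by
  have hd : (0 : ℝ) < d := by exact_mod_cast hd₁
  -- From σ > 2/d and d ≤ 3; it gives 2σ > 1, the regularity of |β|^{2σ} needed for C¹ dependence.
  have hσ : 2 / 3 < σ := by
    have h3 : (d : ℝ) ≤ 3 := by exact_mod_cast hd₃
    have : (2 : ℝ) / 3 ≤ 2 / d := by gcongr
    linarith
  have hσ0 : 0 < σ := by linarith
  have hσ' : 1 < 2 * σ := by linarith
  obtain ⟨t, η, c, C, N, hc, hbox⟩ := CGL.exists_constants hd₁ hd₃ hσ0 hκ₁ hκ hω hε hδ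
  obtain ⟨ρ, B, hρ, hprof⟩ := CGL.exists_profile hc hσ' d
  refine ⟨ρ, hρ, fun ξ₁ hξ₁ => ?_⟩
  have hX : 1 ≤ ξ₁ ^ 2 := one_le_pow₀ hξ₁
  obtain ⟨u, hu, hu1⟩ := hprof (ξ₁ ^ 2) hX
  have hcon : ∀ p ∈ CGL.paramBox ρ κ₁ κ₂ ω₁ ω₂ ε₁ δ₁ δ₂,
      CGL.Controlled d σ t η c C N p ∧ ‖p.1‖ ≤ ρ := fun p hp =>
    ⟨hbox p hp.2, by simpa using hp.1⟩
  have hcor : ∀ p ∈ CGL.paramBox ρ κ₁ κ₂ ω₁ ω₂ ε₁ δ₁ δ₂, CGL.IsCorrection d σ hc hX p (u p) :=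
    fun p hp => by
      obtain ⟨h1, h2, h3, -⟩ := hu p (hcon p hp).1 (hcon p hp).2
      exact ⟨h1, h2, h3⟩
  have hu1' : ContDiffOn ℝ 1 u (CGL.paramBox ρ κ₁ κ₂ ω₁ ω₂ ε₁ δ₁ δ₂) := hu1.mono hcon
  refine ⟨fun p ξ => CGL.sol d σ ξ₁ p (u p) ξ, ?_, ?_, ?_, ?_, ?_⟩
  · intro β κ ω ε δ hp
    exact (hcor _ hp).isProfile_sol hσ0 (hcon _ hp).1 hξ₁
  · intro ϑ hϑ
    refine ⟨fun p => CGL.solWeighted d σ ϑ hc.t_pos hξ₁ p (u p), fun p hp ξ => ?_, fun p hp => ?_⟩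
    · exact (hcon p hp).1.solWeighted_apply hc hσ0 hξ₁ (u p) hϑ ξ
    · exact (hcon p hp).1.contDiffWithinAt_solWeighted hc hσ0 hξ₁ (hu1' p hp) hϑ
  · refine ⟨fun p => CGL.solSlope d σ hc ξ₁ p (u p), fun p hp => ?_, fun p hp => ?_⟩
    · exact (hcor p hp).hasDerivWithinAt_sol hσ0 (hcon p hp).1 hξ₁
    · exact (hcon p hp).1.contDiffWithinAt_solSlope hc hσ0 hσ' hξ₁ (hu1' p hp) (hcor p hp).norm_le_half
  · intro β κ ω ε δ hp
    exact ⟨(hcor _ hp).contDiffOn_sol hσ0 (hcon _ hp).1 hξ₁,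
      (hcor _ hp).exists_expansion_sol hσ0 (hcon _ hp).1 hξ₁⟩
  · intro κ hκ' ω hω' ε hε' δ hδ'
    have h0 : CGL.Controlled d σ t η c C N ((0 : ℂ), κ, ω, ε, δ) := hbox _ ⟨hκ', hω', hε', hδ'⟩
    have hP0 := h0.kummerP_ne_zero hc hσ0 hξ₁
    refine ⟨hP0, fun ξ hξ => ⟨?_, ?_⟩⟩
    · simp [CGL.sol, CGL.solCoeff_zero]
    · have hP := h0.kummerP_div hc hσ0 hξ₁ (ξ := ξ) (by linarith)
      rw [hP]
      -- The parameters other than β are fixed in the box and β ranges over the full disc, a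
      -- neighbourhood of 0 in ℂ, so an unrestricted complex derivative makes sense.
      have hb : ∀ β : ℂ, ‖β‖ ≤ ρ → ‖u (β, κ, ω, ε, δ)‖ ≤ B * ‖β‖ ^ (2 * σ) := fun β hβ =>
        (hu _ (hbox (β, κ, ω, ε, δ) ⟨hκ', hω', hε', hδ'⟩) hβ).2.2.2
      exact CGL.hasDerivAt_sol_zero hρ hσ0 hb ξ
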